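/- Let $\mathsf{Heis}$ be the $3$-dimensional Heisenberg group, $\mathfrak{heis}$ its Lie algebra, $\mathsf Z$ the center of $\mathfrak{heis}$, let $\rho:\mathbb R\to\mathrm{Aut}(\mathsf{Heis})$ be a (smooth) one-parameter group of automorphisms, acting also on $\mathfrak{heis}$ and on $\mathfrak{heis}/\mathsf Z$, and let $G_\rho=\mathbb R\ltimes_\rho\mathsf{Heis}$. Let $W\in\mathfrak{heis}\setminus\mathsf Z$, let $I=\exp(\mathbb RW)\subset\mathsf{Heis}$ and $\mathsf P_\rho=G_\rho/I$. A Lorentz metric has signature $(-,+,+)$. Minkowski space is $\mathbb R^3$ with coordinates $(u,v,x)$ and the metric $2\,du\,dv+dx^2$, half Minkowski is its open subset $\{u>0\}$, and the hyperbolic (resp. elliptic) Cahen–Wallach space is $\mathbb R^3$ with the metric $2\,du\,dv+x^2du^2+dx^2$ (resp. $2\,du\,dv-x^2du^2+dx^2$). Flat means locally isometric to Minkowski space, symmetric (resp. locally symmetric) that every point $p$ is fixed by an isometry (resp. an isometry between neighbourhoods of $p$) with differential $-\mathrm{Id}$ at $p$. Let $\mathsf{Aff}\subset \mathsf O(1,2)$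 be the identity component of the stabilizer of the degenerate plane $\mathbb R^2=\{u=0\}$; it is isomorphic to $\mathsf{Aff}^+(\mathbb R)$. The representation $\rho$ is called hyperbolic if the action of $\mathbb R$ on $\mathfrak{heis}/\mathsf Z$ is diagonalizable over $\mathbb R$, elliptic if, for some identification $\mathfrak{heis}/\mathsf Z\cong\mathbb C$, it is by multiplications by complex numbers (similarities) that are not all real, and unipotent if all $\rho(t)$ are unipotent on $\mathfrak{heis}$. 1. The $G_\rho$-action on $\mathsf P_\rho$ preserves a Lorentz metric if and only if the image of $W$ in $\mathfrak{heis}/\mathsf Z$ is not an eigenvector of the action of $\rho$ (that is, not a common eigenvector of all $\rho(t)$). Any two $G_\rho$-invariant Lorentz metrics on $\mathsf P_\rho$ agree up to a positive factor and the diffeomorphism of $\mathsf P_\rho$ induced by a Lie group automorphism of $G_\rho$ fixing $W$. From now on, $\mathsf P_\rho$ carries a $G_\rho$-invariant Lorentz metric. 2. No $3$-dimensional (second countable) Lie group acts smoothly and isometrically on $\mathsf P_\rho$ with an open orbit if and only if $\rho$ is elliptic. 3. $\mathsf P_\rho$ is symmetric if and only if $\rho$ fixes $\mathsf Z$ pointwise,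 if and only if $G_\rho$ is unimodular. In this case $\rho$ is unipotent, hyperbolic or elliptic, and $\mathsf P_\rho$ is isometric to Minkowski space if $\rho$ is unipotent, to the hyperbolic Cahen–Wallach space if $\rho$ is hyperbolic, and to the elliptic one if $\rho$ is elliptic. Moreover $\mathsf P_\rho$ is locally symmetric but not symmetric if and only if $G_\rho$ is not unimodular and is isomorphic to $\mathsf{Aff}\ltimes\mathbb R^2\subset \mathsf O(1,2)\ltimes\mathbb R^3$; if $G_\rho\cong\mathsf{Aff}\ltimes\mathbb R^2$, then $\mathsf P_\rho$ is isometric to half Minkowski. 4. $\mathsf P_\rho$ is isometric to Minkowski space if and only if $\rho$ is unipotent. In this case $G_\rho$ is isomorphic to $N\ltimes\mathbb R^3\subset \mathsf O(1,2)\ltimes\mathbb R^3$ for every non-trivial unipotent one-parameter subgroup $N$ of $\mathsf O(1,2)$. 5. $\mathsf P_\rho$ is flat if and only if it is isometric to Minkowski space or to half Minkowski. It is flat and not geodesically complete if and only if it is isometric to half Minkowski; this holds if and only if $G_\rho\cong\mathsf{Aff}\ltimes\mathbb R^2$, and if and only if $G_\rho$ is not unimodular and $\rho$ has a non-zero fixed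 vector in $\mathfrak{heis}$. 6. If $\mathsf P_\rho$ is not isometric to Minkowski space, then $\mathsf{Iso}^0(\mathsf P_\rho)=G_\rho$: the action is an isomorphism of topological groups of $G_\rho$ onto the identity component of the isometry group. Let finally $\rho'$, $W'$ be a second such pair, with an invariant Lorentz metric on $\mathsf P_{\rho'}$. 7. $\mathsf P_\rho$ and $\mathsf P_{\rho'}$ are isometric if and only if the Lie groups $G_\rho$ and $G_{\rho'}$ are isomorphic. 8. If $\mathsf P_\rho$ is not flat, then $\mathsf P_\rho$ and $\mathsf P_{\rho'}$ are locally isometric if and only if $G_\rho$ and $G_{\rho'}$ are isomorphic. -/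

import Mathlib

open scoped Manifold ContDiff Topology

noncomputable section

namespace PlaneWave

/-! ### The Heisenberg group and its extensions -/

/-- The model vector space of all `3`-dimensional manifolds below. -/
notation "E3" => (Fin 3 → ℝ)

/-- The Lie bracket of the Heisenberg algebra `heis = E3`, with basis `X, Y, Z` and `[X, Y] = Z`. -/
def heisBracket (a b : E3) : E3 := ![0, 0, a 0 * b 1 - a 1 * b 0]

theorem contDiff_heisBracket {F : Type*} [NormedAddCommGroup F] [NormedSpace ℝ F] {f g : F → E3}
    (hf : ContDiff ℝ ∞ f) (hg : ContDiff ℝ ∞ g) :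
    ContDiff ℝ ∞ (fun x => heisBracket (f x) (g x)) := by
  have h1 := contDiff_pi.1 hf
  have h2 := contDiff_pi.1 hg
  refine contDiff_pi.2 fun i => ?_
  fin_cases i
  · exact contDiff_const
  · exact contDiff_const
  · exact ((h1 0).mul (h2 1)).sub ((h1 1).mul (h2 0))

/-- The center of the Heisenberg algebra. -/
def heisCenter : Submodule ℝ E3 where
  carrier := {a | ∀ b, heisBracket a b = 0}
  add_mem' {a a'} ha ha' b := by
    have h := congrFun (ha b) 2
    have h' := congrFun (ha' b) 2
    simp [heisBracket] at h h' ⊢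
    linarith
  zero_mem' b := by simp [heisBracket]
  smul_mem' c a ha b := by
    have h := congrFun (ha b) 2
    simp [heisBracket] at h ⊢
    linear_combination c * h

/-- The Heisenberg group in exponential coordinates: `Heis.mk` is the exponential map, `Heis.log`
its inverse, and the product is given by the Baker-Campbell-Hausdorff formula. -/
@[ext]
structure Heis where
  /-- The logarithm. -/
  log : E3

namespace Heis

instance : Mul Heis := ⟨fun a b => ⟨a.log + b.log + (1 / 2 : ℝ) • heisBracket a.log b.log⟩⟩
instance : One Heis := ⟨⟨0⟩⟩
instance : Inv Heis := ⟨fun a => ⟨-a.log⟩⟩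

theorem mul_log (a b : Heis) :
    (a * b).log = a.log + b.log + (1 / 2 : ℝ) • heisBracket a.log b.log := rfl

theorem one_log : (1 : Heis).log = 0 := rfl

theorem inv_log (a : Heis) : (a⁻¹).log = -a.log := rfl

instance : Group Heis :=
  Group.ofLeftAxioms
    (by
      intro a b c
      ext i
      fin_cases i <;> simp [mul_log, heisBracket] <;> ring)
    (by
      intro a
      ext i
      fin_cases i <;> simp [mul_log, one_log, heisBracket])
    (by
      intro a
      ext i
      fin_cases i <;> simp [mul_log, one_log, inv_log, heisBracket]; ring)

/-- The one-parameter subgroup `s ↦ exp (s W)` of the Heisenberg group. -/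
def oneParam (W : E3) : Multiplicative ℝ →* Heis where
  toFun s := ⟨s.toAdd • W⟩
  map_one' := by ext i; simp [one_log]
  map_mul' s t := by
    ext i
    fin_cases i <;> simp [mul_log, heisBracket] <;> ring

end Heis

/-- A representation `t ↦ ρ t` of `ℝ` by automorphisms of the Heisenberg group (a smooth
one-parameter group of automorphisms). -/
structure HeisRep where
  /-- The one-parameter group of automorphisms. -/
  toHom : Multiplicative ℝ →* MulAut Heis
  smooth : ContDiff ℝ ∞ (fun p : ℝ × E3 => (toHom (Multiplicative.ofAdd p.1) ⟨p.2⟩).log)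

/-- The action of `ρ t` on the Lie algebra `heis`: the differential of `ρ t` at the identity. -/
def HeisRep.lie (ρ : HeisRep) (t : ℝ) : E3 →L[ℝ] E3 :=
  fderiv ℝ (fun X : E3 => (ρ.toHom (Multiplicative.ofAdd t) ⟨X⟩).log) 0

/-- The group `G_ρ`, the semidirect product of the Heisenberg group and `ℝ` given by `ρ`. -/
abbrev HeisExt (ρ : HeisRep) := Heis ⋊[ρ.toHom] Multiplicative ℝ

namespace HeisExt

variable (ρ : HeisRep)

/-- Global coordinates of `G_ρ`. -/
def coords : HeisExt ρ ≃ ℝ × E3 where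
  toFun a := (a.right.toAdd, a.left.log)
  invFun p := ⟨⟨p.2⟩, Multiplicative.ofAdd p.1⟩
  left_inv _ := rfl
  right_inv _ := rfl

instance : TopologicalSpace (HeisExt ρ) := TopologicalSpace.induced (coords ρ) inferInstance

/-- Global coordinates of `G_ρ`, as a homeomorphism. -/
def homeo : HeisExt ρ ≃ₜ ℝ × E3 := (coords ρ).toHomeomorphOfIsInducing ⟨rfl⟩

instance : ChartedSpace (ℝ × E3) (HeisExt ρ) := (homeo ρ).isOpenEmbedding.singletonChartedSpace

instance : IsManifold 𝓘(ℝ, ℝ × E3) ∞ (HeisExt ρ) :=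
  (homeo ρ).isOpenEmbedding.isManifold_singleton

theorem contMDiff_homeo : ContMDiff 𝓘(ℝ, ℝ × E3) 𝓘(ℝ, ℝ × E3) ∞ (homeo ρ) :=
  contMDiff_isOpenEmbedding (homeo ρ).isOpenEmbedding

theorem contMDiff_homeo_symm : ContMDiff 𝓘(ℝ, ℝ × E3) 𝓘(ℝ, ℝ × E3) ∞ (homeo ρ).symm := by
  refine ContMDiff.of_comp_isOpenEmbedding (homeo ρ).isOpenEmbedding ?_
  convert! contMDiff_id using 1

/-- `G_ρ` is a Lie group. -/
instance : LieGroup 𝓘(ℝ, ℝ × E3) ∞ (HeisExt ρ) where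
  contMDiff_mul := by
    refine ContMDiff.of_comp_isOpenEmbedding (homeo ρ).isOpenEmbedding ?_
    have h : ContDiff ℝ ∞ (fun q : (ℝ × E3) × (ℝ × E3) => homeo ρ
        ((homeo ρ).symm q.1 * (homeo ρ).symm q.2)) := by
      have h1 : ContDiff ℝ ∞ (fun q : (ℝ × E3) × (ℝ × E3) =>
          (ρ.toHom (Multiplicative.ofAdd q.1.1) ⟨q.2.2⟩).log) :=
        ρ.smooth.comp (g := fun p : ℝ × E3 => (ρ.toHom (Multiplicative.ofAdd p.1) ⟨p.2⟩).log)
          (f := fun q : (ℝ × E3) × (ℝ × E3) => (q.1.1, q.2.2)) (by fun_prop)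
      exact (contDiff_fst.fst.add contDiff_snd.fst).prodMk
        ((contDiff_fst.snd.add h1).add
          ((contDiff_heisBracket contDiff_fst.snd h1).const_smul (1 / 2 : ℝ)))
    exact h.contMDiff.comp
      (((contMDiff_homeo ρ).comp contMDiff_fst).prodMk_space
        ((contMDiff_homeo ρ).comp contMDiff_snd))
  contMDiff_inv := by
    refine ContMDiff.of_comp_isOpenEmbedding (homeo ρ).isOpenEmbedding ?_
    have h : ContDiff ℝ ∞ (fun q : ℝ × E3 => homeo ρ ((homeo ρ).symm q)⁻¹) := by
      have h1 : ContDiff ℝ ∞ (fun q : ℝ × E3 =>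
          (ρ.toHom (Multiplicative.ofAdd (-q.1)) ⟨-q.2⟩).log) :=
        ρ.smooth.comp (g := fun p : ℝ × E3 => (ρ.toHom (Multiplicative.ofAdd p.1) ⟨p.2⟩).log)
          (f := fun q : ℝ × E3 => (-q.1, -q.2)) (by fun_prop)
      exact contDiff_fst.neg.prodMk h1
    exact h.contMDiff.comp (contMDiff_homeo ρ)

end HeisExt

/-- The vectors of the Heisenberg algebra that are not central. -/
abbrev NonCentral := {W : E3 // W ∉ heisCenter}

/-- The one-parameter subgroup `I` of `G_ρ` generated by `W`. -/
def isotropy (ρ : HeisRep) (W : NonCentral) : Subgroup (HeisExt ρ) :=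
  (SemidirectProduct.inl.comp (Heis.oneParam W.1)).range

/-- The homogeneous space `P_ρ = G_ρ / I`, with the quotient topology. -/
abbrev PSpace (ρ : HeisRep) (W : NonCentral) := HeisExt ρ ⧸ isotropy ρ W

namespace PSpace

variable (ρ : HeisRep) (W : NonCentral)

/-- The squared length of the image of `W` in `heis / Z`. -/
def len : ℝ := W.1 0 ^ 2 + W.1 1 ^ 2

theorem len_ne_zero : len W ≠ 0 := by
  intro h
  apply W.2
  have h0 : W.1 0 = 0 := by unfold len at h; nlinarith [sq_nonneg (W.1 0), sq_nonneg (W.1 1)]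
  have h1 : W.1 1 = 0 := by unfold len at h; nlinarith [sq_nonneg (W.1 0), sq_nonneg (W.1 1)]
  intro b
  simp [heisBracket, h0, h1]

/-- Two coordinates on `Heis / I`, lifted to `heis`: the coordinate of `a` transverse to `W` in
`heis / Z`, and the central coordinate of the representative of the coset `exp(a) I` whose image in
`heis / Z` is orthogonal to that of `W`. -/
def slice (a : E3) : ℝ × ℝ :=
  (W.1 0 * a 1 - W.1 1 * a 0,
    a 2 - (W.1 0 * a 0 + W.1 1 * a 1) / len W * W.1 2
      + (1 / 2) * ((W.1 0 * a 0 + W.1 1 * a 1) / len W) * (W.1 0 * a 1 - W.1 1 * a 0))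

/-- The coordinates on `G_ρ` that are invariant under right translations by `I`: for
`a = (h, t)` they are `t` and the coordinates of `ρ(-t) h` in `Heis / I`. -/
def preChart (a : HeisExt ρ) : E3 :=
  ![a.right.toAdd, (slice W (ρ.toHom a.right⁻¹ a.left).log).1,
    (slice W (ρ.toHom a.right⁻¹ a.left).log).2]

/-- A section of the projection `G_ρ → P_ρ`, read in the coordinates. -/
def sect (p : E3) : HeisExt ρ :=
  ⟨ρ.toHom (Multiplicative.ofAdd (p 0)) ⟨![-(p 1 * W.1 1 / len W), p 1 * W.1 0 / len W, p 2]⟩,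
    Multiplicative.ofAdd (p 0)⟩

theorem preChart_mul (a : HeisExt ρ) (s : ℝ) :
    preChart ρ W (a * SemidirectProduct.inl (Heis.oneParam W.1 (Multiplicative.ofAdd s)))
      = preChart ρ W a := by
  have hl := len_ne_zero W
  have key : ∀ k : Heis, slice W (k * Heis.oneParam W.1 (Multiplicative.ofAdd s)).log
      = slice W k.log := by
    intro k
    have : (W.1 0 * (k.log 0 + s * W.1 0) + W.1 1 * (k.log 1 + s * W.1 1)) / len W
        = (W.1 0 * k.log 0 + W.1 1 * k.log 1) / len W + s := by
      field_simp
      unfold len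
      ring
    ext
    · simp [slice, Heis.mul_log, Heis.oneParam, heisBracket]
      ring
    · simp only [slice, Heis.mul_log, Heis.oneParam, heisBracket]
      simp [this]
      ring
  have h2 : ρ.toHom a.right⁻¹ (a.left * ρ.toHom a.right
      (Heis.oneParam W.1 (Multiplicative.ofAdd s)))
      = ρ.toHom a.right⁻¹ a.left * Heis.oneParam W.1 (Multiplicative.ofAdd s) := by
    rw [map_mul]
    simp
  simp only [preChart, SemidirectProduct.mul_left, SemidirectProduct.mul_right,
    SemidirectProduct.left_inl, SemidirectProduct.right_inl, mul_one, h2, key]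

theorem preChart_sect (p : E3) : preChart ρ W (sect ρ W p) = p := by
  have hl := len_ne_zero W
  ext i
  fin_cases i
  · rfl
  · simp [preChart, sect, slice]
    field_simp
    unfold len
    ring
  · simp [preChart, sect, slice]
    ring

theorem exists_eq_sect_mul (a : HeisExt ρ) : ∃ s : ℝ,
    sect ρ W (preChart ρ W a)
      * SemidirectProduct.inl (Heis.oneParam W.1 (Multiplicative.ofAdd s)) = a := by
  have hl := len_ne_zero W
  obtain ⟨k, hk⟩ : ∃ k, k = ρ.toHom a.right⁻¹ a.left := ⟨_, rfl⟩
  have hka : ρ.toHom a.right k = a.left := by rw [hk, map_inv]; simp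
  refine ⟨(W.1 0 * k.log 0 + W.1 1 * k.log 1) / len W, ?_⟩
  have key : (⟨![-((slice W k.log).1 * W.1 1 / len W), (slice W k.log).1 * W.1 0 / len W,
      (slice W k.log).2]⟩ : Heis) * Heis.oneParam W.1
        (Multiplicative.ofAdd ((W.1 0 * k.log 0 + W.1 1 * k.log 1) / len W)) = k := by
    ext i
    fin_cases i
    · simp [slice, Heis.mul_log, Heis.oneParam, heisBracket, Matrix.vecHead, Matrix.vecTail]
      field_simp
      unfold len
      ring
    · simp [slice, Heis.mul_log, Heis.oneParam, heisBracket, Matrix.vecHead, Matrix.vecTail]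
      field_simp
      unfold len
      ring
    · simp [slice, Heis.mul_log, Heis.oneParam, heisBracket, Matrix.vecHead, Matrix.vecTail]
      field_simp
      unfold len
      ring
  refine SemidirectProduct.ext ?_ ?_
  · simp only [sect, preChart, SemidirectProduct.mul_left, SemidirectProduct.left_inl, ← hk]
    simp only [Matrix.cons_val_zero, Matrix.cons_val_one, Matrix.cons_val, ofAdd_toAdd]
    rw [← map_mul, key, hka]
  · simp [sect, preChart]

theorem contDiff_slice {F : Type*} [NormedAddCommGroup F] [NormedSpace ℝ F] {f : F → E3}
    (hf : ContDiff ℝ ∞ f) : ContDiff ℝ ∞ (fun x => slice W (f x)) := by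
  have h0 := contDiff_pi.1 hf 0
  have h1 := contDiff_pi.1 hf 1
  have h2 := contDiff_pi.1 hf 2
  unfold slice
  fun_prop

theorem contMDiff_preChart : ContMDiff 𝓘(ℝ, ℝ × E3) 𝓘(ℝ, E3) ∞ (preChart ρ W) := by
  have h : ContDiff ℝ ∞ (fun q : ℝ × E3 => preChart ρ W ((HeisExt.homeo ρ).symm q)) := by
    have h1 : ContDiff ℝ ∞ (fun q : ℝ × E3 =>
        (ρ.toHom (Multiplicative.ofAdd (-q.1)) ⟨q.2⟩).log) :=
      ρ.smooth.comp (g := fun p : ℝ × E3 => (ρ.toHom (Multiplicative.ofAdd p.1) ⟨p.2⟩).log)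
        (f := fun q : ℝ × E3 => (-q.1, q.2)) (by fun_prop)
    have h2 := contDiff_slice W h1
    refine contDiff_pi.2 fun i => ?_
    fin_cases i
    · exact contDiff_fst
    · exact h2.fst
    · exact h2.snd
  exact h.contMDiff.comp (HeisExt.contMDiff_homeo ρ)

theorem contMDiff_sect : ContMDiff 𝓘(ℝ, E3) 𝓘(ℝ, ℝ × E3) ∞ (sect ρ W) := by
  refine ContMDiff.of_comp_isOpenEmbedding (HeisExt.homeo ρ).isOpenEmbedding ?_
  have h1 : ContDiff ℝ ∞ (fun p : E3 => (ρ.toHom (Multiplicative.ofAdd (p 0))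
      ⟨![-(p 1 * W.1 1 / len W), p 1 * W.1 0 / len W, p 2]⟩).log) :=
    ρ.smooth.comp (g := fun p : ℝ × E3 => (ρ.toHom (Multiplicative.ofAdd p.1) ⟨p.2⟩).log)
      (f := fun p : E3 => (p 0, ![-(p 1 * W.1 1 / len W), p 1 * W.1 0 / len W, p 2])) (by
        refine ContDiff.prodMk (by fun_prop) (contDiff_pi.2 fun i => ?_)
        fin_cases i <;> simp <;> fun_prop)
  have h2 : ContDiff ℝ ∞ (fun p : E3 => p 0) := by fun_prop
  exact (h2.prodMk h1).contMDiff

/-- The global chart of `P_ρ`. -/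
def homeo : PSpace ρ W ≃ₜ E3 where
  toFun := Quotient.lift (preChart ρ W) (by
    intro a b hab
    obtain ⟨s, hs⟩ := QuotientGroup.leftRel_apply.1 hab
    have hb : b = a * SemidirectProduct.inl (Heis.oneParam W.1 s) := by
      rw [← MonoidHom.comp_apply, hs]
      simp
    rw [hb]
    exact (preChart_mul ρ W a s.toAdd).symm)
  invFun p := QuotientGroup.mk (sect ρ W p)
  left_inv x := by
    induction x using QuotientGroup.induction_on with
    | H a =>
      obtain ⟨s, hs⟩ := exists_eq_sect_mul ρ W a
      refine QuotientGroup.eq.2 ⟨Multiplicative.ofAdd s, ?_⟩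
      exact eq_inv_mul_of_mul_eq hs
  right_inv p := preChart_sect ρ W p
  continuous_toFun := (contMDiff_preChart ρ W).continuous.quotient_lift _
  continuous_invFun := continuous_quotient_mk'.comp (contMDiff_sect ρ W).continuous

instance : ChartedSpace E3 (PSpace ρ W) := (homeo ρ W).isOpenEmbedding.singletonChartedSpace

instance : IsManifold 𝓘(ℝ, E3) ∞ (PSpace ρ W) :=
  (homeo ρ W).isOpenEmbedding.isManifold_singleton

/-- The smooth structure of `P_ρ` is the quotient one: the projection `G_ρ → P_ρ` is smooth, and
it has a smooth section. -/
theorem contMDiff_mk : ContMDiff 𝓘(ℝ, ℝ × E3) 𝓘(ℝ, E3) ∞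
    (QuotientGroup.mk : HeisExt ρ → PSpace ρ W) :=
  ContMDiff.of_comp_isOpenEmbedding (homeo ρ W).isOpenEmbedding (contMDiff_preChart ρ W)

theorem exists_smooth_section : ∃ σ : PSpace ρ W → HeisExt ρ,
    ContMDiff 𝓘(ℝ, E3) 𝓘(ℝ, ℝ × E3) ∞ σ ∧ ∀ x, (QuotientGroup.mk (σ x) : PSpace ρ W) = x :=
  ⟨sect ρ W ∘ homeo ρ W, (contMDiff_sect ρ W).comp
    (contMDiff_isOpenEmbedding (homeo ρ W).isOpenEmbedding),
    fun x => (homeo ρ W).symm_apply_apply x⟩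

end PSpace

/-! ### Lorentz geometry in dimension three -/

section Geometry

variable {M : Type*} [TopologicalSpace M] [ChartedSpace E3 M] [IsManifold 𝓘(ℝ, E3) ∞ M]
  {N : Type*} [TopologicalSpace N] [ChartedSpace E3 N] [IsManifold 𝓘(ℝ, E3) ∞ N]

/-- A field `q` of bilinear forms on the tangent spaces, read in the chart around `x₀`: its value
at the point of coordinates `y`, on the vectors of coordinates `a` and `b`. -/
def coordForm (q : (x : M) → TangentSpace 𝓘(ℝ, E3) x →L[ℝ] TangentSpace 𝓘(ℝ, E3) x →L[ℝ] ℝ)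
    (x₀ : M) (y a b : E3) : ℝ :=
  q ((extChartAt 𝓘(ℝ, E3) x₀).symm y)
    (mfderiv 𝓘(ℝ, E3) 𝓘(ℝ, E3) (extChartAt 𝓘(ℝ, E3) x₀).symm y a)
    (mfderiv 𝓘(ℝ, E3) 𝓘(ℝ, E3) (extChartAt 𝓘(ℝ, E3) x₀).symm y b)

/-- A smooth Lorentz metric, of signature `(-, +, +)`, on a `3`-dimensional manifold. -/
structure LorentzMetric (M : Type*) [TopologicalSpace M] [ChartedSpace E3 M]
    [IsManifold 𝓘(ℝ, E3) ∞ M] where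
  /-- The scalar product on the tangent spaces. -/
  val (x : M) : TangentSpace 𝓘(ℝ, E3) x →L[ℝ] TangentSpace 𝓘(ℝ, E3) x →L[ℝ] ℝ
  symm (x : M) (v w : TangentSpace 𝓘(ℝ, E3) x) : val x v w = val x w v
  signature (x : M) : ∃ e : Fin 3 → TangentSpace 𝓘(ℝ, E3) x, ∀ i j,
    val x (e i) (e j) = if i = j then (if i = 0 then -1 else 1) else 0
  /-- The coefficients of the metric in the charts are smooth. -/
  smooth (x₀ : M) (a b : E3) :
    ContDiffOn ℝ ∞ (fun y => coordForm val x₀ y a b) (extChartAt 𝓘(ℝ, E3) x₀).target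

/-- `f^* h = c g`. -/
def ScalesMetric (c : ℝ) (g : LorentzMetric M) (h : LorentzMetric N) (f : M → N) : Prop :=
  ∀ (x : M) (v w : TangentSpace 𝓘(ℝ, E3) x),
    h.val (f x) (mfderiv 𝓘(ℝ, E3) 𝓘(ℝ, E3) f x v) (mfderiv 𝓘(ℝ, E3) 𝓘(ℝ, E3) f x w)
      = c * g.val x v w

/-- `f^* h = g`. -/
def PreservesMetric (g : LorentzMetric M) (h : LorentzMetric N) (f : M → N) : Prop :=
  ∀ (x : M) (v w : TangentSpace 𝓘(ℝ, E3) x),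
    h.val (f x) (mfderiv 𝓘(ℝ, E3) 𝓘(ℝ, E3) f x v) (mfderiv 𝓘(ℝ, E3) 𝓘(ℝ, E3) f x w)
      = g.val x v w

/-- The isometries of `(M, g)` onto `(N, h)`. -/
def Isom (g : LorentzMetric M) (h : LorentzMetric N) :=
  {f : M ≃ₘ⟮𝓘(ℝ, E3), 𝓘(ℝ, E3)⟯ N // PreservesMetric g h f}

/-- The isometry group carries the compact-open topology. -/
instance (g : LorentzMetric M) (h : LorentzMetric N) : TopologicalSpace (Isom g h) :=
  TopologicalSpace.induced (fun f => (⟨f.1, f.1.continuous⟩ : C(M, N))) inferInstance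

/-- The identity isometry. -/
def Isom.refl (g : LorentzMetric M) : Isom g g :=
  ⟨Diffeomorph.refl 𝓘(ℝ, E3) M ∞, fun x v w => by
    have h : mfderiv 𝓘(ℝ, E3) 𝓘(ℝ, E3) (Diffeomorph.refl 𝓘(ℝ, E3) M ∞) x
        = ContinuousLinearMap.id ℝ (TangentSpace 𝓘(ℝ, E3) x) := mfderiv_id
    rw [h]
    rfl⟩

/-- The two Lorentz manifolds are (globally) isometric. -/
def Isometric (g : LorentzMetric M) (h : LorentzMetric N) : Prop := Nonempty (Isom g h)

/-- `e` is an isometry of the open set `e.source` of `(M, g)` onto the open set `e.target` of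
`(N, h)`. -/
def IsPartialIsom (g : LorentzMetric M) (h : LorentzMetric N) (e : OpenPartialHomeomorph M N) :
    Prop :=
  ContMDiffOn 𝓘(ℝ, E3) 𝓘(ℝ, E3) ∞ e e.source ∧
  ContMDiffOn 𝓘(ℝ, E3) 𝓘(ℝ, E3) ∞ e.symm e.target ∧
  ∀ x ∈ e.source, ∀ v w : TangentSpace 𝓘(ℝ, E3) x,
    h.val (e x) (mfderiv 𝓘(ℝ, E3) 𝓘(ℝ, E3) e x v) (mfderiv 𝓘(ℝ, E3) 𝓘(ℝ, E3) e x w)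
      = g.val x v w

/-- `(M, g)` is isometric to the open subset `U` of `(N, h)`. -/
def IsometricToOpen (g : LorentzMetric M) (h : LorentzMetric N) (U : Set N) : Prop :=
  ∃ e : OpenPartialHomeomorph M N, e.source = Set.univ ∧ e.target = U ∧ IsPartialIsom g h e

/-- The two Lorentz manifolds are locally isometric: every point of each of them has an open
neighbourhood that is isometric to an open subset of the other one. -/
def LocallyIsometric (g : LorentzMetric M) (h : LorentzMetric N) : Prop :=
  (∀ x : M, ∃ e : OpenPartialHomeomorph M N, x ∈ e.source ∧ IsPartialIsom g h e) ∧
  (∀ y : N, ∃ e : OpenPartialHomeomorph M N, y ∈ e.target ∧ IsPartialIsom g h e)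

/-- `(M, g)` is a symmetric space: every point is fixed by an isometry whose differential at that
point is `-1`. -/
def IsSymmetricSpace (g : LorentzMetric M) : Prop :=
  ∀ x : M, ∃ f : Isom g g, ∀ v : TangentSpace 𝓘(ℝ, E3) x,
    tangentMap 𝓘(ℝ, E3) 𝓘(ℝ, E3) f.1 ⟨x, v⟩ = ⟨x, -v⟩

/-- `(M, g)` is locally symmetric: every point is fixed by an isometry between two of its open
neighbourhoods whose differential at that point is `-1`. -/
def IsLocallySymmetric (g : LorentzMetric M) : Prop :=
  ∀ x : M, ∃ e : OpenPartialHomeomorph M M, x ∈ e.source ∧ IsPartialIsom g g e ∧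
    ∀ v : TangentSpace 𝓘(ℝ, E3) x, tangentMap 𝓘(ℝ, E3) 𝓘(ℝ, E3) e ⟨x, v⟩ = ⟨x, -v⟩

/-- `γ : ℝ → M` is a geodesic: it is smooth, and at each time `t₀` it satisfies, in the chart
around `γ t₀`, the geodesic equation in its Euler-Lagrange form
`d/dt g(c'(t), a) = (1/2) (∂_a g)(c'(t), c'(t))` for all constant vectors `a`. -/
def IsGeodesic (g : LorentzMetric M) (γ : ℝ → M) : Prop :=
  ContMDiff 𝓘(ℝ, ℝ) 𝓘(ℝ, E3) ∞ γ ∧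
  ∀ (t₀ : ℝ) (a : E3),
    HasDerivAt
      (fun t => coordForm g.val (γ t₀) (extChartAt 𝓘(ℝ, E3) (γ t₀) (γ t))
        (deriv (fun s => extChartAt 𝓘(ℝ, E3) (γ t₀) (γ s)) t) a)
      (1 / 2 * fderiv ℝ (fun y => coordForm g.val (γ t₀) y
        (deriv (fun s => extChartAt 𝓘(ℝ, E3) (γ t₀) (γ s)) t₀)
        (deriv (fun s => extChartAt 𝓘(ℝ, E3) (γ t₀) (γ s)) t₀))
        (extChartAt 𝓘(ℝ, E3) (γ t₀) (γ t₀)) a)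
      t₀

/-- `(M, g)` is (geodesically) complete: every tangent vector is the initial velocity of a geodesic
that is defined on the whole line. -/
def IsGeodesicallyComplete (g : LorentzMetric M) : Prop :=
  ∀ p : TangentBundle 𝓘(ℝ, E3) M, ∃ γ : ℝ → M, IsGeodesic g γ ∧
    (⟨γ 0, mfderiv 𝓘(ℝ, ℝ) 𝓘(ℝ, E3) γ 0 (1 : ℝ)⟩ : TangentBundle 𝓘(ℝ, E3) M) = p

/-- Some `3`-dimensional Lie group acts smoothly and isometrically on `(M, g)` with an open
orbit. -/
def HasOpenOrbitOfDimThree (g : LorentzMetric M) : Prop :=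
  ∃ (L : Type) (_ : Group L) (_ : TopologicalSpace L) (_ : ChartedSpace E3 L)
    (_ : LieGroup 𝓘(ℝ, E3) ∞ L) (_ : T2Space L) (_ : SecondCountableTopology L)
    (_ : MulAction L M),
    ContMDiffSMul 𝓘(ℝ, E3) 𝓘(ℝ, E3) ∞ L M ∧
    (∀ l : L, PreservesMetric g g (fun x => l • x)) ∧
    ∃ x : M, IsOpen (MulAction.orbit L x)

/-- The bilinear form `2 du dv + k x² du² + dx²` at the point `p = (u, v, x)`. -/
def brinkmannForm (k : ℝ) (p : E3) : E3 →L[ℝ] E3 →L[ℝ] ℝ :=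
  let π : Fin 3 → E3 →L[ℝ] ℝ := fun i => ContinuousLinearMap.proj i
  (π 0).smulRight (π 1) + (π 1).smulRight (π 0) + (π 2).smulRight (π 2)
    + (k * p 2 ^ 2) • (π 0).smulRight (π 0)

theorem brinkmannForm_apply (k : ℝ) (p a b : E3) : brinkmannForm k p a b =
    a 0 * b 1 + a 1 * b 0 + a 2 * b 2 + k * p 2 ^ 2 * (a 0 * b 0) := by
  simp [brinkmannForm]

/-- The Lorentz metric `2 du dv + k x² du² + dx²` on `ℝ³`, with coordinates `(u, v, x)`. -/
def brinkmann (k : ℝ) : LorentzMetric E3 where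
  val p := (brinkmannForm k p : E3 →L[ℝ] E3 →L[ℝ] ℝ)
  symm p v w := by
    refine (brinkmannForm_apply k p v w).trans
      (Eq.trans ?_ (brinkmannForm_apply k p w v).symm)
    ring
  signature p := by
    refine ⟨(![![1, -1 / 2 - k * p 2 ^ 2 / 2, 0], ![1, 1 / 2 - k * p 2 ^ 2 / 2, 0],
      ![0, 0, 1]] : Fin 3 → E3), fun i j => ?_⟩
    refine (brinkmannForm_apply k p _ _).trans ?_
    fin_cases i <;> fin_cases j <;> simp <;> ring
  smooth x₀ a b := by
    have h : ContDiff ℝ ∞ (fun y : E3 => brinkmannForm k y a b) := by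
      simp only [brinkmannForm_apply]
      fun_prop
    refine h.contDiffOn.congr fun y _ => ?_
    have h1 : mfderiv 𝓘(ℝ, E3) 𝓘(ℝ, E3) (extChartAt 𝓘(ℝ, E3) x₀).symm y
        = ContinuousLinearMap.id ℝ (TangentSpace 𝓘(ℝ, E3) y) := by
      rw [extChartAt_model_space_eq_id]
      exact mfderiv_id
    unfold coordForm
    rw [h1]
    rfl

/-- Minkowski space: `ℝ³` with the metric `2 du dv + dx²`. -/
def minkowski : LorentzMetric E3 := brinkmann 0

/-- Half Minkowski space is the open subset `u > 0` of Minkowski space. -/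
def halfSpace : Set E3 := {p | 0 < p 0}

/-- The hyperbolic Cahen-Wallach space: `ℝ³` with the metric `2 du dv + x² du² + dx²`. -/
def cahenWallachHyperbolic : LorentzMetric E3 := brinkmann 1

/-- The elliptic Cahen-Wallach space: `ℝ³` with the metric `2 du dv - x² du² + dx²`. -/
def cahenWallachElliptic : LorentzMetric E3 := brinkmann (-1)

/-- `(M, g)` is flat: it is locally isometric to Minkowski space. -/
def IsFlat (g : LorentzMetric M) : Prop :=
  ∀ x : M, ∃ e : OpenPartialHomeomorph M E3, x ∈ e.source ∧ IsPartialIsom g minkowski e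

end Geometry

/-! ### Groups of isometries of Minkowski space -/

/-- The Gram matrix of the Minkowski form `2 du dv + dx²`. -/
def minkMatrix : Matrix (Fin 3) (Fin 3) ℝ := !![0, 1, 0; 1, 0, 0; 0, 0, 1]

/-- The affine map `p ↦ L p + τ` as a matrix. -/
def affineMatrix (L : Matrix (Fin 3) (Fin 3) ℝ) (τ : E3) :
    Matrix (Fin 3 ⊕ Unit) (Fin 3 ⊕ Unit) ℝ :=
  Matrix.fromBlocks L (Matrix.of fun i _ => τ i) 0 1

/-- The copy `Aff` of the affine group of the line in `O(1, 2)`: the identity component of the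
stabilizer of the degenerate plane `u = 0`. -/
def affO12 : Set (Matrix (Fin 3) (Fin 3) ℝ) :=
  {L | L.transpose * minkMatrix * L = minkMatrix ∧ L.det = 1 ∧ L 0 1 = 0 ∧ L 0 2 = 0 ∧ 0 < L 0 0}

/-- The group `Aff ⋉ ℝ²` of affine isometries of Minkowski space, where `ℝ²` is the degenerate
plane `u = 0`. -/
def affR2 : Set (Matrix (Fin 3 ⊕ Unit) (Fin 3 ⊕ Unit) ℝ) :=
  {m | ∃ L ∈ affO12, ∃ τ : E3, τ 0 = 0 ∧ m = affineMatrix L τ}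

/-- `D` generates a (non-trivial) unipotent one-parameter subgroup of `O(1, 2)`. -/
def IsUnipotentGenerator (D : Matrix (Fin 3) (Fin 3) ℝ) : Prop :=
  D.transpose * minkMatrix + minkMatrix * D = 0 ∧ D ≠ 0 ∧ IsNilpotent D

/-- The group `N ⋉ ℝ³` of affine isometries of Minkowski space, with `N = {exp (s D)}`. -/
def unipotentR3 (D : Matrix (Fin 3) (Fin 3) ℝ) : Set (Matrix (Fin 3 ⊕ Unit) (Fin 3 ⊕ Unit) ℝ) :=
  {m | ∃ (s : ℝ) (τ : E3), m = affineMatrix (NormedSpace.exp (s • D)) τ}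

/-- `G_ρ` is isomorphic, as a Lie group, to the closed matrix group whose set of elements is `S`. -/
def LieIsoMatrixGroup (ρ : HeisRep) (S : Set (Matrix (Fin 3 ⊕ Unit) (Fin 3 ⊕ Unit) ℝ)) : Prop :=
  ∃ φ : HeisExt ρ →* Matrix (Fin 3 ⊕ Unit) (Fin 3 ⊕ Unit) ℝ,
    (∀ i j, ContMDiff 𝓘(ℝ, ℝ × E3) 𝓘(ℝ, ℝ) ∞ (fun a => φ a i j)) ∧
    Topology.IsEmbedding φ ∧ Set.range φ = S

/-! ### Properties of representations and of the spaces `P_ρ` -/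

/-- `φ` is an isomorphism of Lie groups. -/
def IsLieIso {ρ ρ' : HeisRep} (φ : HeisExt ρ ≃* HeisExt ρ') : Prop :=
  ContMDiff 𝓘(ℝ, ℝ × E3) 𝓘(ℝ, ℝ × E3) ∞ φ ∧ ContMDiff 𝓘(ℝ, ℝ × E3) 𝓘(ℝ, ℝ × E3) ∞ φ.symm

/-- `G_ρ` and `G_ρ'` are isomorphic Lie groups. -/
def LieIsomorphic (ρ ρ' : HeisRep) : Prop := ∃ φ : HeisExt ρ ≃* HeisExt ρ', IsLieIso φ

/-- `G` is unimodular: it has a Haar measure that is invariant on both sides. -/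
def IsUnimodular (G : Type*) [Group G] [TopologicalSpace G] : Prop :=
  letI : MeasurableSpace G := borel G
  ∃ μ : MeasureTheory.Measure G, μ.IsHaarMeasure ∧ μ.IsMulRightInvariant

namespace HeisRep

variable (ρ : HeisRep)

/-- The image of `W` in `heis / Z` is an eigenvector of the action of `ρ`. -/
def IsEigenvector (W : NonCentral) : Prop :=
  ∀ t : ℝ, ∃ c : ℝ, heisCenter.mkQ (ρ.lie t W.1) = c • heisCenter.mkQ W.1

/-- `ρ` acts on `heis / Z` by similarities, with non-real eigenvalues: for some identification of
`heis / Z` with `ℂ`, each `ρ t` acts as the multiplication by a complex number `c t`, and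
`c t` is not always real. -/
def IsElliptic : Prop :=
  ∃ (P : (E3 ⧸ heisCenter) ≃ₗ[ℝ] ℂ) (c : ℝ → ℂ),
    (∀ (t : ℝ) (X : E3), P (heisCenter.mkQ (ρ.lie t X)) = c t * P (heisCenter.mkQ X)) ∧
    ∃ t : ℝ, (c t).im ≠ 0

/-- `ρ` acts on `heis / Z` diagonalizably, with real eigenvalues. -/
def IsHyperbolic : Prop :=
  ∃ (P : (E3 ⧸ heisCenter) ≃ₗ[ℝ] ℝ × ℝ) (c d : ℝ → ℝ),
    ∀ (t : ℝ) (X : E3), P (heisCenter.mkQ (ρ.lie t X)) =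
      (c t * (P (heisCenter.mkQ X)).1, d t * (P (heisCenter.mkQ X)).2)

/-- `ρ` is unipotent. -/
def IsUnipotent : Prop := ∀ t : ℝ, IsNilpotent (ρ.lie t - 1)

/-- `ρ` fixes the center (pointwise). -/
def FixesCenter : Prop := ∀ t : ℝ, ∀ X ∈ heisCenter, ρ.lie t X = X

/-- `ρ` has a (non-zero) fixed vector in `heis`. -/
def HasFixedVector : Prop := ∃ X : E3, X ≠ 0 ∧ ∀ t : ℝ, ρ.lie t X = X

end HeisRep

section

variable {ρ : HeisRep} {W : NonCentral}

/-- The action of `G_ρ` on `P_ρ` preserves the metric `g`. -/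
def IsInvariant (g : LorentzMetric (PSpace ρ W)) : Prop :=
  ∀ a : HeisExt ρ, PreservesMetric g g (fun x => a • x)

/-- The two metrics on `P_ρ` agree up to scaling and to the diffeomorphism of `P_ρ = G_ρ / I`
induced by a Lie group automorphism of `G_ρ` that fixes `W`. -/
def EquivUpToScaling (g₁ g₂ : LorentzMetric (PSpace ρ W)) : Prop :=
  ∃ (φ : HeisExt ρ ≃* HeisExt ρ)
    (F : PSpace ρ W ≃ₘ⟮𝓘(ℝ, E3), 𝓘(ℝ, E3)⟯ PSpace ρ W) (c : ℝ),
    IsLieIso φ ∧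
    (∀ s, φ (SemidirectProduct.inl (Heis.oneParam W.1 s))
      = SemidirectProduct.inl (Heis.oneParam W.1 s)) ∧
    (∀ a : HeisExt ρ, F (QuotientGroup.mk a) = QuotientGroup.mk (φ a)) ∧
    0 < c ∧ ScalesMetric c g₁ g₂ F

/-- `Iso⁰(P_ρ) = G_ρ`: the action identifies the topological group `G_ρ` with the identity
component of the isometry group. -/
def IdentityComponentEq (g : LorentzMetric (PSpace ρ W)) : Prop :=
  ∃ Φ : HeisExt ρ → Isom g g, (∀ a x, (Φ a).1 x = a • x) ∧ Topology.IsEmbedding Φ ∧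
    Set.range Φ = connectedComponent (Isom.refl g)

end

end PlaneWave
end

noncomputable section
namespace PlaneWave

/-! ### Linear algebra of the Heisenberg algebra -/

/-! The whole statement reduces to two real numbers. If the class of `W` in `heis / Z` is not an
eigenvector of `ρ`, it is not one of the generator either (`HeisRep.area_ne_zero`), so `W` and its
image under the generator span `heis / Z`. By Cayley-Hamilton the generator becomes `X ↦ Y ↦ k X + b
Y`, `Z ↦ b Z` in this frame, where `b` is its trace and `-k` its determinant on `heis / Z`. An extra
term `Y ↦ γ Z` may occur; it disappears when the complement of `Heis` in `G_ρ` is changed by a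
cocycle (`exists_normalForm`). So the pair `(G_ρ, I)` depends only on `(b, k)`, and rescaling time
identifies `(l b, l² k)` with `(b, k)` on the level of groups.

The group in normal form acts by isometries on `ℝ³` with the metric `2 e^{bs} ds dv + k x² ds² +
dx²` (`act`, `modelForm_act`). A Heisenberg element acts through a solution `φ` of `φ'' = b φ' + k
φ` by `x ↦ x + φ(s)`, with a compensating change of `v`, and the Wronskian of two solutions
reproduces the Heisenberg bracket (`act_mul`). The action is transitive and the stabilizer of the
origin is `I`, so `P_ρ` is equivariantly diffeomorphic to this model. Invariance under the unipotent
isotropy leaves only the forms `c g + f ds²` (`NormalForm.isotropy_invariant_form`). The maps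
`rescale`, equivariant under automorphisms of the group, account for both parameters; this gives
existence, uniqueness and `NormalForm.exists_isom_model`. Conversely, if `W` is an eigenvector, `exp
W` fixes a point and its differential there is a transvection, which no nondegenerate form allows
(`not_isEigenvector`).

Rigidity comes from the second-order system satisfied by a local isometry (`IsModelIsom.hessian`).
If `k ≠ 0`, the way its coefficients depend on `x` forces the isometry to preserve the foliation by
level sets of `s`, and `S`, the derivative of its first coordinate along `s`, satisfies `k = k' S²`
and `b = b' S` (`IsModelIsom.eq_of_convex`). If `k = 0` the model is flat: Minkowski space for `b =
0`, and half Minkowski through `u = e^{bs}` for `b ≠ 0`; a global argument on positive affine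
functions then gives the same proportionality (`IsModelIsom.eq_of_flat`). Hence isometry classes,
and local isometry classes away from the flat case, are the classes of `(b, k)` up to scaling. The
trace of the adjoint representation yields the same invariants of the group
(`HeisExt.exists_eq_of_bijective`), so isometric spaces correspond to isomorphic groups. The same
analysis writes each isometry of a model other than Minkowski space as a group element composed with
sign changes (`Isom.exists_eq_act`), which determines the identity component.

The remaining properties are conditions on `(b, k)`: elliptic is `b² + 4k < 0`, while symmetric,
unimodular and central action trivial are each `b = 0`; flat is `k = 0` and unipotent is `b = k =
0`. A real eigenvalue gives an invariant plane in `heis`, hence a transitive three-dimensional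
subgroup (`hasOpenOrbitOfDimThree`). In the elliptic case, a group with an open orbit would have to
realize all of `G_ρ`, whose dimension is four (`not_hasOpenOrbitOfDimThree`). -/

theorem heisBracket_zero (a b : E3) : heisBracket a b 0 = 0 := rfl
theorem heisBracket_one (a b : E3) : heisBracket a b 1 = 0 := rfl
theorem heisBracket_two (a b : E3) : heisBracket a b 2 = a 0 * b 1 - a 1 * b 0 := rfl

theorem ext_E3 {a b : E3} (h0 : a 0 = b 0) (h1 : a 1 = b 1) (h2 : a 2 = b 2) : a = b := by
  ext i
  fin_cases i
  · exact h0
  · exact h1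
  · exact h2

theorem E3_eq_sum (x : E3) :
    x = x 0 • (![1, 0, 0] : E3) + x 1 • (![0, 1, 0] : E3) + x 2 • (![0, 0, 1] : E3) := by
  refine ext_E3 ?_ ?_ ?_ <;> simp

theorem mem_heisCenter {a : E3} : a ∈ heisCenter ↔ a 0 = 0 ∧ a 1 = 0 := by
  constructor
  · intro h
    have h0 := congrFun (h ![0, 1, 0]) 2
    have h1 := congrFun (h ![1, 0, 0]) 2
    simp [heisBracket] at h0 h1
    exact ⟨h0, h1⟩
  · rintro ⟨h0, h1⟩ b
    simp [heisBracket, h0, h1]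

theorem mk_eq_mk_center {a b : E3} :
    heisCenter.mkQ a = heisCenter.mkQ b ↔ a 0 = b 0 ∧ a 1 = b 1 := by
  rw [Submodule.mkQ_apply, Submodule.mkQ_apply, Submodule.Quotient.eq, mem_heisCenter]
  simp [sub_eq_zero]

/-! ### Representations as one-parameter groups of linear maps -/

namespace HeisRep

variable (ρ : HeisRep)

/-- Elements `exp(sX)` and `exp(s'X)` commute, so exchanging their images changes the sign of the
bracket in the Baker-Campbell-Hausdorff formula without changing the product: the bracket is zero
and `s ↦ log φ(exp sX)` is additive. Continuity makes it real linear. -/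
theorem log_toHom_smul (t : ℝ) (s : ℝ) (X : E3) :
    (ρ.toHom (Multiplicative.ofAdd t) ⟨s • X⟩).log
      = s • (ρ.toHom (Multiplicative.ofAdd t) ⟨X⟩).log := by
  set φ := ρ.toHom (Multiplicative.ofAdd t)
  have hadd : ∀ s s' : ℝ, (φ ⟨(s + s') • X⟩).log = (φ ⟨s • X⟩).log + (φ ⟨s' • X⟩).log := by
    intro s s'
    have h1 : ∀ s s' : ℝ, (⟨(s + s') • X⟩ : Heis) = ⟨s • X⟩ * ⟨s' • X⟩ := by
      intro s s'
      ext i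
      fin_cases i <;> simp [Heis.mul_log, heisBracket] <;> ring
    have h2 := congrArg (fun a => (φ a).log) (h1 s s')
    have h3 := congrArg (fun a => (φ a).log) (h1 s' s)
    simp only [map_mul, Heis.mul_log] at h2 h3
    rw [add_comm s' s, h2] at h3
    have h4 := congrFun h3 2
    simp only [Pi.add_apply, Pi.smul_apply, heisBracket_two, smul_eq_mul] at h4
    rw [h2]
    refine ext_E3 ?_ ?_ ?_
    · simp [heisBracket_zero]
    · simp [heisBracket_one]
    · simp only [Pi.add_apply, Pi.smul_apply, heisBracket_two, smul_eq_mul]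
      linarith
  have hc : Continuous (fun s : ℝ => (φ ⟨s • X⟩).log) := by
    have := ρ.smooth.continuous
    exact this.comp (f := fun s : ℝ => (t, s • X)) (by fun_prop)
  let f : ℝ →+ E3 := AddMonoidHom.mk' (fun s : ℝ => (φ ⟨s • X⟩).log) hadd
  have h := map_real_smul f hc s 1
  simpa [f] using h

/-- A map that is homogeneous of degree one and differentiable at the origin equals its differential
there. Thus automorphisms of the group are linear in exponential coordinates. -/
theorem log_toHom (t : ℝ) (a : Heis) :
    (ρ.toHom (Multiplicative.ofAdd t) a).log = ρ.lie t a.log := by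
  set f : E3 → E3 := fun X => (ρ.toHom (Multiplicative.ofAdd t) ⟨X⟩).log with hf
  have hd : DifferentiableAt ℝ f 0 := by
    have h : ContDiff ℝ ∞ f :=
      ρ.smooth.comp (g := fun p : ℝ × E3 => (ρ.toHom (Multiplicative.ofAdd p.1) ⟨p.2⟩).log)
        (f := fun X : E3 => (t, X)) (by fun_prop)
    exact (h.differentiable (by simp)).differentiableAt
  have h1 : HasDerivAt (fun s : ℝ => f (s • a.log)) (fderiv ℝ f 0 a.log) 0 := by
    have h2 : HasDerivAt (fun s : ℝ => s • a.log) a.log 0 := by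
      simpa using (hasDerivAt_id (0 : ℝ)).smul_const a.log
    have h3 : HasFDerivAt f (fderiv ℝ f 0) ((0 : ℝ) • a.log) := by
      rw [zero_smul]; exact hd.hasFDerivAt
    exact h3.comp_hasDerivAt (0 : ℝ) h2
  have h2 : HasDerivAt (fun s : ℝ => f (s • a.log)) (f a.log) 0 := by
    have h3 : (fun s : ℝ => f (s • a.log)) = fun s => s • f a.log := by
      funext s
      exact ρ.log_toHom_smul t s a.log
    rw [h3]
    simpa using (hasDerivAt_id (0 : ℝ)).smul_const (f a.log)
  exact h2.unique h1

theorem toHom_apply (t : ℝ) (a : Heis) :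
    ρ.toHom (Multiplicative.ofAdd t) a = ⟨ρ.lie t a.log⟩ := by
  ext1
  exact ρ.log_toHom t a

theorem toHom_apply' (t : Multiplicative ℝ) (a : Heis) :
    ρ.toHom t a = ⟨ρ.lie t.toAdd a.log⟩ := ρ.toHom_apply t.toAdd a

theorem contDiff_lie : ContDiff ℝ ∞ (fun p : ℝ × E3 => ρ.lie p.1 p.2) := by
  convert! ρ.smooth using 2 with p
  rw [log_toHom]

theorem contDiff_lie_const (x : E3) : ContDiff ℝ ∞ (fun t => ρ.lie t x) :=
  ρ.contDiff_lie.comp (f := fun t : ℝ => (t, x)) (by fun_prop)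

theorem lie_zero (x : E3) : ρ.lie 0 x = x := by
  have h := ρ.log_toHom 0 ⟨x⟩
  rw [ofAdd_zero, map_one] at h
  exact h.symm

theorem lie_add (s t : ℝ) (x : E3) : ρ.lie (s + t) x = ρ.lie s (ρ.lie t x) := by
  have h := ρ.log_toHom (s + t) ⟨x⟩
  rw [ofAdd_add, map_mul, MulAut.mul_apply, log_toHom, log_toHom] at h
  exact h.symm

/-- The linear parts of both sides of `φ(ab) = φ(a)φ(b)` cancel, which leaves half the brackets. -/
theorem lie_bracket (t : ℝ) (x y : E3) :
    ρ.lie t (heisBracket x y) = heisBracket (ρ.lie t x) (ρ.lie t y) := by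
  have h := ρ.log_toHom t (⟨x⟩ * ⟨y⟩)
  rw [map_mul, Heis.mul_log, Heis.mul_log, log_toHom, log_toHom, map_add, map_add, map_smul] at h
  have h2 := add_left_cancel h
  exact (smul_right_injective E3 (by norm_num : (1 / 2 : ℝ) ≠ 0) h2).symm

/-- The infinitesimal generator of `ρ`. -/
def gen (x : E3) : E3 := deriv (fun t => ρ.lie t x) 0

theorem hasDerivAt_lie (t : ℝ) (x : E3) :
    HasDerivAt (fun t => ρ.lie t x) (ρ.lie t (ρ.gen x)) t := by
  have h0 : HasDerivAt (fun s => ρ.lie s x) (ρ.gen x) (t - t) := by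
    rw [sub_self]
    exact ((ρ.contDiff_lie_const x).differentiable (by simp)).differentiableAt.hasDerivAt
  have h1 : HasDerivAt (fun s => ρ.lie (s - t) x) (ρ.gen x) t := h0.comp_sub_const t t
  have h2 := (ρ.lie t).hasFDerivAt.comp_hasDerivAt t h1
  convert! h2 using 2 with s
  simp only [Function.comp]
  rw [← lie_add, add_sub_cancel]

theorem lie_gen (t : ℝ) (x : E3) : ρ.lie t (ρ.gen x) = ρ.gen (ρ.lie t x) := by
  have h1 := ρ.hasDerivAt_lie t x
  have h2 := ρ.hasDerivAt_lie 0 (ρ.lie t x)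
  rw [lie_zero] at h2
  have h3 : HasDerivAt (fun s => ρ.lie s x) (ρ.lie t (ρ.gen x)) (0 + t) := by rwa [zero_add]
  have h4 := h3.comp_add_const 0 t
  refine h4.unique ?_
  convert! h2 using 2 with s
  rw [lie_add]

theorem gen_add (x y : E3) : ρ.gen (x + y) = ρ.gen x + ρ.gen y := by
  have h1 := (ρ.hasDerivAt_lie 0 x).add (ρ.hasDerivAt_lie 0 y)
  have h2 := ρ.hasDerivAt_lie 0 (x + y)
  simp only [lie_zero] at h1 h2
  refine h2.unique ?_
  convert! h1 using 2 with s
  simp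

theorem gen_smul (c : ℝ) (x : E3) : ρ.gen (c • x) = c • ρ.gen x := by
  have h1 := (ρ.hasDerivAt_lie 0 x).const_smul c
  have h2 := ρ.hasDerivAt_lie 0 (c • x)
  simp only [lie_zero] at h1 h2
  refine h2.unique ?_
  convert! h1 using 2 with s
  simp

theorem gen_bracket (x y : E3) :
    ρ.gen (heisBracket x y) = heisBracket (ρ.gen x) y + heisBracket x (ρ.gen y) := by
  have hx := ρ.hasDerivAt_lie 0 x
  have hy := ρ.hasDerivAt_lie 0 y
  have h2 := ρ.hasDerivAt_lie 0 (heisBracket x y)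
  simp only [lie_zero] at hx hy h2
  refine h2.unique ?_
  have e : (fun t => ρ.lie t (heisBracket x y))
      = fun t => heisBracket (ρ.lie t x) (ρ.lie t y) := by
    funext t; exact ρ.lie_bracket t x y
  rw [e, hasDerivAt_pi]
  rw [hasDerivAt_pi] at hx hy
  intro i
  fin_cases i
  · simpa [heisBracket_zero] using hasDerivAt_const (0 : ℝ) (0 : ℝ)
  · simpa [heisBracket_one] using hasDerivAt_const (0 : ℝ) (0 : ℝ)
  · have h := ((hx 0).mul (hy 1)).sub ((hx 1).mul (hy 0))
    simp only [lie_zero] at h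
    convert! h using 1
    simp [heisBracket_two]
    ring

/-- A representation is determined by its infinitesimal generator. -/
theorem lie_eq_of_gen_eq {ρ ρ' : HeisRep} (h : ∀ x, ρ.gen x = ρ'.gen x) (t : ℝ) (x : E3) :
    ρ.lie t x = ρ'.lie t x := by
  -- The two flows are compared through `ρ'(-s) ρ(s) x`: the contributions of the two generators to
  -- its derivative cancel, so it keeps its value `x` at `s = 0`.
  have key : ∀ s : ℝ, HasDerivAt (fun s => ρ'.lie (-s) (ρ.lie s x)) 0 s := by
    intro s
    have h1 : HasFDerivAt (fun p : ℝ × E3 => ρ'.lie p.1 p.2)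
        (fderiv ℝ (fun p : ℝ × E3 => ρ'.lie p.1 p.2) (-s, ρ.lie s x)) (-s, ρ.lie s x) :=
      (ρ'.contDiff_lie.differentiable (by simp)).differentiableAt.hasFDerivAt
    have h2 : HasDerivAt (fun s : ℝ => ((-s, ρ.lie s x) : ℝ × E3))
        (-1, ρ.lie s (ρ.gen x)) s := (hasDerivAt_neg s).prodMk (ρ.hasDerivAt_lie s x)
    have h3 := h1.comp_hasDerivAt s h2
    set D := fderiv ℝ (fun p : ℝ × E3 => ρ'.lie p.1 p.2) (-s, ρ.lie s x)
    have e1 : D (1, 0) = ρ'.lie (-s) (ρ'.gen (ρ.lie s x)) := by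
      have h4 : HasDerivAt (fun r : ℝ => ((r, ρ.lie s x) : ℝ × E3)) (1, 0) (-s) :=
        (hasDerivAt_id _).prodMk (hasDerivAt_const _ _)
      exact (h1.comp_hasDerivAt (-s) h4).unique (ρ'.hasDerivAt_lie (-s) (ρ.lie s x))
    have e2 : ∀ v, D (0, v) = ρ'.lie (-s) v := by
      intro v
      have h4 : HasFDerivAt (fun r : E3 => ((-s, r) : ℝ × E3))
        (ContinuousLinearMap.inr ℝ ℝ E3) (ρ.lie s x) := hasFDerivAt_prodMk_right _ _
      have h5 := (h1.comp _ h4).unique ((ρ'.lie (-s)).hasFDerivAt)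
      have h6 := congrArg (fun T => T v) h5
      simpa using h6
    have e3 : D (-1, ρ.lie s (ρ.gen x)) = 0 := by
      have : ((-1, ρ.lie s (ρ.gen x)) : ℝ × E3) = -(1, 0) + (0, ρ.lie s (ρ.gen x)) := by simp
      rw [this, map_add, map_neg, e1, e2, ρ.lie_gen, h, neg_add_cancel]
    rw [e3] at h3
    exact h3
  have hconst := is_const_of_deriv_eq_zero (f := fun s => ρ'.lie (-s) (ρ.lie s x))
    (fun s => (key s).differentiableAt) (fun s => (key s).deriv) t 0
  simp only [neg_zero, lie_zero] at hconst
  have := congrArg (ρ'.lie t) hconst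
  rw [← lie_add, add_neg_cancel, lie_zero] at this
  exact this

/-- The representation given by a smooth one-parameter group of automorphisms of `heis`. -/
def ofLie (l : ℝ → E3 → E3) (hs : ContDiff ℝ ∞ (fun p : ℝ × E3 => l p.1 p.2))
    (hadd : ∀ t x y, l t (x + y) = l t x + l t y) (hsmul : ∀ t (c : ℝ) x, l t (c • x) = c • l t x)
    (hbr : ∀ t x y, l t (heisBracket x y) = heisBracket (l t x) (l t y))
    (h0 : ∀ x, l 0 x = x) (hl : ∀ s t x, l (s + t) x = l s (l t x)) : HeisRep where
  toHom :=
    { toFun := fun t =>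
        { toFun := fun a => ⟨l t.toAdd a.log⟩
          invFun := fun a => ⟨l (-t.toAdd) a.log⟩
          left_inv := fun a => by ext1; simp [← hl, h0]
          right_inv := fun a => by ext1; simp [← hl, h0]
          map_mul' := fun a b => by ext1; simp only [Heis.mul_log, hadd, hsmul, hbr] }
      map_one' := by
        refine MulEquiv.ext fun a => ?_
        ext1
        exact h0 a.log
      map_mul' := fun s t => by
        refine MulEquiv.ext fun a => ?_
        ext1
        exact hl _ _ a.log }
  smooth := hs

theorem lie_ofLie (l : ℝ → E3 → E3) (hs hadd hsmul hbr h0 hl) (t : ℝ) (x : E3) :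
    (ofLie l hs hadd hsmul hbr h0 hl).lie t x = l t x :=
  ((ofLie l hs hadd hsmul hbr h0 hl).log_toHom t ⟨x⟩).symm

end HeisRep

end PlaneWave
end

noncomputable section
namespace PlaneWave

/-! ### The linear equation `y'' = b y' + k y` -/

theorem contDiff_of_hasDerivAt {F : Type*} [NormedAddCommGroup F] [NormedSpace ℝ F] {f g : ℝ → F}
    (h : ∀ t, HasDerivAt f (g t) t) (hg : ContDiff ℝ ∞ g) : ContDiff ℝ ∞ f := by
  rw [contDiff_infty_iff_deriv]
  refine ⟨fun t => (h t).differentiableAt, ?_⟩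
  have : deriv f = g := funext fun t => (h t).deriv
  rwa [this]

/-- The substitution `y = e^{bt/2} u` removes the first-order term and leaves `u'' = m u` with `4m =
b² + 4k`. According to the sign of the discriminant, `u` is a sine, the identity or a hyperbolic
sine. -/
theorem exists_sol (b k : ℝ) : ∃ f g : ℝ → ℝ, ContDiff ℝ ∞ f ∧ ContDiff ℝ ∞ g ∧
    (∀ t, HasDerivAt f (g t) t) ∧ (∀ t, HasDerivAt g (b * g t + k * f t) t) ∧
    f 0 = 0 ∧ g 0 = 1 := by
  obtain ⟨u, v, m, hu, hv, huv, hvu, hm, hu0, hv0⟩ : ∃ (u v : ℝ → ℝ) (m : ℝ), ContDiff ℝ ∞ u ∧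
      ContDiff ℝ ∞ v ∧ (∀ t, HasDerivAt u (v t) t) ∧ (∀ t, HasDerivAt v (m * u t) t) ∧
      4 * m = b ^ 2 + 4 * k ∧ u 0 = 0 ∧ v 0 = 1 := by
    rcases lt_trichotomy (b ^ 2 + 4 * k) 0 with h | h | h
    · obtain ⟨w, hw, hw2⟩ : ∃ w : ℝ, w ≠ 0 ∧ 4 * w ^ 2 = -(b ^ 2 + 4 * k) := by
        refine ⟨Real.sqrt (-(b ^ 2 + 4 * k)) / 2, ?_, ?_⟩
        · have := Real.sqrt_pos.2 (neg_pos.2 h)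
          positivity
        · rw [div_pow, Real.sq_sqrt (by linarith)]; ring
      refine ⟨fun t => Real.sin (w * t) / w, fun t => Real.cos (w * t), -w ^ 2, by fun_prop,
        by fun_prop, fun t => ?_, fun t => ?_, by linarith, by simp, by simp⟩
      · have h1 : HasDerivAt (fun t => w * t) w t := by simpa using (hasDerivAt_id t).const_mul w
        convert! (h1.sin.div_const w) using 1
        field_simp
      · have h1 : HasDerivAt (fun t => w * t) w t := by simpa using (hasDerivAt_id t).const_mul w
        convert! h1.cos using 1
        field_simp
    · refine ⟨fun t => t, fun _ => 1, 0, contDiff_id, contDiff_const, fun t => hasDerivAt_id t,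
        fun t => ?_, by linarith, rfl, rfl⟩
      simpa using hasDerivAt_const t (1 : ℝ)
    · obtain ⟨w, hw, hw2⟩ : ∃ w : ℝ, w ≠ 0 ∧ 4 * w ^ 2 = b ^ 2 + 4 * k := by
        refine ⟨Real.sqrt (b ^ 2 + 4 * k) / 2, ?_, ?_⟩
        · have := Real.sqrt_pos.2 h
          positivity
        · rw [div_pow, Real.sq_sqrt (by linarith)]; ring
      refine ⟨fun t => Real.sinh (w * t) / w, fun t => Real.cosh (w * t), w ^ 2, by fun_prop,
        by fun_prop, fun t => ?_, fun t => ?_, by linarith, by simp, by simp⟩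
      · have h1 : HasDerivAt (fun t => w * t) w t := by simpa using (hasDerivAt_id t).const_mul w
        convert! (h1.sinh.div_const w) using 1
        field_simp
      · have h1 : HasDerivAt (fun t => w * t) w t := by simpa using (hasDerivAt_id t).const_mul w
        convert! h1.cosh using 1
        field_simp
  have hE : ∀ t : ℝ, HasDerivAt (fun t => Real.exp (b / 2 * t)) (b / 2 * Real.exp (b / 2 * t)) t := by
    intro t
    have h1 : HasDerivAt (fun t => b / 2 * t) (b / 2) t := by
      simpa using (hasDerivAt_id t).const_mul (b / 2)
    convert! h1.exp using 1
    ring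
  refine ⟨fun t => Real.exp (b / 2 * t) * u t,
    fun t => Real.exp (b / 2 * t) * (b / 2 * u t + v t), by fun_prop, by fun_prop,
    fun t => ?_, fun t => ?_, by simp [hu0], by simp [hu0, hv0]⟩
  · convert! (hE t).mul (huv t) using 1
    ring
  · convert! (hE t).mul (((huv t).const_mul (b / 2)).add (hvu t)) using 1
    simp only [Pi.add_apply]
    linear_combination -(Real.exp (b / 2 * t) * u t) / 4 * hm

/-- The solution of `y'' = b y' + k y` with `y 0 = 0` and `y' 0 = 1`. -/
def sol (b k : ℝ) : ℝ → ℝ := (exists_sol b k).choose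

/-- The derivative of `sol`. -/
def sol' (b k : ℝ) : ℝ → ℝ := (exists_sol b k).choose_spec.choose

section sol

variable (b k : ℝ)

theorem contDiff_sol : ContDiff ℝ ∞ (sol b k) := (exists_sol b k).choose_spec.choose_spec.1
theorem contDiff_sol' : ContDiff ℝ ∞ (sol' b k) := (exists_sol b k).choose_spec.choose_spec.2.1
theorem hasDerivAt_sol (t : ℝ) : HasDerivAt (sol b k) (sol' b k t) t :=
  (exists_sol b k).choose_spec.choose_spec.2.2.1 t
theorem hasDerivAt_sol' (t : ℝ) : HasDerivAt (sol' b k) (b * sol' b k t + k * sol b k t) t :=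
  (exists_sol b k).choose_spec.choose_spec.2.2.2.1 t
theorem sol_zero : sol b k 0 = 0 := (exists_sol b k).choose_spec.choose_spec.2.2.2.2.1
theorem sol'_zero : sol' b k 0 = 1 := (exists_sol b k).choose_spec.choose_spec.2.2.2.2.2

theorem hasDerivAt_exp_mul (t : ℝ) :
    HasDerivAt (fun t => Real.exp (b * t)) (b * Real.exp (b * t)) t := by
  have h1 : HasDerivAt (fun t => b * t) b t := by simpa using (hasDerivAt_id t).const_mul b
  convert! h1.exp using 1
  ring

/-- Abel's identity: the Wronskian satisfies `w' = b w`. -/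
theorem wronskian_const {y y' z z' : ℝ → ℝ} (hy : ∀ t, HasDerivAt y (y' t) t)
    (hy' : ∀ t, HasDerivAt y' (b * y' t + k * y t) t) (hz : ∀ t, HasDerivAt z (z' t) t)
    (hz' : ∀ t, HasDerivAt z' (b * z' t + k * z t) t) (t : ℝ) :
    y t * z' t - y' t * z t = Real.exp (b * t) * (y 0 * z' 0 - y' 0 * z 0) := by
  have hd : ∀ t, HasDerivAt (fun t => Real.exp (-b * t) * (y t * z' t - y' t * z t)) 0 t := by
    intro t
    convert! (hasDerivAt_exp_mul (-b) t).mul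
      (((hy t).mul (hz' t)).sub ((hy' t).mul (hz t))) using 1
    simp only [Pi.sub_apply, Pi.mul_apply]
    ring
  have h := is_const_of_deriv_eq_zero (fun s => (hd s).differentiableAt)
    (fun s => (hd s).deriv) t 0
  have e : Real.exp (b * t) * Real.exp (-b * t) = 1 := by
    rw [← Real.exp_add]; simp
  simp only [mul_zero, Real.exp_zero, one_mul] at h
  rw [← h, ← mul_assoc, e, one_mul]

/-- This is Abel's identity for the solutions `sol` and `sol'`. The left side is the determinant of
`nfLie` on the plane of `X` and `Y`, hence the factor by which `Z = [X, Y]` has to be scaled. -/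
theorem sol_wronskian (t : ℝ) :
    sol' b k t ^ 2 - b * sol b k t * sol' b k t - k * sol b k t ^ 2 = Real.exp (b * t) := by
  have h2 : ∀ t, HasDerivAt (fun t => b * sol' b k t + k * sol b k t)
      (b * (b * sol' b k t + k * sol b k t) + k * sol' b k t) t := fun t =>
    ((hasDerivAt_sol' b k t).const_mul b).add ((hasDerivAt_sol b k t).const_mul k)
  have h := wronskian_const b k (hasDerivAt_sol b k) (hasDerivAt_sol' b k)
    (hasDerivAt_sol' b k) h2 t
  rw [sol_zero, sol'_zero] at h
  linarith

/-- The solutions of `y'' = b y' + k y` are determined by their initial values. -/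
theorem eq_sol {y y' : ℝ → ℝ} (hy : ∀ t, HasDerivAt y (y' t) t)
    (hy' : ∀ t, HasDerivAt y' (b * y' t + k * y t) t) (t : ℝ) :
    y t = y 0 * (sol' b k t - b * sol b k t) + y' 0 * sol b k t := by
  have h2 : ∀ t, HasDerivAt (fun t => b * sol' b k t + k * sol b k t)
      (b * (b * sol' b k t + k * sol b k t) + k * sol' b k t) t := fun t =>
    ((hasDerivAt_sol' b k t).const_mul b).add ((hasDerivAt_sol b k t).const_mul k)
  -- The Wronskians of `y` with `sol` and with `sol'` are two linear equations for `y t` and `y' t`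
  -- whose determinant is, up to sign, the nonzero number `e^{bt}`; Cramer's rule gives `y t`.
  have w1 := wronskian_const b k hy hy' (hasDerivAt_sol b k) (hasDerivAt_sol' b k) t
  have w2 := wronskian_const b k hy hy' (hasDerivAt_sol' b k) h2 t
  have w := sol_wronskian b k t
  rw [sol_zero, sol'_zero] at w1 w2
  have hE := Real.exp_pos (b * t)
  have : Real.exp (b * t) * y t = Real.exp (b * t) *
      (y 0 * (sol' b k t - b * sol b k t) + y' 0 * sol b k t) := by
    linear_combination (-y t) * w + sol' b k t * w1 - sol b k t * w2
  exact mul_left_cancel₀ hE.ne' this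

/-- The equation is autonomous, so a time translate of a solution is a solution and is given by its
initial values. -/
theorem sol_add (s t : ℝ) : sol b k (s + t) =
    sol b k t * (sol' b k s - b * sol b k s) + sol' b k t * sol b k s := by
  have h := eq_sol b k (y := fun s => sol b k (s + t)) (y' := fun s => sol' b k (s + t))
    (fun s => (hasDerivAt_sol b k (s + t)).comp_add_const s t)
    (fun s => (hasDerivAt_sol' b k (s + t)).comp_add_const s t) s
  simpa using h

theorem sol'_add (s t : ℝ) : sol' b k (s + t) =
    sol' b k s * sol' b k t + k * sol b k s * sol b k t := by
  have h2 : ∀ t, HasDerivAt (fun t => b * sol' b k t + k * sol b k t)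
      (b * (b * sol' b k t + k * sol b k t) + k * sol' b k t) t := fun t =>
    ((hasDerivAt_sol' b k t).const_mul b).add ((hasDerivAt_sol b k t).const_mul k)
  have h := eq_sol b k (y := fun s => sol' b k (s + t))
    (y' := fun s => b * sol' b k (s + t) + k * sol b k (s + t))
    (fun s => (hasDerivAt_sol' b k (s + t)).comp_add_const s t)
    (fun s => (h2 (s + t)).comp_add_const s t) s
  rw [h]
  simp only [zero_add]
  ring

theorem exists_sol_ne_zero : ∃ t, sol b k t ≠ 0 := by
  by_contra! h
  have h1 : sol b k = fun _ => 0 := funext h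
  have h2 := hasDerivAt_sol b k 0
  rw [h1, sol'_zero] at h2
  exact one_ne_zero (h2.unique (hasDerivAt_const _ _))

end sol

/-! ### The normal form of a representation -/

/-- The one-parameter group generated by `X ↦ Y ↦ k X + b Y`, `Z ↦ b Z`. -/
def nfLie (b k t : ℝ) (x : E3) : E3 :=
  ![(sol' b k t - b * sol b k t) * x 0 + k * sol b k t * x 1,
    sol b k t * x 0 + sol' b k t * x 1, Real.exp (b * t) * x 2]

theorem nfLie_zero' (b k t : ℝ) (x : E3) : nfLie b k t x 0 =
    (sol' b k t - b * sol b k t) * x 0 + k * sol b k t * x 1 := rfl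
theorem nfLie_one (b k t : ℝ) (x : E3) : nfLie b k t x 1 =
    sol b k t * x 0 + sol' b k t * x 1 := rfl
theorem nfLie_two (b k t : ℝ) (x : E3) : nfLie b k t x 2 = Real.exp (b * t) * x 2 := rfl

/-- The normal form of the representations for which `X` is not an eigenvector. -/
def nf (b k : ℝ) : HeisRep :=
  HeisRep.ofLie (nfLie b k)
    (by
      have h1 := contDiff_sol b k
      have h2 := contDiff_sol' b k
      refine contDiff_pi.2 fun i => ?_
      fin_cases i <;> simp only [nfLie] <;> simp <;> fun_prop)
    (fun t x y => by
      refine ext_E3 ?_ ?_ ?_ <;> simp only [nfLie_zero', nfLie_one, nfLie_two, Pi.add_apply] <;> ring)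
    (fun t c x => by
      refine ext_E3 ?_ ?_ ?_ <;>
        simp only [nfLie_zero', nfLie_one, nfLie_two, Pi.smul_apply, smul_eq_mul] <;> ring)
    (fun t x y => by
      refine ext_E3 ?_ ?_ ?_
      · simp [nfLie_zero', heisBracket_zero, heisBracket_one]
      · simp [nfLie_one, heisBracket_zero, heisBracket_one]
      · simp only [nfLie_zero', nfLie_one, nfLie_two, heisBracket_two]
        rw [← sol_wronskian b k t]
        ring)
    (fun x => by
      refine ext_E3 ?_ ?_ ?_ <;>
        simp [nfLie_zero', nfLie_one, nfLie_two, sol_zero, sol'_zero])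
    (fun s t x => by
      refine ext_E3 ?_ ?_ ?_
      · simp only [nfLie_zero', nfLie_one, sol_add, sol'_add]; ring
      · simp only [nfLie_zero', nfLie_one, sol_add, sol'_add]; ring
      · simp only [nfLie_two, mul_add, Real.exp_add]; ring)

theorem nf_lie (b k t : ℝ) (x : E3) : (nf b k).lie t x = nfLie b k t x :=
  HeisRep.lie_ofLie _ _ _ _ _ _ _ _ _

theorem nf_gen (b k : ℝ) (x : E3) : (nf b k).gen x = ![k * x 1, x 0 + b * x 1, b * x 2] := by
  have h := (nf b k).hasDerivAt_lie 0 x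
  rw [HeisRep.lie_zero] at h
  refine h.unique ?_
  simp only [nf_lie]
  rw [hasDerivAt_pi]
  have h1 := hasDerivAt_sol b k 0
  have h2 := hasDerivAt_sol' b k 0
  have h3 := hasDerivAt_exp_mul b 0
  intro i
  fin_cases i
  · simp only [nfLie]
    simp only [Fin.zero_eta, Matrix.cons_val_zero]
    convert! ((h2.sub (h1.const_mul b)).mul_const (x 0)).add ((h1.const_mul k).mul_const (x 1)) using 1
    simp [sol_zero, sol'_zero]
  · simp only [nfLie]
    simp only [Fin.mk_one, Matrix.cons_val_one, Matrix.cons_val_zero]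
    convert! ((h1.mul_const (x 0)).add (h2.mul_const (x 1))) using 1
    simp [sol_zero, sol'_zero]
  · simp only [nfLie]
    simp only [Fin.reduceFinMk, Matrix.cons_val]
    convert! (h3.mul_const (x 2)) using 1
    simp

end PlaneWave
end

noncomputable section
namespace PlaneWave

/-! ### Isomorphisms between the extensions -/

theorem heisBracket_add_left (a a' b : E3) :
    heisBracket (a + a') b = heisBracket a b + heisBracket a' b := by
  refine ext_E3 ?_ ?_ ?_ <;>
    simp only [heisBracket_zero, heisBracket_one, heisBracket_two, Pi.add_apply] <;> ring

theorem heisBracket_add_right (a b b' : E3) :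
    heisBracket a (b + b') = heisBracket a b + heisBracket a b' := by
  refine ext_E3 ?_ ?_ ?_ <;>
    simp only [heisBracket_zero, heisBracket_one, heisBracket_two, Pi.add_apply] <;> ring

theorem heisBracket_smul_left (c : ℝ) (a b : E3) :
    heisBracket (c • a) b = c • heisBracket a b := by
  refine ext_E3 ?_ ?_ ?_ <;>
    simp only [heisBracket_zero, heisBracket_one, heisBracket_two, Pi.smul_apply, smul_eq_mul] <;>
    ring

theorem heisBracket_smul_right (c : ℝ) (a b : E3) :
    heisBracket a (c • b) = c • heisBracket a b := by
  refine ext_E3 ?_ ?_ ?_ <;>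
    simp only [heisBracket_zero, heisBracket_one, heisBracket_two, Pi.smul_apply, smul_eq_mul] <;>
    ring

theorem heisBracket_self (a : E3) : heisBracket a a = 0 := by
  refine ext_E3 ?_ ?_ ?_ <;>
    simp [heisBracket_zero, heisBracket_one, heisBracket_two, mul_comm]

theorem heisBracket_bracket_left (a b c : E3) : heisBracket (heisBracket a b) c = 0 := by
  refine ext_E3 ?_ ?_ ?_ <;>
    simp [heisBracket_zero, heisBracket_one, heisBracket_two]

theorem heisBracket_bracket_right (a b c : E3) : heisBracket a (heisBracket b c) = 0 := by
  refine ext_E3 ?_ ?_ ?_ <;>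
    simp [heisBracket_zero, heisBracket_one, heisBracket_two]

namespace HeisExt

variable {ρ ρ' : HeisRep}

theorem ext_coords {a a' : HeisExt ρ} (h1 : a.left.log = a'.left.log)
    (h2 : a.right.toAdd = a'.right.toAdd) : a = a' := by
  refine SemidirectProduct.ext (Heis.ext h1) ?_
  exact Multiplicative.toAdd.injective h2

theorem log_mul_left (a a' : HeisExt ρ) : (a * a').left.log =
    a.left.log + ρ.lie a.right.toAdd a'.left.log
      + (1 / 2 : ℝ) • heisBracket a.left.log (ρ.lie a.right.toAdd a'.left.log) := by
  rw [SemidirectProduct.mul_left, Heis.mul_log, ρ.toHom_apply']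

theorem toAdd_mul_right (a a' : HeisExt ρ) :
    (a * a').right.toAdd = a.right.toAdd + a'.right.toAdd := rfl

/-- A map into `G_ρ` is smooth if it is so in coordinates. -/
theorem contMDiff_of_coords {Φ : HeisExt ρ' → HeisExt ρ}
    (h : ContDiff ℝ ∞ (fun q : ℝ × E3 => homeo ρ (Φ ((homeo ρ').symm q)))) :
    ContMDiff 𝓘(ℝ, ℝ × E3) 𝓘(ℝ, ℝ × E3) ∞ Φ := by
  have h1 := ((contMDiff_homeo_symm ρ).comp h.contMDiff).comp (contMDiff_homeo ρ')
  convert! h1 using 1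

/-- The isomorphism `(h, t) ↦ (Q h η(t), c t)` between two extensions, for an automorphism `Q` of
`heis`, a cocycle `η` and a constant `c`. -/
def isoOf (ρ' ρ : HeisRep) (Q : E3 ≃ₗ[ℝ] E3) (η : ℝ → E3) (c : ℝ) (hc : c ≠ 0)
    (hQ : ∀ x y, Q (heisBracket x y) = heisBracket (Q x) (Q y))
    (hη : ∀ s t, η (s + t) = η s + ρ.lie (c * s) (η t)
      + (1 / 2 : ℝ) • heisBracket (η s) (ρ.lie (c * s) (η t)))
    (hρ : ∀ t x, Q (ρ'.lie t x) = ρ.lie (c * t) (Q x) + heisBracket (η t) (ρ.lie (c * t) (Q x))) :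
    HeisExt ρ' ≃* HeisExt ρ where
  toFun a := ⟨⟨Q a.left.log⟩ * ⟨η a.right.toAdd⟩, Multiplicative.ofAdd (c * a.right.toAdd)⟩
  invFun a := ⟨⟨Q.symm (a.left * ⟨η (c⁻¹ * a.right.toAdd)⟩⁻¹).log⟩,
    Multiplicative.ofAdd (c⁻¹ * a.right.toAdd)⟩
  left_inv a := by
    refine ext_coords ?_ ?_
    · simp [hc]
    · simp [hc]
  right_inv a := by
    refine ext_coords ?_ ?_
    · simp only [LinearEquiv.apply_symm_apply, toAdd_ofAdd]
      exact congrArg Heis.log (inv_mul_cancel_right a.left ⟨η (c⁻¹ * a.right.toAdd)⟩)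
    · simp [hc]
  -- By `hη`, `t ↦ (η t, c t)` is a homomorphism into `G_ρ`; by `hρ`, conjugation by it acts on
  -- `heis` as `ρ' t` does, read through `Q`. Together with the automorphism `Q` this is what
  -- defines a homomorphism on a semidirect product.
  map_mul' a a' := by
    refine ext_coords ?_ ?_
    · simp only [log_mul_left, toAdd_mul_right, Heis.mul_log, toAdd_ofAdd, map_add, map_smul, hQ,
        hρ, hη, HeisRep.lie_bracket]
      refine ext_E3 ?_ ?_ ?_ <;>
        simp only [heisBracket_zero, heisBracket_one, heisBracket_two, Pi.add_apply,
          Pi.smul_apply, smul_eq_mul] <;> ring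
    · simp only [toAdd_mul_right, toAdd_ofAdd]
      ring

theorem isLieIso_isoOf (ρ' ρ : HeisRep) (Q : E3 ≃ₗ[ℝ] E3) (η : ℝ → E3) (c : ℝ) (hc : c ≠ 0)
    (hQ hη hρ) (hs : ContDiff ℝ ∞ η) : IsLieIso (isoOf ρ' ρ Q η c hc hQ hη hρ) := by
  have hQ1 : ContDiff ℝ ∞ (fun x => Q x) :=
    (LinearMap.toContinuousLinearMap (Q : E3 →ₗ[ℝ] E3)).contDiff
  have hQ2 : ContDiff ℝ ∞ (fun x => Q.symm x) :=
    (LinearMap.toContinuousLinearMap (Q.symm : E3 →ₗ[ℝ] E3)).contDiff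
  constructor
  · refine contMDiff_of_coords ?_
    have h1 : ContDiff ℝ ∞ (fun q : ℝ × E3 => Q q.2) := hQ1.comp contDiff_snd
    have h2 : ContDiff ℝ ∞ (fun q : ℝ × E3 => η q.1) := hs.comp contDiff_fst
    exact (contDiff_const.mul contDiff_fst).prodMk
      ((h1.add h2).add ((contDiff_heisBracket h1 h2).const_smul (1 / 2 : ℝ)))
  · refine contMDiff_of_coords ?_
    have h2 : ContDiff ℝ ∞ (fun q : ℝ × E3 => -η (c⁻¹ * q.1)) :=
      (hs.comp (contDiff_const.mul contDiff_fst)).neg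
    have h3 := hQ2.comp ((contDiff_snd.add h2).add
      ((contDiff_heisBracket contDiff_snd h2).const_smul (1 / 2 : ℝ)))
    exact (contDiff_const.mul contDiff_fst).prodMk h3

end HeisExt

theorem IsLieIso.symm {ρ ρ' : HeisRep} {φ : HeisExt ρ ≃* HeisExt ρ'} (h : IsLieIso φ) :
    IsLieIso φ.symm := ⟨h.2, h.1⟩

theorem IsLieIso.trans {ρ ρ' ρ'' : HeisRep} {φ : HeisExt ρ ≃* HeisExt ρ'}
    {ψ : HeisExt ρ' ≃* HeisExt ρ''} (h : IsLieIso φ) (h' : IsLieIso ψ) :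
    IsLieIso (φ.trans ψ) := ⟨h'.1.comp h.1, h.2.comp h'.2⟩

theorem LieIsomorphic.symm {ρ ρ' : HeisRep} (h : LieIsomorphic ρ ρ') : LieIsomorphic ρ' ρ :=
  ⟨_, h.choose_spec.symm⟩

theorem LieIsomorphic.trans {ρ ρ' ρ'' : HeisRep} (h : LieIsomorphic ρ ρ')
    (h' : LieIsomorphic ρ' ρ'') : LieIsomorphic ρ ρ'' :=
  ⟨_, h.choose_spec.trans h'.choose_spec⟩

/-! ### Cocycles -/

theorem exists_primitive {f : ℝ → E3} (hf : ContDiff ℝ ∞ f) :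
    ∃ F : ℝ → E3, ContDiff ℝ ∞ F ∧ F 0 = 0 ∧ ∀ t, HasDerivAt F (f t) t := by
  have h : ∀ t, HasDerivAt (fun t => ∫ s in (0 : ℝ)..t, f s) (f t) t := fun t =>
    (hf.continuous.integral_hasStrictDerivAt 0 t).hasDerivAt
  exact ⟨fun t => ∫ s in (0 : ℝ)..t, f s, contDiff_of_hasDerivAt h hf, by simp, h⟩

theorem HasDerivAt.heisBracket' {f g : ℝ → E3} {f' g' : E3} {t : ℝ} (hf : HasDerivAt f f' t)
    (hg : HasDerivAt g g' t) : HasDerivAt (fun t => heisBracket (f t) (g t))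
      (heisBracket f' (g t) + heisBracket (f t) g') t := by
  rw [hasDerivAt_pi] at hf hg ⊢
  intro i
  fin_cases i
  · simpa [heisBracket_zero] using hasDerivAt_const t (0 : ℝ)
  · simpa [heisBracket_one] using hasDerivAt_const t (0 : ℝ)
  · convert! ((hf 0).mul (hg 1)).sub ((hf 1).mul (hg 0)) using 1
    simp [heisBracket_two]
    ring

theorem eq_of_hasDerivAt_eq {f g f' : ℝ → E3} (hf : ∀ t, HasDerivAt f (f' t) t)
    (hg : ∀ t, HasDerivAt g (f' t) t) (h0 : f 0 = g 0) (t : ℝ) : f t = g t := by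
  have hd : ∀ t, HasDerivAt (fun t => f t - g t) 0 t := fun t => by
    have h := (hf t).sub (hg t)
    rw [sub_self] at h
    exact h
  have h := is_const_of_deriv_eq_zero (fun s => (hd s).differentiableAt) (fun s => (hd s).deriv) t 0
  simp only [h0, sub_self] at h
  exact sub_eq_zero.1 h

/-- The cocycle with a given derivative at the origin. -/
theorem HeisRep.exists_cocycle (ρ : HeisRep) (X : E3) : ∃ η : ℝ → E3, ContDiff ℝ ∞ η ∧
    HasDerivAt η X 0 ∧ η 0 = 0 ∧ ∀ s t, η (s + t) = η s + ρ.lie s (η t)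
      + (1 / 2 : ℝ) • heisBracket (η s) (ρ.lie s (η t)) := by
  -- The cocycle is the Heisenberg part of a one-parameter subgroup of `G_ρ`. Modulo the center it
  -- is the integral `S` of `ρ(t) X`, and the Baker-Campbell-Hausdorff correction `R`, the integral
  -- of half of `[S(t), ρ(t) X]`, is central.
  obtain ⟨S, hS, hS0, hSd⟩ := exists_primitive (ρ.contDiff_lie_const X)
  obtain ⟨R, hR, hR0, hRd⟩ := exists_primitive
    ((contDiff_heisBracket hS (ρ.contDiff_lie_const X)).const_smul (1 / 2 : ℝ))
  have hRdz : ∀ t y, heisBracket (R t) y = 0 := by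
    intro t y
    refine eq_of_hasDerivAt_eq (f := fun t => heisBracket (R t) y) (g := fun _ => 0)
      (f' := fun _ => 0) (fun t => ?_) (fun t => hasDerivAt_const t 0) ?_ t
    · have h := HasDerivAt.heisBracket' (hRd t) (hasDerivAt_const t y)
      rw [heisBracket_smul_left, heisBracket_bracket_left] at h
      convert! h using 1
      refine ext_E3 ?_ ?_ ?_ <;> simp [heisBracket]
    · simp only [hR0]
      refine ext_E3 ?_ ?_ ?_ <;> simp [heisBracket]
  set η : ℝ → E3 := fun t => S t + R t with hη
  have hηd : ∀ t, HasDerivAt η (ρ.lie t X + (1 / 2 : ℝ) • heisBracket (η t) (ρ.lie t X)) t := by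
    intro t
    have h := (hSd t).add (hRd t)
    rw [hη]
    simp only [heisBracket_add_left, hRdz, add_zero]
    exact h
  have hSadd : ∀ s t, S (s + t) = S s + ρ.lie s (S t) := by
    intro s t
    refine eq_of_hasDerivAt_eq (f := fun t => S (s + t))
      (g := fun t => S s + ρ.lie s (S t)) (f' := fun t => ρ.lie (s + t) X)
      (fun t => ?_) (fun t => ?_) ?_ t
    · exact (hSd (s + t)).comp_const_add s t
    · rw [ρ.lie_add]
      have h := (ρ.lie s).hasFDerivAt.comp_hasDerivAt t (hSd t)
      simpa [Function.comp_def] using h.const_add (S s)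
    · simp [hS0]
  refine ⟨η, hS.add hR, ?_, by simp [hη, hS0, hR0], fun s t => ?_⟩
  · have h := hηd 0
    simp only [hη, hS0, hR0, add_zero, ρ.lie_zero] at h
    convert! h using 1
    refine ext_E3 ?_ ?_ ?_ <;> simp [heisBracket]
  -- For fixed `s` the two sides of the cocycle identity agree at `t = 0` and have the same
  -- derivative in `t`.
  · refine eq_of_hasDerivAt_eq (f := fun t => η (s + t))
      (g := fun t => η s + ρ.lie s (η t) + (1 / 2 : ℝ) • heisBracket (η s) (ρ.lie s (η t)))
      (f' := fun t => ρ.lie (s + t) X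
        + (1 / 2 : ℝ) • heisBracket (η (s + t)) (ρ.lie (s + t) X))
      (fun t => ?_) (fun t => ?_) ?_ t
    · exact (hηd (s + t)).comp_const_add s t
    · have h1 : HasDerivAt (fun t => ρ.lie s (η t))
          (ρ.lie (s + t) X + (1 / 2 : ℝ) • heisBracket (ρ.lie s (η t)) (ρ.lie (s + t) X)) t := by
        have h := (ρ.lie s).hasFDerivAt.comp_hasDerivAt t (hηd t)
        rw [map_add, map_smul, ρ.lie_bracket, ← ρ.lie_add] at h
        exact h
      have h2 := (h1.const_add (η s)).add
        ((HasDerivAt.heisBracket' (hasDerivAt_const t (η s)) h1).const_smul (1 / 2 : ℝ))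
      convert! h2 using 1
      have e : heisBracket (η (s + t)) (ρ.lie (s + t) X)
          = heisBracket (η s) (ρ.lie (s + t) X) + heisBracket (ρ.lie s (η t)) (ρ.lie (s + t) X) := by
        have hz : heisBracket (ρ.lie s (R t)) (ρ.lie (s + t) X) = 0 := by
          rw [ρ.lie_add, ← ρ.lie_bracket, hRdz, map_zero]
        simp only [hη, heisBracket_add_left, hRdz, hSadd, map_add, hz, add_zero]
      rw [e]
      refine ext_E3 ?_ ?_ ?_ <;>
        simp only [heisBracket_zero, heisBracket_one, heisBracket_two, Pi.add_apply,
          Pi.smul_apply, Pi.zero_apply, smul_eq_mul] <;> ring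
    · have h0 : η 0 = 0 := by simp [hη, hS0, hR0]
      simp only [h0, add_zero, map_zero]
      refine ext_E3 ?_ ?_ ?_ <;> simp [heisBracket]

end PlaneWave
end

noncomputable section
namespace PlaneWave

/-! ### Reduction to the normal form -/

/-- The data that identify `(ρ, W)` with the normal form `(nf b k, X)`: an automorphism `Q` of
`heis` that maps `X` to `W` and a cocycle `η`. -/
structure NormalForm (ρ : HeisRep) (W : NonCentral) where
  /-- The trace of the generator on `heis / Z`. -/
  b : ℝ
  /-- Minus the determinant of the generator on `heis / Z`. -/
  k : ℝ
  /-- The automorphism of `heis`. -/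
  Q : E3 ≃ₗ[ℝ] E3
  /-- The cocycle. -/
  η : ℝ → E3
  contDiff_η : ContDiff ℝ ∞ η
  Q_bracket : ∀ x y, Q (heisBracket x y) = heisBracket (Q x) (Q y)
  Q_X : Q ![1, 0, 0] = W.1
  cocycle : ∀ s t, η (s + t) = η s + ρ.lie s (η t) + (1 / 2 : ℝ) • heisBracket (η s) (ρ.lie s (η t))
  lie_eq : ∀ t x, Q (nfLie b k t x) = ρ.lie t (Q x) + heisBracket (η t) (ρ.lie t (Q x))

namespace HeisRep

variable (ρ : HeisRep)

/-- The trace of the generator on `heis / Z`. -/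
def tr : ℝ := ρ.gen ![1, 0, 0] 0 + ρ.gen ![0, 1, 0] 1

/-- Minus the determinant of the generator on `heis / Z`. -/
def negDet : ℝ :=
  ρ.gen ![0, 1, 0] 0 * ρ.gen ![1, 0, 0] 1 - ρ.gen ![1, 0, 0] 0 * ρ.gen ![0, 1, 0] 1

/-- A derivation multiplies `[X, Y]` by its trace on `heis / Z`. -/
theorem gen_center : ρ.gen ![0, 0, 1] = ![0, 0, ρ.tr] := by
  have h : (![0, 0, 1] : E3) = heisBracket ![1, 0, 0] ![0, 1, 0] := by
    refine ext_E3 ?_ ?_ ?_ <;> simp [heisBracket]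
  rw [h, gen_bracket]
  refine ext_E3 ?_ ?_ ?_ <;> simp [heisBracket, tr]

theorem gen_zero_apply (x : E3) :
    ρ.gen x 0 = x 0 * ρ.gen ![1, 0, 0] 0 + x 1 * ρ.gen ![0, 1, 0] 0 := by
  have h := congrArg ρ.gen (E3_eq_sum x)
  rw [gen_add, gen_add, gen_smul, gen_smul, gen_smul, gen_center] at h
  rw [h]
  simp

theorem gen_one_apply (x : E3) :
    ρ.gen x 1 = x 0 * ρ.gen ![1, 0, 0] 1 + x 1 * ρ.gen ![0, 1, 0] 1 := by
  have h := congrArg ρ.gen (E3_eq_sum x)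
  rw [gen_add, gen_add, gen_smul, gen_smul, gen_smul, gen_center] at h
  rw [h]
  simp

/-- Cayley-Hamilton for the generator acting on `heis / Z`, first coordinate. -/
theorem gen_gen_zero (x : E3) : ρ.gen (ρ.gen x) 0 = ρ.tr * ρ.gen x 0 + ρ.negDet * x 0 := by
  rw [gen_zero_apply ρ (ρ.gen x), gen_zero_apply ρ x, gen_one_apply ρ x, tr, negDet]
  ring

theorem gen_gen_one (x : E3) : ρ.gen (ρ.gen x) 1 = ρ.tr * ρ.gen x 1 + ρ.negDet * x 1 := by
  rw [gen_one_apply ρ (ρ.gen x), gen_zero_apply ρ x, gen_one_apply ρ x, tr, negDet]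
  ring

/-- If `W` is not an eigenvector of `ρ`, it is not an eigenvector of the generator. -/
theorem area_ne_zero {W : NonCentral} (h : ¬ ρ.IsEigenvector W) :
    W.1 0 * ρ.gen W.1 1 - W.1 1 * ρ.gen W.1 0 ≠ 0 := by
  intro hd
  apply h
  set w := W.1
  -- By Cayley-Hamilton the area spanned by `W` and `ρ(t) W` satisfies `y'' = tr y' + negDet y`. Its
  -- initial value is zero, and so is its initial derivative if `W` is an eigenvector of the
  -- generator, so it vanishes identically.
  have hy : ∀ t, w 0 * ρ.lie t w 1 - w 1 * ρ.lie t w 0 = 0 := by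
    intro t
    have h1 : ∀ x : E3, ∀ t, HasDerivAt (fun t => w 0 * ρ.lie t x 1 - w 1 * ρ.lie t x 0)
        (w 0 * ρ.lie t (ρ.gen x) 1 - w 1 * ρ.lie t (ρ.gen x) 0) t := by
      intro x t
      have := hasDerivAt_pi.1 (ρ.hasDerivAt_lie t x)
      exact ((this 1).const_mul _).sub ((this 0).const_mul _)
    have h2 := eq_sol ρ.tr ρ.negDet (h1 w) (fun t => by
      convert! h1 (ρ.gen w) t using 1
      simp only [ρ.lie_gen, gen_gen_zero, gen_gen_one]
      ring) t
    rw [h2]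
    simp only [lie_zero, hd]
    ring
  intro t
  refine ⟨(w 0 * ρ.lie t w 0 + w 1 * ρ.lie t w 1) / PSpace.len W, ?_⟩
  have hl := PSpace.len_ne_zero W
  rw [← map_smul, mk_eq_mk_center]
  simp only [Pi.smul_apply, smul_eq_mul]
  have hl2 : PSpace.len W = w 0 ^ 2 + w 1 ^ 2 := rfl
  constructor
  · field_simp
    rw [hl2]
    linear_combination (-w 1) * hy t
  · field_simp
    rw [hl2]
    linear_combination (w 0) * hy t

end HeisRep

/-- The automorphism of `heis` with `X ↦ w`, `Y ↦ u` and `Z ↦ [w, u]`. -/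
def frameEquiv (w u : E3) (hd : w 0 * u 1 - w 1 * u 0 ≠ 0) : E3 ≃ₗ[ℝ] E3 where
  toFun x := x 0 • w + x 1 • u + x 2 • heisBracket w u
  invFun y := ![(y 0 * u 1 - y 1 * u 0) / (w 0 * u 1 - w 1 * u 0),
    (w 0 * y 1 - w 1 * y 0) / (w 0 * u 1 - w 1 * u 0),
    (y 2 - (y 0 * u 1 - y 1 * u 0) / (w 0 * u 1 - w 1 * u 0) * w 2
      - (w 0 * y 1 - w 1 * y 0) / (w 0 * u 1 - w 1 * u 0) * u 2) / (w 0 * u 1 - w 1 * u 0)]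
  map_add' x y := by
    simp only [Pi.add_apply]
    module
  map_smul' c x := by
    simp only [Pi.smul_apply, smul_eq_mul, RingHom.id_apply]
    module
  left_inv x := by
    generalize hD : w 0 * u 1 - w 1 * u 0 = d at hd
    have e0 : ((x 0 * w 0 + x 1 * u 0) * u 1 - (x 0 * w 1 + x 1 * u 1) * u 0) / d = x 0 := by
      field_simp
      linear_combination x 0 * hD
    have e1 : (w 0 * (x 0 * w 1 + x 1 * u 1) - w 1 * (x 0 * w 0 + x 1 * u 0)) / d = x 1 := by
      field_simp
      linear_combination x 1 * hD
    refine ext_E3 ?_ ?_ ?_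
    · simp [heisBracket, e0]
    · simp [heisBracket, e1]
    · simp [heisBracket, e0, e1]
      rw [hD]
      field_simp
      ring
  right_inv y := by
    generalize hD : w 0 * u 1 - w 1 * u 0 = d at hd
    refine ext_E3 ?_ ?_ ?_
    · simp [heisBracket]
      field_simp
      linear_combination y 0 * hD
    · simp [heisBracket]
      field_simp
      linear_combination y 1 * hD
    · simp [heisBracket]
      rw [hD]
      field_simp
      ring

theorem frameEquiv_apply (w u : E3) (hd) (x : E3) :
    frameEquiv w u hd x = x 0 • w + x 1 • u + x 2 • heisBracket w u := rfl

theorem frameEquiv_bracket (w u : E3) (hd) (x y : E3) :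
    frameEquiv w u hd (heisBracket x y)
      = heisBracket (frameEquiv w u hd x) (frameEquiv w u hd y) := by
  simp only [frameEquiv_apply]
  refine ext_E3 ?_ ?_ ?_ <;>
    simp only [heisBracket_zero, heisBracket_one, heisBracket_two, Pi.add_apply,
      Pi.smul_apply, smul_eq_mul] <;> ring

/-- If `W` is not an eigenvector, then `(ρ, W)` has a normal form. -/
theorem exists_normalForm (ρ : HeisRep) (W : NonCentral) (h : ¬ ρ.IsEigenvector W) :
    Nonempty (NormalForm ρ W) := by
  have hd := ρ.area_ne_zero h
  set w := W.1 with hw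
  set u := ρ.gen w with hu
  set Q := frameEquiv w u hd with hQ
  set d := w 0 * u 1 - w 1 * u 0 with hdd
  -- Cayley-Hamilton holds only modulo the center; `γ` measures its central defect in units of `[w,
  -- u]`.
  set γ : ℝ := (ρ.gen u 2 - ρ.negDet * w 2 - ρ.tr * u 2) / d with hγ
  have hgu : ρ.gen u = ρ.negDet • w + ρ.tr • u + γ • heisBracket w u := by
    refine ext_E3 ?_ ?_ ?_
    · simp only [Pi.add_apply, Pi.smul_apply, smul_eq_mul, heisBracket_zero]
      rw [hu, ρ.gen_gen_zero]
      ring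
    · simp only [Pi.add_apply, Pi.smul_apply, smul_eq_mul, heisBracket_one]
      rw [hu, ρ.gen_gen_one]
      ring
    · simp only [Pi.add_apply, Pi.smul_apply, smul_eq_mul, heisBracket_two]
      rw [← hdd, hγ]
      field_simp
      ring
  have hgz : ρ.gen (heisBracket w u) = ρ.tr • heisBracket w u := by
    rw [ρ.gen_bracket, ← hu, heisBracket_self, zero_add, hgu]
    simp only [heisBracket_add_right, heisBracket_smul_right, heisBracket_self,
      heisBracket_bracket_right]
    module
  -- The inner derivation by `-γ w` kills `w` and sends `u` to `-γ [w, u]`. Twisting by the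
  -- corresponding cocycle therefore cancels the defect and leaves the first two relations of the
  -- frame untouched.
  obtain ⟨η, hη, hη1, hη0, hηc⟩ := ρ.exists_cocycle ((-γ) • w)
  have hQ1 : ContDiff ℝ ∞ (fun x => Q x) :=
    (LinearMap.toContinuousLinearMap (Q : E3 →ₗ[ℝ] E3)).contDiff
  set Q' := LinearMap.toContinuousLinearMap (Q.symm : E3 →ₗ[ℝ] E3) with hQ'
  have hQb : ∀ x y, Q (heisBracket x y) = heisBracket (Q x) (Q y) := frameEquiv_bracket w u hd
  have hz : ∀ y, heisBracket 0 y = 0 := fun y => by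
    refine ext_E3 ?_ ?_ ?_ <;> simp [heisBracket]
  -- The representation `ρ`, corrected by conjugation by `exp(η t)` and read in the frame `Q`. It is
  -- a one-parameter group because `η` is a cocycle, so comparing generators with the normal form is
  -- enough.
  let ρ₂ : HeisRep := HeisRep.ofLie
    (fun t x => Q' (ρ.lie t (Q x) + heisBracket (η t) (ρ.lie t (Q x))))
    (by
      have h1 : ContDiff ℝ ∞ (fun p : ℝ × E3 => ρ.lie p.1 (Q p.2)) :=
        ρ.contDiff_lie.comp (contDiff_fst.prodMk (hQ1.comp contDiff_snd))
      exact Q'.contDiff.comp (h1.add (contDiff_heisBracket (hη.comp contDiff_fst) h1)))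
    (fun t x y => by
      simp only [map_add, heisBracket_add_right]
      abel)
    (fun t c x => by
      simp only [map_smul, map_add, heisBracket_smul_right, smul_add])
    (fun t x y => by
      apply Q.injective
      have e : ∀ v, Q (Q' v) = v := fun v => Q.apply_symm_apply v
      rw [e, hQb, ρ.lie_bracket, hQb, e, e]
      simp only [heisBracket_add_left, heisBracket_add_right, heisBracket_bracket_left,
        heisBracket_bracket_right, add_zero])
    (fun x => by
      apply Q.injective
      have e : ∀ v, Q (Q' v) = v := fun v => Q.apply_symm_apply v
      rw [e, hη0, ρ.lie_zero, hz, add_zero])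
    (fun s t x => by
      have e : ∀ v, Q (Q' v) = v := fun v => Q.apply_symm_apply v
      apply Q.injective
      rw [e, e, e, hηc, ρ.lie_add]
      simp only [map_add, heisBracket_add_left, heisBracket_add_right, heisBracket_smul_left,
        heisBracket_bracket_left, ρ.lie_bracket, heisBracket_bracket_right, smul_zero, add_zero]
      abel)
  have hρ₂ : ∀ t x, ρ₂.lie t x = Q' (ρ.lie t (Q x) + heisBracket (η t) (ρ.lie t (Q x))) :=
    fun t x => HeisRep.lie_ofLie _ _ _ _ _ _ _ t x
  have hgen : ∀ x, ρ₂.gen x = (nf ρ.tr ρ.negDet).gen x := by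
    intro x
    have h1 := ρ₂.hasDerivAt_lie 0 x
    rw [ρ₂.lie_zero] at h1
    refine h1.unique ?_
    have h2 := ρ.hasDerivAt_lie 0 (Q x)
    have h3 := h2.add (HasDerivAt.heisBracket' hη1 h2)
    have h4 := Q'.hasFDerivAt.comp_hasDerivAt 0 h3
    simp only [hρ₂]
    refine h4.congr_deriv ?_
    apply Q.injective
    have e : ∀ v, Q (Q' v) = v := fun v => Q.apply_symm_apply v
    rw [e, hη0, hz, ρ.lie_zero, ρ.lie_zero, nf_gen, hQ, frameEquiv_apply, frameEquiv_apply]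
    simp only [ρ.gen_add, ρ.gen_smul, ← hu, hgu, hgz, heisBracket_smul_left, heisBracket_add_right,
      heisBracket_smul_right, heisBracket_self, heisBracket_bracket_right]
    simp
    module
  refine ⟨⟨ρ.tr, ρ.negDet, Q, η, hη, hQb, ?_, hηc, fun t x => ?_⟩⟩
  · rw [hQ, frameEquiv_apply]
    simp [hw]
  · have h1 := HeisRep.lie_eq_of_gen_eq hgen t x
    rw [hρ₂, nf_lie] at h1
    rw [← h1]
    exact Q.apply_symm_apply _

namespace NormalForm

variable {ρ : HeisRep} {W : NonCentral} (n : NormalForm ρ W)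

/-- The isomorphism of `G_ρ` with its normal form. -/
def iso : HeisExt (nf n.b n.k) ≃* HeisExt ρ :=
  HeisExt.isoOf (nf n.b n.k) ρ n.Q n.η 1 one_ne_zero n.Q_bracket
    (fun s t => by rw [one_mul]; exact n.cocycle s t)
    (fun t x => by rw [one_mul, nf_lie]; exact n.lie_eq t x)

theorem isLieIso_iso : IsLieIso n.iso := HeisExt.isLieIso_isoOf _ _ _ _ _ _ _ _ _ n.contDiff_η

theorem η_zero : n.η 0 = 0 := by
  have h := n.cocycle 0 0
  rw [add_zero, ρ.lie_zero, heisBracket_self, smul_zero, add_zero] at h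
  simpa using h

theorem iso_oneParam (s : Multiplicative ℝ) :
    n.iso (SemidirectProduct.inl (Heis.oneParam ![1, 0, 0] s))
      = SemidirectProduct.inl (Heis.oneParam W.1 s) := by
  refine HeisExt.ext_coords ?_ ?_
  · change (n.Q (s.toAdd • ![1, 0, 0]) + n.η 0 + (1 / 2 : ℝ) • heisBracket _ (n.η 0)) = s.toAdd • W.1
    rw [n.η_zero, map_smul, n.Q_X]
    refine ext_E3 ?_ ?_ ?_ <;> simp [heisBracket]
  · change (1 : ℝ) * 0 = 0
    ring

/-- The matrix of `ρ t` in the basis given by the normal form. -/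
theorem exists_lie_Q (t : ℝ) : ∃ r₀ r₁ : ℝ, ∀ x : E3, ρ.lie t (n.Q x) =
    n.Q (nfLie n.b n.k t x + ![0, 0, r₀ * x 0 + r₁ * x 1]) := by
  set e := n.Q.symm (n.η t) with he
  have hη : n.η t = n.Q e := (n.Q.apply_symm_apply _).symm
  -- Bracketing with `η t` kills the central correction in `lie_eq`. Hence the correction can be
  -- expressed through `nfLie` and moved to the other side.
  have hz : ∀ x, heisBracket (n.η t) (ρ.lie t (n.Q x)) = n.Q (heisBracket e (nfLie n.b n.k t x)) := by
    intro x
    have h1 := n.lie_eq t x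
    have h2 := congrArg (heisBracket (n.η t)) h1
    rw [heisBracket_add_right, heisBracket_bracket_right, add_zero] at h2
    rw [← h2, hη, n.Q_bracket]
  refine ⟨-(e 0 * sol n.b n.k t - e 1 * (sol' n.b n.k t - n.b * sol n.b n.k t)),
    -(e 0 * sol' n.b n.k t - e 1 * (n.k * sol n.b n.k t)), fun x => ?_⟩
  have h1 := n.lie_eq t x
  rw [hz] at h1
  have h2 : ρ.lie t (n.Q x) = n.Q (nfLie n.b n.k t x - heisBracket e (nfLie n.b n.k t x)) := by
    rw [map_sub, h1]
    abel
  rw [h2]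
  congr 1
  refine ext_E3 ?_ ?_ ?_
  · simp [heisBracket_zero]
  · simp [heisBracket_one]
  · simp [heisBracket_two, nfLie_zero', nfLie_one]
    ring

end NormalForm

/-- The normal forms with proportional parameters are isomorphic. -/
theorem lieIsomorphic_nf {b k b' k' c : ℝ} (hc : c ≠ 0) (hb : b = c * b') (hk : k = c ^ 2 * k') :
    LieIsomorphic (nf b k) (nf b' k') := by
  subst hb hk
  have hs : ∀ t, sol (c * b') (c ^ 2 * k') t = c⁻¹ * sol b' k' (c * t) := by
    intro t
    have hm : ∀ t, HasDerivAt (fun t => c * t) c t := fun t => by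
      simpa using (hasDerivAt_id t).const_mul c
    have h := eq_sol (c * b') (c ^ 2 * k') (y := fun t => c⁻¹ * sol b' k' (c * t))
      (y' := fun t => sol' b' k' (c * t))
      (fun t => by
        convert! ((hasDerivAt_sol b' k' (c * t)).comp t (hm t)).const_mul c⁻¹ using 1
        field_simp)
      (fun t => by
        convert! ((hasDerivAt_sol' b' k' (c * t)).comp t (hm t)) using 1
        field_simp) t
    rw [h]
    simp [sol_zero, sol'_zero]
  have hs' : ∀ t, sol' (c * b') (c ^ 2 * k') t = sol' b' k' (c * t) := by
    intro t
    refine (hasDerivAt_sol (c * b') (c ^ 2 * k') t).unique ?_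
    have hm : HasDerivAt (fun t => c * t) c t := by
      simpa using (hasDerivAt_id t).const_mul c
    have e : sol (c * b') (c ^ 2 * k') = fun t => c⁻¹ * sol b' k' (c * t) := funext hs
    rw [e]
    convert! ((hasDerivAt_sol b' k' (c * t)).comp t hm).const_mul c⁻¹ using 1
    field_simp
  -- Accelerating time by `c` multiplies the generator by `c`; sending `Y` to `c Y` and fixing `X`
  -- restores the relation `X ↦ Y`.
  let Q : E3 ≃ₗ[ℝ] E3 := frameEquiv ![1, 0, 0] ![0, c, 0] (by simpa using hc)
  refine ⟨HeisExt.isoOf (nf (c * b') (c ^ 2 * k')) (nf b' k') Q (fun _ => 0) c hc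
    (frameEquiv_bracket _ _ _) (fun s t => ?_) (fun t x => ?_),
    HeisExt.isLieIso_isoOf _ _ _ _ _ _ _ _ _ contDiff_const⟩
  · rw [map_zero, heisBracket_self]
    simp
  · simp only [nf_lie, Q, frameEquiv_apply]
    refine ext_E3 ?_ ?_ ?_
    · simp [nfLie_zero', nfLie_one, heisBracket, hs, hs']
      field_simp
    · simp [nfLie_zero', nfLie_one, heisBracket, hs, hs']
      field_simp
    · simp [nfLie_two, heisBracket]
      rw [show c * b' * t = b' * (c * t) by ring]
      ring

end PlaneWave
end

noncomputable section
namespace PlaneWave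

/-! ### Properties of a representation in terms of its normal form -/

theorem single_zero : (Pi.single 0 1 : E3) = ![1, 0, 0] := by refine ext_E3 ?_ ?_ ?_ <;> simp
theorem single_one : (Pi.single 1 1 : E3) = ![0, 1, 0] := by refine ext_E3 ?_ ?_ ?_ <;> simp
theorem single_two : (Pi.single 2 1 : E3) = ![0, 0, 1] := by refine ext_E3 ?_ ?_ ?_ <;> simp

theorem trace_E3 (f : E3 →ₗ[ℝ] E3) : LinearMap.trace ℝ E3 f =
    f ![1, 0, 0] 0 + f ![0, 1, 0] 1 + f ![0, 0, 1] 2 := by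
  rw [LinearMap.trace_eq_matrix_trace ℝ (Pi.basisFun ℝ (Fin 3)), Matrix.trace_fin_three]
  simp only [LinearMap.toMatrix_apply, Pi.basisFun_repr, Pi.basisFun_apply]
  rw [single_zero, single_one, single_two]

theorem det_E3 (f : E3 →ₗ[ℝ] E3) : LinearMap.det f =
    Matrix.det (Matrix.of fun i j => f (![![1, 0, 0], ![0, 1, 0], ![0, 0, 1]] j) i) := by
  rw [← LinearMap.det_toMatrix (Pi.basisFun ℝ (Fin 3))]
  congr 1
  ext i j
  simp only [LinearMap.toMatrix_apply, Pi.basisFun_repr, Pi.basisFun_apply, Matrix.of_apply]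
  fin_cases j
  · simp [single_zero]
  · simp [single_one]
  · simp [single_two]

namespace NormalForm

variable {ρ : HeisRep} {W : NonCentral} (n : NormalForm ρ W)

theorem Q_mem_center {x : E3} : n.Q x ∈ heisCenter ↔ x ∈ heisCenter := by
  constructor
  · intro h y
    apply n.Q.injective
    rw [n.Q_bracket, h, map_zero]
  · intro h y
    obtain ⟨z, rfl⟩ := n.Q.surjective y
    rw [← n.Q_bracket, h, map_zero]

/-- The coordinates on `heis / Z` given by the normal form. -/
def coord : (E3 ⧸ heisCenter) ≃ₗ[ℝ] ℝ × ℝ :=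
  LinearEquiv.ofBijective
    (heisCenter.liftQ
      (((LinearMap.proj 0).prod (LinearMap.proj 1)).comp (n.Q.symm : E3 →ₗ[ℝ] E3)) (by
        intro x hx
        obtain ⟨y, rfl⟩ := n.Q.surjective x
        have h := mem_heisCenter.1 (n.Q_mem_center.1 hx)
        simp [h]))
    (by
      constructor
      · rw [← LinearMap.ker_eq_bot, Submodule.ker_liftQ_eq_bot]
        intro x hx
        obtain ⟨y, rfl⟩ := n.Q.surjective x
        simp at hx
        exact n.Q_mem_center.2 (mem_heisCenter.2 hx)
      · rintro ⟨p, q⟩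
        refine ⟨heisCenter.mkQ (n.Q ![p, q, 0]), ?_⟩
        simp)

theorem coord_mk (x : E3) : n.coord (heisCenter.mkQ (n.Q x)) = (x 0, x 1) := by
  change ((n.Q.symm (n.Q x)) 0, (n.Q.symm (n.Q x)) 1) = (x 0, x 1)
  rw [LinearEquiv.symm_apply_apply]

theorem coord_lie (t : ℝ) (X : E3) : n.coord (heisCenter.mkQ (ρ.lie t X)) =
    ((sol' n.b n.k t - n.b * sol n.b n.k t) * (n.coord (heisCenter.mkQ X)).1
        + n.k * sol n.b n.k t * (n.coord (heisCenter.mkQ X)).2,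
      sol n.b n.k t * (n.coord (heisCenter.mkQ X)).1
        + sol' n.b n.k t * (n.coord (heisCenter.mkQ X)).2) := by
  obtain ⟨x, rfl⟩ := n.Q.surjective X
  obtain ⟨r₀, r₁, h⟩ := n.exists_lie_Q t
  rw [h, coord_mk, coord_mk]
  simp [nfLie_zero', nfLie_one]

/-- The generator on `heis / Z` has characteristic polynomial `λ² - bλ - k`, of discriminant `b² +
4k`. A real root gives a common real eigenvector, on which the complex multipliers would have to be
real. -/
theorem isElliptic_iff : ρ.IsElliptic ↔ n.b ^ 2 + 4 * n.k < 0 := by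
  constructor
  · rintro ⟨P, c, hc, t, ht⟩
    by_contra! hdisc
    -- The equation says that `q X + Y` is an eigenvector of the generator on `heis / Z`, with
    -- eigenvalue `q + b`.
    obtain ⟨q, hq⟩ : ∃ q : ℝ, q ^ 2 + n.b * q = n.k := by
      refine ⟨(-n.b + Real.sqrt (n.b ^ 2 + 4 * n.k)) / 2, ?_⟩
      have := Real.sq_sqrt hdisc
      linear_combination this / 4
    set V := n.Q ![q, 1, 0] with hV
    have h1 : heisCenter.mkQ (ρ.lie t V)
        = (sol' n.b n.k t + q * sol n.b n.k t) • heisCenter.mkQ V := by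
      apply n.coord.injective
      rw [map_smul, n.coord_lie, hV, n.coord_mk]
      ext
      · simp
        linear_combination (-sol n.b n.k t) * hq
      · simp
        ring
    have h2 := hc t V
    rw [h1, map_smul] at h2
    have h3 : P (heisCenter.mkQ V) ≠ 0 := by
      intro h
      rw [map_eq_zero_iff P P.injective] at h
      have h4 := congrArg n.coord h
      rw [hV, n.coord_mk, map_zero] at h4
      have := congrArg Prod.snd h4
      simp at this
    rw [Complex.real_smul] at h2
    have h4 := mul_right_cancel₀ h3 h2
    apply ht
    rw [← h4, Complex.ofReal_im]
  · intro hdisc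
    obtain ⟨w, hw, hw2⟩ : ∃ w : ℝ, w ≠ 0 ∧ 4 * w ^ 2 = -(n.b ^ 2 + 4 * n.k) := by
      refine ⟨Real.sqrt (-(n.b ^ 2 + 4 * n.k)) / 2, ?_, ?_⟩
      · have := Real.sqrt_pos.2 (neg_pos.2 hdisc)
        positivity
      · rw [div_pow, Real.sq_sqrt (by linarith)]; ring
    -- With `λ = b/2 + i w`, a root of the characteristic polynomial, `X ↦ 1` and `Y ↦ λ` turn the
    -- generator into multiplication by `λ`.
    let e : (ℝ × ℝ) ≃ₗ[ℝ] ℂ :=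
      { toFun := fun p => ⟨p.1 + n.b / 2 * p.2, w * p.2⟩
        invFun := fun z => (z.re - n.b / 2 * (z.im / w), z.im / w)
        map_add' := fun p p' => by apply Complex.ext <;> simp <;> ring
        map_smul' := fun r p => by apply Complex.ext <;> simp <;> ring
        left_inv := fun p => by ext <;> simp [hw]
        right_inv := fun z => by
          apply Complex.ext
          · simp
          · simp
            field_simp }
    have he : ∀ p, e p = ⟨p.1 + n.b / 2 * p.2, w * p.2⟩ := fun p => rfl
    refine ⟨n.coord.trans e, fun t =>
      ⟨sol' n.b n.k t - n.b * sol n.b n.k t + n.b / 2 * sol n.b n.k t, w * sol n.b n.k t⟩,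
      fun t X => ?_, ?_⟩
    · simp only [LinearEquiv.trans_apply]
      rw [n.coord_lie, he, he]
      generalize n.coord (heisCenter.mkQ X) = p
      apply Complex.ext
      · simp
        linear_combination ((sol n.b n.k t * p.2) / 4) * hw2
      · simp
        ring
    · obtain ⟨t, ht⟩ := exists_sol_ne_zero n.b n.k
      exact ⟨t, mul_ne_zero hw ht⟩

/-- For `b = 0` the flow is `sol' + sol · A` with `A² = k` on `heis / Z`. Where `sol` does not
vanish, diagonalizing the flow diagonalizes `A`, and real eigenvalues of the nonzero map `A` require
`k > 0`; conversely they are `±√k`. -/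
theorem isHyperbolic_iff (hb : n.b = 0) : ρ.IsHyperbolic ↔ 0 < n.k := by
  constructor
  · rintro ⟨P, c, d, h⟩
    by_contra! hk
    obtain ⟨t, ht⟩ := exists_sol_ne_zero n.b n.k
    have hW : n.coord (heisCenter.mkQ (n.Q ![1, 0, 0])) = (1, 0) := by rw [n.coord_mk]; simp
    have hU : n.coord (heisCenter.mkQ (n.Q ![0, 1, 0])) = (0, 1) := by rw [n.coord_mk]; simp
    set w := heisCenter.mkQ (n.Q ![1, 0, 0]) with hw
    set u := heisCenter.mkQ (n.Q ![0, 1, 0]) with hu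
    have h1 : heisCenter.mkQ (ρ.lie t (n.Q ![1, 0, 0]))
        = sol' n.b n.k t • w + sol n.b n.k t • u := by
      apply n.coord.injective
      rw [n.coord_lie, map_add, map_smul, map_smul, ← hw, hW, hU]
      simp [hb]
    have h2 : heisCenter.mkQ (ρ.lie t (n.Q ![0, 1, 0]))
        = (n.k * sol n.b n.k t) • w + sol' n.b n.k t • u := by
      apply n.coord.injective
      rw [n.coord_lie, map_add, map_smul, map_smul, ← hu, hW, hU]
      simp
    have e1 := h t (n.Q ![1, 0, 0])
    have e2 := h t (n.Q ![0, 1, 0])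
    rw [h1, map_add, map_smul, map_smul, ← hw] at e1
    rw [h2, map_add, map_smul, map_smul, ← hu] at e2
    have a1 := congrArg Prod.fst e1
    have a2 := congrArg Prod.fst e2
    have b1 := congrArg Prod.snd e1
    have b2 := congrArg Prod.snd e2
    simp at a1 a2 b1 b2
    -- Each coordinate of `P` is an eigenform of the flow at time `t`, hence of `A` because `sol t ≠
    -- 0`; its eigenvalue squares to `k`. If `k ≤ 0`, both coordinates of `P u` vanish.
    have f1 : (P u).1 ^ 2 = n.k * (P w).1 ^ 2 := by
      apply mul_left_cancel₀ ht
      linear_combination (P u).1 * a1 - (P w).1 * a2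
    have f2 : (P u).2 ^ 2 = n.k * (P w).2 ^ 2 := by
      apply mul_left_cancel₀ ht
      linear_combination (P u).2 * b1 - (P w).2 * b2
    have g1 : (P u).1 = 0 := by nlinarith [sq_nonneg (P u).1, sq_nonneg (P w).1]
    have g2 : (P u).2 = 0 := by nlinarith [sq_nonneg (P u).2, sq_nonneg (P w).2]
    have g3 : P u = 0 := Prod.ext g1 g2
    rw [map_eq_zero_iff P P.injective] at g3
    rw [g3, map_zero] at hU
    simpa using congrArg Prod.snd hU
  · intro hk
    set m := Real.sqrt n.k with hm
    have hm0 : 0 < m := Real.sqrt_pos.2 hk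
    have hm2 : m ^ 2 = n.k := Real.sq_sqrt hk.le
    let e : (ℝ × ℝ) ≃ₗ[ℝ] ℝ × ℝ :=
      { toFun := fun p => (p.1 + m * p.2, p.1 - m * p.2)
        invFun := fun z => ((z.1 + z.2) / 2, (z.1 - z.2) / (2 * m))
        map_add' := fun p p' => by ext <;> simp <;> ring
        map_smul' := fun r p => by ext <;> simp <;> ring
        left_inv := fun p => by
          ext
          · simp
          · simp
            field_simp
            ring
        right_inv := fun z => by
          ext
          · simp
            field_simp
            ring
          · simp
            field_simp
            ring }
    have he : ∀ p, e p = (p.1 + m * p.2, p.1 - m * p.2) := fun p => rfl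
    refine ⟨n.coord.trans e, fun t => sol' n.b n.k t + m * sol n.b n.k t,
      fun t => sol' n.b n.k t - m * sol n.b n.k t, fun t X => ?_⟩
    simp only [LinearEquiv.trans_apply]
    rw [n.coord_lie, he, he]
    generalize n.coord (heisCenter.mkQ X) = p
    ext
    · simp [hb]
      linear_combination (-sol 0 n.k t * p.2) * hm2
    · simp [hb]
      linear_combination (-sol 0 n.k t * p.2) * hm2

theorem trace_lie (t : ℝ) : LinearMap.trace ℝ E3 (ρ.lie t : E3 →ₗ[ℝ] E3) =
    Real.exp (n.b * t) + 2 * sol' n.b n.k t - n.b * sol n.b n.k t := by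
  obtain ⟨r₀, r₁, h⟩ := n.exists_lie_Q t
  rw [← LinearMap.trace_conj' (ρ.lie t : E3 →ₗ[ℝ] E3) n.Q.symm, trace_E3]
  simp only [LinearEquiv.conj_apply, LinearMap.coe_comp, Function.comp_apply,
    LinearEquiv.coe_coe, LinearEquiv.symm_symm, ContinuousLinearMap.coe_coe, h,
    LinearEquiv.symm_apply_apply]
  simp [nfLie]
  ring

theorem det_lie (t : ℝ) : LinearMap.det (ρ.lie t : E3 →ₗ[ℝ] E3) = Real.exp (n.b * t) ^ 2 := by
  obtain ⟨r₀, r₁, h⟩ := n.exists_lie_Q t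
  rw [← LinearMap.det_conj (ρ.lie t : E3 →ₗ[ℝ] E3) n.Q.symm, det_E3, Matrix.det_fin_three]
  simp only [LinearMap.coe_comp, Function.comp_apply,
    LinearEquiv.coe_coe, LinearEquiv.symm_symm, ContinuousLinearMap.coe_coe, h,
    LinearEquiv.symm_apply_apply, Matrix.of_apply]
  simp [nfLie]
  linear_combination Real.exp (n.b * t) * sol_wronskian n.b n.k t

theorem lie_Z (t : ℝ) : ρ.lie t (n.Q ![0, 0, 1]) = Real.exp (n.b * t) • n.Q ![0, 0, 1] := by
  obtain ⟨r₀, r₁, h⟩ := n.exists_lie_Q t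
  rw [h, ← map_smul]
  congr 1
  refine ext_E3 ?_ ?_ ?_ <;> simp [nfLie]

theorem fixesCenter_iff : ρ.FixesCenter ↔ n.b = 0 := by
  constructor
  · intro h
    have hz : n.Q ![0, 0, 1] ∈ heisCenter := n.Q_mem_center.2 (mem_heisCenter.2 (by simp))
    have h1 := h 1 _ hz
    rw [n.lie_Z, ← map_smul] at h1
    have h2 := congrFun (n.Q.injective h1) 2
    simpa using h2
  · intro hb t X hX
    obtain ⟨x, rfl⟩ := n.Q.surjective X
    have hx := mem_heisCenter.1 (n.Q_mem_center.1 hX)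
    have e : x = x 2 • ![0, 0, 1] := by
      refine ext_E3 ?_ ?_ ?_ <;> simp [hx]
    rw [e, map_smul, map_smul, n.lie_Z, hb]
    simp

/-- The first two derivatives of the trace at the origin determine `b` and `k`. -/
theorem _root_.PlaneWave.trace_function_eq {b k b' k' c : ℝ}
    (h : ∀ t, Real.exp (b * t) + 2 * sol' b k t - b * sol b k t =
      Real.exp (b' * (c * t)) + 2 * sol' b' k' (c * t) - b' * sol b' k' (c * t)) :
    b = c * b' ∧ k = c ^ 2 * k' := by
  have d1 : ∀ b k t, HasDerivAt (fun t => Real.exp (b * t) + 2 * sol' b k t - b * sol b k t)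
      (b * Real.exp (b * t) + b * sol' b k t + 2 * k * sol b k t) t := by
    intro b k t
    refine HasDerivAt.congr_deriv (((hasDerivAt_exp_mul b t).add
      ((hasDerivAt_sol' b k t).const_mul 2)).sub ((hasDerivAt_sol b k t).const_mul b)) ?_
    ring
  have d2 : ∀ b k t, HasDerivAt
      (fun t => b * Real.exp (b * t) + b * sol' b k t + 2 * k * sol b k t)
      (b * (b * Real.exp (b * t)) + b * (b * sol' b k t + k * sol b k t)
        + 2 * k * sol' b k t) t := by
    intro b k t
    exact (((hasDerivAt_exp_mul b t).const_mul b).add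
      ((hasDerivAt_sol' b k t).const_mul b)).add ((hasDerivAt_sol b k t).const_mul (2 * k))
  have hm : ∀ t, HasDerivAt (fun t => c * t) c t := fun t => by
    simpa using (hasDerivAt_id t).const_mul c
  have e1 : ∀ t, b * Real.exp (b * t) + b * sol' b k t + 2 * k * sol b k t =
      (b' * Real.exp (b' * (c * t)) + b' * sol' b' k' (c * t) + 2 * k' * sol b' k' (c * t)) * c := by
    intro t
    refine (d1 b k t).unique ?_
    rw [funext h]
    exact (d1 b' k' (c * t)).comp t (hm t)
  have e2 := (d2 b k 0).unique (by
    rw [funext e1]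
    exact ((d2 b' k' (c * 0)).comp 0 (hm 0)).mul_const c)
  have e10 := e1 0
  simp [sol_zero, sol'_zero] at e10 e2
  have hb : b = c * b' := by linarith
  refine ⟨hb, ?_⟩
  subst hb
  linarith

/-- Unipotent maps of a three-dimensional space have trace three, and a constant trace function
forces `b = k = 0`. In the other direction `ρ t - 1` sends `X` into the span of `Y` and `Z`, `Y`
into the center and `Z` to zero. -/
theorem isUnipotent_iff : ρ.IsUnipotent ↔ n.b = 0 ∧ n.k = 0 := by
  constructor
  · intro h
    have h1 : ∀ t, Real.exp (n.b * t) + 2 * sol' n.b n.k t - n.b * sol n.b n.k t = 3 := by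
      intro t
      have h2 := (h t).map (ContinuousLinearMap.toLinearMapRingHom : (E3 →L[ℝ] E3) →+* (E3 →ₗ[ℝ] E3))
      have h3 := (LinearMap.isNilpotent_trace_of_isNilpotent h2).eq_zero
      have h4 : (ContinuousLinearMap.toLinearMapRingHom : (E3 →L[ℝ] E3) →+* (E3 →ₗ[ℝ] E3)) (ρ.lie t - 1)
          = (ρ.lie t : E3 →ₗ[ℝ] E3) - 1 := rfl
      rw [h4, map_sub, n.trace_lie, LinearMap.trace_one] at h3
      simp at h3
      linarith
    -- With these parameters the right side of the comparison is the constant `1 + 2 = 3`.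
    have h2 := trace_function_eq (b := n.b) (k := n.k) (b' := 0) (k' := 0) (c := 0) (fun t => by
      rw [h1]
      simp [sol'_zero]
      norm_num)
    simpa using h2
  · rintro ⟨hb, hk⟩ t
    obtain ⟨r₀, r₁, h⟩ := n.exists_lie_Q t
    have hs : sol' 0 0 t = 1 := by
      have h := sol_wronskian 0 0 t
      have h0 : ∀ t, HasDerivAt (sol' 0 0) 0 t := fun t => by simpa using hasDerivAt_sol' 0 0 t
      have := is_const_of_deriv_eq_zero (fun s => (h0 s).differentiableAt) (fun s => (h0 s).deriv) t 0
      rw [this, sol'_zero]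
    refine ⟨3, ?_⟩
    ext1 X
    obtain ⟨x, rfl⟩ := n.Q.surjective X
    have e : ∀ x : E3, (ρ.lie t - 1) (n.Q x) =
        n.Q ![0, sol 0 0 t * x 0, r₀ * x 0 + r₁ * x 1] := by
      intro x
      change ρ.lie t (n.Q x) - n.Q x = _
      rw [h, ← map_sub]
      congr 1
      refine ext_E3 ?_ ?_ ?_ <;> simp [nfLie, hb, hk, hs]
    rw [pow_succ, pow_two]
    simp only [mul_apply_eq_comp, e]
    simp

/-- A fixed vector is killed by the generator modulo the center. If `k ≠ 0` the generator is
invertible there, so the vector is central, and no central vector is fixed since `b ≠ 0`. If `k =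
0`, a vector fixed modulo the center exists and is corrected by a central one. -/
theorem hasFixedVector_iff (hb : n.b ≠ 0) : ρ.HasFixedVector ↔ n.k = 0 := by
  constructor
  · rintro ⟨X, hX, h⟩
    obtain ⟨x, rfl⟩ := n.Q.surjective X
    by_contra hk
    have e : ∀ t, sol n.b n.k t * x 0 + sol' n.b n.k t * x 1 = x 1
        ∧ (sol' n.b n.k t - n.b * sol n.b n.k t) * x 0 + n.k * sol n.b n.k t * x 1 = x 0 := by
      intro t
      have h1 := n.coord_lie t (n.Q x)
      rw [h, n.coord_mk] at h1
      have h2 := congrArg Prod.fst h1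
      have h3 := congrArg Prod.snd h1
      simp at h2 h3
      exact ⟨h3.symm, h2.symm⟩
    have d1 := ((hasDerivAt_sol n.b n.k 0).mul_const (x 0)).add
      ((hasDerivAt_sol' n.b n.k 0).mul_const (x 1))
    have d2 := (((hasDerivAt_sol' n.b n.k 0).sub ((hasDerivAt_sol n.b n.k 0).const_mul n.b)).mul_const
      (x 0)).add (((hasDerivAt_sol n.b n.k 0).const_mul n.k).mul_const (x 1))
    have d1' := d1.unique ((hasDerivAt_const (0 : ℝ) (x 1)).congr_of_eventuallyEq
      (Filter.Eventually.of_forall fun t => (e t).1))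
    have d2' := d2.unique ((hasDerivAt_const (0 : ℝ) (x 0)).congr_of_eventuallyEq
      (Filter.Eventually.of_forall fun t => (e t).2))
    simp [sol_zero, sol'_zero, hk] at d1' d2'
    rw [d2'] at d1'
    have hx0 : x 0 = 0 := by simpa using d1'
    have ex : x = x 2 • ![0, 0, 1] := by
      refine ext_E3 ?_ ?_ ?_ <;> simp [hx0, d2']
    have h1 := h 1
    rw [ex, map_smul, map_smul, n.lie_Z, ← map_smul, ← map_smul, ← map_smul] at h1
    have h2 := congrFun (n.Q.injective h1) 2
    have hE : Real.exp n.b ≠ 1 := by simpa using hb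
    have h3 : x 2 = 0 := by
      simp at h2
      by_contra h3
      exact hE (mul_left_cancel₀ h3 (by rw [h2, mul_one]))
    rw [h3, zero_smul] at ex
    rw [ex, map_zero] at hX
    exact hX rfl
  · intro hk
    have hs : ∀ t, sol' n.b n.k t = n.b * sol n.b n.k t + 1 := by
      intro t
      have h0 : ∀ t, HasDerivAt (fun t => sol' n.b n.k t - n.b * sol n.b n.k t) 0 t := fun t => by
        have h1 := (hasDerivAt_sol' n.b n.k t).sub ((hasDerivAt_sol n.b n.k t).const_mul n.b)
        refine HasDerivAt.congr_deriv h1 ?_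
        rw [hk]
        ring
      have := is_const_of_deriv_eq_zero (fun s => (h0 s).differentiableAt) (fun s => (h0 s).deriv) t 0
      simp only [sol_zero, sol'_zero] at this
      linarith
    -- For `k = 0` the vector `Y - b X` spans the kernel of the generator on `heis / Z`.
    set X₀ := n.Q ![-n.b, 1, 0] with hX₀
    set Z := n.Q ![0, 0, 1] with hZ
    have h1 : ∀ t, ∃ r : ℝ, ρ.lie t X₀ = X₀ + r • Z := by
      intro t
      obtain ⟨r₀, r₁, h⟩ := n.exists_lie_Q t
      refine ⟨-r₀ * n.b + r₁, ?_⟩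
      rw [hX₀, h, hZ, ← map_smul, ← map_add]
      congr 1
      refine ext_E3 ?_ ?_ ?_
      · have := hs t
        simp only [hk] at this
        simp [nfLie, this, hk]
      · simp [nfLie, hs]
        ring
      · simp [nfLie]
    choose r hr using h1
    have hZ0 : ∀ c d : ℝ, c • Z = d • Z → c = d := by
      intro c d h
      rw [hZ, ← map_smul, ← map_smul] at h
      simpa using congrFun (n.Q.injective h) 2
    -- The function `r` is a cocycle for the character `e^{bt}` of `ℝ`, and commutativity of `ℝ`
    -- gives this symmetry. As the character is nontrivial, evaluating at time `1` shows that `r` is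
    -- a coboundary, namely `κ (1 - e^{bt})`.
    have h2 : ∀ s t, r s + Real.exp (n.b * s) * r t = r t + Real.exp (n.b * t) * r s := by
      intro s t
      apply hZ0
      have e : ∀ s t, ρ.lie (s + t) X₀ = X₀ + (r s + Real.exp (n.b * s) * r t) • Z := by
        intro s t
        rw [ρ.lie_add, hr t, map_add, map_smul, n.lie_Z, hr s]
        module
      have h3 := e s t
      rw [add_comm s t, e t s] at h3
      exact (add_left_cancel h3).symm
    have hE : 1 - Real.exp (n.b * 1) ≠ 0 := by
      rw [sub_ne_zero, mul_one]
      exact fun h => hb (Real.exp_eq_one_iff _ |>.1 h.symm)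
    obtain ⟨κ, hκ⟩ : ∃ κ, κ * (1 - Real.exp (n.b * 1)) = r 1 := ⟨_, div_mul_cancel₀ _ hE⟩
    refine ⟨X₀ + κ • Z, ?_, fun t => ?_⟩
    · rw [hX₀, hZ, ← map_smul, ← map_add]
      intro h
      rw [map_eq_zero_iff n.Q n.Q.injective] at h
      simpa using congrFun h 1
    · have h3 : r t + κ * Real.exp (n.b * t) = κ := by
        apply mul_right_cancel₀ hE
        linear_combination h2 t 1 - (1 - Real.exp (n.b * t)) * hκ
      have h4 : X₀ + κ • Z = X₀ + (r t + κ * Real.exp (n.b * t)) • Z := by rw [h3]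
      rw [map_add, map_smul, hr, n.lie_Z, h4]
      module

end NormalForm

end PlaneWave
end

noncomputable section
namespace PlaneWave

/-! ### Isometries -/

section General

set_option linter.unusedSectionVars false

variable {M : Type*} [TopologicalSpace M] [ChartedSpace E3 M] [IsManifold 𝓘(ℝ, E3) ∞ M]
  {N : Type*} [TopologicalSpace N] [ChartedSpace E3 N] [IsManifold 𝓘(ℝ, E3) ∞ N]
  {K : Type*} [TopologicalSpace K] [ChartedSpace E3 K] [IsManifold 𝓘(ℝ, E3) ∞ K]

theorem PreservesMetric.comp {g : LorentzMetric M} {h : LorentzMetric N} {l : LorentzMetric K}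
    {f : M → N} {f' : N → K} (hf : PreservesMetric g h f) (hf' : PreservesMetric h l f')
    (hd : MDifferentiable 𝓘(ℝ, E3) 𝓘(ℝ, E3) f) (hd' : MDifferentiable 𝓘(ℝ, E3) 𝓘(ℝ, E3) f') :
    PreservesMetric g l (f' ∘ f) := by
  intro x v w
  rw [mfderiv_comp x (hd' (f x)) (hd x)]
  exact (hf' (f x) _ _).trans (hf x v w)

theorem mfderiv_symm_right (f : M ≃ₘ⟮𝓘(ℝ, E3), 𝓘(ℝ, E3)⟯ N) (y : N)
    (v : TangentSpace 𝓘(ℝ, E3) y) :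
    mfderiv 𝓘(ℝ, E3) 𝓘(ℝ, E3) f (f.symm y) (mfderiv 𝓘(ℝ, E3) 𝓘(ℝ, E3) f.symm y v) = v := by
  have h := mfderiv_comp (I := 𝓘(ℝ, E3)) (I' := 𝓘(ℝ, E3)) (I'' := 𝓘(ℝ, E3)) y
    (f.mdifferentiable (by simp) (f.symm y)) (f.symm.mdifferentiable (by simp) y)
  have e : (f : M → N) ∘ f.symm = id := funext fun z => f.apply_symm_apply z
  rw [e, mfderiv_id] at h
  exact (congrArg (fun T => T v) h).symm

theorem mfderiv_symm_left (f : M ≃ₘ⟮𝓘(ℝ, E3), 𝓘(ℝ, E3)⟯ N) (x : M)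
    (v : TangentSpace 𝓘(ℝ, E3) x) :
    mfderiv 𝓘(ℝ, E3) 𝓘(ℝ, E3) f.symm (f x) (mfderiv 𝓘(ℝ, E3) 𝓘(ℝ, E3) f x v) = v := by
  have h := mfderiv_comp (I := 𝓘(ℝ, E3)) (I' := 𝓘(ℝ, E3)) (I'' := 𝓘(ℝ, E3)) x
    (f.symm.mdifferentiable (by simp) (f x)) (f.mdifferentiable (by simp) x)
  have e : (f.symm : N → M) ∘ f = id := funext fun z => f.symm_apply_apply z
  rw [e, mfderiv_id] at h
  exact (congrArg (fun T => T v) h).symm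

/-- The inverse of an isometry. -/
def Isom.symm {g : LorentzMetric M} {h : LorentzMetric N} (f : Isom g h) : Isom h g :=
  ⟨f.1.symm, by
    intro y v w
    have h1 := f.2 (f.1.symm y) (mfderiv 𝓘(ℝ, E3) 𝓘(ℝ, E3) f.1.symm y v)
      (mfderiv 𝓘(ℝ, E3) 𝓘(ℝ, E3) f.1.symm y w)
    rw [mfderiv_symm_right, mfderiv_symm_right] at h1
    have e : ∀ z, z = y → h.val z v w = h.val y v w := by rintro z rfl; rfl
    rw [← h1]
    exact e _ (f.1.apply_symm_apply y)⟩

/-- The composition of two isometries. -/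
def Isom.trans {g : LorentzMetric M} {h : LorentzMetric N} {l : LorentzMetric K} (f : Isom g h)
    (f' : Isom h l) : Isom g l :=
  ⟨f.1.trans f'.1, by
    have := f.2.comp f'.2 (f.1.mdifferentiable (by simp)) (f'.1.mdifferentiable (by simp))
    exact this⟩

theorem Isometric.symm {g : LorentzMetric M} {h : LorentzMetric N} (H : Isometric g h) :
    Isometric h g := ⟨H.some.symm⟩

theorem Isometric.trans {g : LorentzMetric M} {h : LorentzMetric N} {l : LorentzMetric K}
    (H : Isometric g h) (H' : Isometric h l) : Isometric g l := ⟨H.some.trans H'.some⟩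

theorem IsPartialIsom.mdifferentiableAt {g : LorentzMetric M} {h : LorentzMetric N}
    {e : OpenPartialHomeomorph M N} (he : IsPartialIsom g h e) {x : M} (hx : x ∈ e.source) :
    MDifferentiableAt 𝓘(ℝ, E3) 𝓘(ℝ, E3) e x :=
  (he.1.contMDiffAt (e.open_source.mem_nhds hx)).mdifferentiableAt (by simp)

theorem IsPartialIsom.mdifferentiableAt_symm {g : LorentzMetric M} {h : LorentzMetric N}
    {e : OpenPartialHomeomorph M N} (he : IsPartialIsom g h e) {y : N} (hy : y ∈ e.target) :
    MDifferentiableAt 𝓘(ℝ, E3) 𝓘(ℝ, E3) e.symm y :=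
  (he.2.1.contMDiffAt (e.open_target.mem_nhds hy)).mdifferentiableAt (by simp)

theorem IsPartialIsom.symm {g : LorentzMetric M} {h : LorentzMetric N}
    {e : OpenPartialHomeomorph M N} (he : IsPartialIsom g h e) : IsPartialIsom h g e.symm := by
  refine ⟨he.2.1, by simpa using he.1, fun y hy v w => ?_⟩
  have hy' : y ∈ e.target := hy
  have hx : e.symm y ∈ e.source := e.map_target hy'
  have h1 := he.2.2 (e.symm y) hx (mfderiv 𝓘(ℝ, E3) 𝓘(ℝ, E3) e.symm y v)
    (mfderiv 𝓘(ℝ, E3) 𝓘(ℝ, E3) e.symm y w)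
  have h2 := mfderiv_comp (I := 𝓘(ℝ, E3)) (I' := 𝓘(ℝ, E3)) (I'' := 𝓘(ℝ, E3)) y
    (he.mdifferentiableAt hx) (he.mdifferentiableAt_symm hy')
  have e1 : (e : M → N) ∘ e.symm =ᶠ[𝓝 y] id := by
    filter_upwards [e.open_target.mem_nhds hy'] with z hz using e.right_inv hz
  rw [e1.mfderiv_eq, mfderiv_id] at h2
  have h3 : ∀ v : TangentSpace 𝓘(ℝ, E3) y, mfderiv 𝓘(ℝ, E3) 𝓘(ℝ, E3) e (e.symm y)
      (mfderiv 𝓘(ℝ, E3) 𝓘(ℝ, E3) e.symm y v) = v :=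
    fun v => (congrArg (fun T => T v) h2).symm
  rw [h3, h3] at h1
  rw [← h1]
  have e2 : ∀ z, z = y → h.val z v w = h.val y v w := by rintro z rfl; rfl
  exact e2 _ (e.right_inv hy')

theorem IsPartialIsom.trans {g : LorentzMetric M} {h : LorentzMetric N} {l : LorentzMetric K}
    {e : OpenPartialHomeomorph M N} {e' : OpenPartialHomeomorph N K}
    (he : IsPartialIsom g h e) (he' : IsPartialIsom h l e') :
    IsPartialIsom g l (e.trans e') := by
  refine ⟨?_, ?_, fun x hx v w => ?_⟩
  · rw [OpenPartialHomeomorph.coe_trans, OpenPartialHomeomorph.trans_source]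
    exact he'.1.comp (he.1.mono Set.inter_subset_left) (fun x hx => hx.2)
  · rw [OpenPartialHomeomorph.trans_target, OpenPartialHomeomorph.coe_trans_symm]
    exact he.2.1.comp (he'.2.1.mono Set.inter_subset_left) (fun x hx => hx.2)
  · rw [OpenPartialHomeomorph.trans_source] at hx
    rw [OpenPartialHomeomorph.coe_trans,
      mfderiv_comp x (he'.mdifferentiableAt hx.2) (he.mdifferentiableAt hx.1)]
    exact (he'.2.2 (e x) hx.2 _ _).trans (he.2.2 x hx.1 v w)

/-- An isometry, as a partial isometry. -/
def Isom.toPartial {g : LorentzMetric M} {h : LorentzMetric N} (f : Isom g h) :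
    OpenPartialHomeomorph M N := f.1.toHomeomorph.toOpenPartialHomeomorph

theorem Isom.isPartialIsom {g : LorentzMetric M} {h : LorentzMetric N} (f : Isom g h) :
    IsPartialIsom g h f.toPartial :=
  ⟨f.1.contMDiff.contMDiffOn, f.1.symm.contMDiff.contMDiffOn, fun x _ v w => f.2 x v w⟩

theorem IsometricToOpen.congr_left {g : LorentzMetric M} {h : LorentzMetric N}
    {l : LorentzMetric K} {U : Set K} (H : Isometric g h) (H' : IsometricToOpen h l U) :
    IsometricToOpen g l U := by
  obtain ⟨f⟩ := H
  obtain ⟨e, hs, ht, he⟩ := H'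
  refine ⟨f.toPartial.trans e, ?_, ?_, f.isPartialIsom.trans he⟩
  · rw [OpenPartialHomeomorph.trans_source, hs]
    simp [Isom.toPartial]
  · rw [OpenPartialHomeomorph.trans_target, ht]
    simp [Isom.toPartial]

/-- Two manifolds that are isometric to the same open set are isometric. -/
theorem IsometricToOpen.isometric {g : LorentzMetric M} {h : LorentzMetric N}
    {l : LorentzMetric K} {U : Set K} (H : IsometricToOpen g l U) (H' : IsometricToOpen h l U) :
    Isometric g h := by
  obtain ⟨e, hs, ht, he⟩ := H
  obtain ⟨e', hs', ht', he'⟩ := H'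
  have hp := he.trans he'.symm
  have hsrc : (e.trans e'.symm).source = Set.univ := by
    rw [OpenPartialHomeomorph.trans_source, hs, OpenPartialHomeomorph.symm_source, ht', ← ht,
      Set.univ_inter]
    ext x
    simp only [Set.mem_preimage, Set.mem_univ, iff_true]
    exact e.map_source (by rw [hs]; trivial)
  have htgt : (e.trans e'.symm).target = Set.univ := by
    rw [OpenPartialHomeomorph.trans_target, OpenPartialHomeomorph.symm_target, hs',
      OpenPartialHomeomorph.symm_symm, ht, ← ht', Set.univ_inter]
    ext x
    simp only [Set.mem_preimage, Set.mem_univ, iff_true]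
    exact e'.map_source (by rw [hs']; trivial)
  set F := e.trans e'.symm
  refine ⟨⟨⟨⟨F, F.symm, fun x => F.left_inv (by rw [hsrc]; trivial),
    fun y => F.right_inv (by rw [htgt]; trivial)⟩, ?_, ?_⟩, fun x v w => ?_⟩⟩
  · have := hp.1
    rw [hsrc] at this
    exact contMDiffOn_univ.1 this
  · have := hp.2.1
    rw [htgt] at this
    exact contMDiffOn_univ.1 this
  · exact hp.2.2 x (by rw [hsrc]; trivial) v w

theorem IsFlat.of_isometric {g : LorentzMetric M} {h : LorentzMetric N} (H : Isometric g h)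
    (hf : IsFlat h) : IsFlat g := by
  obtain ⟨f⟩ := H
  intro x
  obtain ⟨e, hx, he⟩ := hf (f.1 x)
  refine ⟨f.toPartial.trans e, ?_, f.isPartialIsom.trans he⟩
  rw [OpenPartialHomeomorph.trans_source]
  exact ⟨trivial, hx⟩

/-- Separates the condition on the base point from that on the differential, the latter being read
in the model vector space, where the two tangent spaces are the same type. -/
theorem tangentMap_eq_neg_iff {f : M → M} {x : M} :
    (∀ v : TangentSpace 𝓘(ℝ, E3) x, tangentMap 𝓘(ℝ, E3) 𝓘(ℝ, E3) f ⟨x, v⟩ = ⟨x, -v⟩) ↔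
    f x = x ∧ ∀ v : TangentSpace 𝓘(ℝ, E3) x,
      (mfderiv 𝓘(ℝ, E3) 𝓘(ℝ, E3) f x v : E3) = -(v : E3) := by
  constructor
  · intro H
    refine ⟨congrArg Bundle.TotalSpace.proj (H 0), fun v => ?_⟩
    have h1 := H v
    unfold tangentMap at h1
    simp only [Bundle.TotalSpace.mk.injEq] at h1
    obtain ⟨h2, h3⟩ := h1
    exact eq_of_heq h3
  · rintro ⟨h, H⟩ v
    unfold tangentMap
    simp only [Bundle.TotalSpace.mk.injEq]
    exact ⟨h, heq_of_eq (H v)⟩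

theorem IsSymmetricSpace.of_isometric {g : LorentzMetric M} {h : LorentzMetric N}
    (H : Isometric g h) (hs : IsSymmetricSpace h) : IsSymmetricSpace g := by
  obtain ⟨f⟩ := H
  intro x
  obtain ⟨s, hs⟩ := hs (f.1 x)
  obtain ⟨hs1, hs2⟩ := tangentMap_eq_neg_iff.1 hs
  refine ⟨(f.trans s).trans f.symm, ?_⟩
  rw [tangentMap_eq_neg_iff]
  have hfx : f.1.symm (s.1 (f.1 x)) = x := by rw [hs1]; exact f.1.symm_apply_apply x
  refine ⟨hfx, fun v => ?_⟩
  have e : (((f.trans s).trans f.symm).1 : M → M) = f.1.symm ∘ (s.1 ∘ f.1) := rfl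
  have d1 := f.1.mdifferentiable (by simp) x
  have d2 := s.1.mdifferentiable (by simp) (f.1 x)
  have d3 := f.1.symm.mdifferentiable (by simp) (s.1 (f.1 x))
  rw [e, mfderiv_comp x d3 (d2.comp x d1), mfderiv_comp x d2 d1]
  have h1 := hs2 (mfderiv 𝓘(ℝ, E3) 𝓘(ℝ, E3) f.1 x v)
  have h2 := mfderiv_symm_left f.1 x v
  change mfderiv 𝓘(ℝ, E3) 𝓘(ℝ, E3) f.1.symm (s.1 (f.1 x))
    (mfderiv 𝓘(ℝ, E3) 𝓘(ℝ, E3) s.1 (f.1 x) (mfderiv 𝓘(ℝ, E3) 𝓘(ℝ, E3) f.1 x v)) = -(v : E3)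
  have h3 : ∀ (z : N) (hz : z = f.1 x) (w : E3),
      (mfderiv 𝓘(ℝ, E3) 𝓘(ℝ, E3) f.1.symm z w : E3)
        = mfderiv 𝓘(ℝ, E3) 𝓘(ℝ, E3) f.1.symm (f.1 x) w := by
    rintro z rfl w; rfl
  refine (h3 _ hs1 _).trans ?_
  refine (congrArg (fun w : E3 => (mfderiv 𝓘(ℝ, E3) 𝓘(ℝ, E3) f.1.symm (f.1 x) w : E3)) h1).trans ?_
  refine (ContinuousLinearMap.map_neg _ _).trans ?_
  exact congrArg (fun w : E3 => -w) h2

theorem IsLocallySymmetric.of_isometric {g : LorentzMetric M} {h : LorentzMetric N}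
    (H : Isometric g h) (hs : IsLocallySymmetric h) : IsLocallySymmetric g := by
  obtain ⟨f⟩ := H
  intro x
  obtain ⟨s, hx, hp, hs⟩ := hs (f.1 x)
  obtain ⟨hs1, hs2⟩ := tangentMap_eq_neg_iff.1 hs
  refine ⟨(f.toPartial.trans s).trans f.symm.toPartial, ?_,
    (f.isPartialIsom.trans hp).trans f.symm.isPartialIsom, ?_⟩
  · simp only [OpenPartialHomeomorph.trans_source]
    exact ⟨⟨trivial, hx⟩, trivial⟩
  rw [tangentMap_eq_neg_iff]
  have hfx : f.1.symm (s (f.1 x)) = x := by rw [hs1]; exact f.1.symm_apply_apply x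
  refine ⟨hfx, fun v => ?_⟩
  have e : (((f.toPartial.trans s).trans f.symm.toPartial) : M → M) = f.1.symm ∘ (s ∘ f.1) := rfl
  have d1 := f.1.mdifferentiable (by simp) x
  have d2 := hp.mdifferentiableAt hx
  have d3 := f.1.symm.mdifferentiable (by simp) (s (f.1 x))
  rw [e, mfderiv_comp x d3 (d2.comp x d1), mfderiv_comp x d2 d1]
  have h1 := hs2 (mfderiv 𝓘(ℝ, E3) 𝓘(ℝ, E3) f.1 x v)
  have h2 := mfderiv_symm_left f.1 x v
  change mfderiv 𝓘(ℝ, E3) 𝓘(ℝ, E3) f.1.symm (s (f.1 x))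
    (mfderiv 𝓘(ℝ, E3) 𝓘(ℝ, E3) s (f.1 x) (mfderiv 𝓘(ℝ, E3) 𝓘(ℝ, E3) f.1 x v)) = -(v : E3)
  have h3 : ∀ (z : N) (hz : z = f.1 x) (w : E3),
      (mfderiv 𝓘(ℝ, E3) 𝓘(ℝ, E3) f.1.symm z w : E3)
        = mfderiv 𝓘(ℝ, E3) 𝓘(ℝ, E3) f.1.symm (f.1 x) w := by
    rintro z rfl w; rfl
  refine (h3 _ hs1 _).trans ?_
  refine (congrArg (fun w : E3 => (mfderiv 𝓘(ℝ, E3) 𝓘(ℝ, E3) f.1.symm (f.1 x) w : E3)) h1).trans ?_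
  refine (ContinuousLinearMap.map_neg _ _).trans ?_
  exact congrArg (fun w : E3 => -w) h2

theorem LocallyIsometric.of_isometric {g : LorentzMetric M} {h : LorentzMetric N}
    (H : Isometric g h) : LocallyIsometric g h := by
  obtain ⟨f⟩ := H
  exact ⟨fun x => ⟨f.toPartial, trivial, f.isPartialIsom⟩,
    fun y => ⟨f.toPartial, trivial, f.isPartialIsom⟩⟩

/-- The existence of an open orbit of a group of dimension three is invariant by isometry. -/
theorem HasOpenOrbitOfDimThree.of_isometric {g : LorentzMetric M} {h : LorentzMetric N}
    (H : Isometric g h) (ho : HasOpenOrbitOfDimThree g) : HasOpenOrbitOfDimThree h := by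
  obtain ⟨f⟩ := H
  obtain ⟨L, i1, i2, i3, i4, i5, i6, i7, hs, hp, x, hx⟩ := ho
  let act : MulAction L N :=
    { smul := fun l y => f.1 (l • f.1.symm y)
      one_smul := fun y => by
        change f.1 ((1 : L) • f.1.symm y) = y
        rw [one_smul, f.1.apply_symm_apply]
      mul_smul := fun l l' y => by
        change f.1 ((l * l') • f.1.symm y) = f.1 (l • f.1.symm (f.1 (l' • f.1.symm y)))
        rw [f.1.symm_apply_apply, mul_smul] }
  refine ⟨L, i1, i2, i3, i4, i5, i6, act, ⟨?_⟩, fun l => ?_, f.1 x, ?_⟩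
  · exact f.1.contMDiff.comp (hs.contMDiff_smul.comp
      (contMDiff_fst.prodMk (f.1.symm.contMDiff.comp contMDiff_snd)))
  · have hl : ContMDiff 𝓘(ℝ, E3) 𝓘(ℝ, E3) ∞ (fun x : M => l • x) :=
      hs.contMDiff_smul.comp (contMDiff_const.prodMk contMDiff_id)
    have h1 := f.symm.2.comp (hp l) (f.1.symm.mdifferentiable (by simp))
      (hl.mdifferentiable (by simp))
    exact h1.comp f.2 ((hl.mdifferentiable (by simp)).comp (f.1.symm.mdifferentiable (by simp)))
      (f.1.mdifferentiable (by simp))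
  · have e : @MulAction.orbit L N act.toSMul (f.1 x) = f.1.symm ⁻¹' (MulAction.orbit L x) := by
      ext y
      constructor
      · rintro ⟨l, rfl⟩
        refine ⟨l, ?_⟩
        change l • x = f.1.symm (f.1 (l • f.1.symm (f.1 x)))
        rw [f.1.symm_apply_apply, f.1.symm_apply_apply]
      · rintro ⟨l, hl⟩
        refine ⟨l, ?_⟩
        change f.1 (l • f.1.symm (f.1 x)) = y
        have hl' : l • x = f.1.symm y := hl
        rw [f.1.symm_apply_apply, hl', f.1.apply_symm_apply]
    rw [e]
    exact hx.preimage f.1.symm.continuous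

end General

end PlaneWave
end

noncomputable section
namespace PlaneWave

/-! ### The model metrics -/

/-- A field of bilinear forms on `ℝ³`, as a Lorentz metric. -/
def LorentzMetric.ofForm (q : E3 → E3 →L[ℝ] E3 →L[ℝ] ℝ) (hsymm : ∀ p v w, q p v w = q p w v)
    (hsig : ∀ p, ∃ e : Fin 3 → E3, ∀ i j,
      q p (e i) (e j) = if i = j then (if i = 0 then -1 else 1) else 0)
    (hs : ∀ a b, ContDiff ℝ ∞ (fun y => q y a b)) : LorentzMetric E3 where
  val p := q p
  symm p v w := hsymm p v w
  signature p := hsig p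
  smooth x₀ a b := by
    refine (hs a b).contDiffOn.congr fun y _ => ?_
    have h1 : mfderiv 𝓘(ℝ, E3) 𝓘(ℝ, E3) (extChartAt 𝓘(ℝ, E3) x₀).symm y
        = ContinuousLinearMap.id ℝ (TangentSpace 𝓘(ℝ, E3) y) := by
      rw [extChartAt_model_space_eq_id]
      exact mfderiv_id
    unfold coordForm
    rw [h1]
    rfl

/-- The bilinear form `2 e^{bs} ds dv + k x² ds² + dx²` at the point `p = (s, v, x)`. -/
def modelForm (b k : ℝ) (p : E3) : E3 →L[ℝ] E3 →L[ℝ] ℝ :=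
  let π : Fin 3 → E3 →L[ℝ] ℝ := fun i => ContinuousLinearMap.proj i
  Real.exp (b * p 0) • ((π 0).smulRight (π 1) + (π 1).smulRight (π 0)) + (π 2).smulRight (π 2)
    + (k * p 2 ^ 2) • (π 0).smulRight (π 0)

theorem modelForm_apply (b k : ℝ) (p a c : E3) : modelForm b k p a c =
    Real.exp (b * p 0) * (a 0 * c 1 + a 1 * c 0) + a 2 * c 2 + k * p 2 ^ 2 * (a 0 * c 0) := by
  simp [modelForm]
  ring

/-- The Lorentz metric `2 e^{bs} ds dv + k x² ds² + dx²` on `ℝ³`. -/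
def model (b k : ℝ) : LorentzMetric E3 :=
  LorentzMetric.ofForm (modelForm b k)
    (fun p v w => by rw [modelForm_apply, modelForm_apply]; ring)
    (fun p => by
      have hE : Real.exp (b * p 0) * Real.exp (-(b * p 0)) = 1 := by
        rw [← Real.exp_add]; simp
      refine ⟨![![1, Real.exp (-(b * p 0)) * (-1 / 2 - k * p 2 ^ 2 / 2), 0],
        ![1, Real.exp (-(b * p 0)) * (1 / 2 - k * p 2 ^ 2 / 2), 0], ![0, 0, 1]], fun i j => ?_⟩
      rw [modelForm_apply]
      fin_cases i <;> fin_cases j <;> simp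
      · linear_combination (-1 - k * p 2 ^ 2) * hE
      · linear_combination (- k * p 2 ^ 2) * hE
      · linear_combination (- k * p 2 ^ 2) * hE
      · linear_combination (1 - k * p 2 ^ 2) * hE)
    (fun a c => by
      simp only [modelForm_apply]
      fun_prop)

theorem brinkmann_eq_model (k : ℝ) : brinkmann k = model 0 k := by
  unfold brinkmann model LorentzMetric.ofForm
  congr 1
  funext p
  refine ContinuousLinearMap.ext fun v => ContinuousLinearMap.ext fun w => ?_
  refine (brinkmannForm_apply k p v w).trans (Eq.trans ?_ (modelForm_apply 0 k p v w).symm)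
  simp

theorem preservesMetric_iff_fderiv {g h : LorentzMetric E3} {f : E3 → E3} :
    PreservesMetric g h f ↔ ∀ y v w : E3,
      h.val (f y) (fderiv ℝ f y v) (fderiv ℝ f y w) = g.val y v w := by
  unfold PreservesMetric
  simp only [mfderiv_eq_fderiv]
  rfl

theorem fderiv_apply_eq_of_hasDerivAt {f : E3 → E3} {y v w : E3} (hf : DifferentiableAt ℝ f y)
    (h0 : HasDerivAt (fun r : ℝ => f (y + r • v) 0) (w 0) 0)
    (h1 : HasDerivAt (fun r : ℝ => f (y + r • v) 1) (w 1) 0)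
    (h2 : HasDerivAt (fun r : ℝ => f (y + r • v) 2) (w 2) 0) : fderiv ℝ f y v = w := by
  have hl : HasDerivAt (fun r : ℝ => y + r • v) v 0 := by
    simpa using ((hasDerivAt_id (0 : ℝ)).smul_const v).const_add y
  have h3 : HasFDerivAt f (fderiv ℝ f y) (y + (0 : ℝ) • v) := by
    rw [zero_smul, add_zero]; exact hf.hasFDerivAt
  refine (h3.comp_hasDerivAt (0 : ℝ) hl).unique ?_
  rw [hasDerivAt_pi]
  intro i
  fin_cases i
  · exact h0
  · exact h1
  · exact h2

/-! ### The action of the normal form on the model -/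

section act

variable {b k : ℝ}

/-- The solution of `φ'' = b φ' + k φ` attached to an element of the group. -/
def phi (a : HeisExt (nf b k)) (s : ℝ) : ℝ := a.left.log 0 * sol b k s + a.left.log 1 * sol' b k s

/-- The derivative of `phi`. -/
def phi' (a : HeisExt (nf b k)) (s : ℝ) : ℝ :=
  a.left.log 0 * sol' b k s + a.left.log 1 * (b * sol' b k s + k * sol b k s)

theorem hasDerivAt_phi (a : HeisExt (nf b k)) (s : ℝ) : HasDerivAt (phi a) (phi' a s) s :=
  ((hasDerivAt_sol b k s).const_mul _).add ((hasDerivAt_sol' b k s).const_mul _)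

theorem hasDerivAt_phi' (a : HeisExt (nf b k)) (s : ℝ) :
    HasDerivAt (phi' a) (b * phi' a s + k * phi a s) s := by
  refine (((hasDerivAt_sol' b k s).const_mul _).add ((((hasDerivAt_sol' b k s).const_mul b).add
    ((hasDerivAt_sol b k s).const_mul k)).const_mul _)).congr_deriv ?_
  unfold phi phi'
  ring

/-- The action of `G_ρ`, for `ρ` in normal form, on the model. -/
def act (a : HeisExt (nf b k)) (y : E3) : E3 :=
  ![y 0 - a.right.toAdd,
    Real.exp (b * a.right.toAdd) * y 1 - Real.exp (-(b * (y 0 - a.right.toAdd)))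
      * phi' a (y 0 - a.right.toAdd) * (y 2 + 1 / 2 * phi a (y 0 - a.right.toAdd)) - a.left.log 2,
    y 2 + phi a (y 0 - a.right.toAdd)]

theorem act_zero (a : HeisExt (nf b k)) (y : E3) : act a y 0 = y 0 - a.right.toAdd := rfl
theorem act_one' (a : HeisExt (nf b k)) (y : E3) : act a y 1 =
    Real.exp (b * a.right.toAdd) * y 1 - Real.exp (-(b * (y 0 - a.right.toAdd)))
      * phi' a (y 0 - a.right.toAdd) * (y 2 + 1 / 2 * phi a (y 0 - a.right.toAdd))
      - a.left.log 2 := rfl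
theorem act_two (a : HeisExt (nf b k)) (y : E3) :
    act a y 2 = y 2 + phi a (y 0 - a.right.toAdd) := rfl

/-- The flow `nfLie` acts on initial data by time shifts of the attached solution, and the bracket
in the product is central, so it does not contribute. -/
theorem phi_mul (a a' : HeisExt (nf b k)) (s : ℝ) :
    phi (a * a') s = phi a s + phi a' (s + a.right.toAdd) := by
  unfold phi
  rw [HeisExt.log_mul_left, nf_lie, sol_add, sol'_add]
  simp only [Pi.add_apply, Pi.smul_apply, heisBracket_zero, heisBracket_one, nfLie_zero', nfLie_one,
    smul_eq_mul]
  ring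

theorem phi'_mul (a a' : HeisExt (nf b k)) (s : ℝ) :
    phi' (a * a') s = phi' a s + phi' a' (s + a.right.toAdd) := by
  unfold phi'
  rw [HeisExt.log_mul_left, nf_lie, sol_add, sol'_add]
  simp only [Pi.add_apply, Pi.smul_apply, heisBracket_zero, heisBracket_one, nfLie_zero', nfLie_one,
    smul_eq_mul]
  ring

/-- Through Abel's identity the Wronskian of the attached solutions is, up to `-e^{bs}`, the area
form that defines the Heisenberg bracket. This is how the group law enters the action. -/
theorem phi_wronskian (a a' : HeisExt (nf b k)) (s : ℝ) :
    phi a s * phi' a' s - phi' a s * phi a' s =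
      -(Real.exp (b * s) * (a.left.log 0 * a'.left.log 1 - a.left.log 1 * a'.left.log 0)) := by
  rw [← sol_wronskian b k s]
  unfold phi phi'
  ring

/-- Only the coordinate `v` needs an argument. Composing two actions there leaves half the Wronskian
of the two solutions, rescaled by an exponential, and this is the central term of the product. -/
theorem act_mul (a a' : HeisExt (nf b k)) (y : E3) : act (a * a') y = act a (act a' y) := by
  have e0 : y 0 - (a * a').right.toAdd = y 0 - a'.right.toAdd - a.right.toAdd := by
    rw [HeisExt.toAdd_mul_right]; ring
  refine ext_E3 ?_ ?_ ?_
  · simp only [act_zero, e0]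
  · simp only [act_one', act_zero, act_two, e0, phi_mul, phi'_mul, sub_add_cancel]
    set S := y 0 - a'.right.toAdd - a.right.toAdd with hS
    have hS' : y 0 - a'.right.toAdd = S + a.right.toAdd := by rw [hS]; ring
    rw [hS']
    set t := a.right.toAdd
    set t' := a'.right.toAdd
    -- An element whose solution at `S` is that of `a'` at `S + t`, so that both solutions are
    -- evaluated at the same time in the Wronskian identity.
    let c : HeisExt (nf b k) := ⟨⟨(nf b k).lie t a'.left.log⟩, 1⟩
    have hc : phi c S = phi a' (S + t) := by
      simp only [c, phi, nf_lie, sol_add, sol'_add, nfLie_zero', nfLie_one]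
      ring
    have hc' : phi' c S = phi' a' (S + t) := by
      simp only [c, phi', nf_lie, sol_add, sol'_add, nfLie_zero', nfLie_one]
      ring
    have hw := phi_wronskian a c S
    rw [hc, hc'] at hw
    have hl : (a * a').left.log 2 = a.left.log 2 + Real.exp (b * t) * a'.left.log 2
        + 1 / 2 * (a.left.log 0 * c.left.log 1 - a.left.log 1 * c.left.log 0) := by
      rw [HeisExt.log_mul_left]
      simp only [Pi.add_apply, Pi.smul_apply, heisBracket_two, smul_eq_mul, c]
      simp only [nf_lie, nfLie_two]
      rfl
    rw [hl, HeisExt.toAdd_mul_right]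
    change Real.exp (b * (t + t')) * y 1 - _ - _ = _
    have E1 : Real.exp (b * (t + t')) = Real.exp (b * t) * Real.exp (b * t') := by
      rw [← Real.exp_add]; congr 1; ring
    have E2 : Real.exp (-(b * S)) = Real.exp (b * t) * Real.exp (-(b * (S + t))) := by
      rw [← Real.exp_add]; congr 1; ring
    have E3' : Real.exp (-(b * S)) * Real.exp (b * S) = 1 := by
      rw [← Real.exp_add]; simp
    set A := phi a S
    set A' := phi' a S
    set B := phi a' (S + t)
    set B' := phi' a' (S + t)
    rw [E1]
    have hw2 : Real.exp (-(b * S)) * (A * B' - A' * B)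
        = -(a.left.log 0 * c.left.log 1 - a.left.log 1 * c.left.log 0) := by
      rw [hw, mul_neg, ← mul_assoc, E3', one_mul]
    linear_combination (-1 / 2) * hw2 - B' * (y 2 + 1 / 2 * B) * E2
  · simp only [act_two, act_zero, e0, phi_mul, sub_add_cancel]
    ring

theorem act_one (y : E3) : act (1 : HeisExt (nf b k)) y = y := by
  have h0 : (1 : HeisExt (nf b k)).left.log = 0 := rfl
  have h1 : (1 : HeisExt (nf b k)).right.toAdd = 0 := rfl
  refine ext_E3 ?_ ?_ ?_
  · simp [act_zero]
  · rw [act_one', phi', phi, h0, h1]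
    simp
  · rw [act_two, phi, h0]
    simp

theorem act_inv_act (a : HeisExt (nf b k)) (y : E3) : act a⁻¹ (act a y) = y := by
  rw [← act_mul, inv_mul_cancel, act_one]

theorem act_act_inv (a : HeisExt (nf b k)) (y : E3) : act a (act a⁻¹ y) = y := by
  rw [← act_mul, mul_inv_cancel, act_one]

theorem contDiff_act' : ContDiff ℝ ∞
    (fun q : (ℝ × E3) × E3 => act ((HeisExt.homeo (nf b k)).symm q.1) q.2) := by
  have h1 := contDiff_sol b k
  have h2 := contDiff_sol' b k
  have h3 : ContDiff ℝ ∞ (fun q : (ℝ × E3) × E3 => q.2 0 - q.1.1) := by fun_prop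
  have h4 := h1.comp h3
  have h5 := h2.comp h3
  simp only [Function.comp_def] at h4 h5
  have e : ∀ q : (ℝ × E3) × E3, act ((HeisExt.homeo (nf b k)).symm q.1) q.2 =
      ![q.2 0 - q.1.1, Real.exp (b * q.1.1) * q.2 1 - Real.exp (-(b * (q.2 0 - q.1.1)))
        * (q.1.2 0 * sol' b k (q.2 0 - q.1.1) + q.1.2 1 * (b * sol' b k (q.2 0 - q.1.1)
          + k * sol b k (q.2 0 - q.1.1)))
        * (q.2 2 + 1 / 2 * (q.1.2 0 * sol b k (q.2 0 - q.1.1)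
          + q.1.2 1 * sol' b k (q.2 0 - q.1.1))) - q.1.2 2,
        q.2 2 + (q.1.2 0 * sol b k (q.2 0 - q.1.1) + q.1.2 1 * sol' b k (q.2 0 - q.1.1))] :=
    fun q => rfl
  simp only [e]
  refine contDiff_pi.2 fun i => ?_
  fin_cases i
  · exact h3
  · simp only [Fin.mk_one, Matrix.cons_val_one, Matrix.cons_val_zero]
    fun_prop
  · simp only [Fin.reduceFinMk, Matrix.cons_val]
    fun_prop

theorem contDiff_act (a : HeisExt (nf b k)) : ContDiff ℝ ∞ (act a) :=
  contDiff_act'.comp (f := fun y : E3 => ((HeisExt.homeo (nf b k) a, y) : (ℝ × E3) × E3))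
    (contDiff_const.prodMk contDiff_id)

theorem fderiv_act (a : HeisExt (nf b k)) (y v : E3) : fderiv ℝ (act a) y v =
    ![v 0, Real.exp (b * a.right.toAdd) * v 1
      - Real.exp (-(b * (y 0 - a.right.toAdd))) * (k * phi a (y 0 - a.right.toAdd)
        * (y 2 + 1 / 2 * phi a (y 0 - a.right.toAdd)) + 1 / 2 * phi' a (y 0 - a.right.toAdd) ^ 2) * v 0
      - Real.exp (-(b * (y 0 - a.right.toAdd))) * phi' a (y 0 - a.right.toAdd) * v 2,
      v 2 + phi' a (y 0 - a.right.toAdd) * v 0] := by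
  set t := a.right.toAdd with ht
  have hl : ∀ i : Fin 3, HasDerivAt (fun r : ℝ => (y + r • v) i) (v i) 0 := by
    intro i
    simpa using ((hasDerivAt_id (0 : ℝ)).mul_const (v i)).const_add (y i)
  have hs : HasDerivAt (fun r : ℝ => (y + r • v) 0 - t) (v 0) 0 := (hl 0).sub_const t
  have hp : HasDerivAt (fun r : ℝ => phi a ((y + r • v) 0 - t)) (phi' a (y 0 - t) * v 0) 0 := by
    have := (hasDerivAt_phi a ((y + (0 : ℝ) • v) 0 - t)).comp (0 : ℝ) hs
    simpa [Function.comp_def] using this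
  have hp' : HasDerivAt (fun r : ℝ => phi' a ((y + r • v) 0 - t))
      ((b * phi' a (y 0 - t) + k * phi a (y 0 - t)) * v 0) 0 := by
    have := (hasDerivAt_phi' a ((y + (0 : ℝ) • v) 0 - t)).comp (0 : ℝ) hs
    simpa [Function.comp_def] using this
  have hE : HasDerivAt (fun r : ℝ => Real.exp (-(b * ((y + r • v) 0 - t))))
      (Real.exp (-(b * (y 0 - t))) * -(b * v 0)) 0 := by
    have := ((hs.const_mul b).neg).exp
    simpa using this
  refine fderiv_apply_eq_of_hasDerivAt
    ((contDiff_act a).differentiable (by simp)).differentiableAt ?_ ?_ ?_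
  · exact hs
  · simp only [act_one', ← ht]
    refine ((((hl 1).const_mul _).sub ((hE.mul hp').mul ((hl 2).add (hp.const_mul (1 / 2))))).sub_const
      _).congr_deriv ?_
    simp
    ring
  · simp only [act_two, ← ht]
    exact (hl 2).add hp

/-- The action on the model is isometric. -/
theorem modelForm_act (a : HeisExt (nf b k)) (y v w : E3) :
    modelForm b k (act a y) (fderiv ℝ (act a) y v) (fderiv ℝ (act a) y w) = modelForm b k y v w := by
  rw [fderiv_act, fderiv_act, modelForm_apply, modelForm_apply, act_zero, act_two]
  set S := y 0 - a.right.toAdd with hS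
  set t := a.right.toAdd
  have hy : y 0 = S + t := by rw [hS]; ring
  have E1 : Real.exp (b * y 0) = Real.exp (b * S) * Real.exp (b * t) := by
    rw [hy, ← Real.exp_add]; congr 1; ring
  have E2 : Real.exp (b * S) * Real.exp (-(b * S)) = 1 := by
    rw [← Real.exp_add]; simp
  rw [E1]
  simp only [Matrix.cons_val_zero, Matrix.cons_val_one, Matrix.cons_val]
  set A := phi a S
  set A' := phi' a S
  linear_combination (-(2 * (k * A * (y 2 + 1 / 2 * A) + 1 / 2 * A' ^ 2) * v 0 * w 0)
    - A' * (v 0 * w 2 + v 2 * w 0)) * E2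

/-- The element of the group that maps the origin to a given point. -/
def translationTo (b k : ℝ) (y : E3) : HeisExt (nf b k) :=
  SemidirectProduct.inr (Multiplicative.ofAdd (-y 0)) *
    SemidirectProduct.inl ⟨![0, y 2, -(Real.exp (b * y 0) * y 1) - 1 / 2 * b * y 2 ^ 2]⟩

theorem act_translationTo (y : E3) : act (translationTo b k y) 0 = y := by
  rw [translationTo, act_mul]
  have E : Real.exp (-(b * y 0)) * Real.exp (b * y 0) = 1 := by
    rw [← Real.exp_add]; simp
  refine ext_E3 ?_ ?_ ?_
  · simp [act]
  · simp [act, phi, phi', sol_zero, sol'_zero, Heis.one_log]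
    linear_combination y 1 * E
  · simp [act, phi, sol_zero, sol'_zero, Heis.one_log]

/-- The stabilizer of the origin. -/
theorem act_zero_eq_zero {a : HeisExt (nf b k)} (h : act a 0 = 0) :
    a = SemidirectProduct.inl (Heis.oneParam ![1, 0, 0] (Multiplicative.ofAdd (a.left.log 0))) := by
  have h0 := congrFun h 0
  have h1 := congrFun h 1
  have h2 := congrFun h 2
  rw [act_zero] at h0
  have ht : a.right.toAdd = 0 := by simpa using h0
  rw [act_two, ht] at h2
  simp [phi, sol_zero, sol'_zero] at h2
  rw [act_one', ht] at h1
  simp [phi, sol_zero, sol'_zero, h2] at h1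
  refine HeisExt.ext_coords ?_ ?_
  · refine ext_E3 ?_ ?_ ?_
    · simp [Heis.oneParam]
    · simp [Heis.oneParam, h2]
    · simp [Heis.oneParam, h1]
  · simpa using ht

theorem act_oneParam (p : ℝ) (y : E3) :
    act (b := b) (k := k) (SemidirectProduct.inl (Heis.oneParam ![1, 0, 0] (Multiplicative.ofAdd p))) y
      = ![y 0, y 1 - Real.exp (-(b * y 0)) * (p * sol' b k (y 0)) * (y 2 + 1 / 2 * (p * sol b k (y 0))),
        y 2 + p * sol b k (y 0)] := by
  refine ext_E3 ?_ ?_ ?_ <;> simp [act, phi, phi', Heis.oneParam]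

theorem contMDiff_translationTo :
    ContMDiff 𝓘(ℝ, E3) 𝓘(ℝ, ℝ × E3) ∞ (translationTo b k) := by
  have h1 := contDiff_sol b k
  have h2 := contDiff_sol' b k
  refine ContMDiff.mul (n := ∞) ?_ ?_
  · have : ContDiff ℝ ∞ (fun y : E3 => ((-y 0, 0) : ℝ × E3)) := by fun_prop
    exact (HeisExt.contMDiff_homeo_symm (nf b k)).comp this.contMDiff
  · have : ContDiff ℝ ∞ (fun y : E3 => ((0,
        ![0, y 2, -(Real.exp (b * y 0) * y 1) - 1 / 2 * b * y 2 ^ 2]) : ℝ × E3)) := by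
      refine contDiff_const.prodMk (contDiff_pi.2 fun i => ?_)
      fin_cases i <;> simp <;> fun_prop
    exact (HeisExt.contMDiff_homeo_symm (nf b k)).comp this.contMDiff

end act

end PlaneWave
end

noncomputable section
namespace PlaneWave

/-! ### Pulling back metrics -/

/-- A symmetric bilinear form of signature `(-, +, +)` has negative Gram determinants and no
kernel. -/
theorem det_gram_neg {q : E3 →L[ℝ] E3 →L[ℝ] ℝ}
    (hq : ∃ e : Fin 3 → E3, ∀ i j, q (e i) (e j) = if i = j then (if i = 0 then -1 else 1) else 0) :
    (Matrix.of fun i j : Fin 3 => q (Pi.single i 1) (Pi.single j 1)).det < 0 := by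
  obtain ⟨e, he⟩ := hq
  set G : Matrix (Fin 3) (Fin 3) ℝ := Matrix.of fun i j => q (Pi.single i 1) (Pi.single j 1) with hG
  set P : Matrix (Fin 3) (Fin 3) ℝ := Matrix.of fun i j => e i j with hP
  have hsum : ∀ x : E3, x = ∑ i, x i • (Pi.single i 1 : E3) := by
    intro x
    ext j
    simp [Finset.sum_apply, Pi.single_apply]
  -- Taking determinants gives `det(P)² det(G) = -1`, which fixes the sign of `det G`.
  have key : P * G * P.transpose = Matrix.diagonal ![-1, 1, 1] := by
    ext i j
    have h1 : (P * G * P.transpose) i j = q (e i) (e j) := by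
      conv_rhs => rw [hsum (e i), hsum (e j)]
      simp only [map_sum, map_smul, sum_apply, smul_apply,
        smul_eq_mul, Matrix.mul_apply, Matrix.transpose_apply, hP, hG, Matrix.of_apply,
        Finset.sum_mul, Finset.mul_sum]
      refine Finset.sum_congr rfl fun x _ => Finset.sum_congr rfl fun y _ => ?_
      ring
    rw [h1, he]
    fin_cases i <;> fin_cases j <;> simp
  have hdet := congrArg Matrix.det key
  rw [Matrix.det_mul, Matrix.det_mul, Matrix.det_transpose, Matrix.det_diagonal] at hdet
  simp [Fin.prod_univ_three] at hdet
  by_contra! h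
  nlinarith [mul_nonneg h (mul_self_nonneg P.det)]

section Pullback

variable {M : Type*} [TopologicalSpace M] [ChartedSpace E3 M] [IsManifold 𝓘(ℝ, E3) ∞ M]

/-- Smoothness of the metric is known only on constant vectors, so the moving vectors are expanded
in the standard basis. -/
theorem contDiffOn_form {q : E3 → E3 →L[ℝ] E3 →L[ℝ] ℝ} (hq : ∀ a b, ContDiff ℝ ∞ fun y => q y a b)
    {U : Set E3} {u v w : E3 → E3} (hu : ContDiffOn ℝ ∞ u U) (hv : ContDiffOn ℝ ∞ v U)
    (hw : ContDiffOn ℝ ∞ w U) : ContDiffOn ℝ ∞ (fun y => q (u y) (v y) (w y)) U := by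
  have hsum : ∀ x : E3, x = ∑ i, x i • (Pi.single i 1 : E3) := by
    intro x
    ext j
    simp [Finset.sum_apply, Pi.single_apply]
  have e : ∀ y, q (u y) (v y) (w y)
      = ∑ i, ∑ j, v y i * (w y j * q (u y) (Pi.single i 1) (Pi.single j 1)) := by
    intro y
    conv_lhs => rw [hsum (v y), hsum (w y)]
    simp only [map_sum, map_smul, sum_apply, smul_apply,
      smul_eq_mul, Finset.mul_sum]
    rw [Finset.sum_comm]
    refine Finset.sum_congr rfl fun x _ => Finset.sum_congr rfl fun z _ => ?_
    ring
  simp only [e]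
  refine ContDiffOn.sum fun i _ => ContDiffOn.sum fun j _ => ?_
  exact (contDiffOn_pi.1 hv i).mul ((contDiffOn_pi.1 hw j).mul ((hq _ _).comp_contDiffOn hu))

/-- Allows rewriting of the base point, on which the type of the tangent vectors depends. -/
theorem LorentzMetric.val_congr (g : LorentzMetric M) {z z' : M} (h : z = z') {v v' w w' : E3}
    (hv : v = v') (hw : w = w') : (g.val z : E3 →L[ℝ] E3 →L[ℝ] ℝ) v w
      = (g.val z' : E3 →L[ℝ] E3 →L[ℝ] ℝ) v' w' := by
  subst h hv hw
  rfl

/-- The pull back of a metric of `ℝ³` by a diffeomorphism. -/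
def pullbackMetric (F : M ≃ₘ⟮𝓘(ℝ, E3), 𝓘(ℝ, E3)⟯ E3) (h : LorentzMetric E3) : LorentzMetric M where
  val x := ContinuousLinearMap.bilinearComp (E := E3) (F := E3) (E' := E3) (F' := E3)
    (h.val (F x)) (mfderiv 𝓘(ℝ, E3) 𝓘(ℝ, E3) F x) (mfderiv 𝓘(ℝ, E3) 𝓘(ℝ, E3) F x)
  symm x v w := h.symm _ _ _
  signature x := by
    obtain ⟨e, he⟩ := h.signature (F x)
    have hinv : ∀ v : TangentSpace 𝓘(ℝ, E3) (F x), ∃ w : TangentSpace 𝓘(ℝ, E3) x,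
        mfderiv 𝓘(ℝ, E3) 𝓘(ℝ, E3) F x w = v := by
      intro v
      have h1 := mfderiv_symm_right F (F x) v
      have h2 : ∀ z, z = x → ∀ w : E3, (mfderiv 𝓘(ℝ, E3) 𝓘(ℝ, E3) F z w : E3)
          = mfderiv 𝓘(ℝ, E3) 𝓘(ℝ, E3) F x w := by rintro z rfl w; rfl
      exact ⟨_, (h2 _ (F.symm_apply_apply x) _).symm.trans h1⟩
    choose e' he' using fun i => hinv (e i)
    refine ⟨e', fun i j => ?_⟩
    change h.val (F x) (mfderiv 𝓘(ℝ, E3) 𝓘(ℝ, E3) F x (e' i))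
      (mfderiv 𝓘(ℝ, E3) 𝓘(ℝ, E3) F x (e' j)) = _
    rw [he', he', he]
  smooth x₀ a b := by
    have hq : ∀ a b : E3, ContDiff ℝ ∞ fun y : E3 => (h.val y : E3 →L[ℝ] E3 →L[ℝ] ℝ) a b := by
      intro a b
      have h1 := h.smooth 0 a b
      have ht : (extChartAt 𝓘(ℝ, E3) (0 : E3)).target = Set.univ := by
        rw [extChartAt_model_space_eq_id]; rfl
      rw [ht, contDiffOn_univ] at h1
      convert! h1 using 2 with y
      unfold coordForm
      have h2 : mfderiv 𝓘(ℝ, E3) 𝓘(ℝ, E3) (extChartAt 𝓘(ℝ, E3) (0 : E3)).symm y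
          = ContinuousLinearMap.id ℝ (TangentSpace 𝓘(ℝ, E3) y) := by
        rw [extChartAt_model_space_eq_id]
        exact mfderiv_id
      rw [h2]
      rfl
    set χ := extChartAt 𝓘(ℝ, E3) x₀
    have hopen : IsOpen χ.target := isOpen_extChartAt_target x₀
    have hχ : ContMDiffOn 𝓘(ℝ, E3) 𝓘(ℝ, E3) ∞ χ.symm χ.target := contMDiffOn_extChartAt_symm x₀
    have hu : ContDiffOn ℝ ∞ (F ∘ χ.symm) χ.target := by
      rw [← contMDiffOn_iff_contDiffOn]
      exact F.contMDiff.comp_contMDiffOn hχ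
    have hd : ∀ v : E3, ContDiffOn ℝ ∞ (fun y => fderiv ℝ (F ∘ χ.symm) y v) χ.target := fun v =>
      (hu.fderiv_of_isOpen hopen (by simp)).clm_apply contDiffOn_const
    refine (contDiffOn_form hq hu (hd a) (hd b)).congr fun y hy => ?_
    have hc : mfderiv 𝓘(ℝ, E3) 𝓘(ℝ, E3) (F ∘ χ.symm) y = (mfderiv 𝓘(ℝ, E3) 𝓘(ℝ, E3) F (χ.symm y)).comp
        (mfderiv 𝓘(ℝ, E3) 𝓘(ℝ, E3) χ.symm y) :=
      mfderiv_comp y (F.mdifferentiable (by simp) _)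
        ((hχ.contMDiffAt (hopen.mem_nhds hy)).mdifferentiableAt (by simp))
    rw [mfderiv_eq_fderiv] at hc
    rw [hc]
    rfl

end Pullback

/-! ### The identification of `P_ρ` with the model -/

namespace NormalForm

variable {ρ : HeisRep} {W : NonCentral} (n : NormalForm ρ W)

theorem _root_.PlaneWave.contMDiff_act {M : Type*} [TopologicalSpace M] {E : Type*} [NormedAddCommGroup E]
    [NormedSpace ℝ E] [ChartedSpace E M] {b k : ℝ} {α : M → HeisExt (nf b k)} {β : M → E3}
    (hα : ContMDiff 𝓘(ℝ, E) 𝓘(ℝ, ℝ × E3) ∞ α) (hβ : ContMDiff 𝓘(ℝ, E) 𝓘(ℝ, E3) ∞ β) :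
    ContMDiff 𝓘(ℝ, E) 𝓘(ℝ, E3) ∞ (fun m => act (α m) (β m)) := by
  exact (contDiff_act' (b := b) (k := k)).contMDiff.comp
    (((HeisExt.contMDiff_homeo (nf b k)).comp hα).prodMk_space hβ)

/-- The diffeomorphism of `P_ρ` with `ℝ³` given by the orbit map of the origin. -/
def real : PSpace ρ W ≃ₘ⟮𝓘(ℝ, E3), 𝓘(ℝ, E3)⟯ E3 where
  toFun := Quotient.lift (fun a : HeisExt ρ => act (n.iso.symm a) 0) (by
    intro a a' h
    obtain ⟨s, hs⟩ := QuotientGroup.leftRel_apply.1 h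
    have ha : a' = a * SemidirectProduct.inl (Heis.oneParam W.1 s) := by
      rw [← MonoidHom.comp_apply, hs]
      simp
    change act (n.iso.symm a) 0 = act (n.iso.symm a') 0
    rw [ha, map_mul, ← n.iso_oneParam, MulEquiv.symm_apply_apply, act_mul]
    congr 1
    have := act_oneParam (b := n.b) (k := n.k) s.toAdd 0
    rw [ofAdd_toAdd] at this
    rw [this]
    refine ext_E3 ?_ ?_ ?_ <;> simp [sol_zero])
  invFun y := QuotientGroup.mk (n.iso (translationTo n.b n.k y))
  left_inv x := by
    induction x using QuotientGroup.induction_on with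
    | H a =>
      change QuotientGroup.mk (n.iso (translationTo n.b n.k (act (n.iso.symm a) 0))) = QuotientGroup.mk a
      set y := act (n.iso.symm a) 0 with hy
      have h1 : act ((translationTo n.b n.k y)⁻¹ * n.iso.symm a) 0 = 0 := by
        rw [act_mul, ← hy]
        nth_rewrite 2 [← act_translationTo (b := n.b) (k := n.k) y]
        rw [act_inv_act]
      have h2 := act_zero_eq_zero h1
      refine QuotientGroup.eq.2 ⟨Multiplicative.ofAdd
        (((translationTo n.b n.k y)⁻¹ * n.iso.symm a).left.log 0), ?_⟩
      have h3 := congrArg n.iso h2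
      rw [n.iso_oneParam, map_mul, map_inv, MulEquiv.apply_symm_apply] at h3
      exact h3.symm
  right_inv y := by
    change act (n.iso.symm (n.iso (translationTo n.b n.k y))) 0 = y
    rw [MulEquiv.symm_apply_apply, act_translationTo]
  contMDiff_toFun := by
    obtain ⟨σ, hσ, hσ'⟩ := PSpace.exists_smooth_section ρ W
    have h1 : ContMDiff 𝓘(ℝ, E3) 𝓘(ℝ, E3) ∞ (fun x => act (n.iso.symm (σ x)) 0) :=
      contMDiff_act (n.isLieIso_iso.2.comp hσ) contMDiff_const
    convert! h1 using 1
    funext x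
    conv_lhs => rw [← hσ' x]
    rfl
  contMDiff_invFun := (PSpace.contMDiff_mk ρ W).comp (n.isLieIso_iso.1.comp contMDiff_translationTo)

theorem real_mk (a : HeisExt ρ) : n.real (QuotientGroup.mk a) = act (n.iso.symm a) 0 := rfl

theorem real_smul (a : HeisExt ρ) (x : PSpace ρ W) :
    n.real (a • x) = act (n.iso.symm a) (n.real x) := by
  induction x using QuotientGroup.induction_on with
  | H a' =>
    change act (n.iso.symm (a * a')) 0 = act (n.iso.symm a) (act (n.iso.symm a') 0)
    rw [map_mul, act_mul]

theorem real_symm_act (a : HeisExt (nf n.b n.k)) (y : E3) :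
    n.real.symm (act a y) = n.iso a • n.real.symm y := by
  apply n.real.toEquiv.injective
  change n.real _ = n.real _
  rw [n.real_smul, n.real.apply_symm_apply, n.real.apply_symm_apply, MulEquiv.symm_apply_apply]

theorem contMDiff_smul (n : NormalForm ρ W) (a : HeisExt ρ) :
    ContMDiff 𝓘(ℝ, E3) 𝓘(ℝ, E3) ∞ (fun x : PSpace ρ W => a • x) := by
  have h : (fun x : PSpace ρ W => a • x) = fun x => n.real.symm (act (n.iso.symm a) (n.real x)) := by
    funext x
    rw [← n.real_smul, n.real.symm_apply_apply]
  rw [h]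
  exact n.real.symm.contMDiff.comp (contMDiff_act contMDiff_const n.real.contMDiff)

/-- An isometric action on the model gives an invariant metric. -/
theorem exists_invariant (n : NormalForm ρ W) : ∃ g : LorentzMetric (PSpace ρ W), IsInvariant g := by
  refine ⟨pullbackMetric n.real (model n.b n.k), fun a => ?_⟩
  intro x v w
  have hm := (n.contMDiff_smul a).mdifferentiable (by simp)
  have e : n.real ∘ (fun x : PSpace ρ W => a • x) = act (n.iso.symm a) ∘ n.real :=
    funext fun x => n.real_smul a x
  have d1 := mfderiv_comp (I := 𝓘(ℝ, E3)) (I' := 𝓘(ℝ, E3)) (I'' := 𝓘(ℝ, E3)) x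
    (n.real.mdifferentiable (by simp) (a • x)) (hm x)
  have d2 := mfderiv_comp (I := 𝓘(ℝ, E3)) (I' := 𝓘(ℝ, E3)) (I'' := 𝓘(ℝ, E3)) x
    (((contDiff_act (n.iso.symm a)).contMDiff).mdifferentiable (by simp) (n.real x))
    (n.real.mdifferentiable (by simp) x)
  rw [e, d2] at d1
  have key : ∀ v : TangentSpace 𝓘(ℝ, E3) x, (mfderiv 𝓘(ℝ, E3) 𝓘(ℝ, E3) n.real (a • x)
      (mfderiv 𝓘(ℝ, E3) 𝓘(ℝ, E3) (fun x : PSpace ρ W => a • x) x v) : E3)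
      = fderiv ℝ (act (n.iso.symm a)) (n.real x) (mfderiv 𝓘(ℝ, E3) 𝓘(ℝ, E3) n.real x v : E3) := by
    intro v
    have := congrArg (fun T => (T v : E3)) d1
    rw [mfderiv_eq_fderiv] at this
    exact this.symm
  exact ((model n.b n.k).val_congr (n.real_smul a x) (key v) (key w)).trans
    (modelForm_act (n.iso.symm a) (n.real x) _ _)

/-! ### Classification of the invariant metrics -/

/-- A form that is invariant under the isotropy at the origin. -/
theorem isotropy_invariant_form {b k : ℝ} {q : E3 →L[ℝ] E3 →L[ℝ] ℝ} (hs : ∀ v w, q v w = q w v)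
    (hq : ∀ (p : ℝ) (v w : E3), q ![v 0, v 1 - p * v 2 - 1 / 2 * p ^ 2 * v 0, v 2 + p * v 0]
      ![w 0, w 1 - p * w 2 - 1 / 2 * p ^ 2 * w 0, w 2 + p * w 0] = q v w) :
    ∃ c f : ℝ, ∀ v w, q v w = c * modelForm b k 0 v w + f * (v 0 * w 0) := by
  have hexp : ∀ v w : E3, q v w = v 0 * w 0 * q ![1, 0, 0] ![1, 0, 0]
      + (v 0 * w 1 + v 1 * w 0) * q ![1, 0, 0] ![0, 1, 0]
      + (v 0 * w 2 + v 2 * w 0) * q ![1, 0, 0] ![0, 0, 1]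
      + v 1 * w 1 * q ![0, 1, 0] ![0, 1, 0]
      + (v 1 * w 2 + v 2 * w 1) * q ![0, 1, 0] ![0, 0, 1]
      + v 2 * w 2 * q ![0, 0, 1] ![0, 0, 1] := by
    intro v w
    conv_lhs => rw [E3_eq_sum v, E3_eq_sum w]
    simp only [map_add, map_smul, add_apply, smul_apply,
      smul_eq_mul]
    rw [hs ![0, 1, 0] ![1, 0, 0], hs ![0, 0, 1] ![1, 0, 0], hs ![0, 0, 1] ![0, 1, 0]]
    ring
  set A := q ![1, 0, 0] ![1, 0, 0]
  set B := q ![1, 0, 0] ![0, 1, 0]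
  set C := q ![1, 0, 0] ![0, 0, 1]
  set D := q ![0, 1, 0] ![0, 1, 0]
  set E := q ![0, 1, 0] ![0, 0, 1]
  set G := q ![0, 0, 1] ![0, 0, 1]
  have h : ∀ (p : ℝ) (v w : E3), _ := fun p v w => by
    have := hq p v w
    rw [hexp, hexp v w] at this
    exact this
  simp only [Matrix.cons_val_zero, Matrix.cons_val_one, Matrix.cons_val] at h
  -- The isotropy element with parameter `1` already suffices. It kills the coefficients `vv`, `vx`
  -- and `sx` and equates `xx` with `sv`, while the coefficient of `ds²` stays free.
  have h1 := h 1 ![0, 0, 1] ![0, 1, 0]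
  have h2 := h 1 ![1, 0, 0] ![0, 1, 0]
  have h3 := h 1 ![1, 0, 0] ![0, 0, 1]
  have h4 := h 1 ![1, 0, 0] ![1, 0, 0]
  simp at h1 h2 h3 h4
  have hE : E = 0 := by linarith
  have hG : G = B := by linarith
  have hC : C = 0 := by linarith
  refine ⟨B, A, fun v w => ?_⟩
  rw [hexp, modelForm_apply, h1, hE, hG, hC]
  simp
  ring

/-- The invariant metrics on `P_ρ`. -/
theorem exists_eq_of_isInvariant {g : LorentzMetric (PSpace ρ W)} (hg : IsInvariant g) :
    ∃ c f : ℝ, 0 < c ∧ ∀ (x : PSpace ρ W) (v w : TangentSpace 𝓘(ℝ, E3) x),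
      g.val x v w = c * modelForm n.b n.k (n.real x) (mfderiv 𝓘(ℝ, E3) 𝓘(ℝ, E3) n.real x v)
        (mfderiv 𝓘(ℝ, E3) 𝓘(ℝ, E3) n.real x w)
        + f * ((mfderiv 𝓘(ℝ, E3) 𝓘(ℝ, E3) n.real x v : E3) 0
          * (mfderiv 𝓘(ℝ, E3) 𝓘(ℝ, E3) n.real x w : E3) 0) := by
  let R : E3 → PSpace ρ W := n.real.symm
  let D : (y : E3) → E3 →L[ℝ] E3 := fun y => mfderiv 𝓘(ℝ, E3) 𝓘(ℝ, E3) n.real.symm y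
  let q : E3 → E3 →L[ℝ] E3 →L[ℝ] ℝ := fun y =>
    ContinuousLinearMap.bilinearComp (E := E3) (F := E3) (g.val (R y)) (D y) (D y)
  have hq : ∀ y v w, q y v w = g.val (R y) (D y v) (D y w) := fun y v w => rfl
  have hinv : ∀ (a : HeisExt (nf n.b n.k)) (y v w : E3),
      q (act a y) (fderiv ℝ (act a) y v) (fderiv ℝ (act a) y w) = q y v w := by
    intro a y v w
    have e : R ∘ act a = (fun x : PSpace ρ W => n.iso a • x) ∘ R :=
      funext fun y => n.real_symm_act a y
    have d1 := mfderiv_comp (I := 𝓘(ℝ, E3)) (I' := 𝓘(ℝ, E3)) (I'' := 𝓘(ℝ, E3)) y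
      (n.real.symm.mdifferentiable (by simp) (act a y))
      ((contDiff_act a).contMDiff.mdifferentiable (by simp) y)
    have d2 := mfderiv_comp (I := 𝓘(ℝ, E3)) (I' := 𝓘(ℝ, E3)) (I'' := 𝓘(ℝ, E3)) y
      ((n.contMDiff_smul (n.iso a)).mdifferentiable (by simp) (R y))
      (n.real.symm.mdifferentiable (by simp) y)
    have e' : n.real.symm ∘ act a = (fun x : PSpace ρ W => n.iso a • x) ∘ n.real.symm := e
    rw [e', d2, mfderiv_eq_fderiv] at d1
    have key : ∀ v : E3, D (act a y) (fderiv ℝ (act a) y v)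
        = mfderiv 𝓘(ℝ, E3) 𝓘(ℝ, E3) (fun x : PSpace ρ W => n.iso a • x) (R y) (D y v) := fun v =>
      (congrArg (fun T => (T v : E3)) d1).symm
    exact (g.val_congr (n.real_symm_act a y) (key v) (key w)).trans
      (hg (n.iso a) (R y) (D y v) (D y w))
  obtain ⟨c, f, hcf⟩ := isotropy_invariant_form (b := n.b) (k := n.k) (q := q 0)
    (fun v w => g.symm _ _ _) (fun p v w => by
      have h := hinv (SemidirectProduct.inl (Heis.oneParam ![1, 0, 0] (Multiplicative.ofAdd p))) 0 v w
      have h0 : act (b := n.b) (k := n.k) (SemidirectProduct.inl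
          (Heis.oneParam ![1, 0, 0] (Multiplicative.ofAdd p))) 0 = 0 := by
        rw [act_oneParam]
        refine ext_E3 ?_ ?_ ?_ <;> simp [sol_zero]
      rw [h0] at h
      rw [← h]
      have h1 : ∀ v : E3, fderiv ℝ (act (b := n.b) (k := n.k) (SemidirectProduct.inl
          (Heis.oneParam ![1, 0, 0] (Multiplicative.ofAdd p)))) 0 v
          = ![v 0, v 1 - p * v 2 - 1 / 2 * p ^ 2 * v 0, v 2 + p * v 0] := by
        intro v
        rw [fderiv_act]
        refine ext_E3 ?_ ?_ ?_
        · simp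
        · simp [phi, phi', sol_zero, sol'_zero, Heis.oneParam]
          ring
        · simp [phi', sol_zero, sol'_zero, Heis.oneParam]
      rw [h1, h1])
  -- The model form and `ds²` are both invariant under the transitive action, so the identity
  -- propagates from the origin with the same constants.
  have hform : ∀ y v w : E3, q y v w = c * modelForm n.b n.k y v w + f * (v 0 * w 0) := by
    intro y v w
    obtain ⟨a, ha⟩ : ∃ a : HeisExt (nf n.b n.k), act a y = 0 :=
      ⟨(translationTo n.b n.k y)⁻¹, by
        nth_rewrite 2 [← act_translationTo (b := n.b) (k := n.k) y]
        rw [act_inv_act]⟩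
    rw [← hinv a, ← modelForm_act a, ha, hcf, fderiv_act, fderiv_act]
    simp
  refine ⟨c, f, ?_, fun x v w => ?_⟩
  · have hsig : ∃ e : Fin 3 → E3, ∀ i j, q 0 (e i) (e j) =
        if i = j then (if i = 0 then -1 else 1) else 0 := by
      obtain ⟨e, he⟩ := g.signature (R 0)
      have h1 : ∀ v : E3, ∃ w : E3, D 0 w = v := by
        intro v
        have := mfderiv_symm_left n.real (R 0) v
        have e2 : ∀ z : E3, z = 0 → ∀ v : E3, (mfderiv 𝓘(ℝ, E3) 𝓘(ℝ, E3) n.real.symm z v : E3)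
          = D 0 v := by rintro z rfl v; rfl
        exact ⟨_, (e2 _ (n.real.apply_symm_apply 0) _).symm.trans this⟩
      choose e' he' using fun i => h1 (e i)
      refine ⟨e', fun i j => ?_⟩
      rw [hq, he', he', he]
    -- At the origin the Gram determinant is `-c³`; the signature makes it negative.
    have hdet := det_gram_neg hsig
    rw [Matrix.det_fin_three] at hdet
    simp only [Matrix.of_apply, hform, modelForm_apply] at hdet
    simp at hdet
    have : 0 < c * c * c := by linarith
    by_contra! hc
    nlinarith [mul_nonneg (mul_self_nonneg c) (neg_nonneg.2 hc)]
  · have h1 := hform (n.real x) (mfderiv 𝓘(ℝ, E3) 𝓘(ℝ, E3) n.real x v)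
      (mfderiv 𝓘(ℝ, E3) 𝓘(ℝ, E3) n.real x w)
    refine Eq.trans ?_ h1
    exact (g.val_congr (n.real.symm_apply_apply x) (mfderiv_symm_left n.real x v)
      (mfderiv_symm_left n.real x w)).symm

end NormalForm

end PlaneWave
end

noncomputable section
namespace PlaneWave

/-! ### Diffeomorphisms that are equivariant under an automorphism -/

/-- The primitive of `s ↦ exp (-b s)` that vanishes at the origin. -/
def expInt (b s : ℝ) : ℝ := ∫ r in (0 : ℝ)..s, Real.exp (-(b * r))

theorem hasDerivAt_expInt (b s : ℝ) : HasDerivAt (expInt b) (Real.exp (-(b * s))) s :=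
  ((by fun_prop : Continuous fun r : ℝ => Real.exp (-(b * r))).integral_hasStrictDerivAt 0 s).hasDerivAt

theorem contDiff_expInt (b : ℝ) : ContDiff ℝ ∞ (expInt b) :=
  contDiff_of_hasDerivAt (hasDerivAt_expInt b) (by fun_prop)

theorem expInt_zero (b : ℝ) : expInt b 0 = 0 := by simp [expInt]

theorem expInt_add (b s t : ℝ) : expInt b (s + t) = expInt b t + Real.exp (-(b * t)) * expInt b s := by
  have hd : ∀ s, HasDerivAt (fun s => expInt b (s + t) - (expInt b t + Real.exp (-(b * t)) * expInt b s))
      0 s := by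
    intro s
    refine ((hasDerivAt_expInt b (s + t)).comp_add_const s t |>.sub
      (((hasDerivAt_expInt b s).const_mul _).const_add _)).congr_deriv ?_
    rw [← Real.exp_add, sub_eq_zero]
    congr 1
    ring
  have h := is_const_of_deriv_eq_zero (fun s => (hd s).differentiableAt) (fun s => (hd s).deriv) s 0
  simp only [zero_add, expInt_zero, mul_zero, add_zero, sub_self] at h
  linarith

/-- A diffeomorphism of `ℝ³` from two inverse smooth maps. -/
def diffeoOfInverse (f g : E3 → E3) (hf : ContDiff ℝ ∞ f) (hg : ContDiff ℝ ∞ g)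
    (hl : ∀ y, g (f y) = y) (hr : ∀ y, f (g y) = y) : E3 ≃ₘ⟮𝓘(ℝ, E3), 𝓘(ℝ, E3)⟯ E3 where
  toFun := f
  invFun := g
  left_inv := hl
  right_inv := hr
  contMDiff_toFun := hf.contMDiff
  contMDiff_invFun := hg.contMDiff

theorem contDiff_of_components {F : Type*} [NormedAddCommGroup F] [NormedSpace ℝ F] {f₀ f₁ f₂ : F → ℝ}
    (h0 : ContDiff ℝ ∞ f₀) (h1 : ContDiff ℝ ∞ f₁) (h2 : ContDiff ℝ ∞ f₂) :
    ContDiff ℝ ∞ (fun y => ![f₀ y, f₁ y, f₂ y]) := by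
  refine contDiff_pi.2 fun i => ?_
  fin_cases i
  · exact h0
  · exact h1
  · exact h2

/-- The diffeomorphism `(s, v, x) ↦ (s, c² v + κ E(s), c x)`. -/
def rescale (b c κ : ℝ) (hc : c ≠ 0) : E3 ≃ₘ⟮𝓘(ℝ, E3), 𝓘(ℝ, E3)⟯ E3 :=
  diffeoOfInverse (fun y => ![y 0, c ^ 2 * y 1 + κ * expInt b (y 0), c * y 2])
    (fun y => ![y 0, (c ^ 2)⁻¹ * (y 1 - κ * expInt b (y 0)), c⁻¹ * y 2])
    (by
      have h : ContDiff ℝ ∞ (fun y : E3 => expInt b (y 0)) := (contDiff_expInt b).comp (by fun_prop)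
      exact contDiff_of_components (by fun_prop) (by fun_prop) (by fun_prop))
    (by
      have h : ContDiff ℝ ∞ (fun y : E3 => expInt b (y 0)) := (contDiff_expInt b).comp (by fun_prop)
      exact contDiff_of_components (by fun_prop) (by fun_prop) (by fun_prop))
    (fun y => by refine ext_E3 ?_ ?_ ?_ <;> simp [hc])
    (fun y => by refine ext_E3 ?_ ?_ ?_ <;> simp [hc])

theorem rescale_apply (b c κ : ℝ) (hc : c ≠ 0) (y : E3) :
    rescale b c κ hc y = ![y 0, c ^ 2 * y 1 + κ * expInt b (y 0), c * y 2] := rfl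

theorem rescale_origin (b c κ : ℝ) (hc : c ≠ 0) : rescale b c κ hc 0 = 0 := by
  rw [rescale_apply]
  refine ext_E3 ?_ ?_ ?_ <;> simp [expInt_zero]

theorem hasDerivAt_line (y v : E3) (i : Fin 3) : HasDerivAt (fun r : ℝ => (y + r • v) i) (v i) 0 := by
  simpa using ((hasDerivAt_id (0 : ℝ)).mul_const (v i)).const_add (y i)

theorem HasDerivAt.comp_line {f : ℝ → ℝ} {f' : ℝ} {y v : E3} {i : Fin 3} (h : HasDerivAt f f' (y i)) :
    HasDerivAt (fun r : ℝ => f ((y + r • v) i)) (f' * v i) 0 := by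
  have h' : HasDerivAt f f' ((y + (0 : ℝ) • v) i) := by simpa using h
  exact h'.comp (0 : ℝ) (hasDerivAt_line y v i)

theorem fderiv_rescale (b c κ : ℝ) (hc : c ≠ 0) (y v : E3) : fderiv ℝ (rescale b c κ hc) y v =
    ![v 0, c ^ 2 * v 1 + κ * (Real.exp (-(b * y 0)) * v 0), c * v 2] := by
  have h0 := hasDerivAt_line y v 0
  have h1 := hasDerivAt_line y v 1
  have h2 := hasDerivAt_line y v 2
  refine fderiv_apply_eq_of_hasDerivAt ((rescale b c κ hc).contMDiff.contDiff.differentiable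
    (by simp)).differentiableAt ?_ ?_ ?_
  · exact h0
  · exact (h1.const_mul _).add (HasDerivAt.comp_line (hasDerivAt_expInt b (y 0)) |>.const_mul κ)
  · exact h2.const_mul c

/-- With `s` fixed, the factors `c²` on `v` and `c` on `x` multiply the metric by `c²`. Since
`expInt` has derivative `e^{-bs}`, adding `κ E(s)` to `v` contributes exactly `2κ ds²`. -/
theorem modelForm_rescale (b k c κ : ℝ) (hc : c ≠ 0) (y v w : E3) :
    modelForm b k (rescale b c κ hc y) (fderiv ℝ (rescale b c κ hc) y v)
      (fderiv ℝ (rescale b c κ hc) y w)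
      = c ^ 2 * modelForm b k y v w + 2 * κ * (v 0 * w 0) := by
  rw [fderiv_rescale, fderiv_rescale, modelForm_apply, modelForm_apply, rescale_apply]
  have E : Real.exp (b * y 0) * Real.exp (-(b * y 0)) = 1 := by rw [← Real.exp_add]; simp
  simp only [Matrix.cons_val_zero, Matrix.cons_val_one, Matrix.cons_val]
  linear_combination 2 * κ * v 0 * w 0 * E

/-- The automorphism of the group that corresponds to `rescale`. -/
def rescaleAut (b k c κ : ℝ) (hc : c ≠ 0) : HeisExt (nf b k) ≃* HeisExt (nf b k) :=
  HeisExt.isoOf (nf b k) (nf b k)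
    (frameEquiv ![c, 0, 0] ![0, c, 0] (by simpa using hc)) (fun t => ![0, 0, -κ * expInt b (-t)]) 1
    one_ne_zero (frameEquiv_bracket _ _ _)
    (fun s t => by
      have h := expInt_add b (-t) (-s)
      rw [show -t + -s = -(s + t) by ring] at h
      have hl : ∀ z, nfLie b k s ![0, 0, z] = ![0, 0, Real.exp (b * s) * z] := fun z => by
        refine ext_E3 ?_ ?_ ?_ <;> simp [nfLie_zero', nfLie_one, nfLie_two]
      rw [one_mul, nf_lie, hl, h]
      refine ext_E3 ?_ ?_ ?_
      · simp [heisBracket]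
      · simp [heisBracket]
      · simp [heisBracket]
        ring)
    (fun t x => by
      simp only [nf_lie, frameEquiv_apply]
      refine ext_E3 ?_ ?_ ?_
      · simp [nfLie_zero', nfLie_one, heisBracket]
        ring
      · simp [nfLie_one, nfLie_zero', heisBracket]
        ring
      · simp [nfLie_two, nfLie_zero', nfLie_one, heisBracket]
        ring)

theorem isLieIso_rescaleAut (b k c κ : ℝ) (hc : c ≠ 0) : IsLieIso (rescaleAut b k c κ hc) := by
  refine HeisExt.isLieIso_isoOf _ _ _ _ _ _ _ _ _ ?_
  have h : ContDiff ℝ ∞ (fun t : ℝ => expInt b (-t)) := (contDiff_expInt b).comp (by fun_prop)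
  exact contDiff_of_components contDiff_const contDiff_const (by fun_prop)

theorem rescaleAut_log (b k c κ : ℝ) (hc : c ≠ 0) (a : HeisExt (nf b k)) :
    (rescaleAut b k c κ hc a).left.log = ![c * a.left.log 0, c * a.left.log 1,
      c ^ 2 * a.left.log 2 - κ * expInt b (-a.right.toAdd)] := by
  change frameEquiv _ _ _ a.left.log + ![0, 0, -κ * expInt b (-a.right.toAdd)]
    + (1 / 2 : ℝ) • heisBracket _ ![0, 0, -κ * expInt b (-a.right.toAdd)] = _
  rw [frameEquiv_apply]
  refine ext_E3 ?_ ?_ ?_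
  · simp [heisBracket]
    ring
  · simp [heisBracket]
    ring
  · simp [heisBracket]
    ring

theorem rescaleAut_right (b k c κ : ℝ) (hc : c ≠ 0) (a : HeisExt (nf b k)) :
    (rescaleAut b k c κ hc a).right.toAdd = a.right.toAdd := by
  change 1 * a.right.toAdd = _
  ring

theorem rescaleAut_oneParam (b k κ : ℝ) (s : Multiplicative ℝ) :
    rescaleAut b k 1 κ one_ne_zero (SemidirectProduct.inl (Heis.oneParam ![1, 0, 0] s))
      = SemidirectProduct.inl (Heis.oneParam ![1, 0, 0] s) := by
  refine HeisExt.ext_coords ?_ ?_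
  · rw [rescaleAut_log]
    refine ext_E3 ?_ ?_ ?_ <;> simp [Heis.oneParam, expInt_zero]
  · rw [rescaleAut_right]

theorem rescale_act (b k c κ : ℝ) (hc : c ≠ 0) (a : HeisExt (nf b k)) (y : E3) :
    rescale b c κ hc (act a y) = act (rescaleAut b k c κ hc a) (rescale b c κ hc y) := by
  have hp : ∀ s, phi (rescaleAut b k c κ hc a) s = c * phi a s := by
    intro s
    simp only [phi, rescaleAut_log, Matrix.cons_val_zero, Matrix.cons_val_one]
    ring
  have hp' : ∀ s, phi' (rescaleAut b k c κ hc a) s = c * phi' a s := by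
    intro s
    simp only [phi', rescaleAut_log, Matrix.cons_val_zero, Matrix.cons_val_one]
    ring
  have hE := expInt_add b (y 0) (-a.right.toAdd)
  refine ext_E3 ?_ ?_ ?_
  · rw [act_zero, rescaleAut_right]
    rfl
  · rw [act_one', hp, hp', rescaleAut_right, rescale_apply, rescale_apply, rescaleAut_log]
    simp only [Matrix.cons_val_zero, Matrix.cons_val_one, Matrix.cons_val, act_zero, act_one', act_two]
    rw [← sub_eq_add_neg] at hE
    rw [hE, mul_neg, neg_neg]
    ring
  · rw [act_two, hp, rescaleAut_right, rescale_apply, rescale_apply]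
    simp only [Matrix.cons_val_zero, Matrix.cons_val, act_two]
    ring

namespace NormalForm

variable {ρ : HeisRep} {W : NonCentral} (n : NormalForm ρ W)

theorem mfderiv_diffeo_trans {M : Type*} [TopologicalSpace M] [ChartedSpace E3 M]
    (F : M ≃ₘ⟮𝓘(ℝ, E3), 𝓘(ℝ, E3)⟯ E3) (T : E3 ≃ₘ⟮𝓘(ℝ, E3), 𝓘(ℝ, E3)⟯ E3) (x : M)
    (v : TangentSpace 𝓘(ℝ, E3) x) : (mfderiv 𝓘(ℝ, E3) 𝓘(ℝ, E3) (F.trans T) x v : E3)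
      = fderiv ℝ T (F x) (mfderiv 𝓘(ℝ, E3) 𝓘(ℝ, E3) F x v : E3) := by
  have h := mfderiv_comp (I := 𝓘(ℝ, E3)) (I' := 𝓘(ℝ, E3)) (I'' := 𝓘(ℝ, E3)) x
    (T.mdifferentiable (by simp) (F x)) (F.mdifferentiable (by simp) x)
  rw [mfderiv_eq_fderiv] at h
  exact congrArg (fun L => (L v : E3)) h

theorem val_diffeo_trans {M : Type*} [TopologicalSpace M] [ChartedSpace E3 M]
    (F : M ≃ₘ⟮𝓘(ℝ, E3), 𝓘(ℝ, E3)⟯ E3) (T : E3 ≃ₘ⟮𝓘(ℝ, E3), 𝓘(ℝ, E3)⟯ E3) (x : M)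
    (v w : TangentSpace 𝓘(ℝ, E3) x) (h : LorentzMetric E3) :
    h.val ((F.trans T) x) (mfderiv 𝓘(ℝ, E3) 𝓘(ℝ, E3) (F.trans T) x v)
      (mfderiv 𝓘(ℝ, E3) 𝓘(ℝ, E3) (F.trans T) x w)
      = (h.val (T (F x)) : E3 →L[ℝ] E3 →L[ℝ] ℝ)
        (fderiv ℝ T (F x) (mfderiv 𝓘(ℝ, E3) 𝓘(ℝ, E3) F x v : E3))
        (fderiv ℝ T (F x) (mfderiv 𝓘(ℝ, E3) 𝓘(ℝ, E3) F x w : E3)) :=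
  h.val_congr rfl (mfderiv_diffeo_trans F T x v) (mfderiv_diffeo_trans F T x w)

/-- Every invariant metric is isometric to the model, equivariantly. -/
theorem exists_isom_model {g : LorentzMetric (PSpace ρ W)} (hg : IsInvariant g) :
    ∃ (F : Isom g (model n.b n.k)) (α : HeisExt ρ ≃* HeisExt (nf n.b n.k)), IsLieIso α ∧
      ∀ a x, F.1 (a • x) = act (α a) (F.1 x) := by
  obtain ⟨c, f, hc, hgf⟩ := n.exists_eq_of_isInvariant hg
  -- The parameters `√c` and `f / 2` are those for which `rescale` pulls the model form back to `c`
  -- times itself plus `f ds²`.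
  have hc' : √c ≠ 0 := (Real.sqrt_pos.2 hc).ne'
  refine ⟨⟨n.real.trans (rescale n.b (√c) (f / 2) hc'), fun x v w => ?_⟩,
    n.iso.symm.trans (rescaleAut n.b n.k (√c) (f / 2) hc'),
    n.isLieIso_iso.symm.trans (isLieIso_rescaleAut _ _ _ _ _), fun a x => ?_⟩
  · refine (val_diffeo_trans n.real (rescale n.b (√c) (f / 2) hc') x v w (model n.b n.k)).trans ?_
    have h := modelForm_rescale n.b n.k (√c) (f / 2) hc' (n.real x)
      (mfderiv 𝓘(ℝ, E3) 𝓘(ℝ, E3) n.real x v) (mfderiv 𝓘(ℝ, E3) 𝓘(ℝ, E3) n.real x w)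
    refine Eq.trans h ?_
    rw [hgf, Real.sq_sqrt hc.le]
    ring
  · change rescale n.b (√c) (f / 2) hc' (n.real (a • x)) = _
    rw [n.real_smul, rescale_act]
    rfl

/-- Two invariant metrics agree up to scaling and an automorphism. -/
theorem equivUpToScaling (n : NormalForm ρ W) {g₁ g₂ : LorentzMetric (PSpace ρ W)}
    (h₁ : IsInvariant g₁) (h₂ : IsInvariant g₂) : EquivUpToScaling g₁ g₂ := by
  obtain ⟨c₁, f₁, hc₁, hg₁⟩ := n.exists_eq_of_isInvariant h₁
  obtain ⟨c₂, f₂, hc₂, hg₂⟩ := n.exists_eq_of_isInvariant h₂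
  -- The automorphism must fix `W`, so it cannot scale `x`. The shear with this `κ` matches the
  -- `ds²` terms once the metrics are normalized, and the ratio `c₂ / c₁` remains.
  set κ := (f₁ / c₁ - f₂ / c₂) / 2 with hκ
  set T := rescale n.b 1 κ one_ne_zero with hT
  set F := (n.real.trans T).trans n.real.symm with hF
  have hFa : ∀ x, n.real (F x) = T (n.real x) := fun x => n.real.apply_symm_apply _
  refine ⟨(n.iso.symm.trans (rescaleAut n.b n.k 1 κ one_ne_zero)).trans n.iso, F, c₂ / c₁,
    (n.isLieIso_iso.symm.trans (isLieIso_rescaleAut _ _ _ _ one_ne_zero)).trans n.isLieIso_iso,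
    fun s => ?_, fun a => ?_, div_pos hc₂ hc₁, fun x v w => ?_⟩
  · change n.iso (rescaleAut n.b n.k 1 κ one_ne_zero (n.iso.symm _)) = _
    rw [← n.iso_oneParam, MulEquiv.symm_apply_apply, rescaleAut_oneParam]
  · apply n.real.toEquiv.injective
    refine (hFa _).trans ?_
    refine Eq.trans ?_ (n.real_mk _).symm
    change T (act (n.iso.symm a) 0) = act (n.iso.symm (n.iso _)) 0
    rw [MulEquiv.symm_apply_apply, hT, rescale_act, rescale_origin]
    rfl
  · have hd : ∀ v : TangentSpace 𝓘(ℝ, E3) x, (mfderiv 𝓘(ℝ, E3) 𝓘(ℝ, E3) n.real (F x)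
        (mfderiv 𝓘(ℝ, E3) 𝓘(ℝ, E3) F x v) : E3)
        = fderiv ℝ T (n.real x) (mfderiv 𝓘(ℝ, E3) 𝓘(ℝ, E3) n.real x v : E3) := by
      intro v
      have e : n.real ∘ F = n.real.trans T := funext hFa
      have h := mfderiv_comp (I := 𝓘(ℝ, E3)) (I' := 𝓘(ℝ, E3)) (I'' := 𝓘(ℝ, E3)) x
        (n.real.mdifferentiable (by simp) (F x)) (F.mdifferentiable (by simp) x)
      rw [e] at h
      exact (congrArg (fun L => (L v : E3)) h).symm.trans (mfderiv_diffeo_trans n.real T x v)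
    have hz : ∀ v : E3, fderiv ℝ T (n.real x) v 0 = v 0 := fun v => by rw [hT, fderiv_rescale]; rfl
    have key : ∀ z z' : E3, z = z' → ∀ v v' : E3, v = v' → ∀ w w' : E3, w = w' →
      c₂ * modelForm n.b n.k z v w + f₂ * (v 0 * w 0)
        = c₂ * modelForm n.b n.k z' v' w' + f₂ * (v' 0 * w' 0) := by
      rintro z _ rfl v _ rfl w _ rfl
      rfl
    have fin : ∀ v w : E3, c₂ * modelForm n.b n.k (T (n.real x)) (fderiv ℝ T (n.real x) v)
        (fderiv ℝ T (n.real x) w) + f₂ * (fderiv ℝ T (n.real x) v 0 * fderiv ℝ T (n.real x) w 0)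
        = c₂ / c₁ * (c₁ * modelForm n.b n.k (n.real x) v w + f₁ * (v 0 * w 0)) := by
      intro v w
      rw [hz, hz, hT, modelForm_rescale, hκ]
      field_simp
      ring
    exact (hg₂ (F x) _ _).trans ((key _ _ (hFa x) _ _ (hd v) _ _ (hd w)).trans
      ((fin _ _).trans (congrArg (c₂ / c₁ * ·) (hg₁ x v w).symm)))

end NormalForm

/-! ### Eigenvectors -/

/-- At time `t`, `exp W` acts on `Heis / I` as left translation by `exp(ρ(-t) W)`. If this vector is
proportional to `W` modulo the center, the transverse coordinate is unchanged and only the central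
one moves. -/
theorem PSpace.chart_smul {ρ : HeisRep} {W : NonCentral} {t c d : ℝ}
    (h : ρ.lie (-t) W.1 = c • W.1 + ![0, 0, d]) (y z : ℝ) :
    PSpace.homeo ρ W ((SemidirectProduct.inl (Heis.oneParam W.1 (Multiplicative.ofAdd 1)) : HeisExt ρ) •
      (PSpace.homeo ρ W).symm ![t, y, z]) = ![t, y, z + d + c * y] := by
  have hl := PSpace.len_ne_zero W
  change PSpace.preChart ρ W ((SemidirectProduct.inl (Heis.oneParam W.1 (Multiplicative.ofAdd 1)) :
    HeisExt ρ) * PSpace.sect ρ W ![t, y, z]) = _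
  have e : ρ.toHom (Multiplicative.ofAdd t)⁻¹ (Heis.oneParam W.1 (Multiplicative.ofAdd 1) *
      ρ.toHom (Multiplicative.ofAdd t) ⟨![-(y * W.1 1 / PSpace.len W), y * W.1 0 / PSpace.len W, z]⟩)
      = ⟨c • W.1 + ![0, 0, d]⟩ * ⟨![-(y * W.1 1 / PSpace.len W), y * W.1 0 / PSpace.len W, z]⟩ := by
    rw [map_mul]
    congr 1
    · apply Heis.ext
      rw [← ofAdd_neg, ρ.log_toHom, ← h]
      simp [Heis.oneParam]
    · rw [map_inv]
      simp
  simp only [PSpace.preChart, PSpace.sect, SemidirectProduct.mul_left, SemidirectProduct.mul_right,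
    SemidirectProduct.left_inl, SemidirectProduct.right_inl, one_mul, Matrix.cons_val_zero,
    Matrix.cons_val_one, Matrix.cons_val, map_one, MulAut.one_apply, e, PSpace.slice, Heis.mul_log]
  refine ext_E3 ?_ ?_ ?_
  · rfl
  · simp [heisBracket, Matrix.vecHead, Matrix.vecTail]
    field_simp
    unfold PSpace.len
    ring
  · simp [heisBracket, Matrix.vecHead, Matrix.vecTail]
    field_simp
    unfold PSpace.len
    ring

/-- For an eigenvector, `exp W` fixes the origin of the chart and its differential there is a
transvection: the identity plus a nonzero linear form times the central direction. Preserving a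
symmetric form then puts that direction in the kernel of the form, against nondegeneracy. -/
theorem not_isEigenvector {ρ : HeisRep} {W : NonCentral} {g : LorentzMetric (PSpace ρ W)}
    (hg : IsInvariant g) : ¬ ρ.IsEigenvector W := by
  intro he
  let χ : PSpace ρ W ≃ₘ⟮𝓘(ℝ, E3), 𝓘(ℝ, E3)⟯ E3 :=
    { toEquiv := (PSpace.homeo ρ W).toEquiv
      contMDiff_toFun := contMDiff_isOpenEmbedding (PSpace.homeo ρ W).isOpenEmbedding
      contMDiff_invFun := by
        refine ContMDiff.of_comp_isOpenEmbedding (PSpace.homeo ρ W).isOpenEmbedding ?_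
        convert! contMDiff_id using 1
        funext y
        exact (PSpace.homeo ρ W).apply_symm_apply y }
  have hl := PSpace.len_ne_zero W
  let L : ℝ → E3 := fun t => ρ.lie (-t) W.1
  let c : ℝ → ℝ := fun t => (W.1 0 * L t 0 + W.1 1 * L t 1) / PSpace.len W
  let d : ℝ → ℝ := fun t => L t 2 - c t * W.1 2
  have hLs : ContDiff ℝ ∞ L := (ρ.contDiff_lie_const W.1).comp contDiff_neg
  have hL0 := contDiff_pi.1 hLs 0
  have hL1 := contDiff_pi.1 hLs 1
  have hL2 := contDiff_pi.1 hLs 2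
  have hcs : ContDiff ℝ ∞ c := ((contDiff_const.mul hL0).add (contDiff_const.mul hL1)).div_const _
  have hds : ContDiff ℝ ∞ d := hL2.sub (hcs.mul contDiff_const)
  have hW : ∀ t, ρ.lie (-t) W.1 = c t • W.1 + ![0, 0, d t] := by
    intro t
    obtain ⟨r, hr⟩ := he (-t)
    rw [← map_smul, mk_eq_mk_center] at hr
    have hc : c t = r := by
      simp only [c, L, hr.1, hr.2, Pi.smul_apply, smul_eq_mul]
      field_simp
      unfold PSpace.len
      ring
    refine ext_E3 ?_ ?_ ?_
    · simp [hc, hr.1]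
    · simp [hc, hr.2]
    · simp [d, L]
  let T : E3 → E3 := fun y => ![y 0, y 1, y 2 + d (y 0) + c (y 0) * y 1]
  let A : HeisExt ρ := SemidirectProduct.inl (Heis.oneParam W.1 (Multiplicative.ofAdd 1))
  have hT : ∀ y, χ (A • χ.symm y) = T y := by
    intro y
    have := PSpace.chart_smul (hW (y 0)) (y 1) (y 2)
    rw [show ![y 0, y 1, y 2] = y from by refine ext_E3 ?_ ?_ ?_ <;> rfl] at this
    exact this
  have hTs : ContDiff ℝ ∞ T := by
    have h1 : ContDiff ℝ ∞ (fun y : E3 => d (y 0)) := hds.comp (by fun_prop)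
    have h2 : ContDiff ℝ ∞ (fun y : E3 => c (y 0)) := hcs.comp (by fun_prop)
    exact contDiff_of_components (by fun_prop) (by fun_prop) (by fun_prop)
  have hAT : (fun x => A • x) = χ.symm ∘ T ∘ χ := by
    funext x
    apply χ.toEquiv.injective
    have := hT (χ x)
    rw [χ.symm_apply_apply] at this
    exact this.trans (χ.apply_symm_apply _).symm
  have hAs : ContMDiff 𝓘(ℝ, E3) 𝓘(ℝ, E3) ∞ (fun x : PSpace ρ W => A • x) := by
    rw [hAT]
    exact χ.symm.contMDiff.comp (hTs.contMDiff.comp χ.contMDiff)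
  let R : E3 → PSpace ρ W := χ.symm
  let D : (y : E3) → E3 →L[ℝ] E3 := fun y => mfderiv 𝓘(ℝ, E3) 𝓘(ℝ, E3) χ.symm y
  let q : E3 → E3 →L[ℝ] E3 →L[ℝ] ℝ := fun y =>
    ContinuousLinearMap.bilinearComp (E := E3) (F := E3) (g.val (R y)) (D y) (D y)
  have hTe : ∀ y, R (T y) = A • R y := by
    intro y
    apply χ.toEquiv.injective
    exact (χ.apply_symm_apply (T y)).trans (hT y).symm
  have hinv : ∀ (y v w : E3), q (T y) (fderiv ℝ T y v) (fderiv ℝ T y w) = q y v w := by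
    intro y v w
    have d1 := mfderiv_comp (I := 𝓘(ℝ, E3)) (I' := 𝓘(ℝ, E3)) (I'' := 𝓘(ℝ, E3)) y
      (χ.symm.mdifferentiable (by simp) (T y)) (hTs.contMDiff.mdifferentiable (by simp) y)
    have d2 := mfderiv_comp (I := 𝓘(ℝ, E3)) (I' := 𝓘(ℝ, E3)) (I'' := 𝓘(ℝ, E3)) y
      (hAs.mdifferentiable (by simp) (R y)) (χ.symm.mdifferentiable (by simp) y)
    have e' : χ.symm ∘ T = (fun x : PSpace ρ W => A • x) ∘ χ.symm := funext hTe
    rw [e', d2, mfderiv_eq_fderiv] at d1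
    have key : ∀ v : E3, D (T y) (fderiv ℝ T y v)
        = mfderiv 𝓘(ℝ, E3) 𝓘(ℝ, E3) (fun x : PSpace ρ W => A • x) (R y) (D y v) := fun v =>
      (congrArg (fun T => (T v : E3)) d1).symm
    exact (g.val_congr (hTe y) (key v) (key w)).trans (hg A (R y) (D y v) (D y w))
  have hc0 : c 0 = 1 := by
    simp only [c, L, neg_zero, ρ.lie_zero]
    field_simp
    unfold PSpace.len
    ring
  have hd0 : d 0 = 0 := by simp [d, hc0, L, ρ.lie_zero]
  have hT0 : T 0 = 0 := by
    refine ext_E3 ?_ ?_ ?_ <;> simp [T, hd0]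
  set δ := deriv d 0
  have hdT : ∀ v : E3, fderiv ℝ T 0 v = ![v 0, v 1, v 2 + (δ * v 0 + v 1)] := by
    intro v
    have h1 : HasDerivAt (fun r : ℝ => d (((0 : E3) + r • v) 0)) (δ * v 0) 0 :=
      HasDerivAt.comp_line (hds.differentiable (by simp) _).hasDerivAt
    have h2 : HasDerivAt (fun r : ℝ => c (((0 : E3) + r • v) 0)) (deriv c 0 * v 0) 0 :=
      HasDerivAt.comp_line (hcs.differentiable (by simp) _).hasDerivAt
    refine fderiv_apply_eq_of_hasDerivAt (hTs.differentiable (by simp) _) (hasDerivAt_line 0 v 0)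
      (hasDerivAt_line 0 v 1) ?_
    refine (((hasDerivAt_line 0 v 2).add h1).add (h2.mul (hasDerivAt_line 0 v 1))).congr_deriv ?_
    simp [hc0]
    ring
  have hqs : ∀ v w, q 0 v w = q 0 w v := fun v w => g.symm _ _ _
  set e2 : E3 := ![0, 0, 1] with he2
  -- The difference of the form before and after the transvection. Testing it on vectors where the
  -- linear form is `0` or `1` shows that `e2` is orthogonal to everything.
  have hq0 : ∀ v w : E3, (δ * v 0 + v 1) * q 0 e2 w + (δ * w 0 + w 1) * q 0 e2 v
      + (δ * v 0 + v 1) * (δ * w 0 + w 1) * q 0 e2 e2 = 0 := by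
    intro v w
    have h := hinv 0 v w
    have e : ∀ v : E3, ![v 0, v 1, v 2 + (δ * v 0 + v 1)] = v + (δ * v 0 + v 1) • e2 := by
      intro v
      refine ext_E3 ?_ ?_ ?_ <;> simp [he2]
    rw [hT0, hdT, hdT, e, e] at h
    simp only [map_add, map_smul, add_apply, smul_apply, smul_eq_mul] at h
    rw [hqs v e2] at h
    linarith
  have h22 : q 0 e2 e2 = 0 := by
    have := hq0 ![0, 1, 0] e2
    simpa [he2] using this
  have h2v : ∀ w, q 0 e2 w = 0 := by
    intro w
    have h1 := hq0 ![0, 1, 0] ![0, 1, 0]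
    have h2 := hq0 ![0, 1, 0] w
    simp [h22] at h1 h2
    rw [h1] at h2
    linarith
  have hsig : ∃ e : Fin 3 → E3, ∀ i j, q 0 (e i) (e j) =
      if i = j then (if i = 0 then -1 else 1) else 0 := by
    obtain ⟨e, he⟩ := g.signature (R 0)
    have h1 : ∀ v : E3, ∃ w : E3, D 0 w = v := by
      intro v
      have := mfderiv_symm_left χ (R 0) v
      have e2 : ∀ z : E3, z = 0 → ∀ v : E3, (mfderiv 𝓘(ℝ, E3) 𝓘(ℝ, E3) χ.symm z v : E3)
        = D 0 v := by rintro z rfl v; rfl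
      exact ⟨_, (e2 _ (χ.apply_symm_apply 0) _).symm.trans this⟩
    choose e' he' using fun i => h1 (e i)
    refine ⟨e', fun i j => ?_⟩
    change g.val (R 0) (D 0 (e' i)) (D 0 (e' j)) = _
    rw [he', he', he]
  have hdet := det_gram_neg hsig
  have hp : (Pi.single 2 1 : E3) = e2 := by
    refine ext_E3 ?_ ?_ ?_ <;> simp [he2]
  rw [Matrix.det_fin_three] at hdet
  simp [hp, h2v, hqs _ e2] at hdet

end PlaneWave
end

noncomputable section
namespace PlaneWave

/-! ### Local isometries between the models -/

/-- The derivative of the metric of the model in the direction `z`. -/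
def modelDeriv (b k : ℝ) (y z v w : E3) : ℝ :=
  b * Real.exp (b * y 0) * z 0 * (v 0 * w 1 + v 1 * w 0) + 2 * k * y 2 * z 2 * (v 0 * w 0)

/-- The Christoffel symbols of the model. -/
def christoffel (b k : ℝ) (y v w : E3) : E3 :=
  ![b * (v 0 * w 0),
    Real.exp (-(b * y 0)) * (k * y 2 * (v 0 * w 2 + v 2 * w 0) - k * b * y 2 ^ 2 * (v 0 * w 0)),
    -(k * y 2 * (v 0 * w 0))]

/-- Koszul's formula for constant vector fields, which certifies the explicit symbols. -/
theorem modelForm_christoffel (b k : ℝ) (y v w z : E3) :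
    2 * modelForm b k y (christoffel b k y v w) z
      = modelDeriv b k y v w z + modelDeriv b k y w v z - modelDeriv b k y z v w := by
  have E : Real.exp (b * y 0) * Real.exp (-(b * y 0)) = 1 := by rw [← Real.exp_add]; simp
  rw [modelForm_apply]
  simp only [modelDeriv, christoffel, Matrix.cons_val_zero, Matrix.cons_val_one, Matrix.cons_val]
  linear_combination 2 * z 0 * (k * y 2 * (v 0 * w 2 + v 2 * w 0) - k * b * y 2 ^ 2 * (v 0 * w 0)) * E

theorem modelForm_symm (b k : ℝ) (y v w : E3) : modelForm b k y v w = modelForm b k y w v := by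
  rw [modelForm_apply, modelForm_apply]
  ring

theorem hasDerivAt_modelForm {b k : ℝ} {Y A B : ℝ → E3} {Y' A' B' : E3} {r : ℝ}
    (hY : HasDerivAt Y Y' r) (hA : HasDerivAt A A' r) (hB : HasDerivAt B B' r) :
    HasDerivAt (fun r => modelForm b k (Y r) (A r) (B r))
      (modelDeriv b k (Y r) Y' (A r) (B r) + modelForm b k (Y r) A' (B r)
        + modelForm b k (Y r) (A r) B') r := by
  rw [hasDerivAt_pi] at hY hA hB
  simp only [modelForm_apply]
  refine (((((hY 0).const_mul b).exp.mul (((hA 0).mul (hB 1)).add ((hA 1).mul (hB 0)))).add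
    ((hA 2).mul (hB 2))).add ((((hY 2).pow 2).const_mul k).mul ((hA 0).mul (hB 0)))).congr_deriv ?_
  simp only [modelDeriv, Pi.mul_apply, Pi.add_apply, Pi.pow_apply]
  push_cast
  ring

theorem modelForm_nondegenerate {b k : ℝ} {y v : E3} (h : ∀ w, modelForm b k y v w = 0) : v = 0 := by
  have h0 := h ![0, 1, 0]
  have h1 := h ![1, 0, 0]
  have h2 := h ![0, 0, 1]
  simp only [modelForm_apply] at h0 h1 h2
  simp at h0 h1 h2
  rw [h0] at h1
  simp at h1
  refine ext_E3 ?_ ?_ ?_ <;> simp [h0, h1, h2]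

/-- `f` is smooth on the open set `U` and maps the first model isometrically to the second one. -/
structure IsModelIsom (b k b' k' : ℝ) (f : E3 → E3) (U : Set E3) : Prop where
  isOpen : IsOpen U
  smooth : ContDiffOn ℝ ∞ f U
  form : ∀ y ∈ U, ∀ v w, modelForm b' k' (f y) (fderiv ℝ f y v) (fderiv ℝ f y w) = modelForm b k y v w

namespace IsModelIsom

variable {b k b' k' : ℝ} {f : E3 → E3} {U : Set E3} (H : IsModelIsom b k b' k' f U)

theorem contDiffAt (H : IsModelIsom b k b' k' f U) {y : E3} (hy : y ∈ U) : ContDiffAt ℝ ∞ f y :=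
  H.smooth.contDiffAt (H.isOpen.mem_nhds hy)

theorem differentiableAt (H : IsModelIsom b k b' k' f U) {y : E3} (hy : y ∈ U) :
    DifferentiableAt ℝ f y :=
  (H.contDiffAt hy).differentiableAt (by simp)

theorem differentiableAt_fderiv (H : IsModelIsom b k b' k' f U) {y : E3} (hy : y ∈ U) :
    DifferentiableAt ℝ (fderiv ℝ f) y :=
  ((H.contDiffAt hy).fderiv_right (m := 1) (by norm_cast)).differentiableAt (by simp)

theorem injective (H : IsModelIsom b k b' k' f U) {y : E3} (hy : y ∈ U) :
    Function.Injective (fderiv ℝ f y) := by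
  refine (injective_iff_map_eq_zero (fderiv ℝ f y)).2 fun v hv => ?_
  refine modelForm_nondegenerate (b := b) (k := k) (y := y) fun w => ?_
  rw [← H.form y hy, hv]
  simp

theorem surjective (H : IsModelIsom b k b' k' f U) {y : E3} (hy : y ∈ U) :
    Function.Surjective (fderiv ℝ f y) :=
  LinearMap.surjective_of_injective (f := (fderiv ℝ f y : E3 →ₗ[ℝ] E3)) (H.injective hy)

theorem mono (H : IsModelIsom b k b' k' f U) {V : Set E3} (hV : IsOpen V) (h : V ⊆ U) :
    IsModelIsom b k b' k' f V :=
  ⟨hV, H.smooth.mono h, fun y hy => H.form y (h hy)⟩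

theorem _root_.PlaneWave.hasDerivAt_add_smul (y z : E3) : HasDerivAt (fun r : ℝ => y + r • z) z 0 := by
  simpa using ((hasDerivAt_id (0 : ℝ)).smul_const z).const_add y

theorem hasDerivAt_comp (H : IsModelIsom b k b' k' f U) {y : E3} (hy : y ∈ U) (z : E3) :
    HasDerivAt (fun r : ℝ => f (y + r • z)) (fderiv ℝ f y z) 0 := by
  have h : HasFDerivAt f (fderiv ℝ f y) (y + (0 : ℝ) • z) := by
    rw [zero_smul, add_zero]; exact (H.differentiableAt hy).hasFDerivAt
  exact h.comp_hasDerivAt (0 : ℝ) (hasDerivAt_add_smul y z)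

theorem hasDerivAt_fderiv (H : IsModelIsom b k b' k' f U) {y : E3} (hy : y ∈ U) (z v : E3) :
    HasDerivAt (fun r : ℝ => fderiv ℝ f (y + r • z) v) (fderiv ℝ (fderiv ℝ f) y z v) 0 := by
  have h : HasFDerivAt (fderiv ℝ f) (fderiv ℝ (fderiv ℝ f) y) (y + (0 : ℝ) • z) := by
    rw [zero_smul, add_zero]; exact (H.differentiableAt_fderiv hy).hasFDerivAt
  have h2 := h.comp_hasDerivAt (0 : ℝ) (hasDerivAt_add_smul y z)
  exact (ContinuousLinearMap.apply ℝ E3 v).hasFDerivAt.comp_hasDerivAt (0 : ℝ) h2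

/-- The second derivatives of a local isometry, by the Koszul formula. -/
theorem hessian (H : IsModelIsom b k b' k' f U) {y : E3} (hy : y ∈ U) (v w : E3) :
    fderiv ℝ (fderiv ℝ f) y v w = fderiv ℝ f y (christoffel b k y v w)
      - christoffel b' k' (f y) (fderiv ℝ f y v) (fderiv ℝ f y w) := by
  set D := fderiv ℝ f y with hD
  set T := fderiv ℝ (fderiv ℝ f) y with hT
  have hsymm : ∀ v w, T v w = T w v := fun v w =>
    ((H.contDiffAt hy).isSymmSndFDerivAt (by simp; norm_cast)) v w
  -- The isometry relation differentiated in the direction `z`.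
  have K : ∀ z v w, modelForm b' k' (f y) (T z v) (D w) + modelForm b' k' (f y) (T z w) (D v)
      = modelDeriv b k y z v w - modelDeriv b' k' (f y) (D z) (D v) (D w) := by
    intro z v w
    have h1 := hasDerivAt_modelForm (b := b') (k := k') (H.hasDerivAt_comp hy z)
      (H.hasDerivAt_fderiv hy z v) (H.hasDerivAt_fderiv hy z w)
    have h2 := hasDerivAt_modelForm (b := b) (k := k) (hasDerivAt_add_smul y z)
      (hasDerivAt_const (0 : ℝ) v) (hasDerivAt_const (0 : ℝ) w)
    have ev : ∀ᶠ r in 𝓝 (0 : ℝ), modelForm b' k' (f (y + r • z)) (fderiv ℝ f (y + r • z) v)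
        (fderiv ℝ f (y + r • z) w) = modelForm b k (y + r • z) v w := by
      have hc : Filter.Tendsto (fun r : ℝ => y + r • z) (𝓝 0) (𝓝 y) := by
        have := (hasDerivAt_add_smul y z).continuousAt.tendsto
        simpa using this
      filter_upwards [hc.eventually (H.isOpen.mem_nhds hy)] with r hr
      exact H.form _ hr v w
    have h3 := (h1.congr_of_eventuallyEq (ev.mono fun r hr => hr.symm)).unique h2
    simp only [zero_smul, add_zero, map_zero, zero_apply] at h3
    rw [modelForm_symm b' k' (f y) (T z w)]
    linarith
  -- As in the proof of uniqueness of the Levi-Civita connection: two cyclic instances of `K` minus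
  -- the third isolate `T v w`, by symmetry of the second derivative.
  have key : ∀ z, modelForm b' k' (f y) (T v w + christoffel b' k' (f y) (D v) (D w)
      - D (christoffel b k y v w)) (D z) = 0 := by
    intro z
    rw [map_sub, map_add, sub_apply, add_apply, H.form y hy]
    have k1 := K v w z
    have k2 := K w v z
    have k3 := K z v w
    rw [hsymm w v] at k2
    rw [hsymm z v, hsymm z w] at k3
    have c1 := modelForm_christoffel b k y v w z
    have c2 := modelForm_christoffel b' k' (f y) (D v) (D w) (D z)
    linarith
  have h0 := modelForm_nondegenerate (b := b') (k := k') (y := f y) (fun u => by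
    obtain ⟨z, rfl⟩ := H.surjective hy u
    exact key z)
  rw [sub_eq_zero] at h0
  rw [← h0]
  abel

end IsModelIsom

end PlaneWave
end

noncomputable section
namespace PlaneWave

/-! ### Local classification -/

theorem clm_vec (D : E3 →L[ℝ] E3) (x y z : ℝ) (i : Fin 3) :
    D ![x, y, z] i = x * D ![1, 0, 0] i + y * D ![0, 1, 0] i + z * D ![0, 0, 1] i := by
  have h : ![x, y, z] = x • (![1, 0, 0] : E3) + y • ![0, 1, 0] + z • ![0, 0, 1] := by
    refine ext_E3 ?_ ?_ ?_ <;> simp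
  rw [h]
  simp only [map_add, map_smul, Pi.add_apply, Pi.smul_apply, smul_eq_mul]

theorem clm_vec_zero (D : E3 →L[ℝ] E3) (i : Fin 3) : D ![0, 0, 0] i = 0 := by
  rw [clm_vec]
  ring

/-- A function whose derivative in the direction `z` vanishes is constant in this direction. -/
theorem eq_of_hasDerivAt_zero {U : Set E3} (hU : Convex ℝ U) {h : E3 → ℝ} {z : E3}
    (hd : ∀ y ∈ U, HasDerivAt (fun r : ℝ => h (y + r • z)) 0 0) {y : E3} {δ : ℝ} (hy : y ∈ U)
    (hy' : y + δ • z ∈ U) : h (y + δ • z) = h y := by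
  have hseg : ∀ τ ∈ Set.Icc (0 : ℝ) 1, y + (τ * δ) • z ∈ U := by
    intro τ hτ
    have := hU.add_smul_sub_mem hy hy' hτ
    simpa [smul_smul] using this
  have hder : ∀ τ ∈ Set.Icc (0 : ℝ) 1, HasDerivAt (fun τ : ℝ => h (y + (τ * δ) • z)) 0 τ := by
    intro τ hτ
    have h1 := hd _ (hseg τ hτ)
    have h2 : HasDerivAt (fun σ : ℝ => (σ - τ) * δ) δ τ := by
      simpa using ((hasDerivAt_id τ).sub_const τ).mul_const δ
    have h3 : HasDerivAt (fun r : ℝ => h (y + (τ * δ) • z + r • z)) 0 ((τ - τ) * δ) := by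
      simpa using h1
    have h4 := h3.comp τ h2
    rw [zero_mul] at h4
    refine h4.congr_of_eventuallyEq (Filter.Eventually.of_forall fun σ => ?_)
    simp only [Function.comp_apply]
    rw [add_assoc, ← add_smul]
    congr 3
    ring
  have h0 := constant_of_has_deriv_right_zero
    (fun τ hτ => (hder τ hτ).continuousAt.continuousWithinAt)
    (fun τ hτ => (hder τ ⟨hτ.1, hτ.2.le⟩).hasDerivWithinAt) 1 (by simp)
  simpa using h0

/-- If `h` does not depend on `x`, then neither do its derivatives. -/
theorem deriv_eq_of_hasDerivAt_zero {U : Set E3} (hU : Convex ℝ U) (hUo : IsOpen U) {h h' : E3 → ℝ}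
    {z e : E3} (hd : ∀ y ∈ U, HasDerivAt (fun r : ℝ => h (y + r • z)) 0 0)
    (hd' : ∀ y ∈ U, HasDerivAt (fun r : ℝ => h (y + r • e)) (h' y) 0) {y : E3} {δ : ℝ} (hy : y ∈ U)
    (hy' : y + δ • z ∈ U) : h' (y + δ • z) = h' y := by
  refine (hd' _ hy').unique ((hd' y hy).congr_of_eventuallyEq ?_)
  have hc : ∀ y : E3, Filter.Tendsto (fun r : ℝ => y + r • e) (𝓝 0) (𝓝 y) := by
    intro y
    have := (hasDerivAt_add_smul y e).continuousAt.tendsto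
    simpa using this
  filter_upwards [(hc y).eventually (hUo.mem_nhds hy), (hc _).eventually (hUo.mem_nhds hy')] with r h1 h2
  have e1 : y + δ • z + r • e = y + r • e + δ • z := by abel
  rw [e1] at h2 ⊢
  exact eq_of_hasDerivAt_zero hU hd h1 h2

namespace IsModelIsom

variable {b k b' k' : ℝ} {f : E3 → E3} {U : Set E3}

/-- The field `∂_v` of the target is parallel, with metric dual `e^{b's} ds`. The pullback of this
form is parallel for the source metric, so no Christoffel symbol of the target survives. -/
theorem hasDerivAt_theta (H : IsModelIsom b k b' k' f U) {y : E3} (hy : y ∈ U) (z v : E3) :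
    HasDerivAt (fun r : ℝ => Real.exp (b' * f (y + r • z) 0) * fderiv ℝ f (y + r • z) v 0)
      (Real.exp (b' * f y 0) * fderiv ℝ f y (christoffel b k y z v) 0) 0 := by
  have h1 := hasDerivAt_pi.1 (H.hasDerivAt_comp hy z) 0
  have h2 := hasDerivAt_pi.1 (H.hasDerivAt_fderiv hy z v) 0
  refine ((h1.const_mul b').exp.mul h2).congr_deriv ?_
  rw [H.hessian hy]
  simp [christoffel]
  ring

theorem hasDerivAt_partial (H : IsModelIsom b k b' k' f U) {y : E3} (hy : y ∈ U) (z v : E3) (i : Fin 3) :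
    HasDerivAt (fun r : ℝ => fderiv ℝ f (y + r • z) v i)
      (fderiv ℝ f y (christoffel b k y z v) i
        - christoffel b' k' (f y) (fderiv ℝ f y z) (fderiv ℝ f y v) i) 0 := by
  have h2 := hasDerivAt_pi.1 (H.hasDerivAt_fderiv hy z v) i
  rwa [H.hessian hy] at h2

theorem exists_shift (hUo : IsOpen U) {y : E3} (hy : y ∈ U) :
    ∃ δ : ℝ, δ ≠ 0 ∧ y + δ • (![0, 0, 1] : E3) ∈ U := by
  have hc : Filter.Tendsto (fun r : ℝ => y + r • (![0, 0, 1] : E3)) (𝓝 0) (𝓝 y) := by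
    have := (hasDerivAt_add_smul y ![0, 0, 1]).continuousAt.tendsto
    simpa using this
  have h1 := (hc.eventually (hUo.mem_nhds hy)).filter_mono (nhdsWithin_le_nhds (s := {0}ᶜ))
  obtain ⟨δ, h, h0⟩ := (h1.and self_mem_nhdsWithin).exists
  exact ⟨δ, h0, h⟩

/-- A local isometry preserves the lightlike foliation. -/
theorem fderiv_zero_eq_zero (H : IsModelIsom b k b' k' f U) (hk : k ≠ 0) (hU : Convex ℝ U) {y : E3}
    (hy : y ∈ U) : fderiv ℝ f y ![0, 1, 0] 0 = 0 ∧ fderiv ℝ f y ![0, 0, 1] 0 = 0 := by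
  -- Write `θ` for the parallel form. Both `θ(∂_v)` and `θ(∂_x)` are constant in `x`, but the
  -- `s`-derivative of `θ(∂_x)` is `e^{-bs} k x θ(∂_v)`. It must be constant in `x` as well, which
  -- forces `θ(∂_v) = 0` when `k ≠ 0`.
  have hv : ∀ y ∈ U, fderiv ℝ f y ![0, 1, 0] 0 = 0 := by
    intro y hy
    obtain ⟨δ, hδ, hy'⟩ := exists_shift H.isOpen hy
    have h1 := eq_of_hasDerivAt_zero hU (z := ![0, 0, 1])
      (h := fun y => Real.exp (b' * f y 0) * fderiv ℝ f y ![0, 1, 0] 0) (fun y hy => by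
        refine (H.hasDerivAt_theta hy ![0, 0, 1] ![0, 1, 0]).congr_deriv ?_
        simp [christoffel, clm_vec_zero]) hy hy'
    have h2 := deriv_eq_of_hasDerivAt_zero hU H.isOpen (z := ![0, 0, 1]) (e := ![1, 0, 0])
      (h := fun y => Real.exp (b' * f y 0) * fderiv ℝ f y ![0, 0, 1] 0)
      (h' := fun y => Real.exp (-(b * y 0)) * k * y 2
        * (Real.exp (b' * f y 0) * fderiv ℝ f y ![0, 1, 0] 0))
      (fun y hy => by
        refine (H.hasDerivAt_theta hy ![0, 0, 1] ![0, 0, 1]).congr_deriv ?_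
        simp [christoffel, clm_vec_zero])
      (fun y hy => by
        refine (H.hasDerivAt_theta hy ![1, 0, 0] ![0, 0, 1]).congr_deriv ?_
        simp [christoffel]
        rw [clm_vec]
        ring) hy hy'
    rw [h1] at h2
    have h3 : Real.exp (-(b * y 0)) * k * δ * (Real.exp (b' * f y 0) * fderiv ℝ f y ![0, 1, 0] 0) = 0 := by
      have e0 : (y + δ • (![0, 0, 1] : E3)) 0 = y 0 := by simp
      have e2 : (y + δ • (![0, 0, 1] : E3)) 2 = y 2 + δ := by simp
      rw [e0, e2] at h2
      linarith
    simpa [hk, hδ] using h3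
  refine ⟨hv y hy, ?_⟩
  obtain ⟨δ, hδ, hy'⟩ := exists_shift H.isOpen hy
  have h1 := eq_of_hasDerivAt_zero hU (z := ![0, 0, 1])
    (h := fun y => Real.exp (b' * f y 0) * fderiv ℝ f y ![0, 0, 1] 0) (fun y hy => by
      refine (H.hasDerivAt_theta hy ![0, 0, 1] ![0, 0, 1]).congr_deriv ?_
      simp [christoffel, clm_vec_zero]) hy hy'
  have hs : ∀ y ∈ U, HasDerivAt (fun r : ℝ => Real.exp (b' * f (y + r • (![0, 0, 1] : E3)) 0)
      * fderiv ℝ f (y + r • (![0, 0, 1] : E3)) ![1, 0, 0] 0) 0 0 := fun y hy => by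
    refine (H.hasDerivAt_theta hy ![0, 0, 1] ![1, 0, 0]).congr_deriv ?_
    simp [christoffel]
    rw [clm_vec, hv y hy]
    ring
  have h2 := eq_of_hasDerivAt_zero hU (z := ![0, 0, 1])
    (h := fun y => Real.exp (b' * f y 0) * fderiv ℝ f y ![1, 0, 0] 0) hs hy hy'
  -- The same argument one level up: `θ(∂_s)` is constant in `x`, while its `s`-derivative contains
  -- `-k x θ(∂_x)`.
  have h3 := deriv_eq_of_hasDerivAt_zero hU H.isOpen (z := ![0, 0, 1]) (e := ![1, 0, 0])
    (h := fun y => Real.exp (b' * f y 0) * fderiv ℝ f y ![1, 0, 0] 0)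
    (h' := fun y => b * (Real.exp (b' * f y 0) * fderiv ℝ f y ![1, 0, 0] 0)
      - k * y 2 * (Real.exp (b' * f y 0) * fderiv ℝ f y ![0, 0, 1] 0))
    hs
    (fun y hy => by
      refine (H.hasDerivAt_theta hy ![1, 0, 0] ![1, 0, 0]).congr_deriv ?_
      simp [christoffel]
      rw [clm_vec, hv y hy]
      ring) hy hy'
  rw [h1, h2] at h3
  have h4 : k * δ * (Real.exp (b' * f y 0) * fderiv ℝ f y ![0, 0, 1] 0) = 0 := by
    have e2 : (y + δ • (![0, 0, 1] : E3)) 2 = y 2 + δ := by simp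
    rw [e2] at h3
    linarith
  simpa [hk, hδ] using h4

/-- The part of the differential of an isometry that preserves the lightlike foliation. -/
theorem of_fderiv_zero (H : IsModelIsom b k b' k' f U) {y : E3} (hy : y ∈ U)
    (h1 : fderiv ℝ f y ![0, 1, 0] 0 = 0) (h2 : fderiv ℝ f y ![0, 0, 1] 0 = 0) :
    fderiv ℝ f y ![1, 0, 0] 0 ≠ 0 ∧ fderiv ℝ f y ![0, 0, 1] 2 ^ 2 = 1 ∧
      fderiv ℝ f y ![0, 1, 0] 2 = 0 := by
  have h3 := H.form y hy ![0, 0, 1] ![0, 0, 1]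
  have h4 := H.form y hy ![0, 1, 0] ![0, 0, 1]
  simp only [modelForm_apply, h1, h2] at h3 h4
  simp at h3 h4
  have h3' : fderiv ℝ f y ![0, 0, 1] 2 ≠ 0 := by
    intro h
    simp [h] at h3
  refine ⟨fun h => ?_, by rw [sq]; exact h3, by simpa [h3'] using h4⟩
  obtain ⟨v, hv⟩ := H.surjective hy ![1, 0, 0]
  have h5 := congrFun hv 0
  have e : v = ![v 0, v 1, v 2] := by refine ext_E3 ?_ ?_ ?_ <;> rfl
  rw [e, clm_vec, h, h1, h2] at h5
  simp at h5

/-- The parameters of two locally isometric models, one of which is not flat, are proportional. -/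
theorem eq_of_convex (H : IsModelIsom b k b' k' f U) (hk : k ≠ 0) (hU : Convex ℝ U) {y : E3}
    (hy : y ∈ U) : k = k' * fderiv ℝ f y ![1, 0, 0] 0 ^ 2 ∧ b = b' * fderiv ℝ f y ![1, 0, 0] 0 := by
  have hz := fun y (hy : y ∈ U) => H.fderiv_zero_eq_zero hk hU hy
  have hp := fun y (hy : y ∈ U) => H.of_fderiv_zero hy (hz y hy).1 (hz y hy).2
  -- Along `x` the third coordinate of `f` is affine with slope `±1`, and its `s`-derivative does
  -- not depend on `x`. Comparing the coefficients of `x` in the second derivative along `s` gives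
  -- `k = k' S²`.
  have hkk : ∀ y ∈ U, k = k' * fderiv ℝ f y ![1, 0, 0] 0 ^ 2 := by
    intro y hy
    obtain ⟨δ, hδ, hy'⟩ := exists_shift H.isOpen hy
    have hXx : ∀ y ∈ U, HasDerivAt (fun r : ℝ => fderiv ℝ f (y + r • (![0, 0, 1] : E3)) ![0, 0, 1] 2) 0 0 :=
      fun y hy => by
        refine (H.hasDerivAt_partial hy ![0, 0, 1] ![0, 0, 1] 2).congr_deriv ?_
        simp [christoffel, (hz y hy).2, clm_vec_zero]
    have h1 := eq_of_hasDerivAt_zero hU (z := ![0, 0, 1])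
      (h := fun y => fderiv ℝ f y ![0, 0, 1] 2) hXx hy hy'
    have h2 := eq_of_hasDerivAt_zero hU (z := ![0, 0, 1])
      (h := fun y => f y 2 - fderiv ℝ f y ![0, 0, 1] 2 * y 2) (fun y hy => by
        refine ((hasDerivAt_pi.1 (H.hasDerivAt_comp hy ![0, 0, 1]) 2).sub
          ((hXx y hy).mul (hasDerivAt_line y ![0, 0, 1] 2))).congr_deriv ?_
        simp) hy hy'
    have h3 := eq_of_hasDerivAt_zero hU (z := ![0, 0, 1])
      (h := fun y => fderiv ℝ f y ![1, 0, 0] 0) (fun y hy => by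
        refine (H.hasDerivAt_partial hy ![0, 0, 1] ![1, 0, 0] 0).congr_deriv ?_
        simp [christoffel, (hz y hy).2]
        rw [clm_vec, (hz y hy).1]
        ring) hy hy'
    have hXs : ∀ y ∈ U, HasDerivAt (fun r : ℝ => fderiv ℝ f (y + r • (![0, 0, 1] : E3)) ![1, 0, 0] 2) 0 0 :=
      fun y hy => by
        refine (H.hasDerivAt_partial hy ![0, 0, 1] ![1, 0, 0] 2).congr_deriv ?_
        simp [christoffel, (hz y hy).2]
        rw [clm_vec, (hp y hy).2.2]
        ring
    have h4 := eq_of_hasDerivAt_zero hU (z := ![0, 0, 1])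
      (h := fun y => fderiv ℝ f y ![1, 0, 0] 2) hXs hy hy'
    have h5 := deriv_eq_of_hasDerivAt_zero hU H.isOpen (z := ![0, 0, 1]) (e := ![1, 0, 0])
      (h := fun y => fderiv ℝ f y ![1, 0, 0] 2)
      (h' := fun y => b * fderiv ℝ f y ![1, 0, 0] 2 - k * y 2 * fderiv ℝ f y ![0, 0, 1] 2
        + k' * f y 2 * fderiv ℝ f y ![1, 0, 0] 0 ^ 2) hXs
      (fun y hy => by
        refine (H.hasDerivAt_partial hy ![1, 0, 0] ![1, 0, 0] 2).congr_deriv ?_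
        simp [christoffel]
        rw [clm_vec, (hp y hy).2.2]
        ring) hy hy'
    have e2 : (y + δ • (![0, 0, 1] : E3)) 2 = y 2 + δ := by simp
    rw [h1, e2] at h2
    rw [h1, h3, h4, e2] at h5
    have hne : fderiv ℝ f y ![0, 0, 1] 2 ≠ 0 := by
      intro h
      have := (hp y hy).2.1
      simp [h] at this
    have h6 : δ * fderiv ℝ f y ![0, 0, 1] 2 * (k' * fderiv ℝ f y ![1, 0, 0] 0 ^ 2 - k) = 0 := by
      have : f (y + δ • ![0, 0, 1]) 2 = f y 2 + fderiv ℝ f y ![0, 0, 1] 2 * δ := by linarith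
      rw [this] at h5
      linarith
    have h7 : k' * fderiv ℝ f y ![1, 0, 0] 0 ^ 2 - k = 0 := by simpa [hδ, hne] using h6
    linarith
  refine ⟨hkk y hy, ?_⟩
  have hd := H.hasDerivAt_partial hy ![1, 0, 0] ![1, 0, 0] 0
  -- Since `k' S²` is constant, so is `S` along `s`; but the Hessian formula gives it the derivative
  -- `b S - b' S²`, and `S ≠ 0`.
  have h8 : HasDerivAt (fun r : ℝ => k' * fderiv ℝ f (y + r • (![1, 0, 0] : E3)) ![1, 0, 0] 0 ^ 2) 0 0 := by
    refine (hasDerivAt_const (0 : ℝ) k).congr_of_eventuallyEq ?_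
    have hc : Filter.Tendsto (fun r : ℝ => y + r • (![1, 0, 0] : E3)) (𝓝 0) (𝓝 y) := by
      have := (hasDerivAt_add_smul y ![1, 0, 0]).continuousAt.tendsto
      simpa using this
    filter_upwards [hc.eventually (H.isOpen.mem_nhds hy)] with r hr
    exact (hkk _ hr).symm
  have h9 := h8.unique ((hd.pow 2).const_mul k')
  have hk' : k' ≠ 0 := fun h => hk (by rw [hkk y hy, h]; ring)
  have hS := (hp y hy).1
  simp [christoffel, hk'] at h9
  have h10 : fderiv ℝ f y ![1, 0, 0] 0 * (b - b' * fderiv ℝ f y ![1, 0, 0] 0) = 0 := by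
    rcases h9 with h | h
    · exact absurd h hS
    · rw [clm_vec, (hz y hy).1, (hz y hy).2] at h
      linarith
  have := (mul_eq_zero.1 h10).resolve_left hS
  linarith

theorem eq_of_ne_zero (H : IsModelIsom b k b' k' f U) (hk : k ≠ 0) {y : E3} (hy : y ∈ U) :
    fderiv ℝ f y ![0, 1, 0] 0 = 0 ∧ fderiv ℝ f y ![0, 0, 1] 0 = 0 ∧
    k = k' * fderiv ℝ f y ![1, 0, 0] 0 ^ 2 ∧ b = b' * fderiv ℝ f y ![1, 0, 0] 0 := by
  obtain ⟨ε, hε, hb⟩ := Metric.isOpen_iff.1 H.isOpen y hy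
  have H' := H.mono Metric.isOpen_ball hb
  have h1 := H'.fderiv_zero_eq_zero hk (convex_ball y ε) (Metric.mem_ball_self hε)
  exact ⟨h1.1, h1.2, H'.eq_of_convex hk (convex_ball y ε) (Metric.mem_ball_self hε)⟩

end IsModelIsom

end PlaneWave
end

noncomputable section
namespace PlaneWave

/-! ### Global isometries of the models -/

/-- An isometry between two models from two inverse smooth maps. -/
def isomOfInverse {b k b' k' : ℝ} (f g : E3 → E3) (hf : ContDiff ℝ ∞ f) (hg : ContDiff ℝ ∞ g)
    (hl : ∀ y, g (f y) = y) (hr : ∀ y, f (g y) = y)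
    (h : ∀ y v w, modelForm b' k' (f y) (fderiv ℝ f y v) (fderiv ℝ f y w) = modelForm b k y v w) :
    Isom (model b k) (model b' k') :=
  ⟨diffeoOfInverse f g hf hg hl hr, preservesMetric_iff_fderiv.2 h⟩

/-- The elements of the group as isometries of the model. -/
def actIsom {b k : ℝ} (a : HeisExt (nf b k)) : Isom (model b k) (model b k) :=
  isomOfInverse (act a) (act a⁻¹) (contDiff_act a) (contDiff_act _) (act_inv_act a) (act_act_inv a)
    (modelForm_act a)

theorem Isom.isModelIsom {b k b' k' : ℝ} (f : Isom (model b k) (model b' k')) :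
    IsModelIsom b k b' k' f.1 Set.univ :=
  ⟨isOpen_univ, f.1.contMDiff.contDiff.contDiffOn, fun y _ => preservesMetric_iff_fderiv.1 f.2 y⟩

theorem IsPartialIsom.isModelIsom {b k b' k' : ℝ} {e : OpenPartialHomeomorph E3 E3}
    (h : IsPartialIsom (model b k) (model b' k') e) : IsModelIsom b k b' k' e e.source :=
  ⟨e.open_source, contMDiffOn_iff_contDiffOn.1 h.1, fun y hy v w => by
    have h1 := h.2.2 y hy v w
    rw [mfderiv_eq_fderiv] at h1
    exact h1⟩

/-- The map `(s, v, x) ↦ (λ s, λ v, ε x)`. -/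
def flip (l ε : ℝ) (y : E3) : E3 := ![l * y 0, l * y 1, ε * y 2]

theorem contDiff_flip (l ε : ℝ) : ContDiff ℝ ∞ (flip l ε) :=
  contDiff_of_components (by fun_prop) (by fun_prop) (by fun_prop)

theorem fderiv_flip (l ε : ℝ) (y v : E3) : fderiv ℝ (flip l ε) y v = flip l ε v :=
  fderiv_apply_eq_of_hasDerivAt ((contDiff_flip l ε).differentiable (by simp) y)
    ((hasDerivAt_line y v 0).const_mul l) ((hasDerivAt_line y v 1).const_mul l)
    ((hasDerivAt_line y v 2).const_mul ε)

theorem flip_flip {l ε : ℝ} (hl : l ^ 2 = 1) (hε : ε ^ 2 = 1) (y : E3) : flip l ε (flip l ε y) = y := by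
  refine ext_E3 ?_ ?_ ?_ <;> simp only [flip, Matrix.cons_val_zero, Matrix.cons_val_one, Matrix.cons_val]
  · linear_combination y 0 * hl
  · linear_combination y 1 * hl
  · linear_combination y 2 * hε

theorem modelForm_flip {b l ε : ℝ} (k : ℝ) (hb : b = b * l) (hl : l ^ 2 = 1) (hε : ε ^ 2 = 1)
    (y v w : E3) : modelForm b k (flip l ε y) (flip l ε v) (flip l ε w) = modelForm b k y v w := by
  rw [modelForm_apply, modelForm_apply]
  simp only [flip, Matrix.cons_val_zero, Matrix.cons_val_one, Matrix.cons_val]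
  rw [← mul_assoc b l, ← hb]
  linear_combination (Real.exp (b * y 0) * (v 0 * w 1 + v 1 * w 0) + k * (ε * y 2) ^ 2 * (v 0 * w 0)) * hl
    + (v 2 * w 2 + k * y 2 ^ 2 * v 0 * w 0) * hε

/-- The isometries `(s, v, x) ↦ (λ s, λ v, ε x)` of the model. -/
def flipIsom {b k l ε : ℝ} (hb : b = b * l) (hl : l ^ 2 = 1) (hε : ε ^ 2 = 1) :
    Isom (model b k) (model b k) :=
  isomOfInverse (flip l ε) (flip l ε) (contDiff_flip l ε) (contDiff_flip l ε) (flip_flip hl hε)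
    (flip_flip hl hε) (fun y v w => by
      rw [fderiv_flip, fderiv_flip, modelForm_flip k hb hl hε])

theorem eq_of_line {h : E3 → ℝ} {z : E3} (hd : ∀ y, HasDerivAt (fun r : ℝ => h (y + r • z)) 0 0)
    (y : E3) (δ : ℝ) : h (y + δ • z) = h y :=
  eq_of_hasDerivAt_zero convex_univ (fun y _ => hd y) trivial trivial

theorem eq_of_lines {h : E3 → ℝ} (h0 : ∀ y, HasDerivAt (fun r : ℝ => h (y + r • (![1, 0, 0] : E3))) 0 0)
    (h1 : ∀ y, HasDerivAt (fun r : ℝ => h (y + r • (![0, 1, 0] : E3))) 0 0)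
    (h2 : ∀ y, HasDerivAt (fun r : ℝ => h (y + r • (![0, 0, 1] : E3))) 0 0) (y : E3) : h y = h 0 := by
  have e : y = 0 + y 0 • (![1, 0, 0] : E3) + y 1 • (![0, 1, 0] : E3) + y 2 • (![0, 0, 1] : E3) := by
    refine ext_E3 ?_ ?_ ?_ <;> simp
  rw [e, eq_of_line h2, eq_of_line h1, eq_of_line h0]

theorem eq_zero_of_affine_pos {A B : ℝ} (h : ∀ r : ℝ, 0 < A + B * r) : B = 0 := by
  by_contra hB
  have := h (-A / B)
  have e : B * (-A / B) = -A := by field_simp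
  rw [e] at this
  linarith

/-- Derivatives along a line at any of its points. -/
theorem HasDerivAt.of_line {h h' : E3 → ℝ} {z : E3}
    (hd : ∀ y, HasDerivAt (fun r : ℝ => h (y + r • z)) (h' y) 0) (y : E3) (r : ℝ) :
    HasDerivAt (fun r : ℝ => h (y + r • z)) (h' (y + r • z)) r := by
  have h1 := hd (y + r • z)
  have h3 : HasDerivAt (fun σ : ℝ => h (y + r • z + σ • z)) (h' (y + r • z)) (r - r) := by
    simpa using h1
  have h4 := h3.comp_sub_const r r
  refine h4.congr_of_eventuallyEq (Filter.Eventually.of_forall fun σ => ?_)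
  simp only
  rw [add_assoc, ← add_smul]
  congr 3
  ring

namespace IsModelIsom

variable {b k b' k' : ℝ} {f : E3 → E3}

/-- A global isometry between two flat models, the second one incomplete. -/
theorem eq_of_flat (H : IsModelIsom b 0 b' 0 f Set.univ) (hb' : b' ≠ 0) (hsurj : Function.Surjective f) :
    ∃ l : ℝ, b = b' * l ∧ ∀ y, fderiv ℝ f y ![0, 1, 0] 0 = 0 ∧ fderiv ℝ f y ![0, 0, 1] 0 = 0 ∧
      fderiv ℝ f y ![1, 0, 0] 0 = l := by
  set α : E3 → E3 → ℝ := fun v y => Real.exp (b' * f y 0) * fderiv ℝ f y v 0 with hα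
  have hθ : ∀ y z v, HasDerivAt (fun r : ℝ => α v (y + r • z)) (b * (z 0 * v 0) * α ![1, 0, 0] y) 0 := by
    intro y z v
    refine (H.hasDerivAt_theta (Set.mem_univ y) z v).congr_deriv ?_
    simp [christoffel]
    rw [clm_vec]
    simp [hα]
    ring
  have hG : ∀ y z, HasDerivAt (fun r : ℝ => Real.exp (b' * f (y + r • z) 0)) (b' * α z y) 0 := by
    intro y z
    refine ((hasDerivAt_pi.1 (H.hasDerivAt_comp (Set.mem_univ y) z) 0).const_mul b').exp.congr_deriv ?_
    simp [hα]
    ring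
  -- Up to a constant, `e^{b' f₀}` is the coordinate `u` of half Minkowski space. On lines inside a
  -- leaf `s = const` it is affine and positive, hence constant.
  have hz : ∀ z : E3, z 0 = 0 → ∀ y, fderiv ℝ f y z 0 = 0 := by
    intro z hz y
    have h1 : ∀ r : ℝ, α z (y + r • z) = α z y := fun r => eq_of_line (h := α z) (z := z)
      (fun y => by simpa [hz] using hθ y z z) y r
    have h2 : ∀ r : ℝ, Real.exp (b' * f (y + r • z) 0) - r * (b' * α z y) = Real.exp (b' * f y 0) := by
      intro r
      have hd : ∀ r, HasDerivAt (fun r : ℝ => Real.exp (b' * f (y + r • z) 0) - r * (b' * α z y)) 0 r := by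
        intro r
        have := HasDerivAt.of_line (h := fun y => Real.exp (b' * f y 0)) (h' := fun y => b' * α z y)
          (fun y => hG y z) y r
        refine (this.sub ((hasDerivAt_id r).mul_const _)).congr_deriv ?_
        rw [h1]
        ring
      have := is_const_of_deriv_eq_zero (fun r => (hd r).differentiableAt) (fun r => (hd r).deriv) r 0
      simpa using this
    have h3 : b' * α z y = 0 := eq_zero_of_affine_pos (A := Real.exp (b' * f y 0)) fun r => by
      have := h2 r
      have := Real.exp_pos (b' * f (y + r • z) 0)
      linarith
    simpa [hα, hb'] using h3
  have hv := hz ![0, 1, 0] rfl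
  have hx := hz ![0, 0, 1] rfl
  have hs : ∀ y, fderiv ℝ f y ![1, 0, 0] 0 ≠ 0 := fun y =>
    (H.of_fderiv_zero (Set.mem_univ y) (hv y) (hx y)).1
  set a := α ![1, 0, 0] 0 with ha
  have ha0 : a ≠ 0 := by simp [ha, hα, hs]
  have hline : ∀ y : E3, y = 0 + y 0 • (![1, 0, 0] : E3) + y 1 • (![0, 1, 0] : E3)
      + y 2 • (![0, 0, 1] : E3) := fun y => by
    refine ext_E3 ?_ ?_ ?_ <;> simp
  have hGs : ∀ y, Real.exp (b' * f y 0) = Real.exp (b' * f (0 + y 0 • (![1, 0, 0] : E3)) 0) := by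
    intro y
    nth_rewrite 1 [hline y]
    rw [eq_of_line (h := fun y => Real.exp (b' * f y 0)) (z := ![0, 0, 1]) (fun y => by
      simpa [hα, hx] using hG y ![0, 0, 1]), eq_of_line (h := fun y => Real.exp (b' * f y 0))
      (z := ![0, 1, 0]) (fun y => by simpa [hα, hv] using hG y ![0, 1, 0])]
  have hαs : ∀ r : ℝ, α ![1, 0, 0] (0 + r • ![1, 0, 0]) = a * Real.exp (b * r) := by
    intro r
    have hd : ∀ r, HasDerivAt (fun r : ℝ => α ![1, 0, 0] (0 + r • ![1, 0, 0]) * Real.exp (-(b * r))) 0 r := by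
      intro r
      have h1 := HasDerivAt.of_line (h := α ![1, 0, 0]) (h' := fun y => b * α ![1, 0, 0] y)
        (z := ![1, 0, 0]) (fun y => by simpa using hθ y ![1, 0, 0] ![1, 0, 0]) 0 r
      refine (h1.mul ((hasDerivAt_id r).const_mul b).neg.exp).congr_deriv ?_
      simp
      ring
    have h2 := is_const_of_deriv_eq_zero (fun r => (hd r).differentiableAt) (fun r => (hd r).deriv) r 0
    have E : Real.exp (-(b * r)) * Real.exp (b * r) = 1 := by rw [← Real.exp_add]; simp
    simp at h2
    rw [ha, ← h2, mul_assoc]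
    simp [E]
  have hGd : ∀ r : ℝ, HasDerivAt (fun r : ℝ => Real.exp (b' * f (0 + r • (![1, 0, 0] : E3)) 0))
      (b' * (a * Real.exp (b * r))) r := by
    intro r
    have := HasDerivAt.of_line (h := fun y => Real.exp (b' * f y 0)) (h' := fun y => b' * α ![1, 0, 0] y)
      (z := ![1, 0, 0]) (fun y => hG y _) 0 r
    rwa [hαs] at this
  -- For `b = 0` the function `e^{b' f₀}` would be affine in `s` as well, positive and of nonzero
  -- slope.
  have hb : b ≠ 0 := by
    rintro rfl
    have hd : ∀ r, HasDerivAt (fun r : ℝ => Real.exp (b' * f (0 + r • (![1, 0, 0] : E3)) 0)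
        - b' * a * r) 0 r := fun r => by
      refine ((hGd r).sub ((hasDerivAt_id r).const_mul (b' * a))).congr_deriv ?_
      simp
    have h3 : b' * a = 0 := eq_zero_of_affine_pos (A := Real.exp (b' * f 0 0)) fun r => by
      have h2 := is_const_of_deriv_eq_zero (fun r => (hd r).differentiableAt) (fun r => (hd r).deriv) r 0
      simp at h2
      have h4 := Real.exp_pos (b' * f (r • (![1, 0, 0] : E3)) 0)
      simp at h4
      linarith
    simp [hb', ha0] at h3
  set P := b' * a / b with hP
  have hP0 : P ≠ 0 := by simp [hP, hb, hb', ha0]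
  obtain ⟨q, hq⟩ : ∃ q, ∀ r : ℝ, Real.exp (b' * f (0 + r • (![1, 0, 0] : E3)) 0)
      = P * Real.exp (b * r) + q := by
    refine ⟨Real.exp (b' * f 0 0) - P, fun r => ?_⟩
    have hd : ∀ r, HasDerivAt (fun r : ℝ => Real.exp (b' * f (0 + r • (![1, 0, 0] : E3)) 0)
        - P * Real.exp (b * r)) 0 r := fun r => by
      refine ((hGd r).sub ((((hasDerivAt_id r).const_mul b).exp).const_mul P)).congr_deriv ?_
      simp [hP]
      field_simp
      ring
    have h2 := is_const_of_deriv_eq_zero (fun r => (hd r).differentiableAt) (fun r => (hd r).deriv) r 0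
    simp at h2
    simp
    linarith
  have hpos : ∀ x : ℝ, 0 < x → 0 < P * x + q := by
    intro x hx
    have h1 := hq (Real.log x / b)
    have h2 : b * (Real.log x / b) = Real.log x := by field_simp
    rw [h2, Real.exp_log hx] at h1
    rw [← h1]
    exact Real.exp_pos _
  have hPpos : 0 < P := by
    by_contra! h
    have hlt : P < 0 := lt_of_le_of_ne h hP0
    have h1 := hpos ((|q| + 1) / (-P)) (by have := abs_nonneg q; exact div_pos (by linarith) (by linarith))
    have h2 : P * ((|q| + 1) / (-P)) = -(|q| + 1) := by field_simp
    rw [h2] at h1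
    have := le_abs_self q
    linarith
  -- Now `e^{b' f₀} = P e^{bs} + q` with `P > 0`. Positivity excludes `q < 0`; if `q > 0`, the value
  -- `q` of `e^{b' f₀}` would be missed, against surjectivity of `f`.
  have hq0 : q = 0 := by
    rcases lt_trichotomy q 0 with h | h | h
    · have h1 := hpos (-q / (2 * P)) (div_pos (by linarith) (by linarith))
      have h2 : P * (-q / (2 * P)) = -q / 2 := by field_simp
      rw [h2] at h1
      linarith
    · exact h
    · obtain ⟨y, hy⟩ := hsurj ![Real.log q / b', 0, 0]
      have h1 := hGs y
      rw [hq, hy] at h1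
      have h2 : b' * (![Real.log q / b', 0, 0] : E3) 0 = Real.log q := by
        simp
        field_simp
      rw [h2, Real.exp_log h] at h1
      have := mul_pos hPpos (Real.exp_pos (b * y 0))
      linarith
  refine ⟨b / b', by field_simp, fun y => ⟨hv y, hx y, ?_⟩⟩
  have h1 : α ![1, 0, 0] y = a * Real.exp (b * y 0) := by
    rw [← hαs]
    nth_rewrite 1 [hline y]
    rw [eq_of_line (h := α ![1, 0, 0]) (z := ![0, 0, 1]) (fun y => by
      simpa using hθ y ![0, 0, 1] ![1, 0, 0]), eq_of_line (h := α ![1, 0, 0])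
      (z := ![0, 1, 0]) (fun y => by simpa using hθ y ![0, 1, 0] ![1, 0, 0])]
  have h2 : Real.exp (b' * f y 0) = P * Real.exp (b * y 0) := by
    rw [hGs, hq, hq0, add_zero]
  simp only [hα] at h1
  rw [h2] at h1
  have h3 : P * fderiv ℝ f y ![1, 0, 0] 0 = a := by
    have hE := (Real.exp_pos (b * y 0)).ne'
    apply mul_right_cancel₀ hE
    linarith
  rw [hP] at h3
  field_simp at h3 ⊢
  linarith

end IsModelIsom

/-- The shape of a global isometry onto a model that is not Minkowski space. -/
theorem Isom.exists_eq {b k b' k' : ℝ} (f : Isom (model b k) (model b' k')) (h : b' ≠ 0 ∨ k' ≠ 0) :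
    ∃ l : ℝ, l ≠ 0 ∧ b = b' * l ∧ k = k' * l ^ 2 ∧ ∀ y : E3, fderiv ℝ f.1 y ![0, 1, 0] 0 = 0 ∧
      fderiv ℝ f.1 y ![0, 0, 1] 0 = 0 ∧ fderiv ℝ f.1 y ![1, 0, 0] 0 = l := by
  have H := f.isModelIsom
  suffices hs : ∃ l : ℝ, b = b' * l ∧ k = k' * l ^ 2 ∧ ∀ y : E3, fderiv ℝ f.1 y ![0, 1, 0] 0 = 0 ∧
      fderiv ℝ f.1 y ![0, 0, 1] 0 = 0 ∧ fderiv ℝ f.1 y ![1, 0, 0] 0 = l by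
    obtain ⟨l, h1, h2, h3⟩ := hs
    refine ⟨l, ?_, h1, h2, h3⟩
    rw [← (h3 0).2.2]
    exact (H.of_fderiv_zero (Set.mem_univ 0) (h3 0).1 (h3 0).2.1).1
  by_cases hk : k = 0
  · subst hk
    have hk' : k' = 0 := by
      by_contra hk'
      have := f.symm.isModelIsom.eq_of_ne_zero hk' (Set.mem_univ 0)
      apply hk'
      rw [this.2.2.1]
      ring
    subst hk'
    obtain ⟨l, h1, h2⟩ := H.eq_of_flat (by simpa using h) f.1.toEquiv.surjective
    exact ⟨l, h1, by ring, h2⟩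
  · have h1 := fun y => H.eq_of_ne_zero hk (Set.mem_univ y)
    -- The relation `b = b' S` cancels the Christoffel terms of source and target in the derivative
    -- of `S` along `s`, so `S` is a constant.
    have hc := fun y => eq_of_lines (h := fun y => fderiv ℝ f.1 y ![1, 0, 0] 0)
      (fun y => by
        refine (H.hasDerivAt_partial (Set.mem_univ y) ![1, 0, 0] ![1, 0, 0] 0).congr_deriv ?_
        simp [christoffel]
        rw [clm_vec, (h1 y).1, (h1 y).2.1]
        linear_combination fderiv ℝ f.1 y ![1, 0, 0] 0 * (h1 y).2.2.2)
      (fun y => by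
        refine (H.hasDerivAt_partial (Set.mem_univ y) ![0, 1, 0] ![1, 0, 0] 0).congr_deriv ?_
        simp [christoffel, clm_vec_zero, (h1 y).1])
      (fun y => by
        refine (H.hasDerivAt_partial (Set.mem_univ y) ![0, 0, 1] ![1, 0, 0] 0).congr_deriv ?_
        simp [christoffel, (h1 y).2.1]
        rw [clm_vec, (h1 y).1]
        ring) y
    exact ⟨_, (h1 0).2.2.2, (h1 0).2.2.1, fun y => ⟨(h1 y).1, (h1 y).2.1, hc y⟩⟩

/-- The shape of an isometry is known only when its target is not Minkowski space; in the remaining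
case it is applied to the inverse, which shows that both models are Minkowski space. -/
theorem exists_eq_of_isometric {b k b' k' : ℝ} (h : Isometric (model b k) (model b' k')) :
    ∃ l : ℝ, l ≠ 0 ∧ b = l * b' ∧ k = l ^ 2 * k' := by
  obtain ⟨f⟩ := h
  by_cases h' : b' ≠ 0 ∨ k' ≠ 0
  · obtain ⟨l, hl, h1, h2, -⟩ := f.exists_eq h'
    exact ⟨l, hl, by rw [h1]; ring, by rw [h2]; ring⟩
  · push Not at h'
    obtain ⟨rfl, rfl⟩ := h'
    by_cases h'' : b ≠ 0 ∨ k ≠ 0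
    · obtain ⟨l, hl, h1, h2, -⟩ := f.symm.exists_eq h''
      refine ⟨1, one_ne_zero, ?_, ?_⟩
      · simpa [hl] using h1.symm
      · simpa [hl] using h2.symm
    · push Not at h''
      exact ⟨1, one_ne_zero, by simp [h''.1], by simp [h''.2]⟩

end PlaneWave
end

noncomputable section
namespace PlaneWave

/-! ### The isometry group of a model -/

theorem fderiv_act_flip {b k : ℝ} (a : HeisExt (nf b k)) (l ε : ℝ) (y v : E3) :
    fderiv ℝ (fun y => act a (flip l ε y)) y v = fderiv ℝ (act a) (flip l ε y) (flip l ε v) := by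
  have h := fderiv_comp y ((contDiff_act a).differentiable (by simp) (flip l ε y))
    ((contDiff_flip l ε).differentiable (by simp) y)
  have hv := congrArg (fun L => L v) h
  simp only [ContinuousLinearMap.comp_apply, fderiv_flip] at hv
  exact hv

/-- Two isometries that agree in the coordinates `s` and `x` differ by a translation along `v`. -/
theorem IsModelIsom.exists_sub_eq {b k b' k' : ℝ} {f g : E3 → E3}
    (hf : IsModelIsom b k b' k' f Set.univ) (hg : IsModelIsom b k b' k' g Set.univ)
    (h0 : ∀ y, f y 0 = g y 0) (h2 : ∀ y, f y 2 = g y 2)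
    (hv : ∀ y, fderiv ℝ f y ![0, 1, 0] 0 = 0) (hx : ∀ y, fderiv ℝ f y ![0, 0, 1] 0 = 0) :
    ∃ d, ∀ y, f y 1 = g y 1 + d := by
  have hd : ∀ {i : Fin 3}, (∀ y, f y i = g y i) → ∀ y z, fderiv ℝ g y z i = fderiv ℝ f y z i := by
    intro i hi y z
    have h3 := hasDerivAt_pi.1 (hf.hasDerivAt_comp (Set.mem_univ y) z) i
    have h4 := hasDerivAt_pi.1 (hg.hasDerivAt_comp (Set.mem_univ y) z) i
    simp only [hi] at h3
    exact h4.unique h3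
  have hd0 := hd h0
  have hd2 := hd h2
  have key : ∀ y z, fderiv ℝ f y z 1 = fderiv ℝ g y z 1 := by
    intro y z
    have hs := (hf.of_fderiv_zero (Set.mem_univ y) (hv y) (hx y)).1
    have hE := (Real.exp_pos (b' * f y 0)).ne'
    -- The two pulled-back metrics agree and so do the other coordinates. Testing on `∂_s` twice
    -- determines the derivative of the `v`-coordinate along `s`; testing on `∂_s` and `z`
    -- determines the rest.
    have main : ∀ z, fderiv ℝ f y ![1, 0, 0] 0 * fderiv ℝ f y z 1
        + fderiv ℝ f y ![1, 0, 0] 1 * fderiv ℝ f y z 0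
        = fderiv ℝ f y ![1, 0, 0] 0 * fderiv ℝ g y z 1
        + fderiv ℝ g y ![1, 0, 0] 1 * fderiv ℝ f y z 0 := by
      intro z
      have e1 := hf.form y trivial ![1, 0, 0] z
      have e2 := hg.form y trivial ![1, 0, 0] z
      rw [← e2, modelForm_apply, modelForm_apply, ← h0, ← h2, hd0, hd0, hd2, hd2] at e1
      apply mul_left_cancel₀ hE
      linarith
    have m0 : fderiv ℝ f y ![1, 0, 0] 1 = fderiv ℝ g y ![1, 0, 0] 1 := by
      have := main ![1, 0, 0]
      apply mul_left_cancel₀ hs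
      linarith
    apply mul_left_cancel₀ hs
    have := main z
    rw [m0] at this
    linarith
  have hdz : ∀ z y, HasDerivAt (fun r : ℝ => f (y + r • z) 1 - g (y + r • z) 1) 0 0 := fun z y => by
    refine ((hasDerivAt_pi.1 (hf.hasDerivAt_comp (Set.mem_univ y) z) 1).sub
      (hasDerivAt_pi.1 (hg.hasDerivAt_comp (Set.mem_univ y) z) 1)).congr_deriv ?_
    rw [key, sub_self]
  refine ⟨f 0 1 - g 0 1, fun y => ?_⟩
  have := eq_of_lines (h := fun y => f y 1 - g y 1) (hdz _) (hdz _) (hdz _) y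
  linarith

/-- The isometries of a model that is not Minkowski space. -/
theorem Isom.exists_eq_act {b k : ℝ} (f : Isom (model b k) (model b k)) (h : b ≠ 0 ∨ k ≠ 0) :
    ∃ (l ε : ℝ) (a : HeisExt (nf b k)), l ^ 2 = 1 ∧ ε ^ 2 = 1 ∧ b = b * l ∧
      ∀ y, f.1 y = act a (flip l ε y) := by
  obtain ⟨l, hl0, hb, hk, hS⟩ := f.exists_eq h
  have H := f.isModelIsom
  have hU := fun y => Set.mem_univ (α := E3) y
  have hl : l ^ 2 = 1 := by
    by_cases hb0 : b = 0
    · have hk0 : k ≠ 0 := by simpa [hb0] using h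
      have : k * (l ^ 2 - 1) = 0 := by linarith
      have := (mul_eq_zero.1 this).resolve_left hk0
      linarith
    · have : b * (l - 1) = 0 := by linarith
      have := (mul_eq_zero.1 this).resolve_left hb0
      rw [show l = 1 by linarith]
      ring
  have hp := fun y => H.of_fderiv_zero (hU y) (hS y).1 (hS y).2.1
  set F : E3 → E3 := ⇑f.1 with hF
  have hXx := eq_of_lines (h := fun y => fderiv ℝ F y ![0, 0, 1] 2)
    (fun y => by
      refine (H.hasDerivAt_partial (hU y) ![1, 0, 0] ![0, 0, 1] 2).congr_deriv ?_
      simp [christoffel, (hS y).2.1]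
      rw [clm_vec, (hp y).2.2]
      ring)
    (fun y => by
      refine (H.hasDerivAt_partial (hU y) ![0, 1, 0] ![0, 0, 1] 2).congr_deriv ?_
      simp [christoffel, clm_vec_zero, (hS y).2.1])
    (fun y => by
      refine (H.hasDerivAt_partial (hU y) ![0, 0, 1] ![0, 0, 1] 2).congr_deriv ?_
      simp [christoffel, clm_vec_zero, (hS y).2.1])
  set ε := fderiv ℝ F 0 ![0, 0, 1] 2 with hε
  have hε1 : ε ^ 2 = 1 := (hp 0).2.1
  have hF0 : ∀ y, F y 0 = l * y 0 + F 0 0 := by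
    intro y
    have := eq_of_lines (h := fun y => F y 0 - l * y 0)
      (fun y => by
        refine ((hasDerivAt_pi.1 (H.hasDerivAt_comp (hU y) ![1, 0, 0]) 0).sub
          ((hasDerivAt_line y ![1, 0, 0] 0).const_mul l)).congr_deriv ?_
        simp [(hS y).2.2])
      (fun y => by
        refine ((hasDerivAt_pi.1 (H.hasDerivAt_comp (hU y) ![0, 1, 0]) 0).sub
          ((hasDerivAt_line y ![0, 1, 0] 0).const_mul l)).congr_deriv ?_
        simp [(hS y).1])
      (fun y => by
        refine ((hasDerivAt_pi.1 (H.hasDerivAt_comp (hU y) ![0, 0, 1]) 0).sub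
          ((hasDerivAt_line y ![0, 0, 1] 0).const_mul l)).congr_deriv ?_
        simp [(hS y).2.1]) y
    simp at this
    linarith
  -- The third coordinate of the isometry is `ε x + φ(s)`, and the Hessian formula turns into `φ'' =
  -- b φ' + k φ`.
  set φ : ℝ → ℝ := fun s => F (0 + s • (![1, 0, 0] : E3)) 2 with hφ
  have hF2 : ∀ y, F y 2 = ε * y 2 + φ (y 0) := by
    intro y
    have e : y = 0 + y 0 • (![1, 0, 0] : E3) + y 1 • (![0, 1, 0] : E3) + y 2 • (![0, 0, 1] : E3) := by
      refine ext_E3 ?_ ?_ ?_ <;> simp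
    have h1 := eq_of_line (h := fun y => F y 2 - ε * y 2) (z := ![0, 1, 0])
      (fun y => by
        refine ((hasDerivAt_pi.1 (H.hasDerivAt_comp (hU y) ![0, 1, 0]) 2).sub
          ((hasDerivAt_line y ![0, 1, 0] 2).const_mul ε)).congr_deriv ?_
        simp [(hp y).2.2])
    have h2 := eq_of_line (h := fun y => F y 2 - ε * y 2) (z := ![0, 0, 1])
      (fun y => by
        refine ((hasDerivAt_pi.1 (H.hasDerivAt_comp (hU y) ![0, 0, 1]) 2).sub
          ((hasDerivAt_line y ![0, 0, 1] 2).const_mul ε)).congr_deriv ?_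
        simp [hXx y])
    have h3 : F y 2 - ε * y 2 = φ (y 0) := by
      have h4 := (h2 (0 + y 0 • (![1, 0, 0] : E3) + y 1 • (![0, 1, 0] : E3)) (y 2)).trans (h1 _ _)
      rw [← e] at h4
      rw [h4, hφ]
      simp
    linarith
  have hφ1 : ∀ s, HasDerivAt φ (fderiv ℝ F (0 + s • (![1, 0, 0] : E3)) ![1, 0, 0] 2) s :=
    HasDerivAt.of_line (h := fun y => F y 2) (h' := fun y => fderiv ℝ F y ![1, 0, 0] 2)
      (fun y => hasDerivAt_pi.1 (H.hasDerivAt_comp (hU y) ![1, 0, 0]) 2) 0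
  set φ' : ℝ → ℝ := fun s => fderiv ℝ F (0 + s • (![1, 0, 0] : E3)) ![1, 0, 0] 2 with hφ'
  have hφ2 : ∀ s, HasDerivAt φ' (b * φ' s + k * φ s) s := by
    intro s
    have := HasDerivAt.of_line (h := fun y => fderiv ℝ F y ![1, 0, 0] 2)
      (h' := fun y => b * fderiv ℝ F y ![1, 0, 0] 2 - k * y 2 * ε + k * F y 2)
      (z := ![1, 0, 0]) (fun y => by
        refine (H.hasDerivAt_partial (hU y) ![1, 0, 0] ![1, 0, 0] 2).congr_deriv ?_
        simp [christoffel]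
        rw [clm_vec, (hp y).2.2, hXx y, (hS y).2.2]
        linear_combination k * F y 2 * hl) 0 s
    refine this.congr_deriv ?_
    simp [hφ', hφ]
  set c := F 0 0 with hc
  -- The reparametrization undoes the affine change `s ↦ l s + c` of the first coordinate. The
  -- equation keeps its form because `l² = 1` and `b l = b`.
  have hψ := eq_sol b k (y := fun σ => φ (l * (σ - c))) (y' := fun σ => l * φ' (l * (σ - c)))
    (fun σ => by
      have h1 : HasDerivAt (fun σ => l * (σ - c)) l σ := by
        simpa using ((hasDerivAt_id σ).sub_const c).const_mul l
      exact ((hφ1 _).comp σ h1).congr_deriv (mul_comm _ _))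
    (fun σ => by
      have h1 : HasDerivAt (fun σ => l * (σ - c)) l σ := by
        simpa using ((hasDerivAt_id σ).sub_const c).const_mul l
      refine (((hφ2 _).comp σ h1).const_mul l).congr_deriv ?_
      linear_combination (b * φ' (l * (σ - c)) + k * φ (l * (σ - c))) * hl
        + φ' (l * (σ - c)) * hb)
  -- Initial data of the reparametrized solution, converted from value and slope to coefficients of
  -- `sol` and `sol'`, as in `phi`.
  set p := l * φ' (l * (0 - c)) - b * φ (l * (0 - c))
  set q := φ (l * (0 - c))
  let a₀ : ℝ → HeisExt (nf b k) := fun r => ⟨⟨![p, q, r]⟩, Multiplicative.ofAdd (-c)⟩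
  have hphi : ∀ r σ, phi (a₀ r) σ = φ (l * (σ - c)) := by
    intro r σ
    rw [hψ]
    change p * sol b k σ + q * sol' b k σ = _
    simp only [p, q]
    ring
  have hphi' : ∀ r σ, phi' (a₀ r) σ = phi' (a₀ 0) σ := fun r σ => rfl
  have g0 : ∀ r y, F y 0 = act (a₀ r) (flip l ε y) 0 := by
    intro r y
    rw [hF0, act_zero]
    simp [flip, a₀]
  have g2 : ∀ r y, F y 2 = act (a₀ r) (flip l ε y) 2 := by
    intro r y
    rw [hF2, act_two, hphi]
    simp [flip, a₀]
    congr 1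
    linear_combination (-y 0) * hl
  have HA : IsModelIsom b k b k (fun y => act (a₀ 0) (flip l ε y)) Set.univ :=
    ⟨isOpen_univ, ((contDiff_act _).comp (contDiff_flip l ε)).contDiffOn, fun y _ v w => by
      rw [fderiv_act_flip, fderiv_act_flip, modelForm_act, modelForm_flip k hb hl hε1]⟩
  -- What remains is a translation along `v`, which the central coordinate of the group element
  -- absorbs.
  obtain ⟨d, hd⟩ := H.exists_sub_eq HA (g0 0) (g2 0) (fun y => (hS y).1) (fun y => (hS y).2.1)
  refine ⟨l, ε, a₀ (-d), hl, hε1, hb, fun y => ext_E3 (g0 _ y) ?_ (g2 _ y)⟩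
  refine (hd y).trans ?_
  have e : (a₀ (-d)).right = (a₀ 0).right := rfl
  rw [act_one', act_one', hphi, hphi, hphi' (-d), e]
  change _ - _ - 0 + d = _ - _ - -d
  ring

end PlaneWave
end

noncomputable section
namespace PlaneWave

/-! ### Geometry of the models -/

/-- The isometry is the change of variables `(s, v, x) ↦ (l s, l⁻¹ v, x)`. -/
theorem isometric_model {b k b' k' l : ℝ} (hl : l ≠ 0) (hb : b = l * b') (hk : k = l ^ 2 * k') :
    Isometric (model b k) (model b' k') := by
  subst hb hk
  have hs : ContDiff ℝ ∞ (fun y : E3 => ![l * y 0, l⁻¹ * y 1, y 2]) :=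
    contDiff_of_components (by fun_prop) (by fun_prop) (by fun_prop)
  have hd : ∀ y v : E3, fderiv ℝ (fun y : E3 => ![l * y 0, l⁻¹ * y 1, y 2]) y v
      = ![l * v 0, l⁻¹ * v 1, v 2] := fun y v =>
    fderiv_apply_eq_of_hasDerivAt (hs.differentiable (by simp) y)
      ((hasDerivAt_line y v 0).const_mul l) ((hasDerivAt_line y v 1).const_mul l⁻¹)
      (hasDerivAt_line y v 2)
  refine ⟨isomOfInverse (fun y => ![l * y 0, l⁻¹ * y 1, y 2]) (fun y => ![l⁻¹ * y 0, l * y 1, y 2])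
    hs (contDiff_of_components (by fun_prop) (by fun_prop) (by fun_prop))
    (fun y => by refine ext_E3 ?_ ?_ ?_ <;> simp [hl])
    (fun y => by refine ext_E3 ?_ ?_ ?_ <;> simp [hl]) fun y v w => ?_⟩
  rw [hd, hd, modelForm_apply, modelForm_apply]
  have E : Real.exp (l * b' * y 0) = Real.exp (b' * (l * y 0)) := by congr 1; ring
  simp only [Matrix.cons_val_zero, Matrix.cons_val_one, Matrix.cons_val]
  rw [E]
  field_simp

/-- The incomplete flat models are isometric to half Minkowski space. -/
theorem isometricToOpen_halfSpace {b : ℝ} (hb : b ≠ 0) :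
    IsometricToOpen (model b 0) minkowski halfSpace := by
  -- With `u = e^{bs}` one has `2 e^{bs} ds dv = 2 du d(v/b)`, and `u` runs over the positive
  -- numbers.
  have hs : ContDiff ℝ ∞ (fun y : E3 => ![Real.exp (b * y 0), b⁻¹ * y 1, y 2]) :=
    contDiff_of_components (by fun_prop) (by fun_prop) (by fun_prop)
  have ht : ContDiffOn ℝ ∞ (fun y : E3 => ![b⁻¹ * Real.log (y 0), b * y 1, y 2]) halfSpace := by
    refine contDiffOn_pi.2 fun i => ?_
    fin_cases i
    · refine contDiffOn_const.mul (ContDiffOn.log (by fun_prop) fun y hy => ?_)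
      exact ne_of_gt hy
    · exact (contDiff_const.mul (by fun_prop : ContDiff ℝ ∞ fun y : E3 => y 1)).contDiffOn
    · exact (by fun_prop : ContDiff ℝ ∞ fun y : E3 => y 2).contDiffOn
  have hd : ∀ y v : E3, fderiv ℝ (fun y : E3 => ![Real.exp (b * y 0), b⁻¹ * y 1, y 2]) y v
      = ![Real.exp (b * y 0) * (b * v 0), b⁻¹ * v 1, v 2] := fun y v => by
    refine fderiv_apply_eq_of_hasDerivAt (hs.differentiable (by simp) y) ?_
      ((hasDerivAt_line y v 1).const_mul b⁻¹) (hasDerivAt_line y v 2)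
    simpa using ((hasDerivAt_line y v 0).const_mul b).exp
  let e : OpenPartialHomeomorph E3 E3 :=
    { toFun := fun y => ![Real.exp (b * y 0), b⁻¹ * y 1, y 2]
      invFun := fun y => ![b⁻¹ * Real.log (y 0), b * y 1, y 2]
      source := Set.univ
      target := halfSpace
      map_source' := fun y _ => Real.exp_pos _
      map_target' := fun _ _ => trivial
      left_inv' := fun y _ => by refine ext_E3 ?_ ?_ ?_ <;> simp [hb]
      right_inv' := fun y hy => by
        have hy0 : 0 < y 0 := hy
        refine ext_E3 ?_ ?_ ?_
        · simp [hb, Real.exp_log hy0]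
        · simp [hb]
        · simp
      open_source := isOpen_univ
      open_target := isOpen_lt continuous_const (continuous_apply 0)
      continuousOn_toFun := hs.continuous.continuousOn
      continuousOn_invFun := ht.continuousOn }
  refine ⟨e, rfl, rfl, hs.contMDiff.contMDiffOn, ht.contMDiffOn, fun y _ v w => ?_⟩
  have hm : minkowski = model 0 0 := brinkmann_eq_model 0
  rw [hm, mfderiv_eq_fderiv]
  have key : ∀ v w : E3, modelForm 0 0 (e y) (fderiv ℝ e y v) (fderiv ℝ e y w)
      = modelForm b 0 y v w := by
    intro v w
    have hd' : ∀ v, fderiv ℝ e y v = ![Real.exp (b * y 0) * (b * v 0), b⁻¹ * v 1, v 2] := hd y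
    rw [hd', hd', modelForm_apply, modelForm_apply]
    simp
    field_simp
  exact key v w

theorem minkowski_eq_model : minkowski = model 0 0 := brinkmann_eq_model 0

theorem isFlat_of_isometricToOpen {M : Type*} [TopologicalSpace M] [ChartedSpace E3 M]
    [IsManifold 𝓘(ℝ, E3) ∞ M] {g : LorentzMetric M} {U : Set E3}
    (h : IsometricToOpen g minkowski U) : IsFlat g := by
  obtain ⟨e, hs, -, he⟩ := h
  exact fun x => ⟨e, by rw [hs]; trivial, he⟩

theorem isFlat_of_isometric_minkowski {M : Type*} [TopologicalSpace M] [ChartedSpace E3 M]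
    [IsManifold 𝓘(ℝ, E3) ∞ M] {g : LorentzMetric M} (h : Isometric g minkowski) : IsFlat g := by
  obtain ⟨f⟩ := h
  exact fun x => ⟨f.toPartial, trivial, f.isPartialIsom⟩

/-- A local isometry from a model with `k ≠ 0` to `model 0 0` would give `k = 0 · S²`. For `k = 0`
the model is Minkowski or half Minkowski space. -/
theorem isFlat_model_iff {b k : ℝ} : IsFlat (model b k) ↔ k = 0 := by
  constructor
  · intro h
    by_contra hk
    obtain ⟨e, h0, he⟩ := h 0
    rw [minkowski_eq_model] at he
    have := (he.isModelIsom.eq_of_ne_zero hk h0).2.2.1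
    apply hk
    rw [this]
    ring
  · rintro rfl
    by_cases hb : b = 0
    · subst hb
      refine isFlat_of_isometric_minkowski ?_
      rw [minkowski_eq_model]
      exact ⟨Isom.refl _⟩
    · exact isFlat_of_isometricToOpen (isometricToOpen_halfSpace hb)

theorem isometric_minkowski_iff {b k : ℝ} : Isometric (model b k) minkowski ↔ b = 0 ∧ k = 0 := by
  rw [minkowski_eq_model]
  constructor
  · intro h
    obtain ⟨l, -, h1, h2⟩ := exists_eq_of_isometric h
    simpa using And.intro h1 h2
  · rintro ⟨rfl, rfl⟩
    exact ⟨Isom.refl _⟩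

/-- Half Minkowski space is also the image of `model 1 0`, so the classification of models rules out
`b = 0`. -/
theorem isometricToOpen_halfSpace_iff {b k : ℝ} :
    IsometricToOpen (model b k) minkowski halfSpace ↔ b ≠ 0 ∧ k = 0 := by
  constructor
  · intro h
    have hk := isFlat_model_iff.1 (isFlat_of_isometricToOpen h)
    refine ⟨fun hb => ?_, hk⟩
    obtain ⟨l, -, h1, -⟩ := exists_eq_of_isometric
      ((isometricToOpen_halfSpace one_ne_zero).isometric h)
    simp [hb] at h1
  · rintro ⟨hb, rfl⟩
    exact isometricToOpen_halfSpace hb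

theorem hasFDerivAt_conj_neg {p q s : E3 → E3} {x : E3} (hp : DifferentiableAt ℝ p x)
    (hq : DifferentiableAt ℝ q (p x)) (hs : HasFDerivAt s (-ContinuousLinearMap.id ℝ E3) (p x))
    (hsp : s (p x) = p x) (h : q ∘ p =ᶠ[𝓝 x] id) (v : E3) : fderiv ℝ (q ∘ s ∘ p) x v = -v := by
  have h1 : HasFDerivAt (s ∘ p) ((-ContinuousLinearMap.id ℝ E3).comp (fderiv ℝ p x)) x :=
    hs.comp x hp.hasFDerivAt
  have h2 : HasFDerivAt q (fderiv ℝ q (p x)) ((s ∘ p) x) := by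
    simp only [Function.comp_apply, hsp]
    exact hq.hasFDerivAt
  have h3 := h2.comp x h1
  have h4 := (hq.hasFDerivAt.comp x hp.hasFDerivAt).unique ((hasFDerivAt_id x).congr_of_eventuallyEq h)
  have h5 : fderiv ℝ q (p x) (fderiv ℝ p x v) = v := congrArg (fun L => L v) h4
  rw [h3.fderiv]
  simp [h5]

/-- If `b ≠ 0`, every isometry has `l = 1`, whereas a symmetry would need `l = -1`. If `b = 0`, the
map `-Id` is a symmetry at the origin and the transitive group carries it to the other points. -/
theorem isSymmetricSpace_model_iff {b k : ℝ} : IsSymmetricSpace (model b k) ↔ b = 0 := by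
  constructor
  · intro h
    by_contra hb
    obtain ⟨f, hf⟩ := h 0
    obtain ⟨l, -, h1, -, h3⟩ := f.exists_eq (Or.inl hb)
    have hf' := (tangentMap_eq_neg_iff.1 hf).2 (![1, 0, 0] : E3)
    rw [mfderiv_eq_fderiv] at hf'
    have h4 : fderiv ℝ f.1 0 ![1, 0, 0] = -(![1, 0, 0] : E3) := hf'
    have h5 := congrFun h4 0
    rw [(h3 0).2.2] at h5
    simp at h5
    rw [h5] at h1
    apply hb
    linarith
  · rintro rfl x
    set a := translationTo 0 k x with ha
    have hax : act a⁻¹ x = 0 := by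
      have h := act_inv_act a 0
      rwa [ha, act_translationTo] at h
    refine ⟨((actIsom a⁻¹).trans (flipIsom (l := -1) (ε := -1) (by simp) (by simp) (by simp))).trans
      (actIsom a), ?_⟩
    have hflip : HasFDerivAt (flip (-1) (-1)) (-ContinuousLinearMap.id ℝ E3) (act a⁻¹ x) := by
      have h1 := ((contDiff_flip (-1) (-1)).differentiable (by simp) (act a⁻¹ x)).hasFDerivAt
      convert! h1 using 1
      refine ContinuousLinearMap.ext fun v => ?_
      rw [fderiv_flip]
      refine ext_E3 ?_ ?_ ?_ <;> simp [flip]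
    have hflip0 : flip (-1) (-1) (act a⁻¹ x) = act a⁻¹ x := by
      rw [hax]
      refine ext_E3 ?_ ?_ ?_ <;> simp [flip]
    rw [tangentMap_eq_neg_iff]
    constructor
    · change act a (flip (-1) (-1) (act a⁻¹ x)) = x
      rw [hflip0, act_act_inv]
    · intro v
      rw [mfderiv_eq_fderiv]
      exact hasFDerivAt_conj_neg ((contDiff_act a⁻¹).differentiable (by simp) x)
        ((contDiff_act a).differentiable (by simp) _) hflip hflip0
        (Filter.Eventually.of_forall fun y => act_act_inv a y) v

/-- The central symmetries of Minkowski space. -/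
def pointReflection (c : E3) : Isom (model 0 0) (model 0 0) :=
  isomOfInverse (fun y => c + (c - y)) (fun y => c + (c - y)) (by fun_prop) (by fun_prop)
    (fun y => by abel) (fun y => by abel) (fun y v w => by
      have h : ∀ v, fderiv ℝ (fun y : E3 => c + (c - y)) y v = -v := fun v => by
        have h1 : HasFDerivAt (fun y : E3 => c + (c - y)) (-ContinuousLinearMap.id ℝ E3) y :=
          ((hasFDerivAt_id y).const_sub c).const_add c
        rw [h1.fderiv]
        rfl
      rw [h, h, modelForm_apply, modelForm_apply]
      simp)

/-- For `k ≠ 0` the obstruction `b = b S` with `S = -1` is already local. For `k = 0` the point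
reflections of Minkowski space are transported by flat charts. -/
theorem isLocallySymmetric_model_iff {b k : ℝ} : IsLocallySymmetric (model b k) ↔ b = 0 ∨ k = 0 := by
  constructor
  · intro h
    by_contra! hbk
    obtain ⟨e, h0, he, hf⟩ := h 0
    have h1 := (he.isModelIsom.eq_of_ne_zero hbk.2 h0).2.2.2
    have hf' := (tangentMap_eq_neg_iff.1 hf).2 (![1, 0, 0] : E3)
    rw [mfderiv_eq_fderiv] at hf'
    have h4 : fderiv ℝ e 0 ![1, 0, 0] = -(![1, 0, 0] : E3) := hf'
    have h5 := congrFun h4 0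
    rw [h5] at h1
    simp at h1
    apply hbk.1
    linarith
  · rintro (rfl | rfl)
    · intro x
      obtain ⟨f, hf⟩ := isSymmetricSpace_model_iff (k := k).2 rfl x
      exact ⟨f.toPartial, trivial, f.isPartialIsom, hf⟩
    · intro x
      obtain ⟨e, hx, he⟩ := isFlat_model_iff (b := b).2 rfl x
      rw [minkowski_eq_model] at he
      have hs0 : (pointReflection (e x)).1 (e x) = e x := by
        change e x + (e x - e x) = e x
        simp
      have hs : HasFDerivAt (pointReflection (e x)).1 (-ContinuousLinearMap.id ℝ E3) (e x) := by
        have := ((hasFDerivAt_id (𝕜 := ℝ) (e x)).const_sub (e x)).const_add (e x)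
        convert! this using 1
      refine ⟨(e.trans (pointReflection (e x)).toPartial).trans e.symm, ?_,
        (he.trans (pointReflection (e x)).isPartialIsom).trans he.symm, ?_⟩
      · simp only [OpenPartialHomeomorph.trans_source]
        refine ⟨⟨hx, trivial⟩, ?_⟩
        change (pointReflection (e x)).1 (e x) ∈ e.target
        rw [hs0]
        exact e.map_source hx
      · rw [tangentMap_eq_neg_iff]
        constructor
        · change e.symm ((pointReflection (e x)).1 (e x)) = x
          rw [hs0, e.left_inv hx]
        · intro v
          rw [mfderiv_eq_fderiv]
          exact hasFDerivAt_conj_neg (he.isModelIsom.differentiableAt hx)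
            (he.symm.isModelIsom.differentiableAt (e.map_source hx)) hs hs0
            (by filter_upwards [e.open_source.mem_nhds hx] with y hy using e.left_inv hy) v

/-- Locally isometric models, one of which is not flat. -/
theorem exists_eq_of_locallyIsometric {b k b' k' : ℝ} (hk : k ≠ 0)
    (h : LocallyIsometric (model b k) (model b' k')) : ∃ l : ℝ, l ≠ 0 ∧ b = l * b' ∧ k = l ^ 2 * k' := by
  obtain ⟨e, h0, he⟩ := h.1 0
  obtain ⟨h1, h2, h3, h4⟩ := he.isModelIsom.eq_of_ne_zero hk h0
  refine ⟨_, fun h => hk ?_, h4.trans (mul_comm _ _), h3.trans (mul_comm _ _)⟩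
  rw [h3, h]
  ring

end PlaneWave
end

noncomputable section
namespace PlaneWave

/-! ### Homomorphisms and the adjoint representation -/

namespace HeisExt

variable {ρ ρ' : HeisRep}

/-- A group homomorphism read in coordinates. -/
def inCoords (φ : HeisExt ρ → HeisExt ρ') (q : ℝ × E3) : ℝ × E3 := homeo ρ' (φ ((homeo ρ).symm q))

theorem contDiff_inCoords {φ : HeisExt ρ → HeisExt ρ'}
    (h : ContMDiff 𝓘(ℝ, ℝ × E3) 𝓘(ℝ, ℝ × E3) ∞ φ) : ContDiff ℝ ∞ (inCoords φ) :=
  ((contMDiff_homeo ρ').comp (h.comp (contMDiff_homeo_symm ρ))).contDiff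

theorem homeo_one : homeo ρ 1 = 0 := rfl

/-- The one-parameter subgroup with a given velocity. -/
theorem exists_oneParam (ρ : HeisRep) (X : ℝ × E3) : ∃ γ : ℝ → HeisExt ρ,
    (∀ r s, γ (r + s) = γ r * γ s) ∧ γ 0 = 1 ∧ HasDerivAt (fun r => homeo ρ (γ r)) X 0 := by
  obtain ⟨τ, ξ⟩ := X
  by_cases hτ : τ = 0
  · subst hτ
    refine ⟨fun r => ⟨⟨r • ξ⟩, 1⟩, fun r s => ?_, ?_, ?_⟩
    · refine ext_coords ?_ ?_
      · rw [log_mul_left]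
        change (r + s) • ξ = r • ξ + ρ.lie 0 (s • ξ) + (1 / 2 : ℝ) • heisBracket _ (ρ.lie 0 (s • ξ))
        rw [ρ.lie_zero]
        refine ext_E3 ?_ ?_ ?_ <;> simp [heisBracket] <;> ring
      · rw [toAdd_mul_right]
        simp
    · refine ext_coords ?_ ?_
      · change (0 : ℝ) • ξ = 0
        simp
      · rfl
    · exact (hasDerivAt_const (0 : ℝ) (0 : ℝ)).prodMk
        (by simpa using (hasDerivAt_id (0 : ℝ)).smul_const ξ)
  · obtain ⟨η, -, hη, hη0, hc⟩ := ρ.exists_cocycle (τ⁻¹ • ξ)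
    refine ⟨fun r => ⟨⟨η (τ * r)⟩, Multiplicative.ofAdd (τ * r)⟩, fun r s => ?_, ?_, ?_⟩
    · refine ext_coords ?_ ?_
      · rw [log_mul_left]
        exact (congrArg η (mul_add τ r s)).trans (hc _ _)
      · rw [toAdd_mul_right]
        simp [mul_add]
    · refine ext_coords ?_ ?_
      · change η (τ * 0) = 0
        rw [mul_zero, hη0]
      · change τ * 0 = 0
        simp
    · have hm : HasDerivAt (fun r : ℝ => τ * r) τ 0 := by
        simpa using (hasDerivAt_id (0 : ℝ)).const_mul τ
      have hη' : HasDerivAt η (τ⁻¹ • ξ) (τ * 0) := by rwa [mul_zero]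
      have h1 : HasDerivAt (fun r => η (τ * r)) ξ 0 := by
        have := hη'.scomp (0 : ℝ) hm
        rwa [smul_smul, mul_inv_cancel₀ hτ, one_smul] at this
      exact hm.prodMk h1

/-- The differential of an injective smooth homomorphism is injective. -/
theorem injective_fderiv {φ : HeisExt ρ →* HeisExt ρ'}
    (hs : ContMDiff 𝓘(ℝ, ℝ × E3) 𝓘(ℝ, ℝ × E3) ∞ φ) (hi : Function.Injective φ) :
    Function.Injective (fderiv ℝ (inCoords φ) 0) := by
  refine (injective_iff_map_eq_zero (fderiv ℝ (inCoords φ) 0)).2 fun X hX => ?_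
  obtain ⟨γ, hγ, hγ0, hd⟩ := exists_oneParam ρ X
  have h1 : HasDerivAt (fun r => homeo ρ' (φ (γ r))) 0 0 := by
    have hφ : HasFDerivAt (inCoords φ) (fderiv ℝ (inCoords φ) 0) (homeo ρ (γ 0)) := by
      rw [hγ0, homeo_one]
      exact ((contDiff_inCoords hs).differentiable (by simp) 0).hasFDerivAt
    have := hφ.comp_hasDerivAt (0 : ℝ) hd
    rw [hX] at this
    exact this
  -- Left translation carries the vanishing velocity at time `0` to all times. Then `φ ∘ γ` is
  -- constant and injectivity makes `γ` trivial.
  have h2 : ∀ r, HasDerivAt (fun r => homeo ρ' (φ (γ r))) 0 r := by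
    intro r
    have hL : ContDiff ℝ ∞ (inCoords (fun a : HeisExt ρ' => φ (γ r) * a)) :=
      contDiff_inCoords (contMDiff_const.mul contMDiff_id)
    have h3 : HasDerivAt (fun s => homeo ρ' (φ (γ s))) 0 (r - r) := by rwa [sub_self]
    have h4 := h3.comp_sub_const r r
    have h5 := (hL.differentiable (by simp) (homeo ρ' (φ (γ (r - r))))).hasFDerivAt.comp_hasDerivAt r h4
    rw [map_zero] at h5
    refine h5.congr_of_eventuallyEq (Filter.Eventually.of_forall fun s => ?_)
    change homeo ρ' (φ (γ s)) = homeo ρ' (φ (γ r) * φ (γ (s - r)))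
    rw [← map_mul, ← hγ, add_sub_cancel]
  have h3 : ∀ r, γ r = 1 := by
    intro r
    have := is_const_of_deriv_eq_zero (fun r => (h2 r).differentiableAt) (fun r => (h2 r).deriv) r 0
    have := hi ((homeo ρ').injective this)
    rw [this, hγ0]
  simp only [h3] at hd
  exact hd.unique (hasDerivAt_const _ _)

/-- The adjoint representation in coordinates. -/
def Ad (a : HeisExt ρ) : ℝ × E3 →L[ℝ] ℝ × E3 := fderiv ℝ (inCoords fun x => a * x * a⁻¹) 0

theorem contDiff_conj (a : HeisExt ρ) : ContDiff ℝ ∞ (inCoords fun x : HeisExt ρ => a * x * a⁻¹) :=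
  contDiff_inCoords ((contMDiff_const.mul contMDiff_id).mul contMDiff_const)

/-- Obtained by differentiating at the identity the fact that `φ` intertwines conjugation by `a` and
by `φ a`. -/
theorem Ad_comp {φ : HeisExt ρ →* HeisExt ρ'} (hs : ContMDiff 𝓘(ℝ, ℝ × E3) 𝓘(ℝ, ℝ × E3) ∞ φ)
    (a : HeisExt ρ) : (Ad (φ a)).comp (fderiv ℝ (inCoords φ) 0)
      = (fderiv ℝ (inCoords φ) 0).comp (Ad a) := by
  have hφ0 : inCoords φ 0 = 0 := by
    change homeo ρ' (φ 1) = 0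
    rw [map_one, homeo_one]
  have hc0 : inCoords (fun x => a * x * a⁻¹) 0 = 0 := by
    change homeo ρ (a * 1 * a⁻¹) = 0
    rw [mul_one, mul_inv_cancel, homeo_one]
  have hd := ((contDiff_inCoords hs).differentiable (by simp) 0).hasFDerivAt
  have e : inCoords (fun x => φ a * x * (φ a)⁻¹) ∘ inCoords φ
      = inCoords φ ∘ inCoords (fun x => a * x * a⁻¹) := by
    funext q
    change homeo ρ' (φ a * φ ((homeo ρ).symm q) * (φ a)⁻¹) = homeo ρ' (φ (a * (homeo ρ).symm q * a⁻¹))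
    rw [map_mul φ, map_mul φ, map_inv φ]
  have h1 : HasFDerivAt (inCoords (fun x => φ a * x * (φ a)⁻¹)) (Ad (φ a)) (inCoords φ 0) := by
    rw [hφ0]
    exact ((contDiff_conj (φ a)).differentiable (by simp) 0).hasFDerivAt
  have h2 : HasFDerivAt (inCoords φ) (fderiv ℝ (inCoords φ) 0) (inCoords (fun x => a * x * a⁻¹) 0) := by
    rw [hc0]
    exact hd
  have h3 := h1.comp (0 : ℝ × E3) hd
  have h4 := h2.comp (0 : ℝ × E3) ((contDiff_conj a).differentiable (by simp) 0).hasFDerivAt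
  rw [e] at h3
  exact h3.unique h4

/-- The dimensions are equal, so the injective differential of `φ` is invertible and conjugates the
two adjoint maps. -/
theorem trace_Ad_map {φ : HeisExt ρ →* HeisExt ρ'} (hs : ContMDiff 𝓘(ℝ, ℝ × E3) 𝓘(ℝ, ℝ × E3) ∞ φ)
    (hi : Function.Injective φ) (a : HeisExt ρ) :
    LinearMap.trace ℝ _ (Ad (φ a) : ℝ × E3 →ₗ[ℝ] ℝ × E3)
      = LinearMap.trace ℝ _ (Ad a : ℝ × E3 →ₗ[ℝ] ℝ × E3) := by
  let D : (ℝ × E3) ≃ₗ[ℝ] (ℝ × E3) := LinearEquiv.ofInjectiveEndo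
    (fderiv ℝ (inCoords φ) 0 : ℝ × E3 →ₗ[ℝ] ℝ × E3) (injective_fderiv hs hi)
  rw [← LinearMap.trace_conj' (Ad a : ℝ × E3 →ₗ[ℝ] ℝ × E3) D]
  congr 1
  refine LinearMap.ext fun X => ?_
  have h := congrArg (fun L => L (D.symm X)) (Ad_comp hs a)
  have hD : ∀ Y, fderiv ℝ (inCoords φ) 0 Y = D Y := fun Y => rfl
  change Ad (φ a) (fderiv ℝ (inCoords φ) 0 (D.symm X)) = fderiv ℝ (inCoords φ) 0 (Ad a (D.symm X)) at h
  rw [hD, hD, LinearEquiv.apply_symm_apply] at h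
  exact h

theorem trace_prod (f : ℝ × E3 →ₗ[ℝ] ℝ × E3) : LinearMap.trace ℝ _ f =
    (f (1, 0)).1 + ((f (0, ![1, 0, 0])).2 0 + (f (0, ![0, 1, 0])).2 1 + (f (0, ![0, 0, 1])).2 2) := by
  rw [LinearMap.trace_eq_matrix_trace ℝ ((Module.Basis.singleton Unit ℝ).prod (Pi.basisFun ℝ (Fin 3)))]
  simp [Matrix.trace, Fin.sum_univ_three, LinearMap.toMatrix_apply, single_zero, single_one,
    single_two]

theorem Ad_heis (a : HeisExt ρ) (x : E3) : Ad a (0, x) = (0, ρ.lie a.right.toAdd x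
    + heisBracket a.left.log (ρ.lie a.right.toAdd x)) := by
  have h1 := ((contDiff_conj a).differentiable (by simp) 0).hasFDerivAt
  have h2 : HasDerivAt (fun r : ℝ => r • ((0, x) : ℝ × E3)) (0, x) 0 := by
    simpa using (hasDerivAt_id (0 : ℝ)).smul_const ((0, x) : ℝ × E3)
  have h1' : HasFDerivAt (inCoords fun x => a * x * a⁻¹) (Ad a) ((0 : ℝ) • ((0, x) : ℝ × E3)) := by
    rw [zero_smul]
    exact h1
  have h3 := h1'.comp_hasDerivAt (0 : ℝ) h2
  set Y : E3 := ρ.lie a.right.toAdd x + heisBracket a.left.log (ρ.lie a.right.toAdd x) with hY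
  have h4 : HasDerivAt (fun r : ℝ => r • ((0, Y) : ℝ × E3)) (0, Y) 0 := by
    simpa using (hasDerivAt_id (0 : ℝ)).smul_const ((0, Y) : ℝ × E3)
  refine h3.unique (h4.congr_of_eventuallyEq (Filter.Eventually.of_forall fun r => ?_))
  have e : a * (homeo ρ).symm (r • ((0, x) : ℝ × E3)) * a⁻¹ = ⟨⟨r • Y⟩, 1⟩ := by
    rw [mul_inv_eq_iff_eq_mul]
    refine ext_coords ?_ ?_
    · rw [log_mul_left, log_mul_left]
      change a.left.log + ρ.lie a.right.toAdd (r • x) + (1 / 2 : ℝ) • heisBracket a.left.log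
        (ρ.lie a.right.toAdd (r • x)) = r • Y + ρ.lie 0 a.left.log
          + (1 / 2 : ℝ) • heisBracket (r • Y) (ρ.lie 0 a.left.log)
      rw [ρ.lie_zero, map_smul, hY]
      refine ext_E3 ?_ ?_ ?_ <;> simp only [heisBracket_zero, heisBracket_one, heisBracket_two,
        Pi.add_apply, Pi.smul_apply, smul_eq_mul] <;> ring
    · rw [toAdd_mul_right, toAdd_mul_right]
      change a.right.toAdd + r * 0 = 0 + a.right.toAdd
      ring
  change homeo ρ (a * (homeo ρ).symm (r • ((0, x) : ℝ × E3)) * a⁻¹) = _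
  rw [e]
  change (0, r • Y) = (r • (0 : ℝ), r • Y)
  simp

theorem Ad_fst (a : HeisExt ρ) (X : ℝ × E3) : (Ad a X).1 = X.1 := by
  have h1 := ((contDiff_conj a).differentiable (by simp) 0).hasFDerivAt
  have h2 := (hasFDerivAt_fst (𝕜 := ℝ) (E := ℝ) (F := E3) (p := inCoords (fun x => a * x * a⁻¹) 0)).comp
    (0 : ℝ × E3) h1
  have h3 : Prod.fst ∘ inCoords (fun x : HeisExt ρ => a * x * a⁻¹) = Prod.fst := by
    funext q
    change a.right.toAdd + q.1 + -a.right.toAdd = q.1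
    ring
  rw [h3] at h2
  exact congrArg (fun L => L X) (h2.unique hasFDerivAt_fst)

/-- The adjoint map is block triangular, and bracketing with the Heisenberg part of `a` contributes
nothing on the diagonal, so only the time of `a` matters. -/
theorem trace_Ad_nf {b k : ℝ} (a : HeisExt (nf b k)) :
    LinearMap.trace ℝ _ (Ad a : ℝ × E3 →ₗ[ℝ] ℝ × E3) = 1 + (Real.exp (b * a.right.toAdd)
      + 2 * sol' b k a.right.toAdd - b * sol b k a.right.toAdd) := by
  rw [trace_prod]
  simp only [ContinuousLinearMap.coe_coe, Ad_fst, Ad_heis, nf_lie]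
  simp only [Pi.add_apply, heisBracket_zero, heisBracket_one, heisBracket_two, nfLie_zero', nfLie_one,
    nfLie_two]
  simp
  ring

/-- The parameters of the normal form are determined, up to scaling, by the group. -/
theorem exists_eq_of_injective {b k b' k' : ℝ} {φ : HeisExt (nf b k) →* HeisExt (nf b' k')}
    (hs : ContMDiff 𝓘(ℝ, ℝ × E3) 𝓘(ℝ, ℝ × E3) ∞ φ) (hi : Function.Injective φ) :
    ∃ c : ℝ, b = c * b' ∧ k = c ^ 2 * k' := by
  -- The composite of `φ` with the inclusion and projection of the time factors is a continuous
  -- endomorphism of `ℝ`, hence multiplication by a constant. That constant is the scaling factor.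
  let T : ℝ →+ ℝ :=
    { toFun := fun t => (φ (SemidirectProduct.inr (Multiplicative.ofAdd t))).right.toAdd
      map_zero' := by simp
      map_add' := fun s t => by simp }
  have hT : Continuous T := by
    have h1 : Continuous fun t : ℝ => (homeo (nf b k)).symm ((t, 0) : ℝ × E3) := by fun_prop
    exact continuous_fst.comp ((homeo (nf b' k')).continuous.comp (hs.continuous.comp h1))
  have hTc : ∀ t, T t = T 1 * t := by
    intro t
    have := (T.toRealLinearMap hT).map_smul t 1
    simp at this
    rw [this, mul_comm]
  refine ⟨T 1, trace_function_eq fun t => ?_⟩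
  have h := trace_Ad_map hs hi (SemidirectProduct.inr (Multiplicative.ofAdd t))
  rw [trace_Ad_nf, trace_Ad_nf] at h
  have e : (φ (SemidirectProduct.inr (Multiplicative.ofAdd t))).right.toAdd = T 1 * t := hTc t
  rw [e] at h
  simp at h
  linarith

end HeisExt

end PlaneWave
end

noncomputable section
namespace PlaneWave

/-! ### Isomorphism classes of the groups -/

theorem sol'_flat (t : ℝ) : sol' 0 0 t = 1 := by
  have hd : ∀ t, HasDerivAt (sol' 0 0) 0 t := fun t => by simpa using hasDerivAt_sol' 0 0 t
  have h := is_const_of_deriv_eq_zero (fun s => (hd s).differentiableAt) (fun s => (hd s).deriv) t 0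
  rw [h, sol'_zero]

theorem sol_flat (t : ℝ) : sol 0 0 t = t := by
  have h := eq_sol 0 0 (y := fun t => t) (y' := fun _ => 1) (fun t => hasDerivAt_id t)
    (fun t => by simpa using hasDerivAt_const t (1 : ℝ)) t
  simpa using h.symm

theorem sol_exp (t : ℝ) : sol 1 0 t = Real.exp t - 1 := by
  have h := eq_sol 1 0 (y := fun t => Real.exp t - 1) (y' := Real.exp)
    (fun t => (Real.hasDerivAt_exp t).sub_const 1)
    (fun t => by simpa using Real.hasDerivAt_exp t) t
  simpa using h.symm

theorem sol'_exp (t : ℝ) : sol' 1 0 t = Real.exp t := by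
  refine (hasDerivAt_sol 1 0 t).unique ?_
  rw [funext sol_exp]
  exact (Real.hasDerivAt_exp t).sub_const 1

namespace HeisExt

/-- The parameters of the normal form are determined, up to scaling, by the group. -/
theorem exists_eq_of_bijective {b k b' k' : ℝ} {φ : HeisExt (nf b k) →* HeisExt (nf b' k')}
    (hs : ContMDiff 𝓘(ℝ, ℝ × E3) 𝓘(ℝ, ℝ × E3) ∞ φ) (hi : Function.Bijective φ) :
    ∃ c : ℝ, c ≠ 0 ∧ b = c * b' ∧ k = c ^ 2 * k' := by
  obtain ⟨c, hb, hk⟩ := exists_eq_of_injective hs hi.1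
  by_cases hc : c = 0
  -- If the factor is zero, then `b = k = 0` and the adjoint trace is constant on the source.
  -- Surjectivity makes it constant on the target, so `b' = k' = 0` too and the factor `1` serves.
  · subst hc
    obtain rfl : b = 0 := by rw [hb]; ring
    obtain rfl : k = 0 := by rw [hk]; ring
    obtain ⟨h1, h2⟩ := trace_function_eq (b := b') (k := k') (b' := 0) (k' := 0) (c := 1) fun t => by
      obtain ⟨a, ha⟩ := hi.2 (SemidirectProduct.inr (Multiplicative.ofAdd t))
      have h := trace_Ad_map hs hi.1 a
      rw [ha, trace_Ad_nf, trace_Ad_nf] at h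
      simp [sol'_flat] at h ⊢
      linarith
    exact ⟨1, one_ne_zero, by rw [h1]; ring, by rw [h2]; ring⟩
  · exact ⟨c, hc, hb, hk⟩

end HeisExt

theorem exists_eq_of_lieIsomorphic {b k b' k' : ℝ} (h : LieIsomorphic (nf b k) (nf b' k')) :
    ∃ c : ℝ, c ≠ 0 ∧ b = c * b' ∧ k = c ^ 2 * k' := by
  obtain ⟨φ, hφ⟩ := h
  exact HeisExt.exists_eq_of_bijective (φ := φ.toMonoidHom) hφ.1 φ.bijective

/-! ### Matrix groups -/

theorem affineMatrix_mul (L L' : Matrix (Fin 3) (Fin 3) ℝ) (τ τ' : E3) :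
    affineMatrix L τ * affineMatrix L' τ' = affineMatrix (L * L') (L.mulVec τ' + τ) := by
  unfold affineMatrix
  rw [Matrix.fromBlocks_multiply]
  congr 1
  · simp
  · ext i j
    simp [Matrix.mul_apply, Matrix.mulVec, dotProduct]
  · simp
  · simp

theorem affineMatrix_one : affineMatrix 1 0 = 1 := by
  unfold affineMatrix
  rw [← Matrix.fromBlocks_one]
  congr 1

theorem affineMatrix_inl_inl (L : Matrix (Fin 3) (Fin 3) ℝ) (τ : E3) (i j : Fin 3) :
    affineMatrix L τ (Sum.inl i) (Sum.inl j) = L i j := rfl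

theorem affineMatrix_inl_inr (L : Matrix (Fin 3) (Fin 3) ℝ) (τ : E3) (i : Fin 3) (j : Unit) :
    affineMatrix L τ (Sum.inl i) (Sum.inr j) = τ i := rfl

theorem LieIsoMatrixGroup.of_lieIso {ρ ρ' : HeisRep} {S : Set (Matrix (Fin 3 ⊕ Unit) (Fin 3 ⊕ Unit) ℝ)}
    (h : LieIsomorphic ρ ρ') (hS : LieIsoMatrixGroup ρ' S) : LieIsoMatrixGroup ρ S := by
  obtain ⟨ψ, hψ⟩ := h
  obtain ⟨φ, h1, h2, h3⟩ := hS
  refine ⟨φ.comp ψ.toMonoidHom, fun i j => (h1 i j).comp hψ.1, ?_, ?_⟩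
  · let e : HeisExt ρ ≃ₜ HeisExt ρ' :=
      { ψ.toEquiv with
        continuous_toFun := hψ.1.continuous
        continuous_invFun := hψ.2.continuous }
    exact h2.comp e.isEmbedding
  · rw [← h3]
    exact ψ.surjective.range_comp φ

theorem contMDiff_affineMatrix {ρ : HeisRep} {L : HeisExt ρ → Matrix (Fin 3) (Fin 3) ℝ}
    {τ : HeisExt ρ → E3} (hL : ∀ i j, ContMDiff 𝓘(ℝ, ℝ × E3) 𝓘(ℝ, ℝ) ∞ fun a => L a i j)
    (hτ : ∀ i, ContMDiff 𝓘(ℝ, ℝ × E3) 𝓘(ℝ, ℝ) ∞ fun a => τ a i) (i j : Fin 3 ⊕ Unit) :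
    ContMDiff 𝓘(ℝ, ℝ × E3) 𝓘(ℝ, ℝ) ∞ fun a => affineMatrix (L a) (τ a) i j := by
  rcases i with i | i <;> rcases j with j | j
  · exact hL i j
  · exact hτ i
  · exact contMDiff_const
  · exact contMDiff_const

theorem contMDiff_of_coords_real {ρ : HeisRep} {f : HeisExt ρ → ℝ} (F : ℝ × E3 → ℝ)
    (hF : ContDiff ℝ ∞ F) (h : ∀ a, f a = F (a.right.toAdd, a.left.log)) :
    ContMDiff 𝓘(ℝ, ℝ × E3) 𝓘(ℝ, ℝ) ∞ f := by
  have : f = F ∘ HeisExt.homeo ρ := funext h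
  rw [this]
  exact hF.contMDiff.comp (HeisExt.contMDiff_homeo ρ)

/-! ### The group of half Minkowski space -/

/-- The linear isometry of Minkowski space with parameters `l` and `m`. -/
def affLinear (l m : ℝ) : Matrix (Fin 3) (Fin 3) ℝ :=
  !![l, 0, 0; -(m ^ 2 * l / 2), l⁻¹, -m; m * l, 0, 1]

theorem affLinear_mul {l m l' m' : ℝ} (hl : l ≠ 0) (hl' : l' ≠ 0) :
    affLinear l m * affLinear l' m' = affLinear (l * l') (m + l⁻¹ * m') := by
  ext i j
  fin_cases i <;> fin_cases j <;> simp [affLinear, Matrix.mul_apply, Fin.sum_univ_three] <;>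
    (field_simp; try ring)

/-- Once the plane `u = 0` is stabilized, the Gram and determinant equations determine all entries
from `L 0 0 = l` and `L 2 0 = m l`. -/
theorem mem_affO12_iff {L : Matrix (Fin 3) (Fin 3) ℝ} :
    L ∈ affO12 ↔ ∃ l m : ℝ, 0 < l ∧ L = affLinear l m := by
  constructor
  · rintro ⟨h, hd, h01, h02, h00⟩
    have e := fun i j => congrFun (congrFun h i) j
    have e11 := e 1 1
    have e01 := e 0 1
    have e22 := e 2 2
    have e02 := e 0 2
    have e00 := e 0 0
    rw [Matrix.det_fin_three] at hd
    simp [minkMatrix, Matrix.mul_apply, Fin.sum_univ_three, h01, h02] at e11 e01 e22 e02 e00 hd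
    have hl := h00.ne'
    simp only [e11, mul_zero, add_zero, sub_zero] at e01 hd
    have h11 : L 1 1 = (L 0 0)⁻¹ := by
      field_simp
      linarith
    have h22 : L 2 2 = 1 := by
      rw [e01, one_mul] at hd
      exact hd
    rw [h22, mul_one] at e02
    refine ⟨L 0 0, L 2 0 / L 0 0, h00, ?_⟩
    ext i j
    fin_cases i <;> fin_cases j <;> simp [affLinear]
    · exact h01
    · exact h02
    · field_simp
      linarith
    · exact h11
    · field_simp
      linarith
    · field_simp
    · exact e11
    · exact h22
  · rintro ⟨l, m, hl, rfl⟩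
    have hl' := hl.ne'
    refine ⟨?_, ?_, rfl, rfl, hl⟩
    · ext i j
      fin_cases i <;> fin_cases j <;>
        simp [affLinear, minkMatrix, Matrix.mul_apply, Fin.sum_univ_three, hl'] <;> ring
    · rw [Matrix.det_fin_three]
      simp [hl.ne', affLinear]

/-- The translation part of the affine action of the group on half Minkowski space. -/
def affTranslation (a : HeisExt (nf 1 0)) : E3 :=
  ![0, (a.left.log 0 + a.left.log 1) * a.left.log 0 / 2 - a.left.log 2, -a.left.log 0]

/-- The affine action of the group on half Minkowski space. -/
def affHom : HeisExt (nf 1 0) →* Matrix (Fin 3 ⊕ Unit) (Fin 3 ⊕ Unit) ℝ where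
  -- This is `act` for `b = 1`, `k = 0`, read in the coordinate `u = e^s`: there `φ(s) = (p + q) u -
  -- p`, and all three components become affine.
  toFun a := affineMatrix (affLinear (Real.exp (-a.right.toAdd)) (a.left.log 0 + a.left.log 1))
    (affTranslation a)
  map_one' := by
    rw [← affineMatrix_one]
    congr 1
    · ext i j
      fin_cases i <;> fin_cases j <;> simp [affLinear, Heis.one_log]
    · refine ext_E3 ?_ ?_ ?_ <;> simp [affTranslation, Heis.one_log]
  map_mul' a a' := by
    rw [affineMatrix_mul, affLinear_mul (Real.exp_pos _).ne' (Real.exp_pos _).ne', ← Real.exp_neg,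
      neg_neg]
    have h := HeisExt.log_mul_left a a'
    rw [nf_lie] at h
    have h0 := congrFun h 0
    have h1 := congrFun h 1
    have h2 := congrFun h 2
    simp only [Pi.add_apply, Pi.smul_apply, heisBracket_zero, heisBracket_one, heisBracket_two,
      nfLie_zero', nfLie_one, nfLie_two, sol_exp, sol'_exp, smul_eq_mul] at h0 h1 h2
    rw [one_mul] at h2
    congr 1
    · congr 1
      · rw [HeisExt.toAdd_mul_right, neg_add, Real.exp_add]
      · rw [h0, h1]
        ring
    · refine ext_E3 ?_ ?_ ?_
      · simp [affTranslation, affLinear]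
      · simp [affTranslation, affLinear, h0, h1, h2, -SemidirectProduct.mul_left]
        rw [Real.exp_neg, inv_inv]
        ring
      · simp [affTranslation, affLinear, h0, -SemidirectProduct.mul_left]

theorem affHom_apply (a : HeisExt (nf 1 0)) : affHom a = affineMatrix
    (affLinear (Real.exp (-a.right.toAdd)) (a.left.log 0 + a.left.log 1)) (affTranslation a) := rfl

/-- Coordinates of an element of `Aff ⋉ ℝ²`. -/
def affCoords (m : Matrix (Fin 3 ⊕ Unit) (Fin 3 ⊕ Unit) ℝ) : E3 :=
  ![-m (Sum.inl 2) (Sum.inr ()), -m (Sum.inl 1) (Sum.inl 2) + m (Sum.inl 2) (Sum.inr ()),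
    m (Sum.inl 1) (Sum.inl 2) * m (Sum.inl 2) (Sum.inr ()) / 2 - m (Sum.inl 1) (Sum.inr ())]

theorem affCoords_affHom (a : HeisExt (nf 1 0)) : affCoords (affHom a) = a.left.log := by
  rw [affHom_apply]
  refine ext_E3 ?_ ?_ ?_
  · simp [affCoords, affineMatrix_inl_inr, affTranslation]
  · simp [affCoords, affineMatrix_inl_inr, affineMatrix_inl_inl, affTranslation, affLinear]
  · simp [affCoords, affineMatrix_inl_inr, affineMatrix_inl_inl, affTranslation, affLinear]
    ring

theorem affHom_zero_zero (a : HeisExt (nf 1 0)) :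
    affHom a (Sum.inl 0) (Sum.inl 0) = Real.exp (-a.right.toAdd) := rfl

theorem affHom_eq {m : Matrix (Fin 3 ⊕ Unit) (Fin 3 ⊕ Unit) ℝ} (hm : m ∈ affR2) :
    0 < m (Sum.inl 0) (Sum.inl 0) ∧
    affHom ⟨⟨affCoords m⟩, Multiplicative.ofAdd (-Real.log (m (Sum.inl 0) (Sum.inl 0)))⟩ = m := by
  obtain ⟨L, hL, τ, hτ, rfl⟩ := hm
  obtain ⟨l, μ, hl, rfl⟩ := mem_affO12_iff.1 hL
  refine ⟨hl, ?_⟩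
  rw [affHom_apply]
  congr 1
  · have h1 : affineMatrix (affLinear l μ) τ (Sum.inl 0) (Sum.inl 0) = l := rfl
    simp only [h1, toAdd_ofAdd, neg_neg, Real.exp_log hl]
    congr 1
    simp [affCoords, affineMatrix_inl_inr, affineMatrix_inl_inl, affLinear]
  · refine ext_E3 ?_ ?_ ?_
    · simp [affTranslation, hτ]
    · simp [affTranslation, affCoords, affineMatrix_inl_inr, affineMatrix_inl_inl, affLinear]
    · simp [affTranslation, affCoords, affineMatrix_inl_inr]

theorem injective_affHom : Function.Injective affHom := by
  intro a a' h
  refine HeisExt.ext_coords ?_ ?_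
  · rw [← affCoords_affHom, h, affCoords_affHom]
  · have := affHom_zero_zero a
    rw [h, affHom_zero_zero] at this
    have := Real.exp_injective this
    linarith

theorem lieIsoMatrixGroup_affR2 : LieIsoMatrixGroup (nf 1 0) affR2 := by
  have hsm : ∀ i j, ContMDiff 𝓘(ℝ, ℝ × E3) 𝓘(ℝ, ℝ) ∞ (fun a => affHom a i j) := by
    refine contMDiff_affineMatrix (fun i j => ?_) (fun i => ?_)
    · refine contMDiff_of_coords_real (fun q => affLinear (Real.exp (-q.1)) (q.2 0 + q.2 1) i j) ?_
        (fun a => rfl)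
      have h1 : ContDiff ℝ ∞ fun q : ℝ × E3 => Real.exp (-q.1) := by fun_prop
      have h2 : ContDiff ℝ ∞ fun q : ℝ × E3 => (Real.exp (-q.1))⁻¹ := by
        simp only [← Real.exp_neg]
        fun_prop
      fin_cases i <;> fin_cases j <;> simp [affLinear] <;> fun_prop
    · refine contMDiff_of_coords_real
        (fun q => (![0, (q.2 0 + q.2 1) * q.2 0 / 2 - q.2 2, -q.2 0] : E3) i) ?_ (fun a => rfl)
      fin_cases i <;> simp <;> fun_prop
  have hc : Continuous affHom := by
    refine continuous_pi fun i => continuous_pi fun j => (hsm i j).continuous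
  refine ⟨affHom, hsm, ?_, ?_⟩
  · let G : Matrix (Fin 3 ⊕ Unit) (Fin 3 ⊕ Unit) ℝ → ℝ × E3 :=
      fun m => (m (Sum.inl 0) (Sum.inl 0), affCoords m)
    have hent : ∀ i j, Continuous fun m : Matrix (Fin 3 ⊕ Unit) (Fin 3 ⊕ Unit) ℝ => m i j :=
      fun i j => continuous_id.matrix_elem i j
    have hG : Continuous G := by
      refine (hent _ _).prodMk (continuous_pi fun i => ?_)
      have h1 := hent (Sum.inl 2) (Sum.inr ())
      have h2 := hent (Sum.inl 1) (Sum.inl 2)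
      have h3 := hent (Sum.inl 1) (Sum.inr ())
      fin_cases i <;> simp [affCoords] <;> fun_prop
    refine Topology.IsEmbedding.of_comp hc hG ?_
    have e : G ∘ affHom = Prod.map (Real.exp ∘ Homeomorph.neg ℝ) id ∘ HeisExt.homeo (nf 1 0) := by
      funext a
      exact Prod.ext (affHom_zero_zero a) (affCoords_affHom a)
    rw [e]
    exact ((Real.isOpenEmbedding_exp.isEmbedding.comp (Homeomorph.neg ℝ).isEmbedding).prodMap
      Topology.IsEmbedding.id).comp (HeisExt.homeo (nf 1 0)).isEmbedding
  · ext m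
    constructor
    · rintro ⟨a, rfl⟩
      exact ⟨_, mem_affO12_iff.2 ⟨_, _, Real.exp_pos _, rfl⟩, _, rfl, rfl⟩
    · intro hm
      exact ⟨_, (affHom_eq hm).2⟩

/-- The groups that are isomorphic to `Aff ⋉ ℝ²`. -/
theorem lieIsoMatrixGroup_affR2_iff {b k : ℝ} : LieIsoMatrixGroup (nf b k) affR2 ↔ b ≠ 0 ∧ k = 0 := by
  constructor
  · rintro ⟨φ, h1, h2, h3⟩
    have hmem : ∀ a, φ a ∈ affR2 := fun a => by rw [← h3]; exact ⟨a, rfl⟩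
    -- An isomorphism onto the matrix group is factored through `affHom`, using the explicit inverse
    -- coordinates. The result is a smooth bijective homomorphism to `nf 1 0`, to which the adjoint
    -- invariants apply.
    let χ : HeisExt (nf b k) → HeisExt (nf 1 0) := fun a =>
      ⟨⟨affCoords (φ a)⟩, Multiplicative.ofAdd (-Real.log (φ a (Sum.inl 0) (Sum.inl 0)))⟩
    have hχ : ∀ a, affHom (χ a) = φ a := fun a => (affHom_eq (hmem a)).2
    let χ' : HeisExt (nf b k) →* HeisExt (nf 1 0) :=
      { toFun := χ
        map_one' := injective_affHom (by rw [hχ, map_one, map_one])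
        map_mul' := fun a a' => injective_affHom (by rw [hχ, map_mul, map_mul, hχ, hχ]) }
    have hs : ContMDiff 𝓘(ℝ, ℝ × E3) 𝓘(ℝ, ℝ × E3) ∞ χ' := by
      have hent : ∀ i j, ContDiff ℝ ∞ (fun q => φ ((HeisExt.homeo (nf b k)).symm q) i j) := fun i j =>
        ((h1 i j).comp (HeisExt.contMDiff_homeo_symm (nf b k))).contDiff
      refine HeisExt.contMDiff_of_coords ?_
      refine ContDiff.prodMk ?_ ?_
      · exact ((hent (Sum.inl 0) (Sum.inl 0)).log fun q => (affHom_eq (hmem _)).1.ne').neg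
      · have e1 := hent (Sum.inl 2) (Sum.inr ())
        have e2 := hent (Sum.inl 1) (Sum.inl 2)
        have e3 := hent (Sum.inl 1) (Sum.inr ())
        exact contDiff_of_components e1.neg (e2.neg.add e1) (((e2.mul e1).div_const 2).sub e3)
    have hbij : Function.Bijective χ' := by
      refine ⟨fun a a' h => h2.injective ?_, fun a => ?_⟩
      · rw [← hχ, ← hχ]
        exact congrArg affHom h
      · have hm : affHom a ∈ Set.range φ := by
          rw [h3]
          exact ⟨_, mem_affO12_iff.2 ⟨_, _, Real.exp_pos _, rfl⟩, _, rfl, rfl⟩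
        obtain ⟨a', ha'⟩ := hm
        exact ⟨a', injective_affHom ((hχ a').trans ha')⟩
    obtain ⟨c, hc, hb, hk⟩ := HeisExt.exists_eq_of_bijective hs hbij
    exact ⟨by simpa [hb] using hc, by simpa using hk⟩
  · rintro ⟨hb, rfl⟩
    exact LieIsoMatrixGroup.of_lieIso (lieIsomorphic_nf (c := b) hb (by ring) (by ring))
      lieIsoMatrixGroup_affR2

end PlaneWave
end

noncomputable section
namespace PlaneWave

/-! ### The groups `N ⋉ ℝ³` -/

namespace IsUnipotentGenerator

variable {D : Matrix (Fin 3) (Fin 3) ℝ}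

/-- A nilpotent matrix of size three has characteristic polynomial `X³`; Cayley-Hamilton concludes.
-/
theorem pow_three (hD : IsUnipotentGenerator D) : D ^ 3 = 0 := by
  have h := (Matrix.isNilpotent_charpoly_sub_pow_of_isNilpotent hD.2.2).eq_zero
  have h' := D.aeval_self_charpoly
  rw [sub_eq_zero.1 h] at h'
  simpa using h'

/-- Conceptually, a skew operator has even rank, while `D² = 0` in dimension three allows rank at
most one. The computation with entries makes this explicit. So `D` is a single Jordan block. -/
theorem mul_self_ne_zero (hD : IsUnipotentGenerator D) : D * D ≠ 0 := by
  obtain ⟨h, h0, -⟩ := hD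
  intro hz
  apply h0
  have e := fun i j => congrFun (congrFun h i) j
  have e00 := e 0 0
  have e01 := e 0 1
  have e02 := e 0 2
  have e11 := e 1 1
  have e12 := e 1 2
  have e22 := e 2 2
  have z00 := congrFun (congrFun hz 0) 0
  have z01 := congrFun (congrFun hz 0) 1
  have z10 := congrFun (congrFun hz 1) 0
  simp [minkMatrix, Matrix.mul_apply, Matrix.vecMul, dotProduct, Fin.sum_univ_three] at e00 e01 e02
  simp [minkMatrix, Matrix.mul_apply, Matrix.vecMul, dotProduct, Fin.sum_univ_three] at e11 e12 e22
  simp [Matrix.mul_apply, Fin.sum_univ_three] at z00 z01 z10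
  have h01 : D 0 1 = 0 := by linarith
  have h10 : D 1 0 = 0 := by linarith
  have h22 : D 2 2 = 0 := by linarith
  have h02 : D 0 2 = 0 := by
    rw [h01] at z01
    have : D 0 2 * D 0 2 = 0 := by linear_combination D 0 2 * e12 - z01
    simpa using this
  have h12 : D 1 2 = 0 := by
    rw [h10] at z10
    have : D 1 2 * D 1 2 = 0 := by linear_combination D 1 2 * e02 - z10
    simpa using this
  have h00 : D 0 0 = 0 := by
    rw [h01, h02] at z00
    have : D 0 0 * D 0 0 = 0 := by linear_combination z00
    simpa using this
  have h20 : D 2 0 = 0 := by linarith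
  have h21 : D 2 1 = 0 := by linarith
  have h11 : D 1 1 = 0 := by linarith
  ext i j
  fin_cases i <;> fin_cases j <;> simp [*]

theorem exists_mulVec_ne_zero (hD : IsUnipotentGenerator D) :
    ∃ w : E3, D.mulVec (D.mulVec w) ≠ 0 := by
  by_contra! h
  refine hD.mul_self_ne_zero (Matrix.ext_of_mulVec_single fun i => ?_)
  rw [← Matrix.mulVec_mulVec, h, Matrix.zero_mulVec]

theorem mulVec_mulVec_mulVec (hD : IsUnipotentGenerator D) (w : E3) :
    D.mulVec (D.mulVec (D.mulVec w)) = 0 := by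
  have h : D * D * D = 0 := by
    rw [← hD.pow_three]
    noncomm_ring
  rw [Matrix.mulVec_mulVec, Matrix.mulVec_mulVec, h, Matrix.zero_mulVec]

theorem exp_smul (hD : IsUnipotentGenerator D) (s : ℝ) :
    NormedSpace.exp (s • D) = 1 + s • D + (s ^ 2 / 2) • (D * D) := by
  have h3 := hD.pow_three
  rw [NormedSpace.exp_eq_tsum ℝ]
  refine (tsum_eq_sum (s := Finset.range 3) fun n hn => ?_).trans ?_
  · obtain ⟨m, rfl⟩ := Nat.exists_eq_add_of_le (not_lt.1 (Finset.mem_range.not.1 hn))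
    simp [smul_pow, pow_add, h3]
  · simp [Finset.sum_range_succ, smul_pow, pow_two, smul_smul]
    ring_nf

/-- The basis `w, D w, D² w`. -/
theorem exists_basis (hD : IsUnipotentGenerator D) : ∃ (w : E3) (e : E3 ≃ₗ[ℝ] E3),
    ∀ c, e c = c 0 • w + c 1 • D.mulVec w + c 2 • D.mulVec (D.mulVec w) := by
  obtain ⟨w, hw⟩ := hD.exists_mulVec_ne_zero
  have h3 := hD.mulVec_mulVec_mulVec
  let T : E3 →ₗ[ℝ] E3 :=
    { toFun := fun c => c 0 • w + c 1 • D.mulVec w + c 2 • D.mulVec (D.mulVec w)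
      map_add' := fun c c' => by simp only [Pi.add_apply]; module
      map_smul' := fun r c => by simp only [Pi.smul_apply, smul_eq_mul, RingHom.id_apply]; module }
  have hT : Function.Injective T := by
    refine (injective_iff_map_eq_zero T).2 fun c hc => ?_
    have hc : c 0 • w + c 1 • D.mulVec w + c 2 • D.mulVec (D.mulVec w) = 0 := hc
    have e0 : c 0 = 0 := by
      have := congrArg (fun v => D.mulVec (D.mulVec v)) hc
      simpa [Matrix.mulVec_add, Matrix.mulVec_smul, h3, hw, -Matrix.mulVec_mulVec] using this
    have e1 : c 1 = 0 := by
      have := congrArg (fun v => D.mulVec v) hc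
      simpa [Matrix.mulVec_add, Matrix.mulVec_smul, h3, hw, e0, -Matrix.mulVec_mulVec] using this
    have e2 : c 2 = 0 := by simpa [e0, e1, hw, -Matrix.mulVec_mulVec] using hc
    exact ext_E3 e0 e1 e2
  exact ⟨w, LinearEquiv.ofInjectiveEndo T hT, fun c => rfl⟩

end IsUnipotentGenerator

/-- The translation part, in the basis `w, D w, D² w`, of the affine action of the group. -/
def unipotentTranslation (a : HeisExt (nf 0 0)) : E3 :=
  ![-a.right.toAdd, a.left.log 1 - a.left.log 0 * a.right.toAdd,
    a.left.log 0 * (a.left.log 1 - a.left.log 0 * a.right.toAdd) / 2 + a.left.log 2]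

/-- For `b = k = 0`, time, `Y` and `Z` commute and generate a normal `ℝ³`, on which `X` acts by a
single Jordan block. Since `D` is also a single Jordan block, the basis `w, D w, D² w` matches this
with `ℝ³` and `X` with `D`. -/
theorem lieIsoMatrixGroup_unipotentR3 {D : Matrix (Fin 3) (Fin 3) ℝ} (hD : IsUnipotentGenerator D) :
    LieIsoMatrixGroup (nf 0 0) (unipotentR3 D) := by
  obtain ⟨w, e, he⟩ := hD.exists_basis
  have h3 := hD.mulVec_mulVec_mulVec
  have hp3 := hD.pow_three
  let lin : ℝ → Matrix (Fin 3) (Fin 3) ℝ := fun s => 1 + s • D + (s ^ 2 / 2) • (D * D)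
  have hlin : ∀ s s', lin s * lin s' = lin (s + s') := by
    intro s s'
    have h4 : D * D * D = 0 := by rw [← hp3]; noncomm_ring
    simp only [lin, mul_add, add_mul, one_mul, mul_one, smul_mul_assoc, mul_smul_comm, ← mul_assoc,
      h4, smul_zero, add_zero]
    module
  have hlinv : ∀ s v, (lin s).mulVec v = v + s • D.mulVec v + (s ^ 2 / 2) • D.mulVec (D.mulVec v) := by
    intro s v
    simp only [lin, Matrix.add_mulVec, Matrix.smul_mulVec, Matrix.one_mulVec, Matrix.mulVec_mulVec]
  let φ : HeisExt (nf 0 0) →* Matrix (Fin 3 ⊕ Unit) (Fin 3 ⊕ Unit) ℝ :=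
    { toFun := fun a => affineMatrix (lin (a.left.log 0)) (e (unipotentTranslation a))
      map_one' := by
        rw [← affineMatrix_one]
        congr 1
        · simp [lin, Heis.one_log]
        · rw [← e.map_zero]
          congr 1
          refine ext_E3 ?_ ?_ ?_ <;> simp [unipotentTranslation, Heis.one_log]
      map_mul' := fun a a' => by
        have h := HeisExt.log_mul_left a a'
        rw [nf_lie] at h
        have h0 := congrFun h 0
        have h1 := congrFun h 1
        have h2 := congrFun h 2
        simp only [Pi.add_apply, Pi.smul_apply, heisBracket_zero, heisBracket_one, heisBracket_two,
          nfLie_zero', nfLie_one, nfLie_two, sol_flat, sol'_flat, smul_eq_mul] at h0 h1 h2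
        rw [affineMatrix_mul, hlin]
        congr 1
        · rw [h0]
          congr 1
          ring
        · have hr := HeisExt.toAdd_mul_right a a'
          simp only [hlinv, he, unipotentTranslation, Matrix.cons_val_zero, Matrix.cons_val_one,
            Matrix.cons_val, h0, h1, h2, hr, Matrix.mulVec_add, Matrix.mulVec_smul, h3, smul_zero,
            add_zero, zero_mul, Real.exp_zero, one_mul]
          module }
  have hφ : ∀ a, φ a = affineMatrix (lin (a.left.log 0)) (e (unipotentTranslation a)) := fun _ => rfl
  have hec : Continuous e := LinearMap.continuous_of_finiteDimensional e.toLinearMap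
  have hesc : Continuous e.symm := LinearMap.continuous_of_finiteDimensional e.symm.toLinearMap
  have hed : ContDiff ℝ ∞ e := (LinearMap.toContinuousLinearMap e.toLinearMap).contDiff
  have hsm : ∀ i j, ContMDiff 𝓘(ℝ, ℝ × E3) 𝓘(ℝ, ℝ) ∞ (fun a => φ a i j) := by
    refine contMDiff_affineMatrix (fun i j => ?_) (fun i => ?_)
    · refine contMDiff_of_coords_real (fun q => lin (q.2 0) i j) ?_ (fun a => rfl)
      simp only [lin, Matrix.add_apply, Matrix.smul_apply, smul_eq_mul]
      fun_prop
    · refine contMDiff_of_coords_real (fun q => e ![-q.1, q.2 1 - q.2 0 * q.1,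
        q.2 0 * (q.2 1 - q.2 0 * q.1) / 2 + q.2 2] i) ?_ (fun a => rfl)
      refine contDiff_pi.1 (hed.comp (contDiff_of_components ?_ ?_ ?_)) i <;> fun_prop
  have hc : Continuous φ := continuous_pi fun i => continuous_pi fun j => (hsm i j).continuous
  -- The coefficient of `D w` in `exp(sD) w` is `s`. This gives a continuous left inverse, so no
  -- separate argument is needed for the embedding.
  let lpart : Matrix (Fin 3 ⊕ Unit) (Fin 3 ⊕ Unit) ℝ → ℝ := fun m => e.symm (m.toBlocks₁₁.mulVec w) 1
  let tpart : Matrix (Fin 3 ⊕ Unit) (Fin 3 ⊕ Unit) ℝ → E3 :=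
    fun m => e.symm fun i => m (Sum.inl i) (Sum.inr ())
  have hl : ∀ s τ, lpart (affineMatrix (lin s) τ) = s := by
    intro s τ
    have h : (affineMatrix (lin s) τ).toBlocks₁₁ = lin s := rfl
    simp only [lpart, h]
    have : (lin s).mulVec w = e ![1, s, s ^ 2 / 2] := by
      rw [hlinv, he]
      simp
    rw [this, e.symm_apply_apply]
    rfl
  have ht : ∀ L τ, tpart (affineMatrix L τ) = e.symm τ := fun L τ => rfl
  have hcl : Continuous lpart := by
    refine (continuous_apply 1).comp (hesc.comp (Continuous.matrix_mulVec ?_ continuous_const))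
    exact continuous_matrix fun i j => continuous_id.matrix_elem _ _
  have hct : Continuous tpart :=
    hesc.comp (continuous_pi fun i => continuous_id.matrix_elem _ _)
  let G : ℝ × E3 → ℝ × E3 := fun q => (-q.2 0, ![q.1, q.2 1 - q.1 * q.2 0,
    q.2 2 - q.1 * q.2 1 / 2])
  have hG : Continuous G := by
    refine Continuous.prodMk (by fun_prop) (continuous_pi fun i => ?_)
    fin_cases i <;> simp <;> fun_prop
  have hinv : Function.LeftInverse
      (fun m => (HeisExt.homeo (nf 0 0)).symm (G (lpart m, tpart m))) φ := by
    intro a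
    have h1 := hl (a.left.log 0) (e (unipotentTranslation a))
    have h2 := ht (lin (a.left.log 0)) (e (unipotentTranslation a))
    rw [e.symm_apply_apply] at h2
    simp only [hφ, h1, h2]
    rw [Homeomorph.symm_apply_eq]
    refine Prod.ext ?_ ?_
    · exact neg_neg _
    · refine ext_E3 rfl ?_ ?_
      · change a.left.log 1 - a.left.log 0 * a.right.toAdd - a.left.log 0 * -a.right.toAdd
          = a.left.log 1
        ring
      · change a.left.log 0 * (a.left.log 1 - a.left.log 0 * a.right.toAdd) / 2 + a.left.log 2
          - a.left.log 0 * (a.left.log 1 - a.left.log 0 * a.right.toAdd) / 2 = a.left.log 2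
        ring
  refine ⟨φ, hsm, hinv.isEmbedding ((HeisExt.homeo _).symm.continuous.comp
    (hG.comp (hcl.prodMk hct))) hc, ?_⟩
  ext m
  constructor
  · rintro ⟨a, rfl⟩
    exact ⟨a.left.log 0, _, by rw [hD.exp_smul]; rfl⟩
  · rintro ⟨s, τ, rfl⟩
    refine ⟨(HeisExt.homeo (nf 0 0)).symm (G (s, e.symm τ)), ?_⟩
    rw [hφ, hD.exp_smul]
    congr 1
    rw [← LinearEquiv.eq_symm_apply]
    refine ext_E3 ?_ ?_ ?_
    · exact neg_neg _
    · change e.symm τ 1 - s * e.symm τ 0 - s * -(e.symm τ 0) = e.symm τ 1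
      ring
    · change s * (e.symm τ 1 - s * e.symm τ 0 - s * -(e.symm τ 0)) / 2
        + (e.symm τ 2 - s * e.symm τ 1 / 2) = e.symm τ 2
      ring

end PlaneWave
end

noncomputable section
namespace PlaneWave

/-! ### Unimodularity -/

open MeasureTheory

namespace HeisExt

variable (ρ : HeisRep)

instance : IsTopologicalGroup (HeisExt ρ) := topologicalGroup_of_lieGroup 𝓘(ℝ, ℝ × E3) ∞

instance : LocallyCompactSpace (HeisExt ρ) := (homeo ρ).isClosedEmbedding.locallyCompactSpace

instance : SecondCountableTopology (HeisExt ρ) := (homeo ρ).secondCountableTopology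

/-- The linear map `X ↦ X + r [Y, X]` of the Heisenberg algebra. -/
def shear (r : ℝ) (Y : E3) : E3 →ₗ[ℝ] E3 where
  toFun X := X + r • heisBracket Y X
  map_add' X X' := by
    refine ext_E3 ?_ ?_ ?_ <;> simp only [heisBracket_zero, heisBracket_one, heisBracket_two,
      Pi.add_apply, Pi.smul_apply, smul_eq_mul] <;> ring
  map_smul' c X := by
    refine ext_E3 ?_ ?_ ?_ <;> simp only [heisBracket_zero, heisBracket_one, heisBracket_two,
      Pi.add_apply, Pi.smul_apply, smul_eq_mul, RingHom.id_apply] <;> ring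

theorem shear_apply (r : ℝ) (Y X : E3) : shear r Y X = X + r • heisBracket Y X := rfl

theorem det_shear (r : ℝ) (Y : E3) : LinearMap.det (shear r Y) = 1 := by
  rw [det_E3, Matrix.det_fin_three]
  simp [shear_apply, heisBracket]

/-- The image of the Lebesgue measure under an affine map. -/
theorem map_affine (A : E3 →ₗ[ℝ] E3) (hA : LinearMap.det A ≠ 0) (v : E3) :
    Measure.map (fun X => A X + v) (volume : Measure E3)
      = ENNReal.ofReal |(LinearMap.det A)⁻¹| • volume := by
  have h : (fun X => A X + v) = (fun X => X + v) ∘ A := rfl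
  have hm : Measurable A := A.continuous_of_finiteDimensional.measurable
  rw [h, ← Measure.map_map (measurable_add_const v) hm,
    Measure.map_linearMap_addHaar_eq_smul_addHaar _ hA, Measure.map_smul, map_add_right_eq_self]

theorem continuous_lie_apply (X : E3) : Continuous fun t => ρ.lie t X := by
  have h : (fun t => ρ.lie t X)
      = (fun p : ℝ × E3 => (ρ.toHom (Multiplicative.ofAdd p.1) ⟨p.2⟩).log) ∘ fun t => (t, X) := by
    funext t
    exact (congrArg Heis.log (ρ.toHom_apply' (Multiplicative.ofAdd t) ⟨X⟩)).symm
  rw [h]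
  exact ρ.smooth.continuous.comp (by fun_prop)

variable [MeasurableSpace (HeisExt ρ)] [BorelSpace (HeisExt ρ)]

/-- The Lebesgue measure in the coordinates of `G_ρ`. -/
def lebesgue : Measure (HeisExt ρ) := Measure.map (homeo ρ).symm volume

instance : IsFiniteMeasureOnCompacts (lebesgue ρ) :=
  Measure.IsFiniteMeasureOnCompacts.map volume (homeo ρ).symm

instance : (lebesgue ρ).IsOpenPosMeasure :=
  (homeo ρ).symm.continuous.isOpenPosMeasure_map (homeo ρ).symm.surjective

theorem map_lebesgue {Ψ : HeisExt ρ → HeisExt ρ} {ψ : ℝ × E3 → ℝ × E3} (hψ : Continuous ψ)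
    (h : ∀ q, Ψ ((homeo ρ).symm q) = (homeo ρ).symm (ψ q)) :
    Measure.map Ψ (lebesgue ρ) = Measure.map (homeo ρ).symm (Measure.map ψ volume) := by
  have hs : Measurable (homeo ρ).symm := (homeo ρ).symm.measurable
  have hc : Continuous Ψ := by
    have e : Ψ = (homeo ρ).symm ∘ ψ ∘ homeo ρ := by
      funext a
      have := h (homeo ρ a)
      rwa [Homeomorph.symm_apply_apply] at this
    rw [e]
    exact (homeo ρ).symm.continuous.comp (hψ.comp (homeo ρ).continuous)
  rw [lebesgue, Measure.map_map hc.measurable hs, Measure.map_map hs hψ.measurable]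
  congr 1
  funext q
  exact h q

/-- A right translation shifts time and acts on each Heisenberg fibre by an affine map whose linear
part is a `shear`, of determinant one; the fibres are then integrated over time. -/
instance : (lebesgue ρ).IsMulRightInvariant where
  map_mul_right_eq_self a := by
    let ψ : ℝ × E3 → ℝ × E3 := fun q => (q.1 + a.right.toAdd,
      shear (-(1 / 2)) (ρ.lie q.1 a.left.log) q.2 + ρ.lie q.1 a.left.log)
    have hl := continuous_lie_apply ρ a.left.log
    have hc2 : Continuous fun q : ℝ × E3 =>
        shear (-(1 / 2)) (ρ.lie q.1 a.left.log) q.2 + ρ.lie q.1 a.left.log := by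
      have hb : Continuous fun q : E3 × E3 => heisBracket q.1 q.2 :=
        (contDiff_heisBracket contDiff_fst contDiff_snd).continuous
      have hl' : Continuous fun q : ℝ × E3 => ρ.lie q.1 a.left.log := hl.comp continuous_fst
      exact (continuous_snd.add ((hb.comp (hl'.prodMk continuous_snd)).const_smul (-(1 / 2) : ℝ))).add hl'
    have hψ : Continuous ψ := Continuous.prodMk (by fun_prop) hc2
    rw [map_lebesgue ρ hψ]
    · have : MeasurePreserving ψ (volume.prod volume) (volume.prod volume) := by
        refine (measurePreserving_add_right volume a.right.toAdd).skew_product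
          (g := fun t X => shear (-(1 / 2)) (ρ.lie t a.left.log) X + ρ.lie t a.left.log)
          hc2.measurable (Filter.Eventually.of_forall fun t => ?_)
        rw [map_affine _ (by rw [det_shear]; exact one_ne_zero), det_shear]
        simp
      have h := this.map_eq
      rw [← Measure.volume_eq_prod] at h
      rw [h]
      rfl
    · intro q
      refine ext_coords ?_ rfl
      rw [log_mul_left]
      change q.2 + ρ.lie q.1 a.left.log + (1 / 2 : ℝ) • heisBracket q.2 (ρ.lie q.1 a.left.log)
        = shear (-(1 / 2)) (ρ.lie q.1 a.left.log) q.2 + ρ.lie q.1 a.left.log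
      rw [shear_apply]
      refine ext_E3 ?_ ?_ ?_ <;> simp only [heisBracket_zero, heisBracket_one, heisBracket_two,
        Pi.add_apply, Pi.smul_apply, smul_eq_mul] <;> ring

/-- The linear part of a left translation on the fibres is a `shear` composed with `ρ t`, so the
Jacobian is the determinant of `ρ t`. -/
theorem map_mul_left_lebesgue (a : HeisExt ρ)
    (hd : LinearMap.det (ρ.lie a.right.toAdd : E3 →ₗ[ℝ] E3) ≠ 0) :
    Measure.map (a * ·) (lebesgue ρ)
      = ENNReal.ofReal |(LinearMap.det (ρ.lie a.right.toAdd : E3 →ₗ[ℝ] E3))⁻¹| • lebesgue ρ := by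
  let A : E3 →ₗ[ℝ] E3 := shear (1 / 2) a.left.log ∘ₗ (ρ.lie a.right.toAdd : E3 →ₗ[ℝ] E3)
  have hA : LinearMap.det A = LinearMap.det (ρ.lie a.right.toAdd : E3 →ₗ[ℝ] E3) := by
    rw [LinearMap.det_comp, det_shear, one_mul]
  let ψ : ℝ × E3 → ℝ × E3 := fun q => (a.right.toAdd + q.1, A q.2 + a.left.log)
  have hc2 : Continuous fun q : ℝ × E3 => A q.2 + a.left.log :=
    (A.continuous_of_finiteDimensional.comp continuous_snd).add continuous_const
  have hψ : Continuous ψ := Continuous.prodMk (by fun_prop) hc2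
  rw [map_lebesgue ρ hψ]
  · have : MeasurePreserving ψ (volume.prod volume)
        (volume.prod (ENNReal.ofReal |(LinearMap.det A)⁻¹| • volume)) := by
      refine (measurePreserving_add_left volume a.right.toAdd).skew_product
        (g := fun t X => A X + a.left.log) hc2.measurable
        (Filter.Eventually.of_forall fun t => map_affine _ (hA ▸ hd) _)
    have h := this.map_eq
    rw [Measure.prod_smul_right, ← Measure.volume_eq_prod, hA] at h
    rw [h, Measure.map_smul]
    rfl
  · intro q
    refine ext_coords ?_ rfl
    rw [log_mul_left]
    change a.left.log + ρ.lie a.right.toAdd q.2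
      + (1 / 2 : ℝ) • heisBracket a.left.log (ρ.lie a.right.toAdd q.2)
        = ρ.lie a.right.toAdd q.2 + (1 / 2 : ℝ) • heisBracket a.left.log (ρ.lie a.right.toAdd q.2)
          + a.left.log
    abel

/-- If `G_ρ` is unimodular, the right-invariant measure is left-invariant. -/
theorem isMulLeftInvariant_lebesgue {μ : Measure (HeisExt ρ)} [μ.IsHaarMeasure]
    [μ.IsMulRightInvariant] : (lebesgue ρ).IsMulLeftInvariant := by
  -- Inversion turns the right-invariant measure into a left-invariant one, which is a multiple of
  -- `μ` by uniqueness of Haar measure; inverting again uses the right invariance of `μ`.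
  have h1 : IsFiniteMeasureOnCompacts (lebesgue ρ).inv :=
    Measure.IsFiniteMeasureOnCompacts.map (lebesgue ρ) (Homeomorph.inv (HeisExt ρ))
  have h2 := Measure.isMulLeftInvariant_eq_smul (lebesgue ρ).inv μ
  have h3 : lebesgue ρ = (lebesgue ρ).inv.haarScalarFactor μ • μ.inv := by
    have := congrArg Measure.inv h2
    rwa [Measure.inv_inv, Measure.inv_def (_ • μ), Measure.map_smul] at this
  rw [h3]
  infer_instance

end HeisExt

/-- Left translations scale `lebesgue ρ` by the inverse determinant. A compact neighbourhood of the
identity has finite positive measure, so invariance forces the factor to be one. -/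
theorem isUnimodular_iff (ρ : HeisRep)
    (hd : ∀ t, 0 < LinearMap.det (ρ.lie t : E3 →ₗ[ℝ] E3)) :
    IsUnimodular (HeisExt ρ) ↔ ∀ t, LinearMap.det (ρ.lie t : E3 →ₗ[ℝ] E3) = 1 := by
  let _ : MeasurableSpace (HeisExt ρ) := borel _
  have : BorelSpace (HeisExt ρ) := ⟨rfl⟩
  constructor
  · rintro ⟨μ, h1, h2⟩ t
    have h3 := HeisExt.isMulLeftInvariant_lebesgue ρ (μ := μ)
    have h4 := HeisExt.map_mul_left_lebesgue ρ ⟨1, Multiplicative.ofAdd t⟩ (hd t).ne'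
    rw [map_mul_left_eq_self] at h4
    obtain ⟨K, hK, h1K⟩ := exists_compact_mem_nhds (1 : HeisExt ρ)
    have h5 := congrArg (fun m => m K) h4
    have h6 : HeisExt.lebesgue ρ K ≠ ⊤ := hK.measure_lt_top.ne
    have h7 : HeisExt.lebesgue ρ K ≠ 0 := (Measure.measure_pos_of_mem_nhds _ h1K).ne'
    simp only [Measure.smul_apply, smul_eq_mul] at h5
    have h8 : ENNReal.ofReal |(LinearMap.det (ρ.lie t : E3 →ₗ[ℝ] E3))⁻¹| = 1 :=
      ((ENNReal.mul_left_inj h7 h6).1 ((one_mul _).trans h5)).symm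
    rw [ENNReal.ofReal_eq_one, abs_of_pos (inv_pos.2 (hd t))] at h8
    exact inv_eq_one.1 h8
  · intro h
    refine ⟨HeisExt.lebesgue ρ, ?_, inferInstance⟩
    have : (HeisExt.lebesgue ρ).IsMulLeftInvariant := ⟨fun a => by
      rw [HeisExt.map_mul_left_lebesgue ρ a (hd _).ne', h]
      simp⟩
    exact { }

namespace NormalForm

theorem isUnimodular_iff {ρ : HeisRep} {W : NonCentral} (n : NormalForm ρ W) :
    IsUnimodular (HeisExt ρ) ↔ n.b = 0 := by
  rw [PlaneWave.isUnimodular_iff ρ fun t => by rw [n.det_lie]; positivity]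
  simp only [n.det_lie]
  constructor
  · intro h
    have := h 1
    rw [mul_one, ← Real.exp_nat_mul, Real.exp_eq_one_iff] at this
    simpa using this
  · intro h t
    simp [h]

end NormalForm

end PlaneWave
end

noncomputable section
namespace PlaneWave

/-! ### The identity component of the isometry group -/

section

variable {b k : ℝ}

/-- The element of the group that maps the origin to `y` and `(0, 0, 1)` to `z`. -/
def ofPoints (b k : ℝ) (y z : E3) : HeisExt (nf b k) :=
  translationTo b k y * SemidirectProduct.inl (Heis.oneParam ![1, 0, 0]
    (Multiplicative.ofAdd (-(act (translationTo b k y)⁻¹ z 1))))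

/-- The image of the origin determines `a` up to the isotropy, and the isotropy element with
parameter `p` moves `(0, 0, 1)` to a point with `v = -p`. Thus an element is recovered, continuously
and smoothly, from its values at two points. -/
theorem ofPoints_act (a : HeisExt (nf b k)) : ofPoints b k (act a 0) (act a ![0, 0, 1]) = a := by
  set τ := translationTo b k (act a 0) with hτ
  have h0 : act (τ⁻¹ * a) 0 = 0 := by
    rw [act_mul]
    conv_lhs => rw [← act_translationTo (b := b) (k := k) (act a 0)]
    rw [← hτ, act_inv_act]
  have h1 := act_zero_eq_zero h0
  have h2 : act τ⁻¹ (act a ![0, 0, 1]) 1 = -(τ⁻¹ * a).left.log 0 := by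
    rw [← act_mul]
    conv_lhs => rw [h1]
    rw [act_oneParam]
    simp [sol_zero, sol'_zero]
  rw [ofPoints, ← hτ, h2, neg_neg, ← h1]
  group

theorem contMDiff_ofPoints {M : Type*} [TopologicalSpace M] {E : Type*} [NormedAddCommGroup E]
    [NormedSpace ℝ E] [ChartedSpace E M] {f g : M → E3} (hf : ContMDiff 𝓘(ℝ, E) 𝓘(ℝ, E3) ∞ f)
    (hg : ContMDiff 𝓘(ℝ, E) 𝓘(ℝ, E3) ∞ g) :
    ContMDiff 𝓘(ℝ, E) 𝓘(ℝ, ℝ × E3) ∞ (fun m => ofPoints b k (f m) (g m)) := by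
  have h1 : ContMDiff 𝓘(ℝ, E) 𝓘(ℝ, ℝ × E3) ∞ (fun m => translationTo b k (f m)) :=
    contMDiff_translationTo.comp hf
  have h2 := contMDiff_act h1.inv hg
  refine h1.mul ?_
  have h3 : ContDiff ℝ ∞ (fun y : E3 => ((0, -y 1 • ![1, 0, 0]) : ℝ × E3)) := by fun_prop
  exact (HeisExt.contMDiff_homeo_symm (nf b k)).comp (h3.contMDiff.comp h2)

theorem continuous_ofPoints {X : Type*} [TopologicalSpace X] {f g : X → E3} (hf : Continuous f)
    (hg : Continuous g) : Continuous fun x => ofPoints b k (f x) (g x) := by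
  have h1 : Continuous fun x => translationTo b k (f x) :=
    contMDiff_translationTo.continuous.comp hf
  have h2 : Continuous fun x => act (translationTo b k (f x))⁻¹ (g x) :=
    (contDiff_act' (b := b) (k := k)).continuous.comp
      (((HeisExt.homeo (nf b k)).continuous.comp h1.inv).prodMk hg)
  have h3 : Continuous (fun y : E3 => ((0, -y 1 • ![1, 0, 0]) : ℝ × E3)) := by fun_prop
  exact h1.mul ((HeisExt.homeo (nf b k)).symm.continuous.comp (h3.comp h2))

/-- Reads the sign `l` off two values of the isometry, so that it depends continuously on the
isometry. -/
theorem act_flip_sub_zero (a : HeisExt (nf b k)) (l ε : ℝ) :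
    act a (flip l ε ![1, 0, 0]) 0 - act a (flip l ε 0) 0 = l := by
  simp [act_zero, flip]

theorem act_flip_sub_two (a : HeisExt (nf b k)) (l ε : ℝ) :
    act a (flip l ε ![0, 0, 1]) 2 - act a (flip l ε 0) 2 = ε := by
  simp [act_two, flip]

theorem flip_one (y : E3) : flip 1 1 y = y := by
  refine ext_E3 ?_ ?_ ?_ <;> simp [flip]

end

theorem eqOn_one_of_sq_eq_one {X : Type*} [TopologicalSpace X] {S : Set X} (hS : IsPreconnected S)
    {f : X → ℝ} (hf : Continuous f) (h : ∀ x, f x ^ 2 = 1) {x₀ : X} (hx₀ : x₀ ∈ S) (h₀ : f x₀ = 1)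
    {x : X} (hx : x ∈ S) : f x = 1 := by
  rcases hS.eq_or_eq_neg_of_sq_eq (g := fun _ => (1 : ℝ)) hf.continuousOn continuousOn_const
    (fun y _ => by simpa using h y) (fun _ => one_ne_zero) with H | H
  · exact H hx
  · have := H hx₀
    simp only [h₀, Pi.neg_apply] at this
    norm_num at this

section

variable {M N : Type*} [TopologicalSpace M] [ChartedSpace E3 M] [IsManifold 𝓘(ℝ, E3) ∞ M]
  [TopologicalSpace N] [ChartedSpace E3 N] [IsManifold 𝓘(ℝ, E3) ∞ N]
  {g : LorentzMetric M} {h : LorentzMetric N}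

theorem Isom.continuous_eval (x : M) : Continuous fun f : Isom g h => f.1 x := by
  have h1 : Continuous fun f : Isom g h => (⟨f.1, f.1.continuous⟩ : C(M, N)) :=
    continuous_induced_dom
  exact (continuous_eval_const (F := C(M, N)) x).comp h1

/-- The value at `y` of the isometry `f`, read through the isometry `F`. -/
def Isom.conjEval (F : Isom g h) (y : N) (f : Isom g g) : N := F.1 (f.1 (F.1.symm y))

theorem Isom.continuous_conjEval (F : Isom g h) (y : N) : Continuous (F.conjEval y) :=
  F.1.continuous.comp (Isom.continuous_eval (F.1.symm y))

theorem Isom.conjEval_refl (F : Isom g h) (y : N) : F.conjEval y (Isom.refl g) = y :=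
  F.1.apply_symm_apply y

theorem Isom.eq_conjEval (F : Isom g h) (f : Isom g g) (x : M) :
    f.1 x = F.1.symm (F.conjEval (F.1 x) f) := by
  rw [Isom.conjEval, F.1.symm_apply_apply, F.1.symm_apply_apply]

/-- The isometries in the identity component belong to the group. -/
theorem Isom.exists_conjEval_eq {b k : ℝ} (h : b ≠ 0 ∨ k ≠ 0) (F : Isom g (model b k))
    {f : Isom g g} (hf : f ∈ connectedComponent (Isom.refl g)) :
    ∃ a : HeisExt (nf b k), ∀ y, F.conjEval y f = act a y := by
  have key : ∀ f : Isom g g, ∃ (l ε : ℝ) (a : HeisExt (nf b k)), l ^ 2 = 1 ∧ ε ^ 2 = 1 ∧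
      ∀ y, F.conjEval y f = act a (flip l ε y) := fun f => by
    obtain ⟨l, ε, a, h1, h2, -, h3⟩ := ((F.symm.trans f).trans F).exists_eq_act h
    exact ⟨l, ε, a, h1, h2, h3⟩
  have e1 : F.conjEval ![1, 0, 0] f 0 - F.conjEval 0 f 0 = 1 := by
    refine eqOn_one_of_sq_eq_one isPreconnected_connectedComponent
      (f := fun f => F.conjEval ![1, 0, 0] f 0 - F.conjEval 0 f 0) ?_ (fun f' => ?_)
      mem_connectedComponent ?_ hf
    · exact ((continuous_apply 0).comp (F.continuous_conjEval _)).sub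
        ((continuous_apply 0).comp (F.continuous_conjEval _))
    · obtain ⟨l, ε, a, h1, h2, h3⟩ := key f'
      rw [h3, h3, act_flip_sub_zero, h1]
    · simp [Isom.conjEval_refl]
  have e2 : F.conjEval ![0, 0, 1] f 2 - F.conjEval 0 f 2 = 1 := by
    refine eqOn_one_of_sq_eq_one isPreconnected_connectedComponent
      (f := fun f => F.conjEval ![0, 0, 1] f 2 - F.conjEval 0 f 2) ?_ (fun f' => ?_)
      mem_connectedComponent ?_ hf
    · exact ((continuous_apply 2).comp (F.continuous_conjEval _)).sub
        ((continuous_apply 2).comp (F.continuous_conjEval _))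
    · obtain ⟨l, ε, a, h1, h2, h3⟩ := key f'
      rw [h3, h3, act_flip_sub_two, h2]
    · simp [Isom.conjEval_refl]
  obtain ⟨l, ε, a, h1, h2, h3⟩ := key f
  rw [h3, h3, act_flip_sub_zero] at e1
  rw [h3, h3, act_flip_sub_two] at e2
  refine ⟨a, fun y => ?_⟩
  rw [h3, e1, e2, flip_one]

end

/-- The image of `G_ρ` is connected and contains the identity. Conversely, the two signs are
constant on the identity component, so its elements come from the group. The embedding property
follows from the continuous left inverse given by evaluation at two points. -/
theorem NormalForm.identityComponentEq {ρ : HeisRep} {W : NonCentral} (n : NormalForm ρ W)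
    {g : LorentzMetric (PSpace ρ W)} (hg : IsInvariant g) (h : n.b ≠ 0 ∨ n.k ≠ 0) :
    IdentityComponentEq g := by
  obtain ⟨F, α, hα, hF⟩ := n.exists_isom_model hg
  obtain ⟨Φ, hΦ'⟩ : ∃ Φ : HeisExt ρ → Isom g g, ∀ a x, (Φ a).1 x = F.1.symm (act (α a) (F.1 x)) :=
    ⟨fun a => (F.trans (actIsom (α a))).trans F.symm, fun a x => rfl⟩
  have hΦ : ∀ a x, (Φ a).1 x = a • x := fun a x => by
    rw [hΦ', ← hF]
    exact F.1.symm_apply_apply _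
  have hevΦ : ∀ y a, F.conjEval y (Φ a) = act (α a) y := fun y a => by
    rw [Isom.conjEval, hΦ', F.1.apply_symm_apply, F.1.apply_symm_apply]
  have hcΦ : Continuous Φ := by
    refine continuous_induced_rng.2 (ContinuousMap.continuous_of_continuous_uncurry _ ?_)
    have h1 : Continuous fun q : HeisExt ρ × PSpace ρ W =>
        ((HeisExt.homeo (nf n.b n.k) (α q.1), F.1 q.2) : (ℝ × E3) × E3) :=
      ((HeisExt.homeo _).continuous.comp (hα.1.continuous.comp continuous_fst)).prodMk
        (F.1.continuous.comp continuous_snd)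
    have h2 := F.1.symm.continuous.comp ((contDiff_act' (b := n.b) (k := n.k)).continuous.comp h1)
    refine h2.congr fun q => (hΦ' q.1 q.2).symm
  have hcp : Continuous fun f : Isom g g =>
      ofPoints n.b n.k (F.conjEval 0 f) (F.conjEval ![0, 0, 1] f) :=
    continuous_ofPoints (F.continuous_conjEval 0) (F.continuous_conjEval ![0, 0, 1])
  have hinv : Function.LeftInverse
      (fun f => α.symm (ofPoints n.b n.k (F.conjEval 0 f) (F.conjEval ![0, 0, 1] f))) Φ := fun a => by
    simp only [hevΦ, ofPoints_act, MulEquiv.symm_apply_apply]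
  refine ⟨Φ, hΦ, hinv.isEmbedding (hα.2.continuous.comp hcp) hcΦ, Set.Subset.antisymm ?_ ?_⟩
  · have : PreconnectedSpace (HeisExt ρ) :=
      ⟨by
        rw [← (HeisExt.homeo ρ).symm.range_coe]
        exact isPreconnected_range (HeisExt.homeo ρ).symm.continuous⟩
    refine (isPreconnected_range hcΦ).subset_connectedComponent
      ⟨1, Subtype.ext (Diffeomorph.ext fun x => ?_)⟩
    exact (hΦ 1 x).trans (one_smul _ x)
  · intro f hf
    obtain ⟨a, ha⟩ := F.exists_conjEval_eq h hf
    refine ⟨α.symm a, Subtype.ext (Diffeomorph.ext fun x => ?_)⟩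
    rw [hΦ', MulEquiv.apply_symm_apply, F.eq_conjEval f, ha]

end PlaneWave
end

noncomputable section
namespace PlaneWave

/-! ### Geodesics of flat metrics -/

theorem brinkmannForm_zero (p : E3) : brinkmannForm 0 p = brinkmannForm 0 0 := by
  refine ContinuousLinearMap.ext fun v => ContinuousLinearMap.ext fun w => ?_
  simp only [brinkmannForm_apply]
  ring

theorem brinkmannForm_symm (p v w : E3) : brinkmannForm 0 p v w = brinkmannForm 0 p w v := by
  simp only [brinkmannForm_apply]
  ring

theorem eq_zero_of_brinkmannForm {p v : E3} (h : ∀ w, brinkmannForm 0 p v w = 0) : v = 0 := by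
  have h0 := h ![1, 0, 0]
  have h1 := h ![0, 1, 0]
  have h2 := h ![0, 0, 1]
  simp [brinkmannForm_apply] at h0 h1 h2
  exact ext_E3 h1 h0 h2

/-- In the coordinates of Minkowski space, the geodesics are the lines. -/
theorem eulerLagrange_iff {f : E3 → E3} {c : ℝ → E3} (hf : ContDiff ℝ ∞ f) (hc : ContDiff ℝ ∞ c)
    (t₀ : ℝ) (hs : Function.Surjective (fderiv ℝ f (c t₀))) :
    (∀ a : E3, HasDerivAt
      (fun t => brinkmannForm 0 0 (fderiv ℝ f (c t) (deriv c t)) (fderiv ℝ f (c t) a))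
      (1 / 2 * fderiv ℝ (fun y => brinkmannForm 0 0 (fderiv ℝ f y (deriv c t₀))
        (fderiv ℝ f y (deriv c t₀))) (c t₀) a) t₀) ↔ deriv (deriv (f ∘ c)) t₀ = 0 := by
  have hf1 : ContDiff ℝ ∞ (fderiv ℝ f) := hf.fderiv_right (by simp)
  have hc' : ∀ t, HasDerivAt c (deriv c t) t := fun t =>
    (hc.differentiable (by simp) t).hasDerivAt
  have hC : ∀ t, deriv (f ∘ c) t = fderiv ℝ f (c t) (deriv c t) := fun t =>
    ((hf.differentiable (by simp) (c t)).hasFDerivAt.comp_hasDerivAt t (hc' t)).deriv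
  have hC2 : HasDerivAt (fun t => fderiv ℝ f (c t) (deriv c t)) (deriv (deriv (f ∘ c)) t₀) t₀ := by
    rw [← funext hC]
    have : ContDiff ℝ ∞ (deriv (f ∘ c)) := (contDiff_infty_iff_deriv.1 (hf.comp hc)).2
    exact (this.differentiable (by simp) t₀).hasDerivAt
  set D := fderiv ℝ (fderiv ℝ f) (c t₀) with hD
  have hDf : HasFDerivAt (fderiv ℝ f) D (c t₀) := (hf1.differentiable (by simp) _).hasFDerivAt
  have hsymm : ∀ u v, D u v = D v u := fun u v =>
    (hf.contDiffAt.isSymmSndFDerivAt (by simp; norm_cast)) u v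
  set V := fderiv ℝ f (c t₀) (deriv c t₀) with hV
  -- Both sides of the Euler-Lagrange equation contain the pairing of `V` with `D(c', a)`, by
  -- symmetry of the second derivative. What is left is the pairing of `(f ∘ c)''` with `df(a)`, and
  -- `df` is surjective.
  have hl : ∀ a, HasDerivAt
      (fun t => brinkmannForm 0 0 (fderiv ℝ f (c t) (deriv c t)) (fderiv ℝ f (c t) a))
      (brinkmannForm 0 0 V (D (deriv c t₀) a)
        + brinkmannForm 0 0 (deriv (deriv (f ∘ c)) t₀) (fderiv ℝ f (c t₀) a)) t₀ := fun a => by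
    have h1 : HasDerivAt (fun t => fderiv ℝ f (c t) a) (D (deriv c t₀) a) t₀ := by
      have := hDf.comp_hasDerivAt t₀ (hc' t₀)
      exact ((ContinuousLinearMap.apply ℝ E3 a).hasFDerivAt.comp_hasDerivAt t₀ this)
    exact (brinkmannForm 0 0).hasDerivAt_of_bilinear (fun _ => hC2) (fun _ => h1)
  have hr : ∀ a, fderiv ℝ (fun y => brinkmannForm 0 0 (fderiv ℝ f y (deriv c t₀))
      (fderiv ℝ f y (deriv c t₀))) (c t₀) a = 2 * brinkmannForm 0 0 V (D (deriv c t₀) a) := fun a => by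
    have h1 : HasFDerivAt (fun y => fderiv ℝ f y (deriv c t₀))
        ((ContinuousLinearMap.apply ℝ E3 (deriv c t₀)).comp D) (c t₀) :=
      (ContinuousLinearMap.apply ℝ E3 (deriv c t₀)).hasFDerivAt.comp (c t₀) hDf
    have h2 := ((brinkmannForm 0 0).hasFDerivAt_of_bilinear h1 h1).fderiv
    rw [h2]
    have h3 : brinkmannForm 0 0 V (D a (deriv c t₀)) + brinkmannForm 0 0 (D a (deriv c t₀)) V
        = 2 * brinkmannForm 0 0 V (D (deriv c t₀) a) := by
      rw [brinkmannForm_symm 0 (D a _) V, hsymm]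
      ring
    exact h3
  constructor
  · intro h
    refine eq_zero_of_brinkmannForm (p := 0) fun w => ?_
    obtain ⟨a, rfl⟩ := hs w
    have := (hl a).unique (h a)
    rw [hr] at this
    linarith
  · intro h a
    have := hl a
    rw [h] at this
    rw [hr]
    convert! this using 1
    simp

section

variable {M : Type*} [TopologicalSpace M] [ChartedSpace E3 M] [IsManifold 𝓘(ℝ, E3) ∞ M]
  {g : LorentzMetric M}

/-- All charts coincide with the global `ψ`, so the chart-dependent equation becomes one
Euler-Lagrange equation for the flat form pulled back by `e ∘ ψ⁻¹`. -/
theorem isGeodesic_iff (ψ : M ≃ₘ⟮𝓘(ℝ, E3), 𝓘(ℝ, E3)⟯ E3)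
    (hψ : ∀ x : M, (extChartAt 𝓘(ℝ, E3) x : M → E3) = ψ)
    (hψ' : ∀ x : M, ((extChartAt 𝓘(ℝ, E3) x).symm : E3 → M) = ψ.symm)
    {e : OpenPartialHomeomorph M E3} (hsrc : e.source = Set.univ) (he : IsPartialIsom g minkowski e)
    {γ : ℝ → M} : IsGeodesic g γ ↔
      ContMDiff 𝓘(ℝ, ℝ) 𝓘(ℝ, E3) ∞ γ ∧ ∀ t, deriv (deriv (e ∘ γ)) t = 0 := by
  have hec : ContMDiff 𝓘(ℝ, E3) 𝓘(ℝ, E3) ∞ e := by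
    have := he.1
    rwa [hsrc, contMDiffOn_univ] at this
  have hmem : ∀ x, x ∈ e.source := fun x => by simp [hsrc]
  let f : E3 → E3 := e ∘ ψ.symm
  have hf : ContDiff ℝ ∞ f := (hec.comp ψ.symm.contMDiff).contDiff
  have hs : ∀ y, Function.Surjective (fderiv ℝ f y) := by
    intro y
    let f' : E3 → E3 := ψ ∘ e.symm
    have hm : e (ψ.symm y) ∈ e.target := e.map_source (hmem _)
    have h1 : DifferentiableAt ℝ f' (f y) := by
      have : MDifferentiableAt 𝓘(ℝ, E3) 𝓘(ℝ, E3) f' (f y) :=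
        ((ψ.contMDiff.mdifferentiable (by simp)) _).comp _ (he.mdifferentiableAt_symm hm)
      exact this.differentiableAt
    have h2 : f ∘ f' =ᶠ[𝓝 (f y)] id := by
      filter_upwards [e.open_target.mem_nhds hm] with z hz
      change e (ψ.symm (ψ (e.symm z))) = z
      rw [ψ.symm_apply_apply, e.right_inv hz]
    have hy : f' (f y) = y := by
      change ψ (e.symm (e (ψ.symm y))) = y
      rw [e.left_inv (hmem _), ψ.apply_symm_apply]
    have h3 := fderiv_comp (f y) (hf.differentiable (by simp) (f' (f y))) h1
    rw [h2.fderiv_eq, fderiv_id, hy] at h3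
    intro w
    exact ⟨fderiv ℝ f' (f y) w, (congrArg (fun L : E3 →L[ℝ] E3 => L w) h3).symm⟩
  have hform : ∀ (x₀ : M) (y a a' : E3), coordForm g.val x₀ y a a'
      = brinkmannForm 0 0 (fderiv ℝ f y a) (fderiv ℝ f y a') := by
    intro x₀ y a a'
    have h1 : ∀ v : E3, fderiv ℝ f y v = mfderiv 𝓘(ℝ, E3) 𝓘(ℝ, E3) e (ψ.symm y)
        (mfderiv 𝓘(ℝ, E3) 𝓘(ℝ, E3) ψ.symm y v) := by
      intro v
      have := mfderiv_comp y ((hec.mdifferentiable (by simp)) (ψ.symm y))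
        ((ψ.symm.contMDiff.mdifferentiable (by simp)) y)
      rw [← mfderiv_eq_fderiv]
      exact congrArg (fun L : E3 →L[ℝ] E3 => L v) this
    rw [h1, h1, ← brinkmannForm_zero (e (ψ.symm y))]
    unfold coordForm
    rw [hψ']
    exact (he.2.2 (ψ.symm y) (hmem _) _ _).symm
  have key : ∀ γ : ℝ → M, ContMDiff 𝓘(ℝ, ℝ) 𝓘(ℝ, E3) ∞ γ → ∀ t₀,
      ((∀ a : E3, HasDerivAt
        (fun t => brinkmannForm 0 0 (fderiv ℝ f (ψ (γ t)) (deriv (fun s => ψ (γ s)) t))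
          (fderiv ℝ f (ψ (γ t)) a))
        (1 / 2 * fderiv ℝ (fun y => brinkmannForm 0 0 (fderiv ℝ f y (deriv (fun s => ψ (γ s)) t₀))
          (fderiv ℝ f y (deriv (fun s => ψ (γ s)) t₀))) (ψ (γ t₀)) a) t₀)
      ↔ deriv (deriv (e ∘ γ)) t₀ = 0) := by
    intro γ hγ t₀
    have hc : ContDiff ℝ ∞ fun s => ψ (γ s) := (ψ.contMDiff.comp hγ).contDiff
    have h := eulerLagrange_iff hf hc t₀ (hs _)
    have e1 : (f ∘ fun s => ψ (γ s)) = e ∘ γ := by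
      funext s
      change e (ψ.symm (ψ (γ s))) = e (γ s)
      rw [ψ.symm_apply_apply]
    rw [e1] at h
    exact h
  unfold IsGeodesic
  refine and_congr_right fun hγ => forall_congr' fun t₀ => ?_
  rw [← key γ hγ t₀]
  simp only [hform, hψ]

theorem isGeodesicallyComplete_of_isometric (ψ : M ≃ₘ⟮𝓘(ℝ, E3), 𝓘(ℝ, E3)⟯ E3)
    (hψ : ∀ x : M, (extChartAt 𝓘(ℝ, E3) x : M → E3) = ψ)
    (hψ' : ∀ x : M, ((extChartAt 𝓘(ℝ, E3) x).symm : E3 → M) = ψ.symm)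
    (h : Isometric g minkowski) : IsGeodesicallyComplete g := by
  obtain ⟨F⟩ := h
  rintro ⟨x, v⟩
  let w : E3 := mfderiv 𝓘(ℝ, E3) 𝓘(ℝ, E3) F.1 x v
  let ℓ : ℝ → E3 := fun t => F.1 x + t • w
  have hℓ : ContMDiff 𝓘(ℝ, ℝ) 𝓘(ℝ, E3) ∞ ℓ := by
    have : ContDiff ℝ ∞ ℓ := by fun_prop
    exact this.contMDiff
  have hd : ∀ t, HasDerivAt ℓ w t := fun t => by
    exact (one_smul ℝ w) ▸ ((hasDerivAt_id t).smul_const w).const_add (F.1 x)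
  refine ⟨F.1.symm ∘ ℓ, (isGeodesic_iff ψ hψ hψ' (e := F.toPartial) rfl F.isPartialIsom).2
    ⟨F.1.symm.contMDiff.comp hℓ, fun t => ?_⟩, ?_⟩
  · have e1 : F.toPartial ∘ F.1.symm ∘ ℓ = ℓ := by
      funext s
      exact F.1.apply_symm_apply _
    rw [e1, funext fun t => (hd t).deriv]
    simp
  · have h1 : tangentMap 𝓘(ℝ, ℝ) 𝓘(ℝ, E3) ℓ ⟨0, (1 : ℝ)⟩
        = tangentMap 𝓘(ℝ, E3) 𝓘(ℝ, E3) F.1 ⟨x, v⟩ := by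
      have hext : ∀ (p p' a a' : E3), p = p' → a = a' →
          (⟨p, a⟩ : TangentBundle 𝓘(ℝ, E3) E3) = ⟨p', a'⟩ := by
        rintro p p' a a' rfl rfl
        rfl
      refine hext _ _ _ _ ?_ ?_
      · simp [ℓ]
      · rw [mfderiv_eq_fderiv]
        exact (congrArg (fun L : ℝ →L[ℝ] E3 => L 1) (hd 0).hasFDerivAt.fderiv).trans (one_smul ℝ w)
    have h2 := tangentMap_comp_at (I := 𝓘(ℝ, ℝ)) (I' := 𝓘(ℝ, E3)) (I'' := 𝓘(ℝ, E3))
      (f := ℓ) (g := F.1.symm) ⟨0, (1 : ℝ)⟩ ((F.1.symm.contMDiff.mdifferentiable (by simp)) _)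
      ((hℓ.mdifferentiable (by simp)) _)
    have h3 := tangentMap_comp_at (I := 𝓘(ℝ, E3)) (I' := 𝓘(ℝ, E3)) (I'' := 𝓘(ℝ, E3))
      (f := F.1) (g := F.1.symm) ⟨x, v⟩ ((F.1.symm.contMDiff.mdifferentiable (by simp)) _)
      ((F.1.contMDiff.mdifferentiable (by simp)) _)
    have h4 : F.1.symm ∘ F.1 = id := funext F.1.symm_apply_apply
    rw [h4, tangentMap_id] at h3
    exact h2.trans ((congrArg _ h1).trans h3.symm)

theorem eq_line_of_deriv_deriv {C : ℝ → ℝ} (hC : ContDiff ℝ ∞ C) (h : ∀ t, deriv (deriv C) t = 0)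
    (t : ℝ) : C t = C 0 + t * deriv C 0 := by
  have h1 : ∀ t, deriv C t = deriv C 0 := fun t =>
    is_const_of_deriv_eq_zero ((contDiff_infty_iff_deriv.1 hC).2.differentiable (by simp)) h t 0
  have h2 : ∀ t, HasDerivAt (fun t => C t - t * deriv C 0) 0 t := fun t => by
    have := (hC.differentiable (by simp) t).hasDerivAt.sub ((hasDerivAt_id t).mul_const (deriv C 0))
    rw [h1 t, one_mul, sub_self] at this
    exact this
  have h3 := is_const_of_deriv_eq_zero (fun s => (h2 s).differentiableAt) (fun s => (h2 s).deriv) t 0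
  simp only [zero_mul, sub_zero] at h3
  linarith

/-- The geodesic starting at `(1, 0, 0)` with the opposite velocity would follow a line reaching `u
= 0` at time one, outside the open half space. -/
theorem not_isGeodesicallyComplete (ψ : M ≃ₘ⟮𝓘(ℝ, E3), 𝓘(ℝ, E3)⟯ E3)
    (hψ : ∀ x : M, (extChartAt 𝓘(ℝ, E3) x : M → E3) = ψ)
    (hψ' : ∀ x : M, ((extChartAt 𝓘(ℝ, E3) x).symm : E3 → M) = ψ.symm)
    (h : IsometricToOpen g minkowski halfSpace) : ¬ IsGeodesicallyComplete g := by
  obtain ⟨e, hsrc, htgt, he⟩ := h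
  have hec : ContMDiff 𝓘(ℝ, E3) 𝓘(ℝ, E3) ∞ e := by
    have := he.1
    rwa [hsrc, contMDiffOn_univ] at this
  intro hcomp
  let p : E3 := ![1, 0, 0]
  have hp : p ∈ e.target := by
    rw [htgt]
    exact (zero_lt_one : (0 : ℝ) < 1)
  obtain ⟨γ, hγ, h0⟩ := hcomp (tangentMap 𝓘(ℝ, E3) 𝓘(ℝ, E3) e.symm ⟨p, (-p : E3)⟩)
  obtain ⟨hγs, h2⟩ := (isGeodesic_iff ψ hψ hψ' hsrc he).1 hγ
  have hC : ContDiff ℝ ∞ (e ∘ γ) := (hec.comp hγs).contDiff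
  have h3 := tangentMap_comp_at (I := 𝓘(ℝ, ℝ)) (I' := 𝓘(ℝ, E3)) (I'' := 𝓘(ℝ, E3))
    (f := γ) (g := e) ⟨0, (1 : ℝ)⟩ ((hec.mdifferentiable (by simp)) _)
    ((hγs.mdifferentiable (by simp)) _)
  have h4 := tangentMap_comp_at (I := 𝓘(ℝ, E3)) (I' := 𝓘(ℝ, E3)) (I'' := 𝓘(ℝ, E3))
    (f := e.symm) (g := e) ⟨p, (-p : E3)⟩ ((hec.mdifferentiable (by simp)) _)
    (he.mdifferentiableAt_symm hp)
  have h5 : tangentMap 𝓘(ℝ, ℝ) 𝓘(ℝ, E3) (e ∘ γ) ⟨0, (1 : ℝ)⟩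
      = tangentMap 𝓘(ℝ, E3) 𝓘(ℝ, E3) (e ∘ e.symm) ⟨p, (-p : E3)⟩ :=
    h3.trans ((congrArg (tangentMap 𝓘(ℝ, E3) 𝓘(ℝ, E3) e) h0).trans h4.symm)
  have h6 : (e ∘ e.symm) =ᶠ[𝓝 p] id := by
    filter_upwards [e.open_target.mem_nhds hp] with z hz
    exact e.right_inv hz
  have h7 : mfderiv 𝓘(ℝ, E3) 𝓘(ℝ, E3) (e ∘ e.symm) p = ContinuousLinearMap.id ℝ E3 :=
    h6.mfderiv_eq.trans mfderiv_id
  have hsnd : ∀ (p p' a a' : E3), (⟨p, a⟩ : TangentBundle 𝓘(ℝ, E3) E3) = ⟨p', a'⟩ →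
      p = p' ∧ a = a' := by
    intro p p' a a' h
    cases h
    exact ⟨rfl, rfl⟩
  obtain ⟨e1, e2⟩ := hsnd _ _ _ _ h5
  have e1' : (e ∘ γ) 0 = p := e1.trans (e.right_inv hp)
  have e2' : deriv (e ∘ γ) 0 = -p := by
    refine Eq.trans ?_ (e2.trans (congrArg (fun L : E3 →L[ℝ] E3 => L (-p)) h7))
    rw [mfderiv_eq_fderiv]
    rfl
  have hC0 : ContDiff ℝ ∞ fun t => (e ∘ γ) t 0 := contDiff_pi.1 hC 0
  have hd1 : ∀ t, deriv (fun t => (e ∘ γ) t 0) t = deriv (e ∘ γ) t 0 := fun t =>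
    (hasDerivAt_pi.1 (hC.differentiable (by simp) t).hasDerivAt 0).deriv
  have hd2 : ∀ t, deriv (deriv fun t => (e ∘ γ) t 0) t = 0 := fun t => by
    rw [funext hd1]
    have hC' : ContDiff ℝ ∞ (deriv (e ∘ γ)) := (contDiff_infty_iff_deriv.1 hC).2
    rw [(hasDerivAt_pi.1 (hC'.differentiable (by simp) t).hasDerivAt 0).deriv, h2]
    rfl
  have h8 := eq_line_of_deriv_deriv hC0 hd2 1
  rw [hd1, e1', e2'] at h8
  have h9 : (e ∘ γ) 1 ∈ e.target := e.map_source (by simp [hsrc])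
  rw [htgt] at h9
  have h10 : 0 < (e ∘ γ) 1 0 := h9
  rw [h8] at h10
  simp [p] at h10

end

/-- The global chart of `P_ρ`, as a diffeomorphism. -/
def PSpace.chart (ρ : HeisRep) (W : NonCentral) : PSpace ρ W ≃ₘ⟮𝓘(ℝ, E3), 𝓘(ℝ, E3)⟯ E3 where
  toEquiv := (PSpace.homeo ρ W).toEquiv
  contMDiff_toFun := contMDiff_isOpenEmbedding (PSpace.homeo ρ W).isOpenEmbedding
  contMDiff_invFun := by
    refine ContMDiff.of_comp_isOpenEmbedding (PSpace.homeo ρ W).isOpenEmbedding ?_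
    convert! contMDiff_id using 1
    funext y
    exact (PSpace.homeo ρ W).apply_symm_apply y

theorem PSpace.extChartAt_eq (ρ : HeisRep) (W : NonCentral) (x : PSpace ρ W) :
    (extChartAt 𝓘(ℝ, E3) x : PSpace ρ W → E3) = PSpace.chart ρ W := rfl

theorem PSpace.extChartAt_symm_eq (ρ : HeisRep) (W : NonCentral) (x : PSpace ρ W) :
    ((extChartAt 𝓘(ℝ, E3) x).symm : E3 → PSpace ρ W) = (PSpace.chart ρ W).symm := by
  funext y
  apply (PSpace.chart ρ W).injective
  refine Eq.trans ?_ ((PSpace.chart ρ W).apply_symm_apply y).symm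
  exact (extChartAt 𝓘(ℝ, E3) x).right_inv (by simp [mfld_simps])

end PlaneWave
end

noncomputable section
namespace PlaneWave

/-! ### Subgroups of the elliptic groups -/

theorem addSubgroup_eq_top_of_mem_nhds {G : Type*} [AddGroup G] [TopologicalSpace G]
    [IsTopologicalAddGroup G] [ConnectedSpace G] (H : AddSubgroup G) {x : G} (h : (H : Set G) ∈ 𝓝 x) :
    H = ⊤ := by
  have ho := H.isOpen_of_mem_nhds h
  have hc : IsClopen (H : Set G) := ⟨H.isClosed_of_isOpen ho, ho⟩
  exact SetLike.coe_injective (hc.eq_univ ⟨0, H.zero_mem⟩)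

section

variable {b k : ℝ}

/-- The image in `heis / Z` of the orbit of a vector. -/
def planeOrbit (b k : ℝ) (v : ℝ × ℝ) (t : ℝ) : ℝ × ℝ :=
  ((sol' b k t - b * sol b k t) * v.1 + k * sol b k t * v.2, sol b k t * v.1 + sol' b k t * v.2)

theorem planeOrbit_zero (v : ℝ × ℝ) : planeOrbit b k v 0 = v := by
  simp [planeOrbit, sol_zero, sol'_zero]

theorem contDiff_planeOrbit (v : ℝ × ℝ) : ContDiff ℝ ∞ (planeOrbit b k v) := by
  have h1 := contDiff_sol b k
  have h2 := contDiff_sol' b k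
  unfold planeOrbit
  fun_prop

theorem hasDerivAt_planeOrbit (v : ℝ × ℝ) (t : ℝ) : HasDerivAt (planeOrbit b k v)
    (k * (planeOrbit b k v t).2, (planeOrbit b k v t).1 + b * (planeOrbit b k v t).2) t := by
  have h1 := hasDerivAt_sol b k t
  have h2 := hasDerivAt_sol' b k t
  refine HasDerivAt.prodMk ?_ ?_
  · convert! ((h2.sub (h1.const_mul b)).mul_const v.1).add ((h1.const_mul k).mul_const v.2) using 1
    simp only [planeOrbit]
    ring
  · convert! (h1.mul_const v.1).add (h2.mul_const v.2) using 1
    simp only [planeOrbit]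
    ring

theorem exists_solution_of_det_ne_zero {A B A' B' : ℝ} (h : A * B' - B * A' ≠ 0) (u w : ℝ) :
    ∃ x y, x * A + y * A' = u ∧ x * B + y * B' = w :=
  ⟨(u * B' - w * A') / (A * B' - B * A'), (A * w - B * u) / (A * B' - B * A'), by
    rw [div_mul_eq_mul_div, div_mul_eq_mul_div, ← add_div, div_eq_iff h]
    ring, by
    rw [div_mul_eq_mul_div, div_mul_eq_mul_div, ← add_div, div_eq_iff h]
    ring⟩

/-- A subgroup of the plane that is invariant under an elliptic flow is trivial or the whole plane. -/
theorem eq_top_of_planeOrbit (h : b ^ 2 + 4 * k < 0) (V : AddSubgroup (ℝ × ℝ)) {v : ℝ × ℝ}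
    (hv : v ≠ 0) (hV : ∀ t, planeOrbit b k v t ∈ V) : V = ⊤ := by
  obtain ⟨t₁, ht₁⟩ := exists_sol_ne_zero b k
  -- The sum of two points of the orbit is a submersion at `(0, t₁)`, so the subgroup contains an
  -- open set.
  let f : ℝ × ℝ → ℝ × ℝ := fun q => planeOrbit b k v q.1 + planeOrbit b k v q.2
  have hf : ContDiff ℝ ∞ f :=
    ((contDiff_planeOrbit v).comp contDiff_fst).add ((contDiff_planeOrbit v).comp contDiff_snd)
  have hs := hf.contDiffAt (x := ((0, t₁) : ℝ × ℝ)) |>.hasStrictFDerivAt (by simp)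
  have hd1 : fderiv ℝ f (0, t₁) (1, 0) = (k * v.2, v.1 + b * v.2) := by
    have h1 : HasDerivAt (fun s : ℝ => ((s, t₁) : ℝ × ℝ)) (1, 0) 0 :=
      (hasDerivAt_id 0).prodMk (hasDerivAt_const 0 t₁)
    have h2 := hs.hasFDerivAt.comp_hasDerivAt (0 : ℝ) h1
    have h3 := (hasDerivAt_planeOrbit (b := b) (k := k) v 0).add_const (planeOrbit b k v t₁)
    rw [planeOrbit_zero] at h3
    exact h2.unique h3
  have hd2 : fderiv ℝ f (0, t₁) (0, 1) = (k * (planeOrbit b k v t₁).2,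
      (planeOrbit b k v t₁).1 + b * (planeOrbit b k v t₁).2) := by
    have h1 : HasDerivAt (fun s : ℝ => ((0, s) : ℝ × ℝ)) (0, 1) t₁ :=
      (hasDerivAt_const t₁ 0).prodMk (hasDerivAt_id t₁)
    have h2 := hs.hasFDerivAt.comp_hasDerivAt t₁ h1
    exact h2.unique ((hasDerivAt_planeOrbit (b := b) (k := k) v t₁).const_add (planeOrbit b k v 0))
  have hk : k ≠ 0 := by nlinarith [sq_nonneg b]
  -- This is the area spanned by `v` and its image under the generator, a definite quadratic form in
  -- the elliptic case.
  have hq : v.1 ^ 2 + b * v.1 * v.2 - k * v.2 ^ 2 ≠ 0 := by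
    intro h0
    have h1 : (2 * v.1 + b * v.2) ^ 2 + -(b ^ 2 + 4 * k) * v.2 ^ 2 = 0 := by linear_combination 4 * h0
    have h2 : v.2 = 0 := by
      have h3 : -(b ^ 2 + 4 * k) * v.2 ^ 2 ≤ 0 := by nlinarith [sq_nonneg (2 * v.1 + b * v.2)]
      have h4 : v.2 ^ 2 ≤ 0 := by
        by_contra! h5
        have := mul_pos (neg_pos.2 h) h5
        linarith
      exact pow_eq_zero_iff (two_ne_zero) |>.1 (le_antisymm h4 (sq_nonneg _))
    have h3 : v.1 = 0 := by
      rw [h2] at h0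
      simpa using h0
    exact hv (Prod.ext h3 h2)
  have hdet : k * v.2 * ((planeOrbit b k v t₁).1 + b * (planeOrbit b k v t₁).2)
      - (v.1 + b * v.2) * (k * (planeOrbit b k v t₁).2) ≠ 0 := by
    have : k * v.2 * ((planeOrbit b k v t₁).1 + b * (planeOrbit b k v t₁).2)
        - (v.1 + b * v.2) * (k * (planeOrbit b k v t₁).2)
        = -(k * sol b k t₁ * (v.1 ^ 2 + b * v.1 * v.2 - k * v.2 ^ 2)) := by
      simp only [planeOrbit]
      ring
    rw [this]
    exact neg_ne_zero.2 (mul_ne_zero (mul_ne_zero hk ht₁) hq)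
  have hsurj : (fderiv ℝ f (0, t₁) : ℝ × ℝ →ₗ[ℝ] ℝ × ℝ).range = ⊤ := by
    rw [LinearMap.range_eq_top]
    intro w
    obtain ⟨x, y, hx, hy⟩ := exists_solution_of_det_ne_zero hdet w.1 w.2
    have e : ((x, y) : ℝ × ℝ) = x • ((1, 0) : ℝ × ℝ) + y • ((0, 1) : ℝ × ℝ) := by simp
    refine ⟨(x, y), ?_⟩
    rw [ContinuousLinearMap.coe_coe, e, map_add, map_smul, map_smul, hd1, hd2]
    exact Prod.ext hx hy
  have hn := hs.map_nhds_eq_of_surj hsurj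
  refine addSubgroup_eq_top_of_mem_nhds V (x := f (0, t₁)) ?_
  rw [← hn]
  exact Filter.mem_map.2 (Filter.Eventually.of_forall fun q => V.add_mem (hV _) (hV _))

/-- The elements of the Heisenberg group, in coordinates. -/
def heisElem (b k p q r : ℝ) : HeisExt (nf b k) := SemidirectProduct.inl ⟨![p, q, r]⟩

theorem heisElem_mul (p q r p' q' r' : ℝ) : heisElem b k p q r * heisElem b k p' q' r'
    = heisElem b k (p + p') (q + q') (r + r' + 1 / 2 * (p * q' - q * p')) := by
  unfold heisElem
  rw [← map_mul]
  congr 1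
  ext i
  fin_cases i <;> simp [Heis.mul_log, heisBracket]

theorem heisElem_inv (p q r : ℝ) : (heisElem b k p q r)⁻¹ = heisElem b k (-p) (-q) (-r) := by
  unfold heisElem
  rw [← map_inv]
  congr 1
  ext i
  fin_cases i <;> simp [Heis.inv_log]

theorem eq_heisElem {a : HeisExt (nf b k)} (ha : a.right = 1) :
    a = heisElem b k (a.left.log 0) (a.left.log 1) (a.left.log 2) := by
  refine SemidirectProduct.ext ?_ ha
  ext i
  fin_cases i <;> rfl

theorem exists_conj_heisElem (a : HeisExt (nf b k)) (p q r : ℝ) :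
    ∃ r', a * heisElem b k p q r * a⁻¹ = heisElem b k (planeOrbit b k (p, q) a.right.toAdd).1
      (planeOrbit b k (p, q) a.right.toAdd).2 r' := by
  set c := a * heisElem b k p q r * a⁻¹ with hc
  have hr : c.right = 1 := by simp [hc, heisElem]
  have hca : c * a = a * heisElem b k p q r := by rw [hc]; group
  have h1 := HeisExt.log_mul_left c a
  have h2 := HeisExt.log_mul_left a (heisElem b k p q r)
  rw [hca, h2, hr, toAdd_one, nf_lie, nf_lie] at h1
  have e0 := congrFun h1 0
  have e1 := congrFun h1 1
  simp only [Pi.add_apply, Pi.smul_apply, heisBracket_zero, heisBracket_one, nfLie_zero', nfLie_one,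
    sol_zero, sol'_zero, smul_eq_mul] at e0 e1
  refine ⟨c.left.log 2, ?_⟩
  have hp : (heisElem b k p q r).left.log 0 = p := rfl
  have hq : (heisElem b k p q r).left.log 1 = q := rfl
  rw [hp, hq] at e0 e1
  conv_lhs => rw [eq_heisElem hr]
  congr 1
  · simp only [planeOrbit]
    linarith
  · simp only [planeOrbit]
    linarith

/-- A subgroup of an elliptic group that is large enough is the whole group. -/
theorem eq_top_of_elliptic (h : b ^ 2 + 4 * k < 0) (H : Subgroup (HeisExt (nf b k)))
    (ht : ∀ t : ℝ, ∃ a ∈ H, a.right.toAdd = t)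
    (hH : ∃ a ∈ H, a.right = 1 ∧ ((a.left.log 0, a.left.log 1) : ℝ × ℝ) ≠ 0) : H = ⊤ := by
  -- The image in `heis / Z` of the Heisenberg elements of `H`. Conjugation by elements of `H` with
  -- arbitrary time makes it invariant under the flow.
  let V : AddSubgroup (ℝ × ℝ) :=
    { carrier := {v | ∃ r, heisElem b k v.1 v.2 r ∈ H}
      zero_mem' := ⟨0, by
        have : heisElem b k 0 0 0 = 1 := by
          rw [eq_heisElem (b := b) (k := k) (a := 1) rfl]
          rfl
        exact this ▸ H.one_mem⟩
      add_mem' := by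
        rintro v v' ⟨r, hr⟩ ⟨r', hr'⟩
        have := H.mul_mem hr hr'
        rw [heisElem_mul] at this
        exact ⟨_, this⟩
      neg_mem' := by
        rintro v ⟨r, hr⟩
        have := H.inv_mem hr
        rw [heisElem_inv] at this
        exact ⟨_, this⟩ }
  obtain ⟨a₀, ha₀, hr₀, hv⟩ := hH
  have hV : V = ⊤ := by
    refine eq_top_of_planeOrbit h V hv fun t => ?_
    obtain ⟨a, ha, rfl⟩ := ht t
    obtain ⟨r', hr'⟩ := exists_conj_heisElem a (a₀.left.log 0) (a₀.left.log 1) (a₀.left.log 2)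
    refine ⟨r', ?_⟩
    rw [← hr', ← eq_heisElem hr₀]
    exact H.mul_mem (H.mul_mem ha ha₀) (H.inv_mem ha)
  have hmem : ∀ p q, ∃ r, heisElem b k p q r ∈ H := fun p q => by
    have : ((p, q) : ℝ × ℝ) ∈ V := hV ▸ AddSubgroup.mem_top _
    exact this
  -- The commutator of lifts of `(1, 0)` and `(0, s)` is central with coordinate `s`.
  have hz : ∀ s, heisElem b k 0 0 s ∈ H := fun s => by
    obtain ⟨r, hr⟩ := hmem 1 0
    obtain ⟨r', hr'⟩ := hmem 0 s
    have := H.mul_mem (H.mul_mem hr hr') (H.inv_mem (H.mul_mem hr' hr))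
    rw [heisElem_mul, heisElem_mul, heisElem_inv, heisElem_mul] at this
    convert! this using 2 <;> ring
  refine (Subgroup.eq_top_iff' H).2 fun a => ?_
  obtain ⟨a', ha', hr'⟩ := ht a.right.toAdd
  have h1 : (a * a'⁻¹).right = 1 := by
    have : a'.right = a.right := Multiplicative.toAdd.injective hr'
    simp [this]
  have h2 := eq_heisElem h1
  set c := a * a'⁻¹ with hc
  obtain ⟨r, hr⟩ := hmem (c.left.log 0) (c.left.log 1)
  have h3 : c ∈ H := by
    have := H.mul_mem hr (hz (c.left.log 2 - r))
    rw [heisElem_mul] at this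
    rw [h2]
    convert! this using 2 <;> ring
  have h4 := H.mul_mem h3 ha'
  rwa [hc, inv_mul_cancel_right] at h4

end

/-! ### Dimension -/

/-- A smooth map from a manifold of smaller dimension is not surjective. -/
theorem not_surjective_of_finrank_lt {E F L : Type*} [NormedAddCommGroup E] [NormedSpace ℝ E]
    [FiniteDimensional ℝ E] [NormedAddCommGroup F] [NormedSpace ℝ F] [FiniteDimensional ℝ F]
    [TopologicalSpace L] [ChartedSpace E L] [IsManifold 𝓘(ℝ, E) ∞ L] [SecondCountableTopology L]
    (hd : Module.finrank ℝ E < Module.finrank ℝ F) {f : L → F}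
    (hf : ContMDiff 𝓘(ℝ, E) 𝓘(ℝ, F) ∞ f) : ¬ Function.Surjective f := by
  intro hsurj
  -- A `C¹` map does not increase Hausdorff dimension. Countably many charts cover the source, and a
  -- countable union keeps the bound.
  have key : ∀ x : L, ∃ U ∈ 𝓝 x, dimH (f '' U) ≤ Module.finrank ℝ E := by
    intro x
    have ht : (extChartAt 𝓘(ℝ, E) x).target ∈ 𝓝 (extChartAt 𝓘(ℝ, E) x x) := extChartAt_target_mem_nhds x
    obtain ⟨ε, hε, hB⟩ := Metric.mem_nhds_iff.1 ht
    set B := Metric.ball (extChartAt 𝓘(ℝ, E) x x) ε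
    refine ⟨(extChartAt 𝓘(ℝ, E) x).source ∩ extChartAt 𝓘(ℝ, E) x ⁻¹' B, ?_, ?_⟩
    · exact Filter.inter_mem (extChartAt_source_mem_nhds x)
        ((continuousAt_extChartAt x).preimage_mem_nhds (Metric.ball_mem_nhds _ hε))
    · have hsub : f '' ((extChartAt 𝓘(ℝ, E) x).source ∩ extChartAt 𝓘(ℝ, E) x ⁻¹' B)
          ⊆ (f ∘ (extChartAt 𝓘(ℝ, E) x).symm) '' B := by
        rintro _ ⟨y, ⟨hy, hyB⟩, rfl⟩
        exact ⟨_, hyB, congrArg f ((extChartAt 𝓘(ℝ, E) x).left_inv hy)⟩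
      have hs : ContDiffOn ℝ 1 (f ∘ (extChartAt 𝓘(ℝ, E) x).symm) B := by
        have h1 : ContMDiffOn 𝓘(ℝ, E) 𝓘(ℝ, F) ∞ (f ∘ (extChartAt 𝓘(ℝ, E) x).symm) B :=
          hf.comp_contMDiffOn ((contMDiffOn_extChartAt_symm x).mono hB)
        exact h1.contDiffOn.of_le (by simp)
      refine (dimH_mono hsub).trans ((hs.dimH_image_le (convex_ball _ _) subset_rfl).trans ?_)
      exact (dimH_mono (Set.subset_univ _)).trans (Real.dimH_univ_eq_finrank E).le
  choose U hU hdim using key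
  obtain ⟨s, hs, hcov⟩ := TopologicalSpace.countable_cover_nhds hU
  have h1 : dimH (Set.univ : Set F) ≤ Module.finrank ℝ E := by
    have h2 : (Set.univ : Set F) = ⋃ x ∈ s, f '' U x := by
      rw [← Set.image_iUnion₂, hcov, Set.image_univ, hsurj.range_eq]
    rw [h2, dimH_bUnion hs]
    exact iSup₂_le fun x _ => hdim x
  rw [Real.dimH_univ_eq_finrank] at h1
  exact absurd hd (not_lt.2 (by exact_mod_cast h1))

end PlaneWave
end

noncomputable section
namespace PlaneWave

/-! ### Isometric actions of three-dimensional groups, elliptic case -/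

section

variable {b k : ℝ} {L : Type*} [Group L] [MulAction L E3]

/-- The elements of the group whose action is that of an element of `L`. -/
def realizedBy (b k : ℝ) (L : Type*) [Group L] [MulAction L E3] : Subgroup (HeisExt (nf b k)) where
  carrier := {a | ∃ l : L, ∀ y : E3, l • y = act a y}
  one_mem' := ⟨1, fun y => by rw [one_smul, act_one]⟩
  mul_mem' := by
    rintro a a' ⟨l, hl⟩ ⟨l', hl'⟩
    exact ⟨l * l', fun y => by rw [mul_smul, hl', hl, act_mul]⟩
  inv_mem' := by
    rintro a ⟨l, hl⟩
    refine ⟨l⁻¹, fun y => ?_⟩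
    rw [inv_smul_eq_iff, hl, act_act_inv]

/-- Reaching the points near `y` along `s` produces elements of all small times, hence of all times.
Reaching a nearby point along `x` produces an element of time zero with nonzero image in `heis / Z`.
Ellipticity then gives everything. -/
theorem realizedBy_eq_top (h : b ^ 2 + 4 * k < 0) {y : E3}
    (hy : {z : E3 | ∃ a ∈ realizedBy b k L, act a y = z} ∈ 𝓝 y) : realizedBy b k L = ⊤ := by
  have hline : ∀ v : E3, ∀ᶠ s : ℝ in 𝓝 0, ∃ a ∈ realizedBy b k L, act a y = y + s • v := by
    intro v
    have hc : Filter.Tendsto (fun s : ℝ => y + s • v) (𝓝 0) (𝓝 y) := by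
      have : Continuous fun s : ℝ => y + s • v := by fun_prop
      simpa using this.tendsto 0
    exact hc hy
  refine eq_top_of_elliptic h _ ?_ ?_
  · let T : AddSubgroup ℝ :=
      { carrier := {t | ∃ a ∈ realizedBy b k L, a.right.toAdd = t}
        zero_mem' := ⟨1, Subgroup.one_mem _, rfl⟩
        add_mem' := by
          rintro _ _ ⟨a, ha, rfl⟩ ⟨a', ha', rfl⟩
          exact ⟨a * a', Subgroup.mul_mem _ ha ha', rfl⟩
        neg_mem' := by
          rintro _ ⟨a, ha, rfl⟩
          exact ⟨a⁻¹, Subgroup.inv_mem _ ha, rfl⟩ }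
    have hT : T = ⊤ := by
      refine addSubgroup_eq_top_of_mem_nhds T (x := 0) ?_
      filter_upwards [hline ![1, 0, 0]] with s hs
      obtain ⟨a, ha, hs⟩ := hs
      have h0 := congrFun hs 0
      rw [act_zero] at h0
      have h1 : a.right.toAdd = -s := by
        simp at h0
        linarith
      have h2 : -s ∈ T := ⟨a, ha, h1⟩
      exact T.neg_mem_iff.1 h2
    intro t
    have : t ∈ T := hT ▸ AddSubgroup.mem_top t
    exact this
  · have h1 := ((hline ![0, 0, 1]).filter_mono nhdsWithin_le_nhds).and
      (self_mem_nhdsWithin : {(0 : ℝ)}ᶜ ∈ 𝓝[≠] 0)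
    obtain ⟨s, ⟨a, ha, hs⟩, hs0⟩ := h1.exists
    have e0 := congrFun hs 0
    have e2 := congrFun hs 2
    rw [act_zero] at e0
    rw [act_two] at e2
    have ht : a.right.toAdd = 0 := by simpa using e0
    refine ⟨a, ha, Multiplicative.toAdd.injective ht, fun h0 => hs0 ?_⟩
    have hp := congrArg Prod.fst h0
    have hq := congrArg Prod.snd h0
    simp only [Prod.fst_zero, Prod.snd_zero] at hp hq
    simp [phi, hp, hq] at e2
    exact e2

end

/-- Each element of `L` acts as a group element times signs. By Baire, the elements with fixed signs
in some compact piece already sweep out an open set, so the subgroup of `G_ρ` realized by `L` is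
everything. A smooth map would then send the three-dimensional `L` onto the four-dimensional group.
-/
theorem not_hasOpenOrbitOfDimThree {b k : ℝ} (h : b ^ 2 + 4 * k < 0) :
    ¬ HasOpenOrbitOfDimThree (model b k) := by
  rintro ⟨L, i1, i2, i3, i4, i5, i6, i7, hsm, hiso, x, hx⟩
  have hk : b ≠ 0 ∨ k ≠ 0 := Or.inr (by nlinarith [sq_nonneg b])
  have hsmul : ContMDiff (𝓘(ℝ, E3).prod 𝓘(ℝ, E3)) 𝓘(ℝ, E3) ∞ (fun p : L × E3 => p.1 • p.2) :=
    hsm.contMDiff_smul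
  have hev : ∀ y : E3, ContMDiff 𝓘(ℝ, E3) 𝓘(ℝ, E3) ∞ (fun l : L => l • y) := fun y =>
    hsmul.comp (contMDiff_id.prodMk contMDiff_const)
  have hl : ∀ l : L, ContDiff ℝ ∞ (fun y : E3 => l • y) := fun l =>
    (hsmul.comp (contMDiff_const.prodMk contMDiff_id)).contDiff
  let S : L → ℝ × ℝ := fun l =>
    ((l • (![1, 0, 0] : E3)) 0 - (l • (0 : E3)) 0, (l • (![0, 0, 1] : E3)) 2 - (l • (0 : E3)) 2)
  have hS : Continuous S :=
    (((continuous_apply 0).comp (hev _).continuous).sub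
      ((continuous_apply 0).comp (hev _).continuous)).prodMk
    (((continuous_apply 2).comp (hev _).continuous).sub
      ((continuous_apply 2).comp (hev _).continuous))
  have key : ∀ l : L, (S l).1 ^ 2 = 1 ∧ (S l).2 ^ 2 = 1 ∧
      ∃ a : HeisExt (nf b k), ∀ y : E3, l • y = act a (flip (S l).1 (S l).2 y) := by
    intro l
    obtain ⟨s, ε, a, h1, h2, -, h3⟩ := (isomOfInverse (b := b) (k := k) (b' := b) (k' := k)
      (fun y : E3 => l • y) (fun y : E3 => l⁻¹ • y) (hl l) (hl l⁻¹) (fun y => inv_smul_smul l y)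
      (fun y => smul_inv_smul l y) (preservesMetric_iff_fderiv.1 (hiso l))).exists_eq_act hk
    have h3 : ∀ y : E3, l • y = act a (flip s ε y) := h3
    have e1 : (S l).1 = s := by
      simp only [S, h3]
      exact act_flip_sub_zero a s ε
    have e2 : (S l).2 = ε := by
      simp only [S, h3]
      exact act_flip_sub_two a s ε
    rw [e1, e2]
    exact ⟨h1, h2, a, h3⟩
  have : LocallyCompactSpace L := ChartedSpace.locallyCompactSpace E3 L
  let sgn : Bool → ℝ := fun i => if i then 1 else -1
  have hsgn : ∀ r : ℝ, r ^ 2 = 1 → ∃ i, r = sgn i := fun r hr => by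
    rcases sq_eq_sq_iff_eq_or_eq_neg.1 (hr.trans (one_pow 2).symm) with h | h
    · exact ⟨true, h⟩
    · exact ⟨false, h⟩
  -- A countable closed cover of the whole space for Baire's theorem: the complement of the open
  -- orbit, and the images of compact pieces of `L` on which both signs are fixed.
  let P : Option (ℕ × Bool × Bool) → Set E3 := fun o => o.elim (MulAction.orbit L x)ᶜ fun i =>
    (fun l : L => l • x) '' (compactCovering L i.1 ∩ S ⁻¹' {(sgn i.2.1, sgn i.2.2)})
  have hPc : ∀ o, IsClosed (P o) := by
    rintro (_ | i)
    · exact hx.isClosed_compl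
    · exact (((isCompact_compactCovering L i.1).inter_right
        (isClosed_singleton.preimage hS)).image (hev x).continuous).isClosed
  have hPu : ⋃ o, P o = Set.univ := by
    refine Set.eq_univ_of_forall fun z => ?_
    by_cases hz : z ∈ MulAction.orbit L x
    · obtain ⟨l, rfl⟩ := hz
      have hn : l ∈ ⋃ n, compactCovering L n := by
        rw [iUnion_compactCovering]
        exact Set.mem_univ l
      obtain ⟨n, hn⟩ := Set.mem_iUnion.1 hn
      obtain ⟨i, hi⟩ := hsgn _ (key l).1
      obtain ⟨j, hj⟩ := hsgn _ (key l).2.1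
      exact Set.mem_iUnion.2 ⟨some (n, i, j), l, ⟨hn, Prod.ext hi hj⟩, rfl⟩
    · exact Set.mem_iUnion.2 ⟨none, hz⟩
  obtain ⟨y, hyx, hyP⟩ := (dense_iUnion_interior_of_closed hPc hPu).inter_open_nonempty _ hx
    ⟨x, MulAction.mem_orbit_self x⟩
  obtain ⟨o, ho⟩ := Set.mem_iUnion.1 hyP
  rcases o with _ | i
  · exact interior_subset ho hyx
  obtain ⟨l₀, ⟨-, hl₀⟩, hy₀⟩ := interior_subset ho
  have hy₀ : l₀ • x = y := hy₀
  have hnhds : {z : E3 | ∃ a ∈ realizedBy b k L, act a y = z} ∈ 𝓝 y := by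
    refine Filter.mem_of_superset (mem_interior_iff_mem_nhds.1 ho) ?_
    rintro z ⟨l, ⟨-, hl⟩, rfl⟩
    obtain ⟨-, -, a₀, ha₀⟩ := key l₀
    obtain ⟨-, -, a, ha⟩ := key l
    have hSS : S l = S l₀ := hl.trans hl₀.symm
    -- Equal signs cancel in the quotient, which therefore acts as an element of the group.
    have hact : ∀ w : E3, (l * l₀⁻¹) • w = act (a * a₀⁻¹) w := by
      intro w
      obtain ⟨w', rfl⟩ : ∃ w' : E3, l₀ • w' = w := ⟨l₀⁻¹ • w, smul_inv_smul l₀ w⟩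
      rw [mul_smul, inv_smul_smul, ha, ha₀, act_mul, act_inv_act, hSS]
    refine ⟨a * a₀⁻¹, ⟨l * l₀⁻¹, hact⟩, ?_⟩
    rw [← hact, ← hy₀, mul_smul, inv_smul_smul]
  have htop := realizedBy_eq_top h hnhds
  -- Evaluation at two points is smooth on all of `L`; on elements acting without signs it returns
  -- the group element, so it is surjective.
  have hα : ContMDiff 𝓘(ℝ, E3) 𝓘(ℝ, ℝ × E3) ∞
      (fun l : L => ofPoints b k (l • (0 : E3)) (l • (![0, 0, 1] : E3))) :=
    contMDiff_ofPoints (hev _) (hev _)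
  refine not_surjective_of_finrank_lt (E := E3) (F := ℝ × E3) (L := L) (by simp)
    ((HeisExt.contMDiff_homeo (nf b k)).comp hα) ?_
  refine (HeisExt.homeo (nf b k)).surjective.comp fun a => ?_
  obtain ⟨l, hl⟩ : a ∈ realizedBy b k L := htop ▸ Subgroup.mem_top a
  exact ⟨l, by simp only [hl, ofPoints_act]⟩

end PlaneWave
end

noncomputable section
namespace PlaneWave

/-! ### Isometric actions of three-dimensional groups, non-elliptic case -/

/-- The group `ℝ ⋉ ℝ²`, where `t` acts on `ℝ²` by the diagonal matrix with entries `e^{κt}` and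
`e^{bt}`. -/
@[ext]
structure DiagGroup (κ b : ℝ) where
  /-- The coordinates. -/
  coords : E3

namespace DiagGroup

variable {κ b : ℝ}

instance : Mul (DiagGroup κ b) := ⟨fun x y => ⟨![x.coords 0 + y.coords 0,
  x.coords 1 + Real.exp (κ * x.coords 0) * y.coords 1,
  x.coords 2 + Real.exp (b * x.coords 0) * y.coords 2]⟩⟩

instance : One (DiagGroup κ b) := ⟨⟨0⟩⟩

instance : Inv (DiagGroup κ b) := ⟨fun x => ⟨![-x.coords 0, -(Real.exp (κ * -x.coords 0) * x.coords 1),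
  -(Real.exp (b * -x.coords 0) * x.coords 2)]⟩⟩

theorem mul_coords (x y : DiagGroup κ b) : (x * y).coords = ![x.coords 0 + y.coords 0,
  x.coords 1 + Real.exp (κ * x.coords 0) * y.coords 1,
  x.coords 2 + Real.exp (b * x.coords 0) * y.coords 2] := rfl

theorem one_coords : (1 : DiagGroup κ b).coords = 0 := rfl

theorem inv_coords (x : DiagGroup κ b) : x⁻¹.coords = ![-x.coords 0,
  -(Real.exp (κ * -x.coords 0) * x.coords 1), -(Real.exp (b * -x.coords 0) * x.coords 2)] := rfl

instance : Group (DiagGroup κ b) :=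
  Group.ofLeftAxioms
    (by
      intro x y z
      ext i
      fin_cases i <;> simp [mul_coords, mul_add, Real.exp_add] <;> ring)
    (by
      intro x
      ext i
      fin_cases i <;> simp [mul_coords, one_coords])
    (by
      intro x
      ext i
      fin_cases i <;> simp [mul_coords, one_coords, inv_coords])

/-- The global coordinates, as an equivalence. -/
def equiv (κ b : ℝ) : DiagGroup κ b ≃ E3 := ⟨coords, mk, fun _ => rfl, fun _ => rfl⟩

instance : TopologicalSpace (DiagGroup κ b) := TopologicalSpace.induced (equiv κ b) inferInstance

/-- The global coordinates, as a homeomorphism. -/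
def homeo (κ b : ℝ) : DiagGroup κ b ≃ₜ E3 := (equiv κ b).toHomeomorphOfIsInducing ⟨rfl⟩

instance : ChartedSpace E3 (DiagGroup κ b) := (homeo κ b).isOpenEmbedding.singletonChartedSpace

instance : IsManifold 𝓘(ℝ, E3) ∞ (DiagGroup κ b) := (homeo κ b).isOpenEmbedding.isManifold_singleton

instance : T2Space (DiagGroup κ b) := (homeo κ b).symm.t2Space

instance : SecondCountableTopology (DiagGroup κ b) := (homeo κ b).secondCountableTopology

theorem contMDiff_homeo : ContMDiff 𝓘(ℝ, E3) 𝓘(ℝ, E3) ∞ (homeo κ b) :=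
  contMDiff_isOpenEmbedding (homeo κ b).isOpenEmbedding

instance : LieGroup 𝓘(ℝ, E3) ∞ (DiagGroup κ b) where
  contMDiff_mul := by
    refine ContMDiff.of_comp_isOpenEmbedding (homeo κ b).isOpenEmbedding ?_
    have h : ContDiff ℝ ∞ (fun q : E3 × E3 => (![q.1 0 + q.2 0,
        q.1 1 + Real.exp (κ * q.1 0) * q.2 1, q.1 2 + Real.exp (b * q.1 0) * q.2 2] : E3)) :=
      contDiff_of_components (by fun_prop) (by fun_prop) (by fun_prop)
    exact h.contMDiff.comp
      ((contMDiff_homeo.comp contMDiff_fst).prodMk_space (contMDiff_homeo.comp contMDiff_snd))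
  contMDiff_inv := by
    refine ContMDiff.of_comp_isOpenEmbedding (homeo κ b).isOpenEmbedding ?_
    have h : ContDiff ℝ ∞ (fun q : E3 => (![-q 0, -(Real.exp (κ * -q 0) * q 1),
        -(Real.exp (b * -q 0) * q 2)] : E3)) :=
      contDiff_of_components (by fun_prop) (by fun_prop) (by fun_prop)
    exact h.contMDiff.comp contMDiff_homeo

/-- The hypothesis makes `m + b` a root of `λ² - bλ - k`, with eigenvector `m X + Y` on `heis / Z`.
-/
theorem exp_eq_sol {k m : ℝ} (hm : m ^ 2 + b * m = k) (t : ℝ) :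
    Real.exp ((m + b) * t) = sol' b k t + m * sol b k t := by
  have h1 : ∀ t, HasDerivAt (fun t => Real.exp ((m + b) * t)) ((m + b) * Real.exp ((m + b) * t)) t :=
    fun t => by
      have := ((hasDerivAt_id t).const_mul (m + b)).exp
      simpa [mul_comm] using this
  have h2 := eq_sol b k h1 (fun t => by
    convert! (h1 t).const_mul (m + b) using 1
    rw [← hm]
    ring) t
  simp only [mul_zero, Real.exp_zero] at h2
  rw [h2]
  ring

/-- The embedding of the group in `G_ρ`, for `ρ` in normal form, defined by an invariant plane. -/
def toHeisExt {k m : ℝ} (hm : m ^ 2 + b * m = k) : DiagGroup (m + b) b →* HeisExt (nf b k) where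
  toFun x := ⟨⟨![m * x.coords 1, x.coords 1, x.coords 2]⟩, Multiplicative.ofAdd (x.coords 0)⟩
  map_one' := by
    refine HeisExt.ext_coords (ext_E3 ?_ ?_ ?_) ?_ <;> simp [one_coords, Heis.one_log]
  map_mul' x y := by
    have he := exp_eq_sol hm (x.coords 0)
    refine HeisExt.ext_coords ?_ rfl
    rw [HeisExt.log_mul_left, nf_lie]
    refine ext_E3 ?_ ?_ ?_
    · simp only [Pi.add_apply, Pi.smul_apply, heisBracket_zero, nfLie_zero', smul_eq_mul, mul_coords,
        toAdd_ofAdd, Matrix.cons_val_zero, Matrix.cons_val_one, Matrix.cons_val]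
      rw [he]
      linear_combination y.coords 1 * sol b k (x.coords 0) * hm
    · simp only [Pi.add_apply, Pi.smul_apply, heisBracket_one, nfLie_one, smul_eq_mul, mul_coords,
        toAdd_ofAdd, Matrix.cons_val_zero, Matrix.cons_val_one, Matrix.cons_val]
      rw [he]
      ring
    · simp only [Pi.add_apply, Pi.smul_apply, heisBracket_two, nfLie_zero', nfLie_one, nfLie_two,
        smul_eq_mul, mul_coords, toAdd_ofAdd, Matrix.cons_val_zero, Matrix.cons_val_one,
        Matrix.cons_val]
      linear_combination -(1 / 2) * x.coords 1 * y.coords 1 * sol b k (x.coords 0) * hm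

theorem contMDiff_toHeisExt {k m : ℝ} (hm : m ^ 2 + b * m = k) :
    ContMDiff 𝓘(ℝ, E3) 𝓘(ℝ, ℝ × E3) ∞ (toHeisExt hm) := by
  have h : ContDiff ℝ ∞ (fun q : E3 => ((q 0, ![m * q 1, q 1, q 2]) : ℝ × E3)) :=
    ContDiff.prodMk (by fun_prop) (contDiff_of_components (by fun_prop) (by fun_prop) (by fun_prop))
  exact (HeisExt.contMDiff_homeo_symm (nf b k)).comp (h.contMDiff.comp contMDiff_homeo)

end DiagGroup

/-- A real eigenvalue gives the invariant abelian plane spanned by `m X + Y` and `Z`, and with time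
a three-dimensional subgroup. It is transitive: its solutions are multiples of an exponential, which
never vanishes, so `x` can be prescribed at any `s`. -/
theorem hasOpenOrbitOfDimThree {b k : ℝ} (h : 0 ≤ b ^ 2 + 4 * k) :
    HasOpenOrbitOfDimThree (model b k) := by
  obtain ⟨m, hm⟩ : ∃ m : ℝ, m ^ 2 + b * m = k :=
    ⟨(-b + √(b ^ 2 + 4 * k)) / 2, by linear_combination Real.sq_sqrt h / 4⟩
  let ι := DiagGroup.toHeisExt hm
  let i7 : MulAction (DiagGroup (m + b) b) E3 :=
    { smul := fun l y => act (ι l) y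
      one_smul := fun y => by
        change act (ι 1) y = y
        rw [map_one, act_one]
      mul_smul := fun l l' y => by
        change act (ι (l * l')) y = act (ι l) (act (ι l') y)
        rw [map_mul, act_mul] }
  refine ⟨DiagGroup (m + b) b, inferInstance, inferInstance, inferInstance, inferInstance,
    inferInstance, inferInstance, i7, ⟨?_⟩, fun l => (actIsom (ι l)).2, 0, ?_⟩
  · exact (contDiff_act' (b := b) (k := k)).contMDiff.comp
      (((HeisExt.contMDiff_homeo (nf b k)).comp
        ((DiagGroup.contMDiff_toHeisExt hm).comp contMDiff_fst)).prodMk_space contMDiff_snd)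
  · have : MulAction.orbit (DiagGroup (m + b) b) (0 : E3) = Set.univ := by
      refine Set.eq_univ_of_forall fun y => ?_
      let c : ℝ := sol' b k (y 0) + m * sol b k (y 0)
      have hc : c ≠ 0 := by
        simp only [c, ← DiagGroup.exp_eq_sol hm]
        exact (Real.exp_pos _).ne'
      let l (r : ℝ) : DiagGroup (m + b) b := ⟨![-y 0, y 2 / c, r]⟩
      have hphi : ∀ r, phi (ι (l r)) (y 0) = y 2 := fun r => by
        change m * (y 2 / c) * sol b k (y 0) + y 2 / c * sol' b k (y 0) = y 2
        have : m * (y 2 / c) * sol b k (y 0) + y 2 / c * sol' b k (y 0) = y 2 / c * c := by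
          simp only [c]
          ring
        rw [this, div_mul_cancel₀ _ hc]
      let r₀ : ℝ := -y 1 - Real.exp (-(b * y 0)) * phi' (ι (l 0)) (y 0) * (1 / 2 * y 2)
      refine ⟨l r₀, ?_⟩
      change act (ι (l r₀)) 0 = y
      have ht : (0 : E3) 0 - (ι (l r₀)).right.toAdd = y 0 := by
        change (0 : ℝ) - -y 0 = y 0
        ring
      refine ext_E3 ?_ ?_ ?_
      · rw [act_zero, ht]
      · rw [act_one', ht, hphi]
        have e1 : phi' (ι (l r₀)) (y 0) = phi' (ι (l 0)) (y 0) := rfl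
        have e2 : (ι (l r₀)).left.log 2 = r₀ := rfl
        rw [e1, e2]
        simp only [r₀, Pi.zero_apply]
        ring
      · rw [act_two, ht, hphi]
        simp
    rw [this]
    exact isOpen_univ

theorem hasOpenOrbitOfDimThree_iff {b k : ℝ} :
    ¬ HasOpenOrbitOfDimThree (model b k) ↔ b ^ 2 + 4 * k < 0 :=
  ⟨fun h => not_le.1 fun h' => h (hasOpenOrbitOfDimThree h'), not_hasOpenOrbitOfDimThree⟩

end PlaneWave
end

noncomputable section
namespace PlaneWave

/-! ### The space `P_ρ` and its model -/

theorem LocallyIsometric.congr {M N M' N' : Type*} [TopologicalSpace M] [ChartedSpace E3 M]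
    [IsManifold 𝓘(ℝ, E3) ∞ M] [TopologicalSpace N] [ChartedSpace E3 N] [IsManifold 𝓘(ℝ, E3) ∞ N]
    [TopologicalSpace M'] [ChartedSpace E3 M'] [IsManifold 𝓘(ℝ, E3) ∞ M'] [TopologicalSpace N']
    [ChartedSpace E3 N'] [IsManifold 𝓘(ℝ, E3) ∞ N'] {g : LorentzMetric M} {h : LorentzMetric N}
    {g' : LorentzMetric M'} {h' : LorentzMetric N'} (H : Isometric g h) (H' : Isometric g' h')
    (hl : LocallyIsometric g g') : LocallyIsometric h h' := by
  obtain ⟨F⟩ := H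
  obtain ⟨F'⟩ := H'
  have key : ∀ e : OpenPartialHomeomorph M M', IsPartialIsom g g' e →
      IsPartialIsom h h' (F.symm.toPartial.trans (e.trans F'.toPartial)) := fun e he =>
    F.symm.isPartialIsom.trans (he.trans F'.isPartialIsom)
  constructor
  · intro y
    obtain ⟨e, hx, he⟩ := hl.1 (F.1.symm y)
    refine ⟨_, ?_, key e he⟩
    rw [OpenPartialHomeomorph.trans_source, OpenPartialHomeomorph.trans_source]
    exact ⟨trivial, hx, trivial⟩
  · intro y
    obtain ⟨e, hx, he⟩ := hl.2 (F'.1.symm y)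
    refine ⟨_, ?_, key e he⟩
    rw [OpenPartialHomeomorph.trans_target, OpenPartialHomeomorph.trans_target]
    exact ⟨⟨trivial, hx⟩, trivial⟩

theorem isometric_model_iff {b k b' k' : ℝ} : Isometric (model b k) (model b' k') ↔
    ∃ l : ℝ, l ≠ 0 ∧ b = l * b' ∧ k = l ^ 2 * k' :=
  ⟨exists_eq_of_isometric, fun ⟨_, hl, hb, hk⟩ => isometric_model hl hb hk⟩

theorem lieIsomorphic_nf_iff {b k b' k' : ℝ} : LieIsomorphic (nf b k) (nf b' k') ↔
    ∃ l : ℝ, l ≠ 0 ∧ b = l * b' ∧ k = l ^ 2 * k' :=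
  ⟨exists_eq_of_lieIsomorphic, fun ⟨_, hl, hb, hk⟩ => lieIsomorphic_nf hl hb hk⟩

theorem locallyIsometric_model_iff {b k b' k' : ℝ} (hk : k ≠ 0) :
    LocallyIsometric (model b k) (model b' k') ↔ ∃ l : ℝ, l ≠ 0 ∧ b = l * b' ∧ k = l ^ 2 * k' :=
  ⟨exists_eq_of_locallyIsometric hk, fun ⟨_, hl, hb, hk⟩ =>
    LocallyIsometric.of_isometric (isometric_model hl hb hk)⟩

namespace NormalForm

variable {ρ : HeisRep} {W : NonCentral} (n : NormalForm ρ W) {g : LorentzMetric (PSpace ρ W)}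

theorem isometric_model (hg : IsInvariant g) : Isometric g (model n.b n.k) :=
  let ⟨F, _⟩ := n.exists_isom_model hg
  ⟨F⟩

theorem lieIsomorphic : LieIsomorphic (nf n.b n.k) ρ := ⟨n.iso, n.isLieIso_iso⟩

theorem lieIsoMatrixGroup_iff {S : Set (Matrix (Fin 3 ⊕ Unit) (Fin 3 ⊕ Unit) ℝ)} :
    LieIsoMatrixGroup ρ S ↔ LieIsoMatrixGroup (nf n.b n.k) S :=
  ⟨LieIsoMatrixGroup.of_lieIso n.lieIsomorphic, LieIsoMatrixGroup.of_lieIso n.lieIsomorphic.symm⟩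

theorem isFlat_iff (hg : IsInvariant g) : IsFlat g ↔ n.k = 0 :=
  Iff.trans ⟨IsFlat.of_isometric (n.isometric_model hg).symm, IsFlat.of_isometric (n.isometric_model hg)⟩
    isFlat_model_iff

theorem isSymmetricSpace_iff (hg : IsInvariant g) : IsSymmetricSpace g ↔ n.b = 0 :=
  Iff.trans ⟨IsSymmetricSpace.of_isometric (n.isometric_model hg).symm,
    IsSymmetricSpace.of_isometric (n.isometric_model hg)⟩ isSymmetricSpace_model_iff

theorem isLocallySymmetric_iff (hg : IsInvariant g) : IsLocallySymmetric g ↔ n.b = 0 ∨ n.k = 0 :=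
  Iff.trans ⟨IsLocallySymmetric.of_isometric (n.isometric_model hg).symm,
    IsLocallySymmetric.of_isometric (n.isometric_model hg)⟩ isLocallySymmetric_model_iff

theorem isometric_minkowski_iff (hg : IsInvariant g) :
    Isometric g minkowski ↔ n.b = 0 ∧ n.k = 0 :=
  Iff.trans ⟨(n.isometric_model hg).symm.trans, (n.isometric_model hg).trans⟩
    PlaneWave.isometric_minkowski_iff

theorem isometricToOpen_halfSpace_iff (hg : IsInvariant g) :
    IsometricToOpen g minkowski halfSpace ↔ n.b ≠ 0 ∧ n.k = 0 :=
  Iff.trans ⟨IsometricToOpen.congr_left (n.isometric_model hg).symm,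
    IsometricToOpen.congr_left (n.isometric_model hg)⟩ PlaneWave.isometricToOpen_halfSpace_iff

theorem hasOpenOrbitOfDimThree_iff (hg : IsInvariant g) :
    ¬ HasOpenOrbitOfDimThree g ↔ n.b ^ 2 + 4 * n.k < 0 := by
  rw [← PlaneWave.hasOpenOrbitOfDimThree_iff, not_iff_not]
  exact ⟨HasOpenOrbitOfDimThree.of_isometric (n.isometric_model hg),
    HasOpenOrbitOfDimThree.of_isometric (n.isometric_model hg).symm⟩

theorem isometric_brinkmann (hg : IsInvariant g) (hb : n.b = 0) {κ l : ℝ} (hl : l ≠ 0)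
    (hk : n.k = l ^ 2 * κ) : Isometric g (brinkmann κ) := by
  rw [brinkmann_eq_model]
  exact (n.isometric_model hg).trans (PlaneWave.isometric_model hl (by rw [hb, mul_zero]) hk)

theorem flat_and_not_complete_iff (n : NormalForm ρ W) (hg : IsInvariant g) :
    IsFlat g ∧ ¬ IsGeodesicallyComplete g ↔ IsometricToOpen g minkowski halfSpace := by
  constructor
  · rintro ⟨hf, hc⟩
    rw [n.isometricToOpen_halfSpace_iff hg]
    refine ⟨fun hb => hc ?_, (n.isFlat_iff hg).1 hf⟩
    exact isGeodesicallyComplete_of_isometric (PSpace.chart ρ W) (PSpace.extChartAt_eq ρ W)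
      (PSpace.extChartAt_symm_eq ρ W)
      ((n.isometric_minkowski_iff hg).2 ⟨hb, (n.isFlat_iff hg).1 hf⟩)
  · intro h
    exact ⟨isFlat_of_isometricToOpen h, not_isGeodesicallyComplete (PSpace.chart ρ W)
      (PSpace.extChartAt_eq ρ W) (PSpace.extChartAt_symm_eq ρ W) h⟩

variable {ρ' : HeisRep} {W' : NonCentral} (n' : NormalForm ρ' W') {g' : LorentzMetric (PSpace ρ' W')}

theorem lieIsomorphic_iff : LieIsomorphic ρ ρ' ↔
    ∃ l : ℝ, l ≠ 0 ∧ n.b = l * n'.b ∧ n.k = l ^ 2 * n'.k := by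
  rw [← lieIsomorphic_nf_iff]
  exact ⟨fun h => (n.lieIsomorphic.trans h).trans n'.lieIsomorphic.symm,
    fun h => (n.lieIsomorphic.symm.trans h).trans n'.lieIsomorphic⟩

theorem isometric_iff (n : NormalForm ρ W) (n' : NormalForm ρ' W') (hg : IsInvariant g) (hg' : IsInvariant g') :
    Isometric g g' ↔ LieIsomorphic ρ ρ' := by
  have H := n.isometric_model hg
  have H' := n'.isometric_model hg'
  rw [n.lieIsomorphic_iff n', ← isometric_model_iff]
  exact ⟨fun h => (H.symm.trans h).trans H', fun h => (H.trans h).trans H'.symm⟩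

theorem locallyIsometric_iff (n' : NormalForm ρ' W') (hg : IsInvariant g) (hg' : IsInvariant g')
    (hk : n.k ≠ 0) :
    LocallyIsometric g g' ↔ LieIsomorphic ρ ρ' := by
  have H := n.isometric_model hg
  have H' := n'.isometric_model hg'
  rw [n.lieIsomorphic_iff n', ← locallyIsometric_model_iff hk]
  exact ⟨LocallyIsometric.congr H H', LocallyIsometric.congr H.symm H'.symm⟩

end NormalForm

end PlaneWave
end

/-! ### The theorem, as a list of conditions on `(b, k)` -/

open PlaneWave in
theorem theorem1p1 (ρ : HeisRep) (W : NonCentral) :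
    -- existence and uniqueness of the invariant Lorentz metric
    ((∃ g : LorentzMetric (PSpace ρ W), IsInvariant g) ↔ ¬ ρ.IsEigenvector W) ∧
    (∀ g₁ g₂ : LorentzMetric (PSpace ρ W), IsInvariant g₁ → IsInvariant g₂ →
      EquivUpToScaling g₁ g₂) ∧
    ∀ g : LorentzMetric (PSpace ρ W), IsInvariant g →
      -- isometric actions of three-dimensional groups
      (¬ HasOpenOrbitOfDimThree g ↔ ρ.IsElliptic) ∧
      -- symmetric and locally symmetric cases
      (IsSymmetricSpace g ↔ ρ.FixesCenter) ∧
      (ρ.FixesCenter ↔ IsUnimodular (HeisExt ρ)) ∧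
      (ρ.FixesCenter → ρ.IsUnipotent ∨ ρ.IsHyperbolic ∨ ρ.IsElliptic) ∧
      (ρ.FixesCenter → ρ.IsUnipotent → Isometric g minkowski) ∧
      (ρ.FixesCenter → ρ.IsHyperbolic → Isometric g cahenWallachHyperbolic) ∧
      (ρ.FixesCenter → ρ.IsElliptic → Isometric g cahenWallachElliptic) ∧
      (IsLocallySymmetric g ∧ ¬ IsSymmetricSpace g ↔
        ¬ IsUnimodular (HeisExt ρ) ∧ LieIsoMatrixGroup ρ affR2) ∧
      (LieIsoMatrixGroup ρ affR2 → IsometricToOpen g minkowski halfSpace) ∧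
      -- the Minkowski case
      (Isometric g minkowski ↔ ρ.IsUnipotent) ∧
      (ρ.IsUnipotent → ∀ D, IsUnipotentGenerator D → LieIsoMatrixGroup ρ (unipotentR3 D)) ∧
      -- the half Minkowski case
      (IsFlat g ↔ Isometric g minkowski ∨ IsometricToOpen g minkowski halfSpace) ∧
      (IsFlat g ∧ ¬ IsGeodesicallyComplete g ↔ IsometricToOpen g minkowski halfSpace) ∧
      (IsometricToOpen g minkowski halfSpace ↔ LieIsoMatrixGroup ρ affR2) ∧
      (IsometricToOpen g minkowski halfSpace ↔
        ¬ IsUnimodular (HeisExt ρ) ∧ ρ.HasFixedVector) ∧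
      -- the isometry group
      (¬ Isometric g minkowski → IdentityComponentEq g) ∧
      -- isometry and local isometry of two spaces
      ∀ (ρ' : HeisRep) (W' : NonCentral) (g' : LorentzMetric (PSpace ρ' W')), IsInvariant g' →
        (Isometric g g' ↔ LieIsomorphic ρ ρ') ∧
        (¬ IsFlat g → (LocallyIsometric g g' ↔ LieIsomorphic ρ ρ')) := by
  refine ⟨⟨fun ⟨g, hg⟩ => not_isEigenvector hg, fun h =>
    let ⟨n⟩ := exists_normalForm ρ W h
    n.exists_invariant⟩, fun g₁ g₂ h₁ h₂ => ?_, fun g hg => ?_⟩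
  · obtain ⟨n⟩ := exists_normalForm ρ W (not_isEigenvector h₁)
    exact n.equivUpToScaling h₁ h₂
  obtain ⟨n⟩ := exists_normalForm ρ W (not_isEigenvector hg)
  -- A normal form is fixed once and for all. Each property then translates into a condition on
  -- `n.b` and `n.k`, and the equivalences become propositional.
  have hhalf := n.isometricToOpen_halfSpace_iff hg
  have haff : LieIsoMatrixGroup ρ affR2 ↔ n.b ≠ 0 ∧ n.k = 0 :=
    n.lieIsoMatrixGroup_iff.trans lieIsoMatrixGroup_affR2_iff
  have hmink := n.isometric_minkowski_iff hg
  have huni := n.isUnimodular_iff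
  refine ⟨(n.hasOpenOrbitOfDimThree_iff hg).trans n.isElliptic_iff.symm,
    (n.isSymmetricSpace_iff hg).trans n.fixesCenter_iff.symm, n.fixesCenter_iff.trans huni.symm,
    fun hb => ?_, fun _ hu => hmink.2 (n.isUnipotent_iff.1 hu), fun hb hh => ?_, fun hb he => ?_,
    ?_, fun h => hhalf.2 (haff.1 h), hmink.trans n.isUnipotent_iff.symm, fun hu D hD => ?_, ?_,
    n.flat_and_not_complete_iff hg, hhalf.trans haff.symm, ?_, fun h => ?_,
    fun ρ' W' g' hg' => ?_⟩
  · have hb := n.fixesCenter_iff.1 hb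
    rw [n.isUnipotent_iff, n.isHyperbolic_iff hb, n.isElliptic_iff, hb]
    rcases lt_trichotomy n.k 0 with hk | hk | hk
    · exact Or.inr (Or.inr (by linarith))
    · exact Or.inl ⟨rfl, hk⟩
    · exact Or.inr (Or.inl hk)
  · have hb := n.fixesCenter_iff.1 hb
    have hk := (n.isHyperbolic_iff hb).1 hh
    exact n.isometric_brinkmann hg hb (Real.sqrt_pos.2 hk).ne' (by rw [Real.sq_sqrt hk.le, mul_one])
  · have hb := n.fixesCenter_iff.1 hb
    have hk := n.isElliptic_iff.1 he
    rw [hb] at hk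
    have hk' : 0 < -n.k := by linarith
    exact n.isometric_brinkmann hg hb (Real.sqrt_pos.2 hk').ne' (by rw [Real.sq_sqrt hk'.le]; ring)
  · rw [n.isLocallySymmetric_iff hg, n.isSymmetricSpace_iff hg, huni, haff]
    tauto
  · obtain ⟨hb, hk⟩ := n.isUnipotent_iff.1 hu
    rw [n.lieIsoMatrixGroup_iff, hb, hk]
    exact lieIsoMatrixGroup_unipotentR3 hD
  · rw [n.isFlat_iff hg, hmink, hhalf]
    tauto
  · rw [hhalf, huni]
    exact and_congr_right fun hb => (n.hasFixedVector_iff hb).symm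
  · refine n.identityComponentEq hg ?_
    rw [hmink] at h
    tauto
  · obtain ⟨n'⟩ := exists_normalForm ρ' W' (not_isEigenvector hg')
    refine ⟨n.isometric_iff n' hg hg', fun hf => n.locallyIsometric_iff n' hg hg' ?_⟩
    rwa [n.isFlat_iff hg] at hf
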